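/- Let $\mathcal G$ be a class of finite simple undirected graphs on vertex sets $[n]$ ($n\ge 0$), and let $p\in(0,1)$ be a fixed real number that is known to the algorithms in the following sense: given $n$ in unary, one can compute in polynomial time an integer $a\ge 0$ with $|np-a|\le 1$ (for example, any rational $p$). Assume there is a polynomial-time randomized algorithm $A$ which, on every input $G\in\mathcal G$, outputs an independent set $I$ of $G$ such that for every vertex $v$ of $G$ the probability that $v\in I$ is at least $p$. Then there is a Monte-Carlo algorithm which, given $G\in\mathcal G$ and integers $k,l\ge 0$, decides whether $G$ contains a (not necessarily induced) subtree with exactly $k$ vertices of which exactly $l$ are leaves (vertices of degree one in the subtree). It always runs in time \[O^*\bigl(2^{(1-p)k+pl}\bigr)\] and in polynomial space, never reports a false positive, and reports false negatives with probability at most some constant smaller than $1$. Here $O^*$ hides factors polynomial in the size of the input $(G,k,l)$ ($G$ given by its adjacency matrix, $k$ and $l$ in binary); time and space are worst-case over the random bits, and algorithms are programs using fair coin flips on a standard machine model whose time and space agree, up to factors polynomial in the space used, with those of probabilistic Turing machines. -/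

import Mathlib

/-! ### Randomized programs over binary trees, with time and space

The machine model is the usual WHILE language on binary trees (lists built from `nil` and `cons`)
with fair coin flips. Copying a tree is charged its full size, so that time and space agree, up to
factors polynomial in the space used, with those of a probabilistic multitape Turing machine. -/

namespace TreeProg

/-- The data: finite binary trees with unlabelled nodes. -/
inductive Data : Type
  | nil : Data
  | cons : Data → Data → Data

namespace Data

/-- Number of nodes. -/
def size : Data → ℕ
  | nil => 1
  | cons a b => a.size + b.size + 1

def hd : Data → Data
  | nil => nil
  | cons a _ => a

def tl : Data → Data
  | nil => nil
  | cons _ b => b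

/-- `false` is the tree `nil`, `true` is a tree different from `nil`. -/
def ofBool : Bool → Data
  | false => nil
  | true => cons nil nil

def ofList : List Data → Data
  | [] => nil
  | a :: as => cons a (ofList as)

/-- Unary representation of a natural number. -/
def ofNatUnary (n : ℕ) : Data := ofList (List.replicate n nil)

/-- Binary representation of a natural number, least significant bit first. -/
def ofNat (n : ℕ) : Data := ofList (n.bits.map ofBool)

end Data

/-- Expressions over a type `ι` of variables. -/
inductive Expr (ι : Type) : Type
  | var : ι → Expr ι
  | nil : Expr ι
  | cons : Expr ι → Expr ι → Expr ι
  | hd : Expr ι → Expr ι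
  | tl : Expr ι → Expr ι

/-- A store holds one tree for each variable. -/
abbrev Store (ι : Type) : Type := ι → Data

/-- Total size of the trees in a store. -/
def storeSize {ι : Type} [Fintype ι] (s : Store ι) : ℕ := ∑ i, (s i).size

namespace Expr

def eval {ι : Type} (s : Store ι) : Expr ι → Data
  | var i => s i
  | nil => Data.nil
  | cons a b => Data.cons (a.eval s) (b.eval s)
  | hd a => (a.eval s).hd
  | tl a => (a.eval s).tl

/-- Cost of evaluating an expression: reading a variable costs the size of the tree copied, every
other operation costs one unit. It bounds the size of all intermediate results together. -/
def cost {ι : Type} (s : Store ι) : Expr ι → ℕ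
  | var i => (s i).size + 1
  | nil => 1
  | cons a b => a.cost s + b.cost s + 1
  | hd a => a.cost s + 1
  | tl a => a.cost s + 1

end Expr

/-- Commands. The guards of `branch` and `loop` are true when the variable is not `nil`. -/
inductive Cmd (ι : Type) : Type
  | assign : ι → Expr ι → Cmd ι
  | flip : ι → Cmd ι
  | seq : Cmd ι → Cmd ι → Cmd ι
  | branch : ι → Cmd ι → Cmd ι → Cmd ι
  | loop : ι → Cmd ι → Cmd ι

/-- A configuration: the commands still to be executed, the store, the time spent so far, and the
largest amount of space in use so far. The run has halted when `todo` is empty. -/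
structure Config (ι : Type) : Type where
  todo : List (Cmd ι)
  store : Store ι
  time : ℕ
  space : ℕ

/-- One execution step; the only random command is `flip`, which tosses a fair coin that is
independent of all others. -/
noncomputable def step {ι : Type} [Fintype ι] [DecidableEq ι] : Config ι → PMF (Config ι)
  | ⟨[], s, t, m⟩ => PMF.pure ⟨[], s, t, m⟩
  | ⟨Cmd.assign i e :: k, s, t, m⟩ =>
      PMF.pure ⟨k, Function.update s i (e.eval s), t + e.cost s + 1,
        max m (storeSize s + e.cost s)⟩
  | ⟨Cmd.flip i :: k, s, t, m⟩ =>
      (PMF.uniformOfFintype Bool).map fun b =>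
        ⟨k, Function.update s i (Data.ofBool b), t + 1,
          max m (storeSize (Function.update s i (Data.ofBool b)))⟩
  | ⟨Cmd.seq c d :: k, s, t, m⟩ => PMF.pure ⟨c :: d :: k, s, t + 1, m⟩
  | ⟨Cmd.branch i c d :: k, s, t, m⟩ =>
      match s i with
      | Data.nil => PMF.pure ⟨d :: k, s, t + 1, m⟩
      | Data.cons _ _ => PMF.pure ⟨c :: k, s, t + 1, m⟩
  | ⟨Cmd.loop i c :: k, s, t, m⟩ =>
      match s i with
      | Data.nil => PMF.pure ⟨k, s, t + 1, m⟩
      | Data.cons _ _ => PMF.pure ⟨c :: Cmd.loop i c :: k, s, t + 1, m⟩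

/-- A randomized program: finitely many variables, of which one receives the input and one holds
the output, and a command. -/
structure Program : Type 1 where
  Var : Type
  [fintypeVar : Fintype Var]
  [decEqVar : DecidableEq Var]
  input : Var
  output : Var
  body : Cmd Var

attribute [instance] Program.fintypeVar Program.decEqVar

namespace Program

/-- All variables except the input variable start with `nil`. -/
def initStore (P : Program) (x : Data) : Store P.Var :=
  Function.update (fun _ => Data.nil) P.input x

def init (P : Program) (x : Data) : Config P.Var :=
  ⟨[P.body], P.initStore x, 0, storeSize (P.initStore x)⟩

/-- The law of the configuration after `m` steps on input `x`. -/
noncomputable def law (P : Program) (x : Data) : ℕ → PMF (Config P.Var)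
  | 0 => PMF.pure (P.init x)
  | m + 1 => (P.law x m).bind step

/-- On input `x`, whatever the coin flips, the time spent never exceeds `T`. Every step of a run
that has not halted takes at least one unit of time, so in particular every run halts. -/
def RunsInTime (P : Program) (x : Data) (T : ℝ) : Prop :=
  ∀ m, ∀ c ∈ (P.law x m).support, (c.time : ℝ) ≤ T

/-- On input `x`, whatever the coin flips, the space in use never exceeds `S`. -/
def RunsInSpace (P : Program) (x : Data) (S : ℝ) : Prop :=
  ∀ m, ∀ c ∈ (P.law x m).support, (c.space : ℝ) ≤ S

/-- The probability that on input `x` the program halts with an output in `E`. -/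
noncomputable def prob (P : Program) (x : Data) (E : Set Data) : ENNReal :=
  ⨆ m, (P.law x m).toOuterMeasure {c | c.todo = [] ∧ c.store P.output ∈ E}

end Program

/-! ### Encodings of graphs and vertex sets -/

open Classical in
/-- The adjacency matrix, as the list of its rows. -/
noncomputable def encodeGraph {n : ℕ} (G : SimpleGraph (Fin n)) : Data :=
  Data.ofList (List.ofFn fun i => Data.ofList (List.ofFn fun j => Data.ofBool (decide (G.Adj i j))))

/-- The characteristic vector of a set of vertices. -/
def encodeSet {n : ℕ} (I : Finset (Fin n)) : Data :=
  Data.ofList (List.ofFn fun i => Data.ofBool (decide (i ∈ I)))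

/-- An instance of the `(k,l)`-Tree problem; `k` and `l` are written in binary. -/
noncomputable def encodeInstance {n : ℕ} (G : SimpleGraph (Fin n)) (k l : ℕ) : Data :=
  Data.cons (encodeGraph G) (Data.cons (Data.ofNat k) (Data.ofNat l))

/-! ### The notions of the theorem -/

/-- `G` contains a tree with `k` vertices of which exactly `l` are leaves (have degree one in the
tree). -/
def HasTree {n : ℕ} (G : SimpleGraph (Fin n)) (k l : ℕ) : Prop :=
  ∃ T : G.Subgraph, T.coe.IsTree ∧ T.verts.ncard = k ∧
    {v | v ∈ T.verts ∧ (T.neighborSet v).ncard = 1}.ncard = l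

/-- `A` is a polynomial-time randomized algorithm which, on every graph of the class `𝒢`, outputs
an independent set that contains each given vertex with probability at least `p`. -/
def SamplesIndepSets (A : Program) (𝒢 : ∀ n : ℕ, Set (SimpleGraph (Fin n))) (p : ℝ) : Prop :=
  ∃ q : Polynomial ℕ, ∀ n : ℕ, ∀ G ∈ 𝒢 n,
    A.RunsInTime (encodeGraph G) ((q.eval (encodeGraph G).size : ℕ) : ℝ) ∧
    A.prob (encodeGraph G) {d | ∃ I : Finset (Fin n), G.IsIndepSet (I : Set (Fin n)) ∧
      d = encodeSet I} = 1 ∧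
    ∀ v : Fin n, ENNReal.ofReal p ≤
      A.prob (encodeGraph G) {d | ∃ I : Finset (Fin n), v ∈ I ∧ d = encodeSet I}

/-- From `n` in unary one can compute in polynomial time a natural number `a` such that `a / n`
approximates `p` within `1 / n`. -/
def IsPolyTimeApproximable (p : ℝ) : Prop :=
  ∃ (Q : Program) (q : Polynomial ℕ), ∀ n : ℕ,
    Q.RunsInTime (Data.ofNatUnary n) ((q.eval n : ℕ) : ℝ) ∧
    Q.prob (Data.ofNatUnary n) {d | ∃ a : ℕ, |n * p - a| ≤ 1 ∧ d = Data.ofNat a} = 1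

/-- On the graphs of the class `𝒢`, `B` is a Monte Carlo algorithm for the `(k,l)`-Tree problem:
its answer is always YES (`Data.ofBool true`) or NO (`Data.ofBool false`), it never gives a false
positive, and the probability of a false negative is at most a constant less than one. -/
def SolvesTree (B : Program) (𝒢 : ∀ n : ℕ, Set (SimpleGraph (Fin n))) : Prop :=
  ∃ δ : ENNReal, δ < 1 ∧ ∀ n : ℕ, ∀ G ∈ 𝒢 n, ∀ k l : ℕ,
    B.prob (encodeInstance G k l) {Data.ofBool true, Data.ofBool false} = 1 ∧
    (¬ HasTree G k l → B.prob (encodeInstance G k l) {Data.ofBool true} = 0) ∧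
    (HasTree G k l → B.prob (encodeInstance G k l) {Data.ofBool false} ≤ δ)

end TreeProg

/-! Fix a tree in `G` with `k` vertices and `l` leaves. A random independent set `I` contains on
average at least `p (k - l)` of its `k - l` inner vertices. If exactly `j` inner vertices lie in
`I`, an algebraic sieve has to tell apart only the other `k - j` vertices, at the price of a sum
over `2 ^ (k - j)` sets of labels. For `j` close to `p (k - l)` this is `2 ^ ((1 - p) k + p l)` up
to a constant factor.

Enumeration of trees. Each vertex `w` sends to `p` the message `a w + b w * ∏ (1 + x * M)`, the
product running over the other vertices. If all weights `a v`, `b v` annihilate each other and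
themselves, branches that share a vertex multiply to zero, so the fixed point enumerates subtrees
(`msgStep_stubSum`, `rootValue_stubSum`). Inner vertices in `I` must carry no label, so their
weights are not nilpotent. In characteristic two the fixed point still enumerates trees
(`MsgSystem.rootValue_eq`) as long as the free vertices are pairwise non-adjacent and satisfy `(a v
+ b v) ^ 2 = 0`. This is an induction on the number of free vertices. Let a free vertex `v₀` send an
infinitesimal `ε`; the first-order effect on what `v₀` receives back cancels by a symmetry of double
sums (`MsgSystem.sum_snd_eq_zero`). Hence the root value is affine in a common scaling `ξ` of the
two weights of `v₀` (`MsgSystem.affine`). An affine function is determined by its value at `ξ = ε`,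
where `v₀` has become nilpotent and the induction hypothesis applies; its value at `ξ = 1` is the
one wanted. The fixed point itself exists, is unique and is reached after few rounds, because two
rounds contract the nilpotent ideal (`MsgSystem.contract`).

Sieve. The weights `wA`, `wB` mark leaves by `t`, inner vertices in `I` by `z`, and every other
vertex `v` by a linear form `y v` in `L` label variables (`treeWt_eq`). Summing over all sets of
labels extracts, at the lowest order `s ^ L`, the trees whose labelled vertices carry every label
once (`sum_algF_eq`). With `t`, `z`, `s` replaced by growing powers of one variable over `F₂`, the
part with given `l` and `j` occupies its own block of coefficients (`coeff_sum_algF`). That part,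
`selPoly`, vanishes if there is no tree (`selPoly_eq_zero`), and for random polynomial entries it is
nonzero with probability at least one half if there is a tree whose inner vertices meet `I` in `j`
elements (`card_selPoly_eq_zero_le`, Schwartz–Zippel).

Probability and time. Some `j ≥ p (k - l) - 1` occurs with probability at least `1 / (k - l + 1) ^
2` (`exists_likely_card`). The algorithm tries every `j ≤ k - l`, skipping those too small to be
affordable (`two_pow_le_expo`), and goes through the list `2 (n + 1) ^ 2` times; the probability of
failure is then at most `1 / e` (`iterK_fail_le`, `pow_failure_le`).

Programs. `Halts` describes all runs at once, `Spec` is a calculus for commands, `Impl` for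
subroutines with private variables. On top of it `PT` collects deterministic polynomial-time
functions, and `RT` randomized ones with polynomial space and a given exponential factor `E` in the
time. -/

set_option linter.unusedSectionVars false
-- Execution, specification and composition of randomized programs
namespace TreeProg

/-! ### Runs of programs -/

section Runs
variable {ι : Type} [Fintype ι] [DecidableEq ι]

/-- All runs from a configuration halt, with time at most `T` and space at most `S` at the end; the
last argument is the law of the final store. -/
inductive Halts (T S : ℕ) : Config ι → PMF (Store ι) → Prop
  | done (s : Store ι) (t m : ℕ) (ht : t ≤ T) (hm : m ≤ S) : Halts T S ⟨[], s, t, m⟩ (PMF.pure s)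
  | step (c : Config ι) (ν : Config ι → PMF (Store ι)) (hc : c.todo ≠ [])
      (h : ∀ c' ∈ (step c).support, Halts T S c' (ν c')) : Halts T S c ((step c).bind ν)

theorem Halts.of_pure {T S : ℕ} {c c' : Config ι} {μ : PMF (Store ι)} (hc : c.todo ≠ [])
    (hs : TreeProg.step c = PMF.pure c') (h : Halts T S c' μ) : Halts T S c μ := by
  have := Halts.step (T := T) (S := S) c (fun _ => μ) hc (by
    intro c'' hc''
    rw [hs, PMF.mem_support_pure_iff] at hc''
    subst hc''; exact h)
  rwa [hs, PMF.pure_bind] at this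

theorem step_time {c c' : Config ι} (hc : c.todo ≠ []) (h : c' ∈ (step c).support) :
    c.time + 1 ≤ c'.time ∧ c.space ≤ c'.space := by
  obtain ⟨k, s, t, m⟩ := c
  cases k with
  | nil => exact absurd rfl hc
  | cons a k =>
    cases a with
    | assign i e =>
      simp only [step, PMF.mem_support_pure_iff] at h
      subst h; simp only [le_sup_left, and_true]; omega
    | flip i =>
      simp only [step, PMF.support_map, Set.mem_image] at h
      obtain ⟨b, -, rfl⟩ := h
      simp
    | seq c d =>
      simp only [step, PMF.mem_support_pure_iff] at h
      subst h; simp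
    | branch i c d =>
      simp only [step] at h
      split at h <;> (rw [PMF.mem_support_pure_iff] at h; subst h; simp)
    | loop i c =>
      simp only [step] at h
      split at h <;> (rw [PMF.mem_support_pure_iff] at h; subst h; simp)

theorem Halts.bounds {T S : ℕ} {c : Config ι} {μ : PMF (Store ι)} (h : Halts T S c μ) :
    c.time ≤ T ∧ c.space ≤ S := by
  induction h with
  | done s t m ht hm => exact ⟨ht, hm⟩
  | step c ν hc h ih =>
    obtain ⟨c', hc'⟩ := (TreeProg.step c).support_nonempty
    have := step_time hc hc'
    have := ih c' hc'
    omega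

theorem Halts.mono {T S T' S' : ℕ} {c : Config ι} {μ : PMF (Store ι)} (h : Halts T S c μ)
    (hT : T ≤ T') (hS : S ≤ S') : Halts T' S' c μ := by
  induction h with
  | done s t m ht hm => exact .done _ _ _ (ht.trans hT) (hm.trans hS)
  | step c ν hc h ih => exact .step c ν hc ih

/-- The law of the configuration after a number of steps. -/
noncomputable def lawFrom (c : Config ι) : ℕ → PMF (Config ι)
  | 0 => PMF.pure c
  | m + 1 => (step c).bind fun c' => lawFrom c' m

theorem lawFrom_succ (m : ℕ) : ∀ c : Config ι, lawFrom c (m + 1) = (lawFrom c m).bind step := by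
  induction m with
  | zero => intro c; simp [lawFrom]
  | succ m ih =>
    intro c
    rw [lawFrom]
    simp_rw [ih]
    rw [← PMF.bind_bind, ← lawFrom, ih]

theorem law_eq_lawFrom (P : Program) (x : Data) (m : ℕ) : P.law x m = lawFrom (P.init x) m := by
  induction m with
  | zero => rfl
  | succ m ih => rw [lawFrom_succ, Program.law, ih]

theorem lawFrom_of_halted (s : Store ι) (t m n : ℕ) :
    lawFrom ⟨[], s, t, m⟩ n = PMF.pure ⟨[], s, t, m⟩ := by
  induction n with
  | zero => rfl
  | succ n ih => simp [lawFrom, step, ih]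

/-- Time and space only grow along a run, so bounds that hold when it halts hold at every
configuration before. -/
theorem Halts.reachable_bounds {T S : ℕ} {c : Config ι} {μ : PMF (Store ι)} (h : Halts T S c μ)
    (n : ℕ) : ∀ c' ∈ (lawFrom c n).support, c'.time ≤ T ∧ c'.space ≤ S := by
  induction h generalizing n with
  | done s t m ht hm =>
    intro c' hc'
    rw [lawFrom_of_halted, PMF.mem_support_pure_iff] at hc'
    subst hc'; exact ⟨ht, hm⟩
  | step c ν hc h ih =>
    intro c' hc'
    cases n with
    | zero =>
      rw [lawFrom, PMF.mem_support_pure_iff] at hc'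
      subst hc'; exact (Halts.step c' ν hc h).bounds
    | succ n =>
      rw [lawFrom, PMF.mem_support_bind_iff] at hc'
      obtain ⟨d, hd, hc'⟩ := hc'
      exact ih d hd n c' hc'

theorem toOuterMeasure_bind_congr {α β γ : Type} (p : PMF α) (f : α → PMF β) (g : α → PMF γ)
    (A : Set β) (B : Set γ)
    (h : ∀ a ∈ p.support, (f a).toOuterMeasure A = (g a).toOuterMeasure B) :
    (p.bind f).toOuterMeasure A = (p.bind g).toOuterMeasure B := by
  rw [PMF.toOuterMeasure_bind_apply, PMF.toOuterMeasure_bind_apply]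
  refine tsum_congr fun a => ?_
  by_cases ha : p a = 0
  · simp [ha]
  · rw [h a ((p.mem_support_iff a).2 ha)]

theorem toOuterMeasure_bind_mono {α β γ : Type} (p : PMF α) (f : α → PMF β) (g : α → PMF γ)
    (A : Set β) (B : Set γ)
    (h : ∀ a ∈ p.support, (f a).toOuterMeasure A ≤ (g a).toOuterMeasure B) :
    (p.bind f).toOuterMeasure A ≤ (p.bind g).toOuterMeasure B := by
  rw [PMF.toOuterMeasure_bind_apply, PMF.toOuterMeasure_bind_apply]
  refine ENNReal.tsum_le_tsum fun a => ?_
  by_cases ha : p a = 0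
  · simp [ha]
  · gcongr; exact h a ((p.mem_support_iff a).2 ha)

/-- Halted configurations are absorbing, so what has halted in `E` after `n` steps is a part of what
finally halts in `E`. -/
theorem Halts.measure_le {T S : ℕ} {c : Config ι} {μ : PMF (Store ι)} (h : Halts T S c μ)
    (E : Set (Store ι)) (n : ℕ) :
    (lawFrom c n).toOuterMeasure {c | c.todo = [] ∧ c.store ∈ E} ≤ μ.toOuterMeasure E := by
  classical
  induction h generalizing n with
  | done s t m ht hm =>
    rw [lawFrom_of_halted, PMF.toOuterMeasure_pure_apply, PMF.toOuterMeasure_pure_apply]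
    simp
  | step c ν hc h ih =>
    cases n with
    | zero =>
      rw [lawFrom, PMF.toOuterMeasure_pure_apply]
      simp [hc]
    | succ n =>
      rw [lawFrom]
      exact toOuterMeasure_bind_mono _ _ _ _ _ fun c' hc' => ih c' hc' n

/-- Each step of a live run costs at least one unit of time. Once `c.time + n` exceeds `T`, no
branch is still running and the law after `n` steps is the final one. -/
theorem Halts.measure_eq {T S : ℕ} {c : Config ι} {μ : PMF (Store ι)} (h : Halts T S c μ)
    (E : Set (Store ι)) (n : ℕ) (hn : T + 1 ≤ c.time + n) :
    (lawFrom c n).toOuterMeasure {c | c.todo = [] ∧ c.store ∈ E} = μ.toOuterMeasure E := by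
  classical
  induction h generalizing n with
  | done s t m ht hm =>
    rw [lawFrom_of_halted, PMF.toOuterMeasure_pure_apply, PMF.toOuterMeasure_pure_apply]
    simp
  | step c ν hc h ih =>
    cases n with
    | zero => have := (Halts.step c ν hc h).bounds; omega
    | succ n =>
      rw [lawFrom]
      refine toOuterMeasure_bind_congr _ _ _ _ _ fun c' hc' => ih c' hc' n ?_
      have := step_time hc hc'
      omega

theorem Halts.prob_eq {P : Program} {x : Data} {T S : ℕ} {μ : PMF (Store P.Var)}
    (h : Halts T S (P.init x) μ) (E : Set Data) :
    P.prob x E = μ.toOuterMeasure {s | s P.output ∈ E} := by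
  unfold Program.prob
  simp_rw [law_eq_lawFrom]
  apply le_antisymm
  · exact iSup_le fun n => h.measure_le {s | s P.output ∈ E} n
  · rw [← h.measure_eq {s | s P.output ∈ E} (T + 1) (by omega)]
    exact le_iSup (fun m => (lawFrom (P.init x) m).toOuterMeasure
      {c | c.todo = [] ∧ c.store P.output ∈ E}) (T + 1)

theorem Halts.runsInTime {P : Program} {x : Data} {T S : ℕ} {μ : PMF (Store P.Var)}
    (h : Halts T S (P.init x) μ) : P.RunsInTime x T := by
  intro m c hc
  rw [law_eq_lawFrom] at hc
  exact_mod_cast (h.reachable_bounds m c hc).1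

theorem Halts.runsInSpace {P : Program} {x : Data} {T S : ℕ} {μ : PMF (Store P.Var)}
    (h : Halts T S (P.init x) μ) : P.RunsInSpace x S := by
  intro m c hc
  rw [law_eq_lawFrom] at hc
  exact_mod_cast (h.reachable_bounds m c hc).2

/-! ### Space is bounded in terms of time -/

theorem Data.size_pos (d : Data) : 1 ≤ d.size := by cases d <;> simp [Data.size]

theorem Data.size_hd_le (d : Data) : d.hd.size ≤ d.size := by
  cases d <;> simp [Data.size, Data.hd]; omega

theorem Data.size_tl_le (d : Data) : d.tl.size ≤ d.size := by
  cases d <;> simp [Data.size, Data.tl]; omega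

theorem Data.size_ofBool_le (b : Bool) : (Data.ofBool b).size ≤ 3 := by
  cases b <;> simp [Data.ofBool, Data.size]

theorem Expr.size_eval_le (s : Store ι) (e : Expr ι) : (e.eval s).size ≤ e.cost s := by
  induction e with
  | var i => simp [Expr.eval, Expr.cost]
  | nil => simp [Expr.eval, Expr.cost, Data.size]
  | cons a b iha ihb => simp only [Expr.eval, Expr.cost, Data.size]; omega
  | hd a ih => exact (Data.size_hd_le _).trans (by simp only [Expr.cost]; omega)
  | tl a ih => exact (Data.size_tl_le _).trans (by simp only [Expr.cost]; omega)

theorem storeSize_update (s : Store ι) (i : ι) (d : Data) :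
    storeSize (Function.update s i d) + (s i).size = storeSize s + d.size := by
  unfold storeSize
  rw [← Finset.add_sum_erase _ _ (Finset.mem_univ i),
    ← Finset.add_sum_erase _ (fun j => (s j).size) (Finset.mem_univ i)]
  have : ∑ j ∈ Finset.univ.erase i, (Function.update s i d j).size =
      ∑ j ∈ Finset.univ.erase i, (s j).size := by
    refine Finset.sum_congr rfl fun j hj => ?_
    rw [Function.update_of_ne (Finset.ne_of_mem_erase hj)]
  rw [this]; simp; omega

theorem size_le_storeSize (s : Store ι) (i : ι) : (s i).size ≤ storeSize s :=
  Finset.single_le_sum (f := fun j => (s j).size) (fun _ _ => Nat.zero_le _) (Finset.mem_univ i)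

/-- An assignment pays for the tree it creates; a coin flip costs one unit and may create a tree
with three nodes. Hence the slope `3`. -/
theorem step_space {c c' : Config ι} {S₀ : ℕ} (h : c' ∈ (step c).support)
    (h1 : storeSize c.store ≤ S₀ + 3 * c.time) (h2 : c.space ≤ S₀ + 3 * c.time) :
    storeSize c'.store ≤ S₀ + 3 * c'.time ∧ c'.space ≤ S₀ + 3 * c'.time := by
  obtain ⟨k, s, t, m⟩ := c
  simp only at h1 h2
  cases k with
  | nil =>
    simp only [step, PMF.mem_support_pure_iff] at h
    subst h; exact ⟨h1, h2⟩
  | cons a k =>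
    cases a with
    | assign i e =>
      simp only [step, PMF.mem_support_pure_iff] at h
      subst h
      have := storeSize_update s i (e.eval s)
      have := e.size_eval_le s
      simp only [sup_le_iff]
      omega
    | flip i =>
      simp only [step, PMF.support_map, Set.mem_image] at h
      obtain ⟨b, -, rfl⟩ := h
      have := storeSize_update s i (Data.ofBool b)
      have := Data.size_ofBool_le b
      simp only [sup_le_iff]
      omega
    | seq c d =>
      simp only [step, PMF.mem_support_pure_iff] at h
      subst h; simp only; omega
    | branch i c d =>
      simp only [step] at h
      split at h <;> (rw [PMF.mem_support_pure_iff] at h; subst h; simp only; omega)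
    | loop i c =>
      simp only [step] at h
      split at h <;> (rw [PMF.mem_support_pure_iff] at h; subst h; simp only; omega)

/-- This is how the given programs, known only through a bound on their time, enter the calculus:
induction on the remaining time builds the tree of all runs, and `step_space` supplies the bound on
the space. -/
theorem exists_halts {T S₀ : ℕ} {c₀ : Config ι}
    (hT : ∀ n, ∀ c ∈ (lawFrom c₀ n).support, c.time ≤ T)
    (h1 : storeSize c₀.store ≤ S₀ + 3 * c₀.time) (h2 : c₀.space ≤ S₀ + 3 * c₀.time) :
    ∃ μ, Halts T (S₀ + 3 * T) c₀ μ ∧ ∀ s ∈ μ.support, storeSize s ≤ S₀ + 3 * T := by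
  induction hd : T - c₀.time using Nat.strong_induction_on generalizing c₀ with
  | _ d ih =>
  have h0 : c₀.time ≤ T := hT 0 c₀ (by simp [lawFrom])
  by_cases hc : c₀.todo = []
  · obtain ⟨k, s, t, m⟩ := c₀
    simp only at hc h0 h1 h2; subst hc
    refine ⟨_, .done s t m h0 (by omega), fun s' hs' => ?_⟩
    rw [PMF.mem_support_pure_iff] at hs'
    subst hs'; omega
  · have key : ∀ c' : Config ι, ∃ μ, c' ∈ (step c₀).support → Halts T (S₀ + 3 * T) c' μ ∧
        ∀ s ∈ μ.support, storeSize s ≤ S₀ + 3 * T := by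
      intro c'
      by_cases hc' : c' ∈ (step c₀).support
      · have ht := step_time hc hc'
        have hT' : ∀ n, ∀ c ∈ (lawFrom c' n).support, c.time ≤ T := by
          intro n c hcn
          refine hT (n + 1) c ?_
          rw [lawFrom, PMF.mem_support_bind_iff]
          exact ⟨c', hc', hcn⟩
        have h0' : c'.time ≤ T := hT' 0 c' (by simp [lawFrom])
        have hs := step_space hc' h1 h2
        obtain ⟨μ, hμ⟩ := ih (T - c'.time) (by omega) hT' hs.1 hs.2 rfl
        exact ⟨μ, fun _ => hμ⟩
      -- A dummy law, as `c'` is not reached in one step.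
      · exact ⟨PMF.pure c₀.store, fun h => absurd h hc'⟩
    choose ν hν using key
    refine ⟨_, .step c₀ ν hc fun c' hc' => (hν c' hc').1, fun s hs => ?_⟩
    obtain ⟨c', hc', hs⟩ := (PMF.mem_support_bind_iff _ _ _).1 hs
    exact (hν c' hc').2 s hs

/-! ### Specifications of commands -/

/-- Started in the store `s`, the command `c` halts within time `T`, uses space at most `S`, and
the law of the final store is `μ`. -/
def Spec (c : Cmd ι) (s : Store ι) (T S : ℕ) (μ : PMF (Store ι)) : Prop :=
  ∀ (k : List (Cmd ι)) (t m T' S' : ℕ) (ν : Store ι → PMF (Store ι)),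
    (∀ s' ∈ μ.support, ∀ t' m', t' ≤ t + T → m' ≤ max m S → Halts T' S' ⟨k, s', t', m'⟩ (ν s')) →
    Halts T' S' ⟨c :: k, s, t, m⟩ (μ.bind ν)

theorem Spec.mono {c : Cmd ι} {s : Store ι} {T S T' S' : ℕ} {μ : PMF (Store ι)}
    (h : Spec c s T S μ) (hT : T ≤ T') (hS : S ≤ S') : Spec c s T' S' μ := by
  intro k t m T'' S'' ν H
  exact h k t m T'' S'' ν fun s' hs' t' m' ht hm => H s' hs' t' m' (by omega) (by omega)

theorem Spec.assign (i : ι) (e : Expr ι) (s : Store ι) :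
    Spec (.assign i e) s (e.cost s + 1) (storeSize s + e.cost s)
      (PMF.pure (Function.update s i (e.eval s))) := by
  intro k t m T' S' ν H
  rw [PMF.pure_bind]
  refine Halts.of_pure (by simp) rfl (H _ ?_ _ _ ?_ ?_)
  · simp
  · omega
  · simp

theorem Spec.flip (i : ι) (s : Store ι) :
    Spec (.flip i) s 1 (storeSize s + 3) ((PMF.uniformOfFintype Bool).map fun b =>
      Function.update s i (Data.ofBool b)) := by
  intro k t m T' S' ν H
  have := Halts.step (T := T') (S := S') ⟨.flip i :: k, s, t, m⟩ (fun c => ν c.store) (by simp) (by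
    intro c' hc'
    simp only [TreeProg.step, PMF.support_map, Set.mem_image] at hc'
    obtain ⟨b, -, rfl⟩ := hc'
    refine H _ ?_ _ _ ?_ ?_
    · rw [PMF.support_map]; exact ⟨b, by simp, rfl⟩
    · exact le_rfl
    · have := storeSize_update s i (Data.ofBool b)
      have := Data.size_ofBool_le b
      simp only [sup_le_iff, le_sup_left, true_and]
      exact le_max_of_le_right (by omega))
  simp only [TreeProg.step] at this
  rw [PMF.bind_map] at this ⊢
  exact this

theorem Spec.seq {c d : Cmd ι} {s : Store ι} {T₁ T₂ S : ℕ} {μ : PMF (Store ι)}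
    {ν : Store ι → PMF (Store ι)} (h₁ : Spec c s T₁ S μ)
    (h₂ : ∀ s' ∈ μ.support, Spec d s' T₂ S (ν s')) :
    Spec (.seq c d) s (T₁ + T₂ + 1) S (μ.bind ν) := by
  intro k t m T' S' ν' H
  refine Halts.of_pure (by simp) rfl ?_
  rw [PMF.bind_bind]
  refine h₁ _ _ _ _ _ _ fun s' hs' t' m' ht hm => h₂ s' hs' _ _ _ _ _ _
    fun s'' hs'' t'' m'' ht' hm' => H s'' ?_ t'' m'' ?_ ?_
  · exact (PMF.mem_support_bind_iff _ _ _).2 ⟨s', hs', hs''⟩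
  · omega
  · omega

theorem Spec.branch_nil {i : ι} {c d : Cmd ι} {s : Store ι} {T S : ℕ} {μ : PMF (Store ι)}
    (hi : s i = Data.nil) (h : Spec d s T S μ) : Spec (.branch i c d) s (T + 1) S μ := by
  intro k t m T' S' ν H
  refine Halts.of_pure (by simp) (c' := ⟨d :: k, s, t + 1, m⟩) (by simp [TreeProg.step, hi]) ?_
  exact h _ _ _ _ _ _ fun s' hs' t' m' ht hm => H s' hs' t' m' (by omega) hm

theorem Spec.branch_cons {i : ι} {c d : Cmd ι} {s : Store ι} {T S : ℕ} {μ : PMF (Store ι)}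
    (hi : s i ≠ Data.nil) (h : Spec c s T S μ) : Spec (.branch i c d) s (T + 1) S μ := by
  intro k t m T' S' ν H
  obtain ⟨a, b, hab⟩ : ∃ a b, s i = Data.cons a b := by
    cases h : s i with
    | nil => exact absurd h hi
    | cons a b => exact ⟨a, b, rfl⟩
  refine Halts.of_pure (by simp) (c' := ⟨c :: k, s, t + 1, m⟩) (by simp [TreeProg.step, hab]) ?_
  exact h _ _ _ _ _ _ fun s' hs' t' m' ht hm => H s' hs' t' m' (by omega) hm

theorem Spec.loop_nil {i : ι} {c : Cmd ι} {s : Store ι} (S : ℕ) (hi : s i = Data.nil) :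
    Spec (.loop i c) s 1 S (PMF.pure s) := by
  intro k t m T' S' ν H
  refine Halts.of_pure (by simp) (c' := ⟨k, s, t + 1, m⟩) (by simp [TreeProg.step, hi]) ?_
  rw [PMF.pure_bind]
  exact H s (by simp) _ _ le_rfl (le_max_left _ _)

theorem Spec.loop_cons {i : ι} {c : Cmd ι} {s : Store ι} {T₁ T₂ S : ℕ} {μ : PMF (Store ι)}
    {ν : Store ι → PMF (Store ι)} (hi : s i ≠ Data.nil) (h₁ : Spec c s T₁ S μ)
    (h₂ : ∀ s' ∈ μ.support, Spec (.loop i c) s' T₂ S (ν s')) :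
    Spec (.loop i c) s (T₁ + T₂ + 1) S (μ.bind ν) := by
  intro k t m T' S' ν' H
  obtain ⟨a, b, hab⟩ : ∃ a b, s i = Data.cons a b := by
    cases h : s i with
    | nil => exact absurd h hi
    | cons a b => exact ⟨a, b, rfl⟩
  refine Halts.of_pure (by simp) (c' := ⟨c :: .loop i c :: k, s, t + 1, m⟩)
    (by simp [TreeProg.step, hab]) ?_
  rw [PMF.bind_bind]
  refine h₁ _ _ _ _ _ _ fun s' hs' t' m' ht hm => h₂ s' hs' _ _ _ _ _ _
    fun s'' hs'' t'' m'' ht' hm' => H s'' ?_ t'' m'' ?_ ?_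
  · exact (PMF.mem_support_bind_iff _ _ _).2 ⟨s', hs', hs''⟩
  · omega
  · omega

theorem Spec.halts {c : Cmd ι} {s : Store ι} {T S : ℕ} {μ : PMF (Store ι)} (h : Spec c s T S μ)
    (m : ℕ) (hm : m ≤ S) : Halts T S ⟨[c], s, 0, m⟩ μ := by
  have := h [] 0 m T S PMF.pure fun s' _ t' m' ht hm' => .done s' t' m' (by omega) (by omega)
  rwa [PMF.bind_pure] at this

end Runs

/-! ### Renaming variables -/

section Rename
variable {ι ι' : Type}

def Expr.map (e : ι → ι') : Expr ι → Expr ι'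
  | var i => var (e i)
  | nil => nil
  | cons a b => cons (a.map e) (b.map e)
  | hd a => hd (a.map e)
  | tl a => tl (a.map e)

def Cmd.map (e : ι → ι') : Cmd ι → Cmd ι'
  | assign i a => assign (e i) (a.map e)
  | flip i => flip (e i)
  | seq c d => seq (c.map e) (d.map e)
  | branch i c d => branch (e i) (c.map e) (d.map e)
  | loop i c => loop (e i) (c.map e)

theorem Expr.eval_map (e : ι → ι') (s : Store ι') (a : Expr ι) :
    (a.map e).eval s = a.eval (s ∘ e) := by
  induction a <;> simp_all [Expr.map, Expr.eval]

theorem Expr.cost_map (e : ι → ι') (s : Store ι') (a : Expr ι) :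
    (a.map e).cost s = a.cost (s ∘ e) := by
  induction a <;> simp_all [Expr.map, Expr.cost]

variable [Fintype ι] [DecidableEq ι] [Fintype ι'] [DecidableEq ι']

theorem storeSize_split (e : ι → ι') (he : e.Injective) (s : Store ι') :
    storeSize s = storeSize (s ∘ e) + ∑ j ∈ Finset.univ \ Finset.univ.image e, (s j).size := by
  unfold storeSize
  rw [← Finset.sum_sdiff (Finset.subset_univ (Finset.univ.image e)),
    Finset.sum_image (fun a _ b _ h => he h), add_comm]
  rfl

theorem storeSize_extend_le (e : ι → ι') (he : e.Injective) (s : Store ι) (s' : Store ι') :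
    storeSize (Function.extend e s s') ≤ storeSize s + storeSize s' := by
  rw [storeSize_split e he]
  have h1 : Function.extend e s s' ∘ e = s := by ext i; simp [he.extend_apply]
  rw [h1]
  gcongr
  calc _ = ∑ j ∈ Finset.univ \ Finset.univ.image e, (s' j).size := by
        refine Finset.sum_congr rfl fun j hj => ?_
        rw [Function.extend_apply']
        rintro ⟨a, rfl⟩
        simp at hj
    _ ≤ _ := Finset.sum_le_sum_of_subset (Finset.subset_univ _)

theorem update_extend (e : ι → ι') (he : e.Injective) (s : Store ι) (s' : Store ι') (i : ι)
    (d : Data) : Function.update (Function.extend e s s') (e i) d =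
      Function.extend e (Function.update s i d) s' := by
  ext j
  by_cases hj : ∃ a, e a = j
  · obtain ⟨a, rfl⟩ := hj
    rw [he.extend_apply]
    by_cases ha : a = i
    · subst ha; simp
    · rw [Function.update_of_ne (he.ne ha), Function.update_of_ne ha, he.extend_apply]
  · rw [Function.extend_apply' _ _ _ hj, Function.update_of_ne (fun h => hj ⟨i, h.symm⟩),
      Function.extend_apply' _ _ _ hj]

/-- A frame rule: a command whose variables are renamed by an injection acts on its part of the
larger store and leaves the rest `s'` alone. The continuation `ν` lets the induction follow the
branching of the run; the extra space is the size of the frame. -/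
theorem Halts.embed {T S : ℕ} {c : Config ι} {μ : PMF (Store ι)} (h : Halts T S c μ) (e : ι → ι')
    (he : e.Injective) (s' : Store ι') (k : List (Cmd ι')) (t' m' T' S' : ℕ)
    (ν : Store ι' → PMF (Store ι'))
    (H : ∀ s₁ ∈ μ.support, ∀ t₁ m₁, t₁ + c.time ≤ t' + T → m₁ ≤ max m' (S + storeSize s') →
      Halts T' S' ⟨k, Function.extend e s₁ s', t₁, m₁⟩ (ν (Function.extend e s₁ s'))) :
    Halts T' S' ⟨c.todo.map (Cmd.map e) ++ k, Function.extend e c.store s', t', m'⟩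
      (μ.bind fun s₁ => ν (Function.extend e s₁ s')) := by
  induction h generalizing t' m' with
  | done s t m ht hm =>
    rw [PMF.pure_bind]
    exact H s (by simp) _ _ (by simpa using ht) (le_max_left _ _)
  | step c κ hc h ih =>
    have hb := fun c' hc' => (h c' hc').bounds
    obtain ⟨l, s, t, m⟩ := c
    have hext : Function.extend e s s' ∘ e = s := by ext i; simp [he.extend_apply]
    have hsz := storeSize_extend_le e he s s'
    rw [PMF.bind_bind]
    cases l with
    | nil => exact absurd rfl hc
    | cons a l =>
      cases a with
      | assign i a =>
        simp only [TreeProg.step, PMF.pure_bind, PMF.mem_support_pure_iff, forall_eq] at *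
        refine Halts.of_pure (by simp) (c' := ⟨l.map (Cmd.map e) ++ k,
          Function.extend e (Function.update s i (a.eval s)) s', t' + a.cost s + 1,
          max m' (storeSize (Function.extend e s s') + a.cost s)⟩) ?_ ?_
        · simp [Cmd.map, TreeProg.step, Expr.eval_map, Expr.cost_map, hext, update_extend e he]
        · refine ih _ _ fun s₁ hs₁ t₁ m₁ ht₁ hm₁ => H s₁ hs₁ t₁ m₁ (by omega) (by omega)
      | flip i =>
        have := Halts.step (T := T') (S := S') ⟨(Cmd.flip i :: l).map (Cmd.map e) ++ k,
          Function.extend e s s', t', m'⟩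
          (fun c => (κ ⟨l, c.store ∘ e, t + 1, max m (storeSize (c.store ∘ e))⟩).bind
            fun s₁ => ν (Function.extend e s₁ s')) (by simp) (by
            intro c' hc'
            simp only [Cmd.map, List.map_cons, List.cons_append, TreeProg.step, PMF.support_map,
              Set.mem_image] at hc'
            obtain ⟨b, -, rfl⟩ := hc'
            have h2 : Function.extend e (Function.update s i (Data.ofBool b)) s' ∘ e =
              Function.update s i (Data.ofBool b) := by ext i; simp [he.extend_apply]
            simp only [update_extend e he, h2]
            have hmem : (⟨l, Function.update s i (Data.ofBool b), t + 1,
                max m (storeSize (Function.update s i (Data.ofBool b)))⟩ : Config ι) ∈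
                (TreeProg.step ⟨Cmd.flip i :: l, s, t, m⟩).support := by
              simp only [TreeProg.step, PMF.support_map, Set.mem_image]
              exact ⟨b, by simp, rfl⟩
            have hb' := hb _ hmem
            have hsz' := storeSize_extend_le e he (Function.update s i (Data.ofBool b)) s'
            simp only [sup_le_iff] at hb'
            refine ih _ hmem _ _ fun s₁ hs₁ t₁ m₁ ht₁ hm₁ => H s₁ ?_ t₁ m₁ ?_ ?_
            · exact (PMF.mem_support_bind_iff _ _ _).2 ⟨_, hmem, hs₁⟩
            · simp only at ht₁ ⊢; omega
            · omega)
        convert this using 1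
        simp only [Cmd.map, List.map_cons, List.cons_append, TreeProg.step, PMF.bind_map]
        congr 1
        funext b
        have h2 : Function.extend e (Function.update s i (Data.ofBool b)) s' ∘ e =
              Function.update s i (Data.ofBool b) := by ext i; simp [he.extend_apply]
        simp only [Function.comp_apply, update_extend e he, h2]
      | seq c d =>
        simp only [TreeProg.step, PMF.pure_bind, PMF.mem_support_pure_iff, forall_eq] at *
        refine Halts.of_pure (by simp) (c' := ⟨c.map e :: d.map e :: (l.map (Cmd.map e) ++ k),
          Function.extend e s s', t' + 1, m'⟩) rfl ?_
        exact ih _ _ fun s₁ hs₁ t₁ m₁ ht₁ hm₁ => H s₁ hs₁ t₁ m₁ (by omega) (by omega)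
      | branch i c d =>
        have hi : Function.extend e s s' (e i) = s i := he.extend_apply _ _ _
        cases hsi : s i with
        | nil =>
          simp only [TreeProg.step, hsi, PMF.pure_bind, PMF.mem_support_pure_iff, forall_eq] at *
          refine Halts.of_pure (by simp) (c' := ⟨d.map e :: (l.map (Cmd.map e) ++ k),
            Function.extend e s s', t' + 1, m'⟩) (by simp [Cmd.map, TreeProg.step, hi]) ?_
          exact ih _ _ fun s₁ hs₁ t₁ m₁ ht₁ hm₁ => H s₁ hs₁ t₁ m₁ (by omega) (by omega)
        | cons a b =>
          simp only [TreeProg.step, hsi, PMF.pure_bind, PMF.mem_support_pure_iff, forall_eq] at *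
          refine Halts.of_pure (by simp) (c' := ⟨c.map e :: (l.map (Cmd.map e) ++ k),
            Function.extend e s s', t' + 1, m'⟩) (by simp [Cmd.map, TreeProg.step, hi]) ?_
          exact ih _ _ fun s₁ hs₁ t₁ m₁ ht₁ hm₁ => H s₁ hs₁ t₁ m₁ (by omega) (by omega)
      | loop i c =>
        have hi : Function.extend e s s' (e i) = s i := he.extend_apply _ _ _
        cases hsi : s i with
        | nil =>
          simp only [TreeProg.step, hsi, PMF.pure_bind, PMF.mem_support_pure_iff, forall_eq] at *
          refine Halts.of_pure (by simp) (c' := ⟨l.map (Cmd.map e) ++ k,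
            Function.extend e s s', t' + 1, m'⟩) (by simp [Cmd.map, TreeProg.step, hi]) ?_
          exact ih _ _ fun s₁ hs₁ t₁ m₁ ht₁ hm₁ => H s₁ hs₁ t₁ m₁ (by omega) (by omega)
        | cons a b =>
          simp only [TreeProg.step, hsi, PMF.pure_bind, PMF.mem_support_pure_iff, forall_eq] at *
          refine Halts.of_pure (by simp) (c' := ⟨c.map e :: .loop (e i) (c.map e) ::
            (l.map (Cmd.map e) ++ k), Function.extend e s s', t' + 1, m'⟩)
            (by simp [Cmd.map, TreeProg.step, hi]) ?_
          exact ih _ _ fun s₁ hs₁ t₁ m₁ ht₁ hm₁ => H s₁ hs₁ t₁ m₁ (by omega) (by omega)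

/-- A command may be run on a part of a larger store. -/
theorem Halts.spec_embed {T S : ℕ} {c : Cmd ι} {m : ℕ} {μ : PMF (Store ι)} (e : ι → ι')
    (he : e.Injective) (s' : Store ι') (h : Halts T S ⟨[c], s' ∘ e, 0, m⟩ μ) :
    Spec (c.map e) s' T (S + storeSize s') (μ.map fun s₁ => Function.extend e s₁ s') := by
  intro k t m' T' S' ν H
  have h0 : Function.extend e (s' ∘ e) s' = s' := by
    ext j
    by_cases hj : ∃ a, e a = j
    · obtain ⟨a, rfl⟩ := hj; rw [he.extend_apply]; rfl
    · rw [Function.extend_apply' _ _ _ hj]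
  have := h.embed e he s' k t m' T' S' ν fun s₁ hs₁ t₁ m₁ ht₁ hm₁ =>
    H _ (by rw [PMF.support_map]; exact ⟨s₁, hs₁, rfl⟩) _ _ (by simpa using ht₁) hm₁
  rw [PMF.bind_map]
  rw [h0] at this
  exact this

end Rename
end TreeProg

namespace TreeProg

/-! ### Subroutines -/

/-- The store of a subroutine: the input-output variable is `none`, all other variables are empty. -/
def st {κ : Type} (x : Data) : Store (Option κ) := fun i => i.elim x fun _ => Data.nil

section st
variable {κ κ' : Type} [Fintype κ] [DecidableEq κ]

@[simp] theorem st_none (x : Data) : (st x : Store (Option κ)) none = x := rfl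
@[simp] theorem st_some (x : Data) (k : κ) : (st x : Store (Option κ)) (some k) = Data.nil := rfl

theorem storeSize_st (x : Data) : storeSize (st x : Store (Option κ)) = x.size + Fintype.card κ := by
  simp [storeSize, Fintype.sum_option, st, Data.size]

theorem update_st_none (x y : Data) :
    Function.update (st x : Store (Option κ)) none y = st y := by
  ext i; cases i <;> simp

theorem extend_st (f : κ → κ') (hf : f.Injective) (x y : Data) :
    Function.extend (Option.map f) (st y) (st x) = (st y : Store (Option κ')) := by
  have he := Option.map_injective hf
  ext j
  cases j with
  | none => exact he.extend_apply (st y) (st x) none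
  | some j =>
    by_cases hj : ∃ a, Option.map f a = some j
    · obtain ⟨a, ha⟩ := hj
      rw [← ha, he.extend_apply]
      cases a <;> simp at ha ⊢
    · rw [Function.extend_apply' _ _ _ hj]; simp

theorem st_comp (f : κ → κ') (x : Data) : (st x : Store (Option κ')) ∘ Option.map f = st x := by
  ext i; cases i <;> rfl

end st

theorem Spec.embed {ι ι' : Type} [Fintype ι] [DecidableEq ι] [Fintype ι'] [DecidableEq ι']
    {T S : ℕ} {c : Cmd ι} {s : Store ι} {μ : PMF (Store ι)} (h : Spec c s T S μ) (e : ι → ι')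
    (he : e.Injective) (s' : Store ι') (hs : s' ∘ e = s) :
    Spec (c.map e) s' T (S + storeSize s') (μ.map fun s₁ => Function.extend e s₁ s') := by
  subst hs
  exact (h.halts 0 (Nat.zero_le _)).spec_embed e he s'

noncomputable instance : DecidableEq Data := Classical.decEq _

theorem Spec.conv {ι : Type} [Fintype ι] [DecidableEq ι] {c : Cmd ι} {s : Store ι} {T S T' S' : ℕ}
    {μ μ' : PMF (Store ι)} (h : Spec c s T S μ) (hT : T ≤ T') (hS : S ≤ S') (hμ : μ = μ') :
    Spec c s T' S' μ' :=
  hμ ▸ h.mono hT hS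

theorem Spec.seq_pure {ι : Type} [Fintype ι] [DecidableEq ι] {c d : Cmd ι} {s s' : Store ι}
    {T₁ T₂ S : ℕ} {μ : PMF (Store ι)} (h₁ : Spec c s T₁ S (PMF.pure s')) (h₂ : Spec d s' T₂ S μ) :
    Spec (.seq c d) s (T₁ + T₂ + 1) S μ := by
  have := Spec.seq (ν := fun _ => μ) h₁ (by
    intro s'' hs''
    rw [PMF.mem_support_pure_iff] at hs''
    subst hs''; exact h₂)
  rwa [PMF.pure_bind] at this

/-- There is a command which meets the specification `R`: from input `x` it produces an output with
law `μ` within time `T` and space `S`, up to an additive constant, whenever `R x μ T S`. -/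
def Impl (R : Data → PMF Data → ℕ → ℕ → Prop) : Prop :=
  ∃ (κ : Type) (_ : Fintype κ) (_ : DecidableEq κ) (c : Cmd (Option κ)) (C : ℕ),
    ∀ x μ T S, R x μ T S → Spec c (st x) T (S + C) (μ.map st)

theorem Impl.mono {R R' : Data → PMF Data → ℕ → ℕ → Prop} (h : Impl R)
    (H : ∀ x μ T S, R' x μ T S → ∃ T₀ S₀, R x μ T₀ S₀ ∧ T₀ ≤ T ∧ S₀ ≤ S) : Impl R' := by
  obtain ⟨κ, i1, i2, c, C, hc⟩ := h
  refine ⟨κ, i1, i2, c, C, fun x μ T S hR => ?_⟩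
  obtain ⟨T₀, S₀, h1, h2, h3⟩ := H x μ T S hR
  exact (hc x μ T₀ S₀ h1).mono h2 (by omega)

/-- The two subroutines share only the input-output variable; their private variables are the
summands of a disjoint sum. Both start and end with empty private variables, so they can be run one
after the other. The terms `x.size` and `y.size` pay for the frame in `Spec.embed`. -/
theorem Impl.seq {R₁ R₂ : Data → PMF Data → ℕ → ℕ → Prop} (h₁ : Impl R₁) (h₂ : Impl R₂) :
    Impl fun x μ T S => ∃ μ₁ ν T₁ T₂ S₁, R₁ x μ₁ T₁ S₁ ∧ S₁ + x.size ≤ S ∧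
      (∀ y ∈ μ₁.support, ∃ S₂, R₂ y (ν y) T₂ S₂ ∧ S₂ + y.size ≤ S) ∧ μ = μ₁.bind ν ∧
      T₁ + T₂ + 1 ≤ T := by
  obtain ⟨κ₁, i1, i2, c₁, C₁, hc₁⟩ := h₁
  obtain ⟨κ₂, i3, i4, c₂, C₂, hc₂⟩ := h₂
  refine ⟨κ₁ ⊕ κ₂, inferInstance, inferInstance,
    .seq (c₁.map (Option.map Sum.inl)) (c₂.map (Option.map Sum.inr)),
    C₁ + C₂ + Fintype.card (κ₁ ⊕ κ₂), ?_⟩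
  rintro x μ T S ⟨μ₁, ν, T₁, T₂, S₁, h1, hS1, h2, rfl, hT⟩
  have e1 := (hc₁ _ _ _ _ h1).embed (Option.map Sum.inl) (Option.map_injective Sum.inl_injective)
    (st x : Store (Option (κ₁ ⊕ κ₂))) (st_comp _ _)
  rw [PMF.map_comp] at e1
  have : ((fun s₁ => Function.extend (Option.map Sum.inl) s₁ (st x)) ∘ st :
      Data → Store (Option (κ₁ ⊕ κ₂))) = st := by
    ext1 y; exact extend_st _ Sum.inl_injective _ _
  rw [this] at e1
  have e2 : ∀ s' ∈ (μ₁.map st : PMF (Store (Option (κ₁ ⊕ κ₂)))).support,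
      Spec (c₂.map (Option.map Sum.inr)) s' T₂ (S + (C₁ + C₂ + Fintype.card (κ₁ ⊕ κ₂)))
        ((fun s : Store (Option (κ₁ ⊕ κ₂)) => (ν (s none)).map st) s') := by
    intro s' hs'
    rw [PMF.support_map] at hs'
    obtain ⟨y, hy, rfl⟩ := hs'
    obtain ⟨S₂, hR, hS₂⟩ := h2 y hy
    have e2 := (hc₂ _ _ _ _ hR).embed (Option.map Sum.inr)
      (Option.map_injective Sum.inr_injective) (st y : Store (Option (κ₁ ⊕ κ₂))) (st_comp _ _)
    rw [PMF.map_comp] at e2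
    have : ((fun s₁ => Function.extend (Option.map Sum.inr) s₁ (st y)) ∘ st :
        Data → Store (Option (κ₁ ⊕ κ₂))) = st := by
      ext1 y'; exact extend_st _ Sum.inr_injective _ _
    rw [this] at e2
    refine e2.mono le_rfl ?_
    rw [storeSize_st]; omega
  have := Spec.seq (e1.mono le_rfl (by rw [storeSize_st]; omega)) e2
  rw [PMF.bind_map] at this
  rw [PMF.map_bind]
  exact this.mono hT le_rfl

/-- A subroutine destroys its input. One more private variable, `some none`, holds a copy while it
runs. This is the only form of memory needed to compose computations that use the same data twice.
-/
theorem Impl.keep {R : Data → PMF Data → ℕ → ℕ → Prop} (h : Impl R) :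
    Impl fun x μ T S => ∃ μ₀ T₀ S₀ B, R x μ₀ T₀ S₀ ∧ (∀ y ∈ μ₀.support, y.size ≤ B) ∧
      μ = μ₀.map (Data.cons x) ∧ T₀ + 2 * x.size + B + 20 ≤ T ∧ S₀ + 4 * x.size + 2 * B ≤ S := by
  obtain ⟨κ, i1, i2, c, C, hc⟩ := h
  refine ⟨Option κ, inferInstance, inferInstance,
    .seq (.assign (some none) (.var none)) (.seq (c.map (Option.map some))
      (.seq (.assign none (.cons (.var (some none)) (.var none))) (.assign (some none) .nil))),
    C + 2 * Fintype.card (Option κ) + 20, ?_⟩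
  rintro x μ T S ⟨μ₀, T₀, S₀, B, hR, hB, rfl, hT, hS⟩
  set C' := C + 2 * Fintype.card (Option κ) + 20
  let s₁ : Store (Option (Option κ)) := Function.update (st x) (some none) x
  have hs₁ : s₁ ∘ Option.map some = st x := by
    ext i; cases i <;> simp [s₁]
  have hz₁ : storeSize s₁ ≤ 2 * x.size + Fintype.card (Option κ) := by
    have := storeSize_update (st x : Store (Option (Option κ))) (some none) x
    rw [storeSize_st] at this
    simp only [s₁]; omega
  have hinj : (Option.map (some : κ → Option κ)).Injective :=
    Option.map_injective (Option.some_injective _)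
  have hext : ∀ y, Function.extend (Option.map some) (st y) s₁ =
      (Function.update (st y) (some none) x : Store (Option (Option κ))) := by
    intro y
    ext j
    match j with
    | none => exact hinj.extend_apply (st y) s₁ none
    | some none =>
      rw [Function.extend_apply']
      · simp [s₁]
      · rintro ⟨a, ha⟩; cases a <;> simp at ha
    | some (some k) => exact hinj.extend_apply (st y) s₁ (some k)
  have a1 : Spec (.assign (some none) (.var none)) (st x) (x.size + 2) (S + C')
      (PMF.pure s₁) := by
    refine (Spec.assign _ _ _).mono ?_ ?_
    · simp [Expr.cost]
    · simp only [Expr.cost, storeSize_st, st_none]; omega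
  have a2 := (hc _ _ _ _ hR).embed (Option.map some) hinj s₁ hs₁
  have a3 : ∀ s' ∈ ((μ₀.map st).map fun s => Function.extend (Option.map some) s s₁).support,
      Spec (.seq (.assign none (.cons (.var (some none)) (.var none)))
        (.assign (some none) .nil)) s' (x.size + B + 10) (S + C')
        ((fun s' => PMF.pure (st (Data.cons x (s' none)))) s') := by
    intro s' hs'
    rw [PMF.map_comp, PMF.support_map] at hs'
    obtain ⟨y, hy, rfl⟩ := hs'
    simp only [Function.comp, hext]
    have hBy := hB y hy
    have hsy : storeSize (Function.update (st y) (some none) x : Store (Option (Option κ))) ≤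
        y.size + x.size + Fintype.card (Option κ) := by
      have := storeSize_update (st y : Store (Option (Option κ))) (some none) x
      rw [storeSize_st] at this; omega
    refine Spec.conv (((Spec.assign _ _ _).mono (S' := S + C') le_rfl ?_).seq_pure
      ((Spec.assign _ _ _).mono le_rfl ?_)) ?_ le_rfl ?_
    · simp only [Expr.cost, ne_eq, reduceCtorEq, not_false_eq_true, Function.update_of_ne,
        Function.update_self, st_none]
      omega
    · have := storeSize_update (Function.update (st y) (some none) x : Store (Option (Option κ)))
        none (Data.cons x y)
      simp only [Expr.cost, Expr.eval, ne_eq, reduceCtorEq, not_false_eq_true,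
        Function.update_of_ne, Function.update_self, st_none, Data.size] at this ⊢
      omega
    · simp only [Expr.cost, ne_eq, reduceCtorEq, not_false_eq_true,
        Function.update_of_ne, Function.update_self, st_none]
      omega
    · congr 1
      ext j
      match j with
      | none => simp [Expr.eval]
      | some none => simp [Expr.eval]
      | some (some k) => simp
  have := a1.seq_pure ((a2.mono le_rfl (by omega)).seq a3)
  refine this.conv (by omega) le_rfl ?_
  · rw [PMF.map_comp, PMF.map_comp, PMF.bind_map, ← PMF.bind_pure_comp]
    congr 1
    funext y
    simp [hext]

theorem Impl.flip : Impl fun x μ T S =>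
    μ = (PMF.uniformOfFintype Bool).map (fun b => Data.cons (Data.ofBool b) x) ∧
      x.size + 20 ≤ T ∧ 2 * x.size ≤ S := by
  refine ⟨Unit, inferInstance, inferInstance, .seq (.flip (some ()))
    (.seq (.assign none (.cons (.var (some ())) (.var none))) (.assign (some ()) .nil)), 30, ?_⟩
  rintro x μ T S ⟨rfl, hT, hS⟩
  have key := storeSize_st (κ := Unit) x
  have hu : ∀ b, storeSize (Function.update (st x : Store (Option Unit)) (some ())
      (Data.ofBool b)) ≤ x.size + 5 := by
    intro b
    have := storeSize_update (st x : Store (Option Unit)) (some ()) (Data.ofBool b)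
    have := Data.size_ofBool_le b
    simp at key
    omega
  have a1 := Spec.flip (some ()) (st x : Store (Option Unit))
  have a2 : ∀ s' ∈ ((PMF.uniformOfFintype Bool).map fun b =>
      Function.update (st x : Store (Option Unit)) (some ()) (Data.ofBool b)).support,
      Spec (.seq (.assign none (.cons (.var (some ())) (.var none))) (.assign (some ()) .nil))
        s' (x.size + 15) (S + 30)
        ((fun s' => PMF.pure (st (Data.cons (s' (some ())) (s' none)))) s') := by
    intro s' hs'
    rw [PMF.support_map] at hs'
    obtain ⟨b, hb, rfl⟩ := hs'
    have h1 := hu b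
    have h2 := Data.size_ofBool_le b
    have h3 := Data.size_pos (Data.ofBool b)
    refine Spec.conv (((Spec.assign _ _ _).mono (S' := S + 30) le_rfl ?_).seq_pure
      ((Spec.assign _ _ _).mono le_rfl ?_)) ?_ le_rfl ?_
    · simp only [Expr.cost, ne_eq, reduceCtorEq, not_false_eq_true, Function.update_of_ne,
        Function.update_self, st_none]
      omega
    · have := storeSize_update (Function.update (st x) (some ()) (Data.ofBool b) :
        Store (Option Unit)) none (Data.cons (Data.ofBool b) x)
      simp only [Expr.cost, Expr.eval, ne_eq, reduceCtorEq, not_false_eq_true,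
        Function.update_of_ne, Function.update_self, st_none, Data.size] at this ⊢
      omega
    · simp only [Expr.cost, ne_eq, reduceCtorEq, not_false_eq_true,
        Function.update_of_ne, Function.update_self, st_none]
      omega
    · congr 1
      ext j
      match j with
      | none => simp [Expr.eval]
      | some () => simp [Expr.eval]
  have := (a1.mono le_rfl (by simp at key; omega)).seq a2
  refine this.conv (by omega) le_rfl ?_
  rw [PMF.map_comp, PMF.bind_map, ← PMF.bind_pure_comp]
  congr 1

theorem Impl.expr (e : Expr Unit) : Impl fun x μ T S =>
    μ = PMF.pure (e.eval fun _ => x) ∧ e.cost (fun _ => x) + 1 ≤ T ∧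
      x.size + e.cost (fun _ => x) ≤ S := by
  refine ⟨Empty, inferInstance, inferInstance, .assign none (e.map fun _ => none), 0, ?_⟩
  rintro x μ T S ⟨rfl, hT, hS⟩
  have := Spec.assign none (e.map fun _ => none) (st x : Store (Option Empty))
  rw [Expr.cost_map, Expr.eval_map, update_st_none, storeSize_st] at this
  rw [PMF.pure_map]
  exact this.mono hT hS

/-- The head of the input serves as guard and the tail as argument. The guard variable is private
and must be empty when a subroutine ends: it is cleared before the first branch and is `nil` already
in the second. -/
theorem Impl.branch {R₁ R₂ : Data → PMF Data → ℕ → ℕ → Prop} (h₁ : Impl R₁) (h₂ : Impl R₂) :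
    Impl fun x μ T S => ∃ T₀ S₀, (x.hd ≠ Data.nil → R₁ x.tl μ T₀ S₀) ∧
      (x.hd = Data.nil → R₂ x.tl μ T₀ S₀) ∧ T₀ + 2 * x.size + 20 ≤ T ∧ S₀ + 4 * x.size ≤ S := by
  obtain ⟨κ₁, i1, i2, c₁, C₁, hc₁⟩ := h₁
  obtain ⟨κ₂, i3, i4, c₂, C₂, hc₂⟩ := h₂
  let f₁ : κ₁ → Option (κ₁ ⊕ κ₂) := fun k => some (.inl k)
  let f₂ : κ₂ → Option (κ₁ ⊕ κ₂) := fun k => some (.inr k)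
  have hf₁ : f₁.Injective := fun a b h => by simpa [f₁] using h
  have hf₂ : f₂.Injective := fun a b h => by simpa [f₂] using h
  let fl : Option (Option (κ₁ ⊕ κ₂)) := some none
  refine ⟨Option (κ₁ ⊕ κ₂), inferInstance, inferInstance,
    .seq (.assign fl (.hd (.var none))) (.seq (.assign none (.tl (.var none)))
      (.branch fl (.seq (.assign fl .nil) (c₁.map (Option.map f₁))) (c₂.map (Option.map f₂)))),
    C₁ + C₂ + 2 * Fintype.card (Option (κ₁ ⊕ κ₂)) + 20 , ?_⟩
  rintro x μ T S ⟨T₀, S₀, H₁, H₂, hT, hS⟩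
  set C' := C₁ + C₂ + 2 * Fintype.card (Option (κ₁ ⊕ κ₂)) + 20
  have hx1 := x.size_hd_le
  have hx2 := x.size_tl_le
  let s₁ : Store (Option (Option (κ₁ ⊕ κ₂))) := Function.update (st x) fl x.hd
  let s₂ : Store (Option (Option (κ₁ ⊕ κ₂))) := Function.update (st x.tl) fl x.hd
  have hs12 : Function.update s₁ none x.tl = s₂ := by
    ext j
    match j with
    | none => simp [s₂, fl]
    | some none => simp [s₁, s₂, fl]
    | some (some k) => simp [s₁, s₂, fl]
  have hs2 : Function.update s₂ fl Data.nil = st x.tl := by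
    ext j
    match j with
    | none => simp [s₂, fl]
    | some none => simp [s₂, fl]
    | some (some k) => simp [s₂, fl]
  have hz₁ : storeSize s₁ ≤ 2 * x.size + Fintype.card (Option (κ₁ ⊕ κ₂)) := by
    have := storeSize_update (st x : Store (Option (Option (κ₁ ⊕ κ₂)))) fl x.hd
    rw [storeSize_st] at this
    simp only [s₁]; omega
  have hz₂ : storeSize s₂ ≤ 2 * x.size + Fintype.card (Option (κ₁ ⊕ κ₂)) := by
    have := storeSize_update (st x.tl : Store (Option (Option (κ₁ ⊕ κ₂)))) fl x.hd
    rw [storeSize_st] at this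
    simp only [s₂]; omega
  have a1 : Spec (.assign fl (.hd (.var none))) (st x) (x.size + 3) (S + C') (PMF.pure s₁) := by
    refine (Spec.assign _ _ _).mono ?_ ?_
    · simp [Expr.cost]
    · simp only [Expr.cost, storeSize_st, st_none]; omega
  have a2 : Spec (.assign none (.tl (.var none))) s₁ (x.size + 3) (S + C') (PMF.pure s₂) := by
    rw [← hs12]
    have : s₁ none = x := by simp [s₁, fl]
    refine (Spec.assign none (.tl (.var none)) s₁).mono ?_ ?_
    · simp [Expr.cost, this]
    · simp only [Expr.cost, this]; omega
  have a0 : Spec (.assign fl .nil) s₂ 2 (S + C') (PMF.pure (st x.tl)) := by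
    have h := Spec.assign fl .nil s₂
    simp only [Expr.eval, Expr.cost, hs2] at h
    exact h.mono le_rfl (by omega)
  have hext : ∀ {κ : Type} [Fintype κ] [DecidableEq κ] (f : κ → Option (κ₁ ⊕ κ₂)) (hf : f.Injective),
      ((fun s₁ => Function.extend (Option.map f) s₁ (st x.tl)) ∘ st :
        Data → Store (Option (Option (κ₁ ⊕ κ₂)))) = st := by
    intro κ _ _ f hf
    ext1 y; exact extend_st _ hf _ _
  have hz := storeSize_st (κ := Option (κ₁ ⊕ κ₂)) x.tl
  have a3 : Spec (.branch fl (.seq (.assign fl .nil) (c₁.map (Option.map f₁)))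
      (c₂.map (Option.map f₂))) s₂ (T₀ + 4) (S + C') (μ.map st) := by
    by_cases hx : x.hd = Data.nil
    · have e := (hc₂ _ _ _ _ (H₂ hx)).embed (Option.map f₂) (Option.map_injective hf₂)
        (st x.tl) (st_comp _ _)
      rw [PMF.map_comp, hext f₂ hf₂] at e
      have : s₂ = st x.tl := by
        rw [← hs2, ← hx]
        ext j
        match j with
        | none => simp [s₂, fl]
        | some none => simp [s₂, fl]
        | some (some k) => simp [s₂, fl]
      rw [this]
      exact (Spec.branch_nil (by simp [fl]) (e.mono le_rfl (by omega))).mono (by omega) le_rfl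
    · have e := (hc₁ _ _ _ _ (H₁ hx)).embed (Option.map f₁) (Option.map_injective hf₁)
        (st x.tl) (st_comp _ _)
      rw [PMF.map_comp, hext f₁ hf₁] at e
      exact (Spec.branch_cons (by simpa [s₂, fl] using hx)
        (a0.seq_pure (e.mono le_rfl (by omega)))).mono (by omega) le_rfl
  exact (a1.seq_pure (a2.seq_pure a3)).mono (by omega) le_rfl

/-- Iterate a kernel as long as the head of the state is not `nil`, at most `n` times. -/
noncomputable def iterK (K : Data → PMF Data) : ℕ → Data → PMF Data
  | 0, x => PMF.pure x
  | n + 1, x => if x.hd = Data.nil then PMF.pure x else (K x).bind (iterK K n)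

/-- The invariant `P m y` says that at most `m` passes remain: a state with nonempty head is
possible only for `m = m' + 1`, and a pass leads to `P m'`. So `n` passes suffice whatever the coin
flips, and `τ`, `σ` bound each of them. -/
theorem Impl.while {R : Data → PMF Data → ℕ → ℕ → Prop} (h : Impl R) :
    Impl fun x μ T S => ∃ (P : ℕ → Data → Prop) (K : Data → PMF Data) (τ σ n : ℕ), P n x ∧
      (∀ m y, P m y → y.size ≤ σ ∧ (y.hd ≠ Data.nil → ∃ m', m = m' + 1 ∧ R y (K y) τ σ ∧
        ∀ z ∈ (K y).support, P m' z)) ∧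
      μ = iterK K n x ∧ (n + 1) * (τ + σ + 20) ≤ T ∧ 4 * σ ≤ S := by
  obtain ⟨κ, i1, i2, c, C, hc⟩ := h
  let fl : Option (Option κ) := some none
  refine ⟨Option κ, inferInstance, inferInstance,
    .seq (.assign fl (.hd (.var none))) (.loop fl (.seq (c.map (Option.map some))
      (.assign fl (.hd (.var none))))), C + 2 * Fintype.card (Option κ) + 20 , ?_⟩
  rintro x μ T S ⟨P, K, τ, σ, n, hPx, hP, rfl, hT, hS⟩
  set C' := C + 2 * Fintype.card (Option κ) + 20
  have hinj : (Option.map (some : κ → Option κ)).Injective :=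
    Option.map_injective (Option.some_injective _)
  let s₁ : Data → Store (Option (Option κ)) := fun y => Function.update (st y) fl y.hd
  have hz : ∀ y d, storeSize (Function.update (st y : Store (Option (Option κ))) fl d) ≤
      y.size + d.size + Fintype.card (Option κ) := by
    intro y d
    have := storeSize_update (st y : Store (Option (Option κ))) fl d
    rw [storeSize_st] at this
    omega
  have a1 : ∀ y d, y.size ≤ σ → d.size ≤ σ → Spec (.assign fl (.hd (.var none)))
      (Function.update (st y) fl d) (σ + 3) (S + C') (PMF.pure (s₁ y)) := by
    intro y d hy hd
    have h := Spec.assign fl (.hd (.var none)) (Function.update (st y : Store (Option (Option κ))) fl d)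
    have e : (Function.update (st y : Store (Option (Option κ))) fl d) none = y := by simp [fl]
    simp only [Expr.eval, Expr.cost, e, Function.update_idem] at h
    have := hz y d
    exact h.mono (by omega) (by omega)
  have hfl : ∀ y, s₁ y fl = y.hd := fun y => by simp [s₁]
  have loop : ∀ n y, P n y → Spec (.loop fl (.seq (c.map (Option.map some))
      (.assign fl (.hd (.var none))))) (s₁ y) (n * (τ + σ + 20) + 1) (S + C')
      ((iterK K n y).map s₁) := by
    intro n
    induction n with
    | zero =>
      intro y hy
      have hy0 : y.hd = Data.nil := by
        by_contra hne
        obtain ⟨m', hm', -⟩ := (hP 0 y hy).2 hne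
        omega
      have := Spec.loop_nil (c := (.seq (c.map (Option.map some))
        (.assign fl (.hd (.var none))))) (S + C') ((hfl y).trans hy0)
      rw [iterK, PMF.pure_map]
      exact this.mono (by omega) le_rfl
    | succ n ih =>
      intro y hy
      by_cases hy0 : y.hd = Data.nil
      · have := Spec.loop_nil (c := (.seq (c.map (Option.map some))
          (.assign fl (.hd (.var none))))) (S + C') ((hfl y).trans hy0)
        rw [iterK, if_pos hy0, PMF.pure_map]
        exact this.mono (by omega) le_rfl
      · obtain ⟨hyσ, h'⟩ := hP _ y hy
        obtain ⟨m', hm', hR, hz'⟩ := h' hy0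
        obtain rfl : n = m' := by omega
        rw [iterK, if_neg hy0]
        have hcomp : s₁ y ∘ Option.map some = (st y : Store (Option κ)) := by
          ext i; cases i <;> simp [s₁, fl]
        have b1 := (hc _ _ _ _ hR).embed (Option.map some) hinj (s₁ y) hcomp
        rw [PMF.map_comp] at b1
        have hext : ((fun s : Store (Option κ) => Function.extend (Option.map some) s (s₁ y)) ∘ st) =
            fun z => (Function.update (st z) fl y.hd : Store (Option (Option κ))) := by
          funext z j
          match j with
          | none => exact hinj.extend_apply (st z) (s₁ y) none
          | some none =>
            rw [Function.comp, Function.extend_apply']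
            · simp [s₁, fl]
            · rintro ⟨a, ha⟩; cases a <;> simp at ha
          | some (some k) => exact hinj.extend_apply (st z) (s₁ y) (some k)
        rw [hext] at b1
        have hyh := y.size_hd_le
        have hzy := hz y y.hd
        have b2 := (b1.mono (S' := S + C') le_rfl (by simp only [s₁]; omega)).seq (T₂ := σ + 3)
          (d := .assign fl (.hd (.var none)))
          (ν := fun s => PMF.pure (s₁ (s none))) (by
            intro s' hs'
            rw [PMF.support_map] at hs'
            obtain ⟨z, hz, rfl⟩ := hs'
            have := a1 z y.hd (hP _ z (hz' z hz)).1 (by omega)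
            simpa [fl] using this)
        have b3 := Spec.loop_cons (i := fl) (by rw [hfl]; exact hy0) b2
          (ν := fun s => (iterK K n (s none)).map s₁) (T₂ := n * (τ + σ + 20) + 1) (by
            intro s' hs'
            rw [PMF.bind_map, PMF.mem_support_bind_iff] at hs'
            obtain ⟨z, hz, hs'⟩ := hs'
            simp only [Function.comp, PMF.mem_support_pure_iff] at hs'
            subst hs'
            have := ih z (hz' z hz)
            simpa [s₁, fl] using this)
        refine b3.conv (by ring_nf; omega) le_rfl ?_
        rw [PMF.bind_map, PMF.bind_bind, PMF.map_bind]
        congr 1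
        funext z
        simp [s₁, fl]
  have hx := (hP _ x hPx).1
  have f1 := a1 x Data.nil hx (by have := Data.size_pos x; simp [Data.size]; omega)
  have e1 : Function.update (st x : Store (Option (Option κ))) fl Data.nil = st x := by
    ext j
    match j with
    | none => simp [fl]
    | some none => simp [fl]
    | some (some k) => simp [fl]
  rw [e1] at f1
  -- The guard variable repeats the head of the state, which is `nil` when the loop ends; so all
  -- private variables are empty again.
  have hfin : (iterK K n x).map s₁ = (iterK K n x).map st := by
    have : ∀ n y, P n y → ∀ z ∈ (iterK K n y).support, z.hd = Data.nil := by
      intro n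
      induction n with
      | zero =>
        intro y hy z hz
        rw [iterK, PMF.mem_support_pure_iff] at hz
        subst hz
        by_contra hne
        obtain ⟨m', hm', -⟩ := (hP 0 _ hy).2 hne
        omega
      | succ n ih =>
        intro y hy z hz
        by_cases hy0 : y.hd = Data.nil
        · rw [iterK, if_pos hy0, PMF.mem_support_pure_iff] at hz
          subst hz; exact hy0
        · obtain ⟨m', hm', hR, hz'⟩ := (hP _ y hy).2 hy0
          obtain rfl : n = m' := by omega
          rw [iterK, if_neg hy0, PMF.mem_support_bind_iff] at hz
          obtain ⟨w, hw, hz⟩ := hz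
          exact ih w (hz' w hw) z hz
    have hs : ∀ z, z.hd = Data.nil → s₁ z = st z := by
      intro z hz
      ext j
      match j with
      | none => simp [s₁, fl]
      | some none => simp [s₁, fl, hz]
      | some (some k) => simp [s₁, fl]
    rw [← PMF.bind_pure_comp, ← PMF.bind_pure_comp]
    ext a
    rw [PMF.bind_apply, PMF.bind_apply]
    refine tsum_congr fun z => ?_
    by_cases hz : (iterK K n x) z = 0
    · simp [hz]
    · rw [Function.comp, Function.comp, hs z (this n x hPx z (((iterK K n x).mem_support_iff z).2 hz))]
  rw [← hfin]
  exact (f1.seq_pure (loop n x hPx)).mono (by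
    have : (n + 1) * (τ + σ + 20) = n * (τ + σ + 20) + (τ + σ + 20) := by ring
    omega) le_rfl

/-- Set all variables of a list to `nil`. -/
def clearAll {ι : Type} (l : List ι) (j : ι) : Cmd ι :=
  l.foldr (fun i c => .seq (.assign i .nil) c) (.assign j .nil)

theorem Spec.clearAll {ι : Type} [Fintype ι] [DecidableEq ι] (l : List ι) (j : ι) (s : Store ι) :
    Spec (clearAll l j) s (3 * l.length + 2) (storeSize s + 1)
      (PMF.pure fun i => if i = j ∨ i ∈ l then Data.nil else s i) := by
  induction l generalizing s with
  | nil =>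
    have := Spec.assign j .nil s
    simp only [Expr.eval, Expr.cost] at this
    refine this.conv (by simp) le_rfl ?_
    congr 1
    ext i
    simp [Function.update_apply]
  | cons a l ih =>
    have h1 := Spec.assign a .nil s
    have h2 := ih (Function.update s a Data.nil)
    have := storeSize_update s a Data.nil
    have := Data.size_pos (s a)
    simp only [Expr.eval, Expr.cost, Data.size] at *
    refine (h1.seq_pure (h2.mono le_rfl (by omega))).conv (by simp; omega) le_rfl ?_
    congr 1
    funext i
    by_cases h1 : i = a <;> by_cases h2 : i = j <;> by_cases h3 : i ∈ l <;>
      simp [h1, h2, h3]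

/-- A whole program becomes a subroutine: copy the input to its input variable, run the body on the
private variables, copy the output back, and empty every private variable. The last step needs one
assignment per variable, which is why `C` depends on `P`. -/
theorem Impl.program (P : Program) : ∃ C : ℕ, Impl fun x μ T S => ∃ μ₀ T₀,
    Halts T₀ T₀ (P.init x) μ₀ ∧ (∀ s ∈ μ₀.support, storeSize s ≤ T₀) ∧
      μ = μ₀.map (fun s => s P.output) ∧ x.size ≤ T₀ ∧ C * (T₀ + 1) ≤ T ∧ 10 * T₀ ≤ S := by
  refine ⟨10 * Fintype.card P.Var + 50, P.Var, inferInstance, inferInstance,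
    .seq (.assign (some P.input) (.var none)) (.seq (P.body.map some)
      (.seq (.assign none (.var (some P.output)))
        ((clearAll Finset.univ.toList P.input).map some))), 10 * Fintype.card P.Var + 20, ?_⟩
  rintro x μ T S ⟨μ₀, T₀, hH, hsz, rfl, hx, hT, hS⟩
  set C' := 10 * Fintype.card P.Var + 20
  have hinj : (some : P.Var → Option P.Var).Injective := Option.some_injective _
  let s₁ : Store (Option P.Var) := Function.update (st x) (some P.input) x
  have hcomp : s₁ ∘ some = P.initStore x := by
    ext i
    by_cases hi : i = P.input
    · subst hi; simp [s₁, Program.initStore]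
    · simp [s₁, Program.initStore, hi]
  have hz₁ : storeSize s₁ ≤ 2 * x.size + Fintype.card P.Var := by
    have := storeSize_update (st x : Store (Option P.Var)) (some P.input) x
    rw [storeSize_st] at this
    simp only [s₁]; omega
  have hsize : ∀ s : Store (Option P.Var), storeSize s = (s none).size + storeSize (s ∘ some) := by
    intro s; simp [storeSize, Fintype.sum_option]
  have a1 : Spec (.assign (some P.input) (.var none)) (st x) (x.size + 2) (S + C')
      (PMF.pure s₁) := by
    refine (Spec.assign _ _ _).mono ?_ ?_
    · simp [Expr.cost]
    · simp only [Expr.cost, storeSize_st, st_none]; omega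
  have a2 : Spec (P.body.map some) s₁ T₀ (S + C') (μ₀.map fun s => Function.extend some s s₁) := by
    have h0 : Halts T₀ T₀ ⟨[P.body], s₁ ∘ some, 0, storeSize (P.initStore x)⟩ μ₀ := by
      rw [hcomp]; exact hH
    exact (h0.spec_embed some hinj s₁).mono le_rfl (by omega)
  have hnone : ∀ s, (Function.extend some s s₁ : Store (Option P.Var)) none = x := by
    intro s
    rw [Function.extend_apply' _ _ _ (by rintro ⟨a, ha⟩; cases ha)]
    simp [s₁]
  have hsome : ∀ s i, (Function.extend some s s₁ : Store (Option P.Var)) (some i) = s i :=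
    fun s i => hinj.extend_apply s s₁ i
  have a3 : ∀ s' ∈ (μ₀.map fun s => Function.extend some s s₁).support,
      Spec (.seq (.assign none (.var (some P.output)))
        ((clearAll Finset.univ.toList P.input).map some)) s'
        (T₀ + 3 * Fintype.card P.Var + 10) (S + C')
        ((fun s' : Store (Option P.Var) => PMF.pure (st (s' (some P.output)))) s') := by
    intro s' hs'
    rw [PMF.support_map] at hs'
    obtain ⟨s, hs, rfl⟩ := hs'
    set s' : Store (Option P.Var) := Function.extend some s s₁
    have hs0 := hsz s hs
    have h1 : storeSize s' ≤ x.size + T₀ := by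
      rw [hsize, show s' none = x from hnone s]
      have : s' ∘ some = s := by ext i; exact hsome s i
      rw [this]; omega
    have h2 : s' (some P.output) = s P.output := hsome _ _
    have h3 := size_le_storeSize s P.output
    have b1 := Spec.assign none (.var (some P.output)) s'
    simp only [Expr.cost, Expr.eval, h2] at b1 ⊢
    set s₂ : Store (Option P.Var) := Function.update s' none (s P.output)
    have h4 : storeSize s₂ ≤ 2 * T₀ := by
      rw [hsize]
      have : s₂ ∘ some = s := by ext i; simp [s₂, hsome, s']
      rw [this]
      simp only [s₂, Function.update_self]; omega
    have b2 := (Spec.clearAll Finset.univ.toList P.input (s₂ ∘ some)).embed some hinj s₂ rfl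
    have h5 : storeSize (s₂ ∘ some) ≤ storeSize s₂ := by rw [hsize s₂]; omega
    have b3 := (b1.mono (S' := S + C') le_rfl (by omega)).seq_pure
      (b2.mono (S' := S + C') le_rfl (by omega))
    refine b3.conv (by simp; omega) le_rfl ?_
    rw [PMF.pure_map]
    congr 1
    ext j
    cases j with
    | none =>
      rw [Function.extend_apply' _ _ _ (by rintro ⟨a, ha⟩; cases ha)]
      simp [s₂, s', hsome]
    | some j => rw [hinj.extend_apply]; simp
  have := a1.seq_pure (a2.seq a3)
  refine this.conv (by
    have : (10 * Fintype.card P.Var + 50) * (T₀ + 1) =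
      10 * (Fintype.card P.Var * T₀) + 10 * Fintype.card P.Var + 50 * T₀ + 50 := by ring
    omega) le_rfl ?_
  rw [PMF.map_comp, PMF.bind_map, ← PMF.bind_pure_comp]
  congr 1
  funext s
  simp [hsome]

end TreeProg

namespace TreeProg

/-! ### Polynomial-time functions -/

theorem eval_mono (q : Polynomial ℕ) {a b : ℕ} (h : a ≤ b) : q.eval a ≤ q.eval b := by
  rw [Polynomial.eval_eq_sum, Polynomial.eval_eq_sum]
  exact Finset.sum_le_sum fun i _ => Nat.mul_le_mul_left _ (Nat.pow_le_pow_left h i)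

/-- Functions computed by a deterministic program in polynomial time. -/
@[fun_prop]
def PT (f : Data → Data) : Prop :=
  ∃ q : Polynomial ℕ, Impl (fun x μ T S => μ = PMF.pure (f x) ∧ q.eval x.size ≤ T ∧
    q.eval x.size ≤ S) ∧ ∀ x, (f x).size ≤ q.eval x.size

theorem PT.of_impl {f : Data → Data} {R : Data → PMF Data → ℕ → ℕ → Prop} (h : Impl R)
    (q : Polynomial ℕ) (hq : ∀ x, ∃ T S, R x (PMF.pure (f x)) T S ∧ T ≤ q.eval x.size ∧
      S ≤ q.eval x.size ∧ (f x).size ≤ q.eval x.size) : PT f := by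
  refine ⟨q, h.mono ?_, fun x => ?_⟩
  · rintro x μ T S ⟨rfl, hT, hS⟩
    obtain ⟨T₀, S₀, h1, h2, h3, -⟩ := hq x
    exact ⟨T₀, S₀, h1, h2.trans hT, h3.trans hS⟩
  · obtain ⟨T₀, S₀, h1, h2, h3, h4⟩ := hq x
    exact h4

theorem Expr.cost_le (e : Expr Unit) : ∃ N : ℕ, ∀ x : Data, e.cost (fun _ => x) ≤ N * (x.size + 1) := by
  induction e with
  | var i => exact ⟨1, fun x => by simp [Expr.cost]⟩
  | nil => exact ⟨1, fun x => by simp [Expr.cost]⟩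
  | cons a b iha ihb =>
    obtain ⟨N, hN⟩ := iha
    obtain ⟨M, hM⟩ := ihb
    refine ⟨N + M + 1, fun x => ?_⟩
    have := hN x; have := hM x
    simp only [Expr.cost]
    ring_nf at *; omega
  | hd a ih =>
    obtain ⟨N, hN⟩ := ih
    refine ⟨N + 1, fun x => ?_⟩
    have := hN x
    simp only [Expr.cost]
    ring_nf at *; omega
  | tl a ih =>
    obtain ⟨N, hN⟩ := ih
    refine ⟨N + 1, fun x => ?_⟩
    have := hN x
    simp only [Expr.cost]
    ring_nf at *; omega

theorem PT.expr (e : Expr Unit) : PT fun x => e.eval fun _ => x := by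
  obtain ⟨N, hN⟩ := e.cost_le
  refine PT.of_impl (Impl.expr e) (Polynomial.C N * (Polynomial.X + 1) + Polynomial.X + 1)
    fun x => ⟨_, _, ⟨rfl, le_rfl, le_rfl⟩, ?_⟩
  have := hN x
  have := e.size_eval_le fun _ => x
  simp only [Polynomial.eval_add, Polynomial.eval_mul, Polynomial.eval_C, Polynomial.eval_X,
    Polynomial.eval_one]
  omega

@[fun_prop]
theorem PT.id : PT fun x => x := PT.expr (.var ())

@[fun_prop]
theorem PT.comp {g f : Data → Data} (hg : PT g) (hf : PT f) : PT fun x => g (f x) := by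
  obtain ⟨p, hp, hp'⟩ := hf
  obtain ⟨q, hq, hq'⟩ := hg
  refine PT.of_impl (hp.seq hq) (p + q.comp p + Polynomial.X + p + 1) fun x =>
    ⟨_, _, ⟨PMF.pure (f x), fun y => PMF.pure (g y), p.eval x.size, q.eval (p.eval x.size),
      p.eval x.size, ⟨rfl, le_rfl, le_rfl⟩, ?_, ?_, by simp, le_rfl⟩, ?_, le_rfl, ?_⟩
  · simp; omega
  · intro y hy
    rw [PMF.mem_support_pure_iff] at hy
    subst hy
    have h1 := eval_mono q (hp' x)
    refine ⟨q.eval (p.eval x.size), ⟨rfl, h1, h1⟩, ?_⟩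
    have := hp' x
    simp; omega
  · simp; omega
  · have h1 := eval_mono q (hp' x)
    have := hq' (f x)
    simp; omega

theorem PT.keep {f : Data → Data} (hf : PT f) : PT fun x => Data.cons x (f x) := by
  obtain ⟨p, hp, hp'⟩ := hf
  refine PT.of_impl hp.keep (10 * p + 10 * Polynomial.X + 30) fun x =>
    ⟨p.eval x.size + 2 * x.size + p.eval x.size + 20, p.eval x.size + 4 * x.size + 2 * p.eval x.size,
      ⟨PMF.pure (f x), p.eval x.size, p.eval x.size, p.eval x.size, ⟨rfl, le_rfl, le_rfl⟩, ?_, ?_,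
      le_rfl, le_rfl⟩, ?_⟩
  · intro y hy
    rw [PMF.mem_support_pure_iff] at hy
    subst hy; exact hp' x
  · rw [PMF.pure_map]
  · have := hp' x
    simp [Data.size]
    omega

@[fun_prop]
theorem PT.hd {f : Data → Data} (hf : PT f) : PT fun x => (f x).hd :=
  PT.comp (g := Data.hd) (PT.expr (.hd (.var ()))) hf

@[fun_prop]
theorem PT.tl {f : Data → Data} (hf : PT f) : PT fun x => (f x).tl :=
  PT.comp (g := Data.tl) (PT.expr (.tl (.var ()))) hf

-- Both components need the input, so it is kept: the intermediate value is `cons (cons x (f x)) (g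
-- x)`.
@[fun_prop]
theorem PT.cons {f g : Data → Data} (hf : PT f) (hg : PT g) : PT fun x => Data.cons (f x) (g x) := by
  have h1 := PT.comp (PT.keep (hg.comp (PT.expr (.hd (.var ()))))) (PT.keep hf)
  exact (PT.expr (.cons (.tl (.hd (.var ()))) (.tl (.var ())))).comp h1

@[fun_prop]
theorem PT.const (d : Data) : PT fun _ => d := by
  induction d with
  | nil => exact PT.expr .nil
  | cons a b iha ihb => exact iha.cons ihb

@[fun_prop]
theorem PT.ite {c f g : Data → Data} (hc : PT c) (hf : PT f) (hg : PT g) :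
    PT fun x => if c x = Data.nil then f x else g x := by
  have h1 := hc.cons PT.id
  obtain ⟨p, hp, hp'⟩ := hf
  obtain ⟨q, hq, hq'⟩ := hg
  have : PT fun y => if y.hd = Data.nil then f y.tl else g y.tl := by
    refine PT.of_impl (hq.branch hp) (p + q + 10 * Polynomial.X + 20) fun x =>
      ⟨p.eval x.size + q.eval x.size + 2 * x.size + 20, p.eval x.size + q.eval x.size + 4 * x.size,
      ⟨p.eval x.size + q.eval x.size, p.eval x.size + q.eval x.size, ?_, ?_, le_rfl, le_rfl⟩, ?_⟩
    · intro hx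
      have := eval_mono q x.size_tl_le
      exact ⟨by rw [if_neg hx], by omega, by omega⟩
    · intro hx
      have := eval_mono p x.size_tl_le
      exact ⟨by rw [if_pos hx], by omega, by omega⟩
    · have := eval_mono q x.size_tl_le
      have := eval_mono p x.size_tl_le
      have := hp' x.tl
      have := hq' x.tl
      simp
      split_ifs <;> omega
  exact this.comp h1

namespace Data

def toList : Data → List Data
  | nil => []
  | cons a b => a :: b.toList

@[simp] theorem toList_nil : toList nil = [] := rfl
@[simp] theorem toList_cons (a b : Data) : toList (cons a b) = a :: b.toList := rfl

@[simp] theorem toList_ofList (l : List Data) : (ofList l).toList = l := by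
  induction l <;> simp_all [ofList]

@[simp] theorem ofList_toList (d : Data) : ofList d.toList = d := by
  induction d <;> simp_all [ofList]

theorem size_ofList (l : List Data) : (ofList l).size = (l.map fun d => d.size + 1).sum + 1 := by
  induction l with
  | nil => rfl
  | cons a l ih => simp only [ofList, size, ih, List.map_cons, List.sum_cons]; omega

theorem length_toList_lt (d : Data) : d.toList.length < d.size := by
  induction d with
  | nil => simp [size]
  | cons a b _ ih => simp only [toList_cons, List.length_cons, size]; have := a.size_pos; omega

theorem size_lt_of_mem {a d : Data} (h : a ∈ d.toList) : a.size < d.size := by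
  induction d with
  | nil => simp at h
  | cons b c _ ih =>
    simp only [toList_cons, List.mem_cons] at h
    rcases h with rfl | h
    · simp only [size]; omega
    · have := ih h; simp only [size]; omega

theorem size_ofList_le_of_suffix {l l' : List Data} (h : l <:+ l') :
    (ofList l).size ≤ (ofList l').size := by
  obtain ⟨t, rfl⟩ := h
  rw [size_ofList, size_ofList, List.map_append, List.sum_append]
  omega

theorem size_ofList_le {l : List Data} {B : ℕ} (h : ∀ d ∈ l, d.size ≤ B) :
    (ofList l).size ≤ l.length * (B + 1) + 1 := by
  rw [size_ofList]
  have := List.sum_le_card_nsmul (l.map fun d => d.size + 1) (B + 1) (by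
    intro x hx
    obtain ⟨d, hd, rfl⟩ := List.mem_map.1 hx
    have := h d hd; omega)
  simpa using this

end Data

/-- A left fold as a loop: the state consists of the rest of the list, the accumulator and the
parameter `x`, and the loop guard is the rest of the list. -/
theorem iterK_foldl (h : Data → Data → Data) (x : Data) (l : List Data) (acc : Data) :
    iterK (fun y => PMF.pure (Data.cons y.hd.tl (Data.cons (h y.tl.hd y.hd.hd) x))) l.length
      (Data.cons (Data.ofList l) (Data.cons acc x)) =
    PMF.pure (Data.cons Data.nil (Data.cons (l.foldl h acc) x)) := by
  induction l generalizing acc with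
  | nil => rfl
  | cons a l ih =>
    rw [List.length_cons, iterK, if_neg (by simp [Data.hd, Data.ofList]), PMF.pure_bind]
    exact ih _

theorem iterK_congr (K K' : Data → PMF Data) (P : Data → Prop) (hP : ∀ y, P y → y.hd ≠ Data.nil →
    K y = K' y ∧ ∀ z ∈ (K y).support, P z) (n : ℕ) : ∀ x, P x → iterK K n x = iterK K' n x := by
  induction n with
  | zero => intro x _; rfl
  | succ n ih =>
    intro x hx
    rw [iterK, iterK]
    split_ifs with h0
    · rfl
    · obtain ⟨h1, h2⟩ := hP x hx h0
      rw [← h1]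
      ext a
      rw [PMF.bind_apply, PMF.bind_apply]
      refine tsum_congr fun z => ?_
      by_cases hz : (K x) z = 0
      · simp [hz]
      · rw [ih z (h2 z (((K x).mem_support_iff z).2 hz))]

/-- Iterating a polynomial-time map may blow up the accumulator exponentially. The hypothesis `hb`
excludes this by a polynomial bound on the fold over every prefix of the list. -/
theorem PT.foldl {g : Data → Data → Data → Data} {a l : Data → Data}
    (hg : PT fun y => g y.hd y.tl.hd y.tl.tl) (ha : PT a) (hl : PT l)
    (hb : ∃ q : Polynomial ℕ, ∀ x l', l' <+: (l x).toList →
      (l'.foldl (g x) (a x)).size ≤ q.eval x.size) :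
    PT fun x => (l x).toList.foldl (g x) (a x) := by
  obtain ⟨q, hq⟩ := hb
  have hs : PT fun y =>
      Data.cons y.hd.tl (Data.cons (g y.tl.tl y.tl.hd y.hd.hd) y.tl.tl) := by
    have h2 : PT fun y => g y.tl.tl y.tl.hd y.hd.hd :=
      hg.comp (f := fun y => Data.cons y.tl.tl (Data.cons y.tl.hd y.hd.hd)) (by fun_prop)
    exact PT.cons (by fun_prop) (PT.cons h2 (by fun_prop))
  have h0 : PT fun x => Data.cons (l x) (Data.cons (a x) x) := by fun_prop
  obtain ⟨p, hp, -⟩ := hs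
  obtain ⟨r, -, hr⟩ := hl
  obtain ⟨v, hv, hv'⟩ := h0
  let E : Polynomial ℕ := r + q + Polynomial.X + 2
  have hE : ∀ x : Data, E.eval x.size = r.eval x.size + q.eval x.size + x.size + 2 := by
    intro x; simp [E]
  let W : Polynomial ℕ := E + p.comp E
  have hW : ∀ x : Data, W.eval x.size = E.eval x.size + p.eval (E.eval x.size) := by
    intro x; simp [W]
  have hw : PT fun x => Data.cons Data.nil (Data.cons ((l x).toList.foldl (g x) (a x)) x) := by
    refine PT.of_impl (hv.seq hp.while) (v + (r + 1) * (p.comp E + W + 20) + 1 +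
      (v + Polynomial.X + 5 * W + v)) fun x =>
      ⟨_, v.eval x.size + x.size + 5 * W.eval x.size + v.eval x.size,
      ⟨PMF.pure (Data.cons (l x) (Data.cons (a x) x)), fun y => iterK (fun y => PMF.pure
        (Data.cons y.hd.tl (Data.cons (g y.tl.tl y.tl.hd y.hd.hd) y.tl.tl))) (l x).toList.length y,
        v.eval x.size, (r.eval x.size + 1) * (p.eval (E.eval x.size) + W.eval x.size + 20),
        v.eval x.size, ⟨rfl, le_rfl, le_rfl⟩, by omega, ?_, ?_, le_rfl⟩, ?_⟩
    · intro y hy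
      rw [PMF.mem_support_pure_iff] at hy
      subst hy
      -- Invariant: the prefix `l₁` has been folded, `l₂` remains, and its length is the number of
      -- passes left.
      refine ⟨4 * W.eval x.size, ⟨fun m y => ∃ l₁ l₂, l₁ ++ l₂ = (l x).toList ∧
        y = Data.cons (Data.ofList l₂) (Data.cons (l₁.foldl (g x) (a x)) x) ∧ m = l₂.length, _,
        p.eval (E.eval x.size), W.eval x.size, _, ⟨[], (l x).toList, rfl, by simp, rfl⟩, ?_,
        rfl, ?_, le_rfl⟩, ?_⟩
      · rintro m y ⟨l₁, l₂, h12, rfl, rfl⟩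
        have h1 := Data.size_ofList_le_of_suffix (⟨l₁, h12⟩ : l₂ <:+ (l x).toList)
        have h2 := hq x l₁ ⟨l₂, h12⟩
        have h3 := hr x
        rw [Data.ofList_toList] at h1
        have hsz : (Data.cons (Data.ofList l₂) (Data.cons (l₁.foldl (g x) (a x)) x)).size ≤
            E.eval x.size := by
          rw [hE]; simp only [Data.size]; omega
        have h4 := hW x
        refine ⟨by omega, fun hne => ?_⟩
        cases l₂ with
        | nil => exact absurd rfl hne
        | cons b l₂ =>
          have := eval_mono p hsz
          refine ⟨l₂.length, by simp, ⟨rfl, this, by omega⟩, ?_⟩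
          intro z hz
          rw [PMF.mem_support_pure_iff] at hz
          subst hz
          exact ⟨l₁ ++ [b], l₂, by simpa using h12, by simp [Data.hd, Data.tl, Data.ofList], rfl⟩
      · have h1 := Data.length_toList_lt (l x)
        have h2 := hr x
        gcongr
        omega
      · have := hv' x; simp only at this; omega
    · rw [PMF.pure_bind]
      have h1 := iterK_foldl (g x) x (l x).toList (a x)
      rw [Data.ofList_toList] at h1
      rw [← h1]
      refine iterK_congr _ _ (fun y => y.tl.tl = x) (fun y hy _ => ⟨by rw [hy], ?_⟩) _ _ rfl
      intro z hz
      rw [PMF.mem_support_pure_iff] at hz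
      subst hz; simp [Data.tl]
    · have h2 := hq x _ (List.prefix_refl _)
      have h3 := hE x
      have h4 := hW x
      refine ⟨?_, ?_, ?_⟩
      · simp only [Polynomial.eval_add, Polynomial.eval_mul, Polynomial.eval_comp,
          Polynomial.eval_one, Polynomial.eval_ofNat]
        omega
      · simp only [Polynomial.eval_add, Polynomial.eval_mul, Polynomial.eval_comp,
          Polynomial.eval_one, Polynomial.eval_ofNat, Polynomial.eval_X]
        omega
      · simp only [Polynomial.eval_add, Polynomial.eval_mul, Polynomial.eval_comp,
          Polynomial.eval_one, Polynomial.eval_ofNat, Polynomial.eval_X, Data.size]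
        omega
  exact hw.tl.hd

-- A library of polynomial-time functions, and truncated polynomials over `F₂` as bit lists

end TreeProg

namespace TreeProg

/-! ### A library of polynomial-time functions -/

theorem PT.bound {f : Data → Data} (hf : PT f) :
    ∃ q : Polynomial ℕ, ∀ x, (f x).size ≤ q.eval x.size := by
  obtain ⟨q, -, hq⟩ := hf
  exact ⟨q, hq⟩

theorem PT.foldl_of_bounded {g : Data → Data → Data → Data} {a l : Data → Data}
    (hg : PT fun y => g y.hd y.tl.hd y.tl.tl) (ha : PT a) (hl : PT l)
    (hb : ∃ q : Polynomial ℕ, ∀ x acc b, (g x acc b).size ≤ q.eval x.size) :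
    PT fun x => (l x).toList.foldl (g x) (a x) := by
  obtain ⟨q, hq⟩ := hb
  obtain ⟨p, hp⟩ := ha.bound
  refine PT.foldl hg ha hl ⟨q + p, fun x l' _ => ?_⟩
  rw [Polynomial.eval_add]
  rcases List.eq_nil_or_concat l' with rfl | ⟨l', b, rfl⟩
  · have := hp x; simp; omega
  · rw [List.concat_eq_append, List.foldl_append]
    have := hq x (l'.foldl (g x) (a x)) b
    simp only [List.foldl_cons, List.foldl_nil]
    omega

namespace Data

/-- Length of a list. -/
def len (d : Data) : ℕ := d.toList.length

/-- Unary numbers. -/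
def un (n : ℕ) : Data := ofNatUnary n

@[simp] theorem len_un (n : ℕ) : (un n).len = n := by simp [len, un, ofNatUnary]

theorem len_lt_size (d : Data) : d.len < d.size := d.length_toList_lt

theorem size_un (n : ℕ) : (un n).size = 2 * n + 1 := by
  rw [un, ofNatUnary, size_ofList, List.map_replicate, List.sum_replicate]
  simp [size]; omega

@[simp] theorem un_zero : un 0 = nil := rfl
theorem un_succ (n : ℕ) : un (n + 1) = cons nil (un n) := rfl

@[simp] theorem len_nil : nil.len = 0 := rfl
@[simp] theorem len_cons (a b : Data) : (cons a b).len = b.len + 1 := rfl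

def revD (d : Data) : Data := ofList d.toList.reverse

def mapD (h : Data → Data) (d : Data) : Data := ofList (d.toList.map h)

/-- The list of the values of `h` at the unary numbers smaller than the length of `n`. -/
def tab (n : Data) (h : Data → Data) : Data := ofList ((List.range n.len).map fun i => h (un i))

/-- Drop as many entries from `d` as `i` has. -/
def dropD (d i : Data) : Data := ofList (d.toList.drop i.len)

/-- The entry of `d` whose position is the length of `i`. -/
def nthD (d i : Data) : Data := (d.dropD i).hd

def appendD (a b : Data) : Data := ofList (a.toList ++ b.toList)

/-- The unary product of two lengths. -/
def mulU (a b : Data) : Data := un (a.len * b.len)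

end Data

open Data

theorem revD_eq (d : Data) : d.revD = d.toList.foldl (fun acc a => Data.cons a acc) Data.nil := by
  have : ∀ l acc, ofList (List.reverse l ++ toList acc) =
      l.foldl (fun acc a => Data.cons a acc) acc := by
    intro l
    induction l with
    | nil => intro acc; simp
    | cons a l ih => intro acc; rw [List.foldl_cons, ← ih]; simp
  simpa [Data.revD] using this d.toList nil

@[fun_prop]
theorem PT.revD {f : Data → Data} (hf : PT f) : PT fun x => (f x).revD := by
  refine PT.comp (g := Data.revD) ?_ hf
  rw [show Data.revD = fun d => d.toList.foldl (fun acc a => Data.cons a acc) Data.nil from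
    funext revD_eq]
  refine PT.foldl (g := fun _ acc a => Data.cons a acc) (by fun_prop) (by fun_prop) (by fun_prop)
    ⟨Polynomial.X, fun x l' hl' => ?_⟩
  have h1 := revD_eq (ofList l')
  rw [toList_ofList] at h1
  rw [← h1, Data.revD, toList_ofList, Polynomial.eval_X]
  obtain ⟨t, ht⟩ := hl'
  have h2 : x.size = (ofList (l' ++ t)).size := by rw [ht, ofList_toList]
  rw [h2, size_ofList, size_ofList, List.map_append, List.sum_append, List.map_reverse,
    List.sum_reverse]
  omega

@[fun_prop]
theorem PT.mapD {h : Data → Data → Data} {l : Data → Data} (hh : PT fun y => h y.hd y.tl)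
    (hl : PT l) : PT fun x => Data.mapD (h x) (l x) := by
  have key : ∀ x l', (List.foldl (fun acc a => Data.cons (h x a) acc) Data.nil l') =
      ofList (l'.map (h x)).reverse := by
    intro x l'
    have := revD_eq (ofList (l'.map (h x)))
    rw [toList_ofList, List.foldl_map] at this
    rw [← this, Data.revD, toList_ofList]
  have : PT fun x => (l x).toList.foldl (fun acc a => Data.cons (h x a) acc) Data.nil := by
    obtain ⟨q, hq⟩ := hh.bound
    obtain ⟨p, hp⟩ := hl.bound
    refine PT.foldl (g := fun x acc a => Data.cons (h x a) acc) ?_ (by fun_prop) hl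
      ⟨p * (q.comp (Polynomial.X + p + 1) + 1) + 1, fun x l' hl' => ?_⟩
    · refine PT.cons ?_ (by fun_prop)
      exact hh.comp (f := fun y => Data.cons y.hd y.tl.tl) (by fun_prop)
    · rw [key]
      refine (size_ofList_le (B := q.eval (x.size + p.eval x.size + 1)) ?_).trans ?_
      · intro d hd
        rw [List.mem_reverse, List.mem_map] at hd
        obtain ⟨a, ha, rfl⟩ := hd
        refine (hq (Data.cons x a)).trans (eval_mono q ?_)
        have h1 := size_lt_of_mem (hl'.subset ha)
        have h2 := hp x
        simp only [Data.size]; omega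
      · simp only [List.length_reverse, List.length_map, Polynomial.eval_add, Polynomial.eval_mul,
          Polynomial.eval_comp, Polynomial.eval_X, Polynomial.eval_one]
        have h1 := hl'.length_le
        have h2 := hp x
        have h3 := length_toList_lt (l x)
        have : l'.length ≤ p.eval x.size := by omega
        gcongr
  have e : (fun x => (List.foldl (fun acc a => Data.cons (h x a) acc) Data.nil
      (l x).toList).revD) = fun x => Data.mapD (h x) (l x) := by
    funext x
    rw [key, Data.revD, toList_ofList, List.reverse_reverse, Data.mapD]
  rw [← e]
  exact this.revD

theorem PT.range : PT fun x => Data.ofList ((List.range x.len).map Data.un) := by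
  -- The accumulator holds the next unary number and the reversed list of the previous ones.
  let g : Data → Data → Data → Data := fun _ acc _ =>
    Data.cons (Data.cons Data.nil acc.hd) (Data.cons acc.hd acc.tl)
  have key : ∀ (x : Data) (l' : List Data), l'.foldl (g x) (Data.cons Data.nil Data.nil) =
      Data.cons (un l'.length) (ofList ((List.range l'.length).map un).reverse) := by
    intro x l'
    induction l' using List.reverseRecOn with
    | nil => rfl
    | append_singleton l' a ih =>
      rw [List.foldl_append, List.foldl_cons, List.foldl_nil, ih]
      simp [g, Data.hd, Data.tl, List.range_succ, un_succ, ofList]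
  have h1 : PT fun x => x.toList.foldl (g x) (Data.cons Data.nil Data.nil) := by
    refine PT.foldl (g := g) (l := fun x => x) (by simp only [g]; fun_prop) (by fun_prop) PT.id
      ⟨2 * Polynomial.X + 2 + Polynomial.X * (2 * Polynomial.X + 2) + 2, fun x l' hl' => ?_⟩
    rw [key x]
    have h1 := hl'.length_le
    have h2 := length_toList_lt x
    have h3 := size_ofList_le (l := ((List.range l'.length).map un).reverse)
      (B := 2 * x.size + 1) (by
        intro d hd
        rw [List.mem_reverse, List.mem_map] at hd
        obtain ⟨i, hi, rfl⟩ := hd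
        rw [List.mem_range] at hi
        rw [size_un]; omega)
    simp only [List.length_reverse, List.length_map, List.length_range] at h3
    have h4 : l'.length * (2 * x.size + 1 + 1) ≤ x.size * (2 * x.size + 1 + 1) := by
      gcongr; omega
    simp only [Data.size, size_un]
    simp
    ring_nf at *
    omega
  have e : (fun x : Data => (x.toList.foldl (g x) (Data.cons Data.nil Data.nil)).tl.revD) =
      fun x => Data.ofList ((List.range x.len).map Data.un) := by
    funext x
    rw [key x]
    simp [Data.tl, Data.revD, Data.len]
  rw [← e]
  exact h1.tl.revD

@[fun_prop]
theorem PT.tab {n : Data → Data} {h : Data → Data → Data} (hn : PT n)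
    (hh : PT fun y => h y.hd y.tl) : PT fun x => Data.tab (n x) (h x) := by
  have := PT.mapD hh (PT.range.comp hn)
  have e : (fun x => Data.mapD (h x) (Data.ofList ((List.range (n x).len).map Data.un))) =
      fun x => Data.tab (n x) (h x) := by
    funext x
    simp [Data.mapD, Data.tab, Function.comp_def]
  rwa [e] at this

/-- Fold over the unary numbers smaller than the length of `n`. -/
def Data.foldU (n : Data) (g : Data → Data → Data) (a : Data) : Data :=
  (List.range n.len).foldl (fun acc i => g acc (un i)) a

theorem PT.foldU {g : Data → Data → Data → Data} {a n : Data → Data}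
    (hg : PT fun y => g y.hd y.tl.hd y.tl.tl) (ha : PT a) (hn : PT n)
    (hb : ∃ q : Polynomial ℕ, ∀ x acc b, (g x acc b).size ≤ q.eval x.size) :
    PT fun x => (n x).foldU (g x) (a x) := by
  have := PT.foldl_of_bounded hg ha (PT.range.comp hn) hb
  simpa [List.foldl_map, Data.foldU] using this

@[fun_prop]
theorem PT.dropD {f g : Data → Data} (hf : PT f) (hg : PT g) : PT fun x => (f x).dropD (g x) := by
  have key : ∀ (d : Data) (l : List Data), l.foldl (fun acc _ => acc.tl) d =
      ofList (d.toList.drop l.length) := by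
    intro d l
    induction l generalizing d with
    | nil => simp
    | cons a l ih => rw [List.foldl_cons, ih]; cases d <;> simp [Data.tl]
  have : PT fun x => (g x).toList.foldl (fun acc _ => acc.tl) (f x) := by
    obtain ⟨q, hq⟩ := hf.bound
    refine PT.foldl (g := fun _ acc _ => acc.tl) (by fun_prop) hf hg ⟨q, fun x l' _ => ?_⟩
    rw [key]
    refine le_trans ?_ (hq x)
    have := size_ofList_le_of_suffix (List.drop_suffix l'.length (f x).toList)
    rwa [ofList_toList] at this
  simp_rw [key] at this
  exact this

@[fun_prop]
theorem PT.nthD {f g : Data → Data} (hf : PT f) (hg : PT g) : PT fun x => (f x).nthD (g x) := by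
  unfold Data.nthD
  fun_prop

@[fun_prop]
theorem PT.appendD {f g : Data → Data} (hf : PT f) (hg : PT g) :
    PT fun x => (f x).appendD (g x) := by
  have key : ∀ (l : List Data) (b : Data), l.reverse.foldl (fun acc a => Data.cons a acc) b =
      ofList (l ++ b.toList) := by
    intro l b
    induction l with
    | nil => simp
    | cons a l ih => simp [ih, ofList]
  have : PT fun x => (f x).revD.toList.foldl (fun acc a => Data.cons a acc) (g x) := by
    obtain ⟨q, hq⟩ := hf.bound
    obtain ⟨p, hp⟩ := hg.bound
    refine PT.foldl (g := fun _ acc a => Data.cons a acc) (by fun_prop) hg (by fun_prop)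
      ⟨p + q, fun x l' hl' => ?_⟩
    have h1 := key l'.reverse (g x)
    rw [List.reverse_reverse] at h1
    rw [h1, size_ofList, List.map_append, List.sum_append, Polynomial.eval_add]
    have h2 := hq x
    have h3 := hp x
    have h4 := size_ofList (g x).toList
    have h5 := size_ofList (f x).toList
    rw [ofList_toList] at h4 h5
    have h6 : ((l'.reverse).map fun d => d.size + 1).sum ≤
        ((f x).toList.map fun d => d.size + 1).sum := by
      rw [List.map_reverse, List.sum_reverse]
      obtain ⟨t, ht⟩ := hl'
      rw [Data.revD, toList_ofList] at ht
      have : ((f x).toList.map fun d => d.size + 1).sum =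
          ((l' ++ t).map fun d => d.size + 1).sum := by
        rw [ht, List.map_reverse, List.sum_reverse]
      rw [this, List.map_append, List.sum_append]
      omega
    omega
  have e : (fun x => (f x).revD.toList.foldl (fun acc a => Data.cons a acc) (g x)) =
      fun x => (f x).appendD (g x) := by
    funext x
    rw [Data.revD, toList_ofList, key, Data.appendD]
  rwa [e] at this

theorem appendD_un (a b : ℕ) : (un a).appendD (un b) = un (a + b) := by
  simp [Data.appendD, un, ofNatUnary, List.replicate_append_replicate]

theorem tab_nil (n : Data) : Data.tab n (fun _ => Data.nil) = un n.len := by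
  simp [Data.tab, un, ofNatUnary]

@[fun_prop]
theorem PT.mulU {f g : Data → Data} (hf : PT f) (hg : PT g) : PT fun x => (f x).mulU (g x) := by
  have key : ∀ (l : List Data) (b : ℕ), l.foldl (fun acc _ => acc.appendD (un b)) (un 0) =
      un (l.length * b) := by
    intro l b
    induction l using List.reverseRecOn with
    | nil => simp
    | append_singleton l a ih =>
      rw [List.foldl_append, ih]
      simp [appendD_un, Nat.succ_mul]
  have : PT fun x => (f x).toList.foldl
      (fun acc _ => acc.appendD (Data.tab (g x) fun _ => Data.nil)) (un 0) := by
    obtain ⟨q, hq⟩ := hf.bound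
    obtain ⟨p, hp⟩ := hg.bound
    refine PT.foldl (g := fun x acc _ => acc.appendD (Data.tab (g x) fun _ => Data.nil))
      ?_ (by fun_prop) hf ⟨2 * (q * p) + 1, fun x l' hl' => ?_⟩
    · exact PT.appendD (by fun_prop) (PT.tab (hg.comp (by fun_prop)) (by fun_prop))
    · simp only [tab_nil]
      rw [key, size_un]
      have h1 := hl'.length_le
      have h2 := length_toList_lt (f x)
      have h3 := len_lt_size (g x)
      have h4 := hq x
      have h5 := hp x
      have : l'.length * (g x).len ≤ q.eval x.size * p.eval x.size := by
        gcongr <;> omega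
      simpa using this
  simp_rw [tab_nil, key] at this
  exact this

theorem nthD_eq (d i : Data) : d.nthD i = d.toList.getD i.len Data.nil := by
  rw [Data.nthD, Data.dropD]
  rcases h : d.toList.drop i.len with _ | ⟨a, l⟩
  · rw [List.drop_eq_nil_iff] at h
    simp [ofList, Data.hd, h]
  · have h1 := congrArg List.head? h
    rw [List.head?_drop] at h1
    simp at h1
    simp [ofList, Data.hd, h1]

theorem nthD_tab (n : Data) (h : Data → Data) (i : Data) (hi : i.len < n.len) :
    (Data.tab n h).nthD i = h (un i.len) := by
  rw [nthD_eq, Data.tab, toList_ofList]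
  simp [List.getD, hi]

theorem nthD_tab_un (n : Data) (h : Data → Data) (i : ℕ) (hi : i < n.len) :
    (Data.tab n h).nthD (un i) = h (un i) := by
  rw [nthD_tab _ _ _ (by simpa using hi)]; simp

@[simp] theorem len_tab (n : Data) (h : Data → Data) : (Data.tab n h).len = n.len := by
  simp [Data.tab, Data.len]

theorem dropD_un (a b : ℕ) : (un a).dropD (un b) = un (a - b) := by
  simp [Data.dropD, un, ofNatUnary, Data.len]

theorem un_eq_nil_iff (n : ℕ) : un n = Data.nil ↔ n = 0 := by
  cases n <;> simp [un_succ]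

theorem dropD_eq_nil_iff (a b : Data) : a.dropD b = Data.nil ↔ a.len ≤ b.len := by
  have : ∀ l : List Data, ofList l = Data.nil ↔ l = [] := by intro l; cases l <;> simp [ofList]
  rw [Data.dropD, this, List.drop_eq_nil_iff]; rfl

end TreeProg

namespace TreeProg
open Data

/-! ### Truncated polynomials over `F₂` as lists of coefficients -/

namespace Data

def tt : Data := cons nil nil

noncomputable def xorB (a b : Data) : Data :=
  if a = nil then (if b = nil then nil else tt) else (if b = nil then tt else nil)

noncomputable def andB (a b : Data) : Data := if a = nil then nil else (if b = nil then nil else tt)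

/-- The value of a bit. -/
noncomputable def bit (a : Data) : ZMod 2 := if a = nil then 0 else 1

/-- A coefficient of a list of bits. -/
noncomputable def cf (d : Data) (i : ℕ) : ZMod 2 := bit (d.nthD (un i))

/-- Here and below the length of `D` is the order of truncation: coefficients from there on are
dropped. This bounds the size of every result independently of the arguments. -/
noncomputable def addD (D a b : Data) : Data := tab D fun i => xorB (a.nthD i) (b.nthD i)

/-- `cons nil i` has one entry more than `i`, so `j` runs over `0, …, i` in the convolution. -/
noncomputable def mulD (D a b : Data) : Data :=
  tab D fun i => foldU (cons nil i)
    (fun acc j => xorB acc (andB (a.nthD j) (b.nthD (i.dropD j)))) nil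

noncomputable def sumD (D n : Data) (h : Data → Data) : Data :=
  foldU n (fun acc i => addD D acc (h i)) nil

noncomputable def prodD (D n : Data) (h : Data → Data) : Data :=
  foldU n (fun acc i => mulD D acc (h i)) (cons tt nil)

theorem size_xorB_le (a b : Data) : (xorB a b).size ≤ 3 := by
  unfold xorB tt
  split_ifs <;> simp [size]

@[simp] theorem bit_nil : bit nil = 0 := by simp [bit]
@[simp] theorem bit_tt : bit tt = 1 := by simp [bit, tt]
@[simp] theorem bit_ofBool (b : Bool) : bit (ofBool b) = if b then 1 else 0 := by
  cases b <;> simp [ofBool, bit]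

theorem bit_xorB (a b : Data) : bit (xorB a b) = bit a + bit b := by
  unfold xorB
  by_cases ha : a = nil <;> by_cases hb : b = nil <;> simp [ha, hb, bit, tt]
  decide

theorem bit_andB (a b : Data) : bit (andB a b) = bit a * bit b := by
  unfold andB
  by_cases ha : a = nil <;> by_cases hb : b = nil <;> simp [ha, hb, bit, tt]

end Data

@[fun_prop]
theorem PT.xorB {f g : Data → Data} (hf : PT f) (hg : PT g) :
    PT fun x => Data.xorB (f x) (g x) := by
  unfold Data.xorB
  fun_prop

@[fun_prop]
theorem PT.andB {f g : Data → Data} (hf : PT f) (hg : PT g) :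
    PT fun x => Data.andB (f x) (g x) := by
  unfold Data.andB
  fun_prop

theorem size_tab_le (n : Data) (h : Data → Data) (B : ℕ) (hB : ∀ i, (h i).size ≤ B) :
    (tab n h).size ≤ n.size * (B + 1) + 1 := by
  refine (size_ofList_le (B := B) ?_).trans ?_
  · intro d hd
    obtain ⟨i, -, rfl⟩ := List.mem_map.1 hd
    exact hB _
  · simp only [List.length_map, List.length_range]
    have := n.len_lt_size
    gcongr

theorem size_addD_le (D a b : Data) : (addD D a b).size ≤ D.size * 4 + 1 :=
  size_tab_le _ _ 3 fun _ => size_xorB_le _ _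

theorem size_foldU_le (n : Data) (g : Data → Data → Data) (a : Data) (B : ℕ) (ha : a.size ≤ B)
    (hg : ∀ acc i, (g acc i).size ≤ B) : (foldU n g a).size ≤ B := by
  unfold foldU
  rcases List.eq_nil_or_concat (List.range n.len) with h | ⟨l', b, h⟩
  · rw [h]; exact ha
  · rw [h, List.concat_eq_append, List.foldl_append]
    exact hg _ _

theorem size_mulD_le (D a b : Data) : (mulD D a b).size ≤ D.size * 4 + 1 :=
  size_tab_le _ _ 3 fun _ => size_foldU_le _ _ _ _ (by simp [Data.size]) fun _ _ => size_xorB_le _ _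

@[fun_prop]
theorem PT.addD {D f g : Data → Data} (hD : PT D) (hf : PT f) (hg : PT g) :
    PT fun x => Data.addD (D x) (f x) (g x) := by
  unfold Data.addD
  refine PT.tab hD (PT.xorB ?_ ?_)
  · exact PT.nthD (hf.comp (by fun_prop)) (by fun_prop)
  · exact PT.nthD (hg.comp (by fun_prop)) (by fun_prop)

@[fun_prop]
theorem PT.mulD {D f g : Data → Data} (hD : PT D) (hf : PT f) (hg : PT g) :
    PT fun x => Data.mulD (D x) (f x) (g x) := by
  unfold Data.mulD
  refine PT.tab hD (PT.foldU ?_ (by fun_prop) (by fun_prop) ⟨3, fun x acc b => ?_⟩)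
  · refine PT.xorB (by fun_prop) (PT.andB ?_ ?_)
    · exact PT.nthD (hf.comp (by fun_prop)) (by fun_prop)
    · exact PT.nthD (hg.comp (by fun_prop)) (by fun_prop)
  · simpa using size_xorB_le _ _

@[fun_prop]
theorem PT.sumD {D n : Data → Data} {h : Data → Data → Data} (hD : PT D) (hn : PT n)
    (hh : PT fun y => h y.hd y.tl) : PT fun x => Data.sumD (D x) (n x) (h x) := by
  unfold Data.sumD
  obtain ⟨q, hq⟩ := hD.bound
  refine PT.foldU (PT.addD (hD.comp (by fun_prop)) (by fun_prop) ?_) (by fun_prop) hn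
    ⟨q * 4 + 1, fun x acc b => ?_⟩
  · exact hh.comp (f := fun y => Data.cons y.hd y.tl.tl) (by fun_prop)
  · have := size_addD_le (D x) acc (h x b)
    have := hq x
    simp; omega

@[fun_prop]
theorem PT.prodD {D n : Data → Data} {h : Data → Data → Data} (hD : PT D) (hn : PT n)
    (hh : PT fun y => h y.hd y.tl) : PT fun x => Data.prodD (D x) (n x) (h x) := by
  unfold Data.prodD
  obtain ⟨q, hq⟩ := hD.bound
  refine PT.foldU (PT.mulD (hD.comp (by fun_prop)) (by fun_prop) ?_) (by fun_prop) hn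
    ⟨q * 4 + 1, fun x acc b => ?_⟩
  · exact hh.comp (f := fun y => Data.cons y.hd y.tl.tl) (by fun_prop)
  · have := size_mulD_le (D x) acc (h x b)
    have := hq x
    simp; omega

open Polynomial in
/-- The polynomial with a given list of coefficients. -/
noncomputable def toPoly (d : Data) : (ZMod 2)[X] :=
  ∑ i ∈ Finset.range d.len, monomial i (cf d i)

theorem cf_eq_zero {d : Data} {i : ℕ} (h : d.len ≤ i) : cf d i = 0 := by
  have : d.toList.length ≤ i := h
  rw [cf, nthD_eq, len_un, List.getD_eq_default _ _ this, bit_nil]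

theorem coeff_toPoly (d : Data) (i : ℕ) : (toPoly d).coeff i = cf d i := by
  rw [toPoly, Polynomial.finsetSum_coeff]
  simp only [Polynomial.coeff_monomial]
  rw [Finset.sum_ite_eq']
  split_ifs with h
  · rfl
  · rw [cf_eq_zero]; simpa using h

open Polynomial in
/-- The ring of truncated polynomials. -/
abbrev Trunc (D : ℕ) : Type := (ZMod 2)[X] ⧸ Ideal.span {(X : (ZMod 2)[X]) ^ D}

/-- The value of a list of bits in the ring of truncated polynomials. -/
noncomputable def ev (D : ℕ) (d : Data) : Trunc D := Ideal.Quotient.mk _ (toPoly d)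

open Polynomial in
theorem mk_eq_mk_iff (D : ℕ) (p q : (ZMod 2)[X]) :
    (Ideal.Quotient.mk (Ideal.span {(X : (ZMod 2)[X]) ^ D}) p) = Ideal.Quotient.mk _ q ↔
      ∀ i < D, p.coeff i = q.coeff i := by
  rw [Ideal.Quotient.eq, Ideal.mem_span_singleton, X_pow_dvd_iff]
  simp [sub_eq_zero]

theorem cf_tab (D : Data) (h : Data → Data) (i : ℕ) (hi : i < D.len) :
    cf (tab D h) i = bit (h (un i)) := by
  rw [cf, nthD_tab_un _ _ _ hi]

/-- This and its companions for products, sums and constants make `ev` compatible with the ring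
operations of the quotient by `X ^ D`. Identities can then be proved for honest polynomials and read
off from the coefficients below the truncation order. -/
theorem ev_addD (D a b : Data) : ev D.len (addD D a b) = ev D.len a + ev D.len b := by
  rw [ev, ev, ev, ← map_add, mk_eq_mk_iff]
  intro i hi
  rw [Polynomial.coeff_add, coeff_toPoly, coeff_toPoly, coeff_toPoly, addD, cf_tab _ _ _ hi,
    bit_xorB]
  rfl

theorem bit_foldU (n : Data) (h : Data → Data) (a : Data) :
    bit (foldU n (fun acc j => xorB acc (h j)) a) = bit a + ∑ i ∈ Finset.range n.len, bit (h (un i)) := by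
  unfold foldU
  induction n.len with
  | zero => simp
  | succ m ih => rw [List.range_succ, List.foldl_append, Finset.sum_range_succ, List.foldl_cons,
      List.foldl_nil, bit_xorB, ih, add_assoc]

theorem ev_mulD (D a b : Data) : ev D.len (mulD D a b) = ev D.len a * ev D.len b := by
  rw [ev, ev, ev, ← map_mul, mk_eq_mk_iff]
  intro i hi
  rw [Polynomial.coeff_mul, coeff_toPoly, mulD, cf_tab _ _ _ hi, bit_foldU,
    Finset.Nat.sum_antidiagonal_eq_sum_range_succ_mk, bit_nil, zero_add, len_cons, len_un]
  refine Finset.sum_congr rfl fun j hj => ?_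
  rw [bit_andB, coeff_toPoly, coeff_toPoly, dropD_un]
  rfl

theorem ev_nil (D : ℕ) : ev D nil = 0 := by
  simp [ev, toPoly]

theorem ev_one (D : ℕ) : ev D (cons tt nil) = 1 := by
  have : toPoly (cons tt nil) = 1 := by
    simp [toPoly, cf, nthD, dropD, ofList, Data.hd]
  rw [ev, this, map_one]

theorem ev_sumD (D n : Data) (h : Data → Data) :
    ev D.len (sumD D n h) = ∑ i ∈ Finset.range n.len, ev D.len (h (un i)) := by
  unfold sumD foldU
  induction n.len with
  | zero => simp [ev_nil]
  | succ m ih => rw [List.range_succ, List.foldl_append, Finset.sum_range_succ, List.foldl_cons,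
      List.foldl_nil, ev_addD, ih]

theorem ev_prodD (D n : Data) (h : Data → Data) :
    ev D.len (prodD D n h) = ∏ i ∈ Finset.range n.len, ev D.len (h (un i)) := by
  unfold prodD foldU
  induction n.len with
  | zero => simp [ev_one]
  | succ m ih => rw [List.range_succ, List.foldl_append, Finset.prod_range_succ, List.foldl_cons,
      List.foldl_nil, ev_mulD, ih]

/-- A power of the variable; its exponent is given in unary. -/
def monoD (c : Data) : Data := appendD (tab c fun _ => nil) (cons tt nil)

@[fun_prop]
theorem PT.monoD {f : Data → Data} (hf : PT f) : PT fun x => TreeProg.monoD (f x) := by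
  unfold TreeProg.monoD
  fun_prop

open Polynomial in
theorem toPoly_monoD (c : Data) : toPoly (monoD c) = X ^ c.len := by
  ext i
  rw [coeff_toPoly, cf, nthD_eq, coeff_X_pow, len_un, monoD, appendD, toList_ofList, tab_nil, un,
    ofNatUnary, toList_ofList]
  rcases lt_trichotomy i c.len with h | h | h
  · rw [List.getD_append _ _ _ _ (by simpa using h)]
    simp [List.getD, h, h.ne]
  · subst h
    rw [List.getD_append_right _ _ _ _ (by simp)]
    simp
  · rw [List.getD_eq_default _ _ (by simp; omega), if_neg (by omega), bit_nil]

end TreeProg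

/-! ### Message passing and the enumeration of trees in characteristic two -/

namespace TreeProg

/-! ### Message passing over rings of characteristic two -/

section Messages
variable {V : Type} [Fintype V] [DecidableEq V] {E : Type} [CommRing E]

/-- One round of message passing: the message from `w` to `p` combines the messages which `w`
received from its other neighbours. -/
def msgStep (a b : V → E) (x : Sym2 V → E) (M : V → V → E) : V → V → E := fun w p =>
  a w + b w * ∏ q ∈ Finset.univ.erase p, (1 + x s(w, q) * M q w)

/-- The value at the root `r`. -/
def rootValue (a b : V → E) (x : Sym2 V → E) (M : V → V → E) (r : V) : E :=
  b r * ∏ q, (1 + x s(r, q) * M q r) + a r * ∑ q, x s(r, q) * M q r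

/-- The vertices of `N` carry nilpotent weights; the other vertices form an independent set. -/
structure MsgSystem (a b : V → E) (x : Sym2 V → E) (N : Finset V) : Prop where
  two : (2 : E) = 0
  aa : ∀ v ∈ N, a v * a v = 0
  ab : ∀ v ∈ N, a v * b v = 0
  bb : ∀ v ∈ N, b v * b v = 0
  free : ∀ v ∉ N, (a v + b v) * (a v + b v) = 0
  indep : ∀ v ∉ N, ∀ w ∉ N, x s(v, w) = 0
  diag : ∀ v, x s(v, v) = 0

theorem prod_sub_prod_mem {ι : Type} (I : Ideal E) (S : Finset ι) (f g : ι → E)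
    (h : ∀ i ∈ S, f i - g i ∈ I) : ∏ i ∈ S, f i - ∏ i ∈ S, g i ∈ I := by
  rw [← Ideal.Quotient.eq, map_prod, map_prod]
  exact Finset.prod_congr rfl fun i hi => Ideal.Quotient.eq.2 (h i hi)

/-- Only the product in a message depends on the incoming messages, and it is multiplied by `b w`;
this factor is what makes the iteration contract. -/
theorem msgStep_sub_mem (a b : V → E) (x : Sym2 V → E) (M M' : V → V → E) (I : Ideal E) (w p : V)
    (h : ∀ q, x s(w, q) * (M q w - M' q w) ∈ I) :
    ∃ y ∈ I, msgStep a b x M w p - msgStep a b x M' w p = b w * y := by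
  refine ⟨_, prod_sub_prod_mem I (Finset.univ.erase p) (fun q => 1 + x s(w, q) * M q w)
    (fun q => 1 + x s(w, q) * M' q w) fun q _ => ?_, ?_⟩
  · have := h q
    ring_nf at this ⊢
    exact this
  · simp only [msgStep]; ring

/-- A message sent by a vertex of `N` gains the factor `b w ∈ I` in one round. A free vertex gains
nothing by itself, but it hears only from vertices of `N`, since free vertices are not adjacent; so
it inherits the gain one round later. Two rounds gain one power of `I` everywhere. -/
theorem MsgSystem.contract {a b : V → E} {x : Sym2 V → E} {N : Finset V}
    (h : MsgSystem a b x N) {I : Ideal E} (hb : ∀ v ∈ N, b v ∈ I) (i : ℕ) {M M' : V → V → E}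
    (hM : ∀ w p, M w p - M' w p ∈ I ^ i) (w p : V) :
    msgStep a b x (msgStep a b x M) w p - msgStep a b x (msgStep a b x M') w p ∈ I ^ (i + 1) := by
  have h1 : ∀ M M' : V → V → E, (∀ w p, M w p - M' w p ∈ I ^ i) → ∀ w ∈ N, ∀ p,
      msgStep a b x M w p - msgStep a b x M' w p ∈ I ^ (i + 1) := by
    intro M M' hM w hw p
    obtain ⟨y, hy, e⟩ := msgStep_sub_mem a b x M M' (I ^ i) w p
      fun q => Ideal.mul_mem_left _ _ (hM q w)
    rw [e, pow_succ']
    exact Ideal.mul_mem_mul (hb w hw) hy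
  have h2 : ∀ w p, msgStep a b x M w p - msgStep a b x M' w p ∈ I ^ i := by
    intro w p
    obtain ⟨y, hy, e⟩ := msgStep_sub_mem a b x M M' (I ^ i) w p
      fun q => Ideal.mul_mem_left _ _ (hM q w)
    rw [e]
    exact Ideal.mul_mem_left _ _ hy
  by_cases hw : w ∈ N
  · exact h1 _ _ h2 w hw p
  · obtain ⟨y, hy, e⟩ := msgStep_sub_mem a b x (msgStep a b x M) (msgStep a b x M') (I ^ (i + 1)) w p
      fun q => by
        by_cases hq : q ∈ N
        · exact Ideal.mul_mem_left _ _ (h1 _ _ hM q hq w)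
        · rw [h.indep w hw q hq, zero_mul]; exact zero_mem _
    rw [e]
    exact Ideal.mul_mem_left _ _ hy

/-- The ideal generated by the nilpotent weights. -/
def nilIdeal (a b : V → E) (N : Finset V) : Ideal E := Ideal.span (a '' N ∪ b '' N)

/-- The ideal has finitely many generators, all of square zero. -/
theorem MsgSystem.exists_pow_eq_bot {a b : V → E} {x : Sym2 V → E} {N : Finset V}
    (h : MsgSystem a b x N) : ∃ m, nilIdeal a b N ^ m = ⊥ := by
  have hfg : (nilIdeal a b N).FG := by
    classical
    refine ⟨N.image a ∪ N.image b, ?_⟩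
    simp [nilIdeal]
  have : IsNilpotent (nilIdeal a b N) := by
    rw [Ideal.FG.isNilpotent_iff_le_nilradical hfg, nilIdeal, Ideal.span_le]
    rintro _ (⟨v, hv, rfl⟩ | ⟨v, hv, rfl⟩)
    · exact mem_nilradical.2 ⟨2, by rw [sq, h.aa v hv]⟩
    · exact mem_nilradical.2 ⟨2, by rw [sq, h.bb v hv]⟩
  exact this

/-- By contraction, consecutive iterates differ by elements of `I ^ i` after `2 * i` rounds, and `I
^ m` is zero. The explicit number of rounds is what the algorithm uses. -/
theorem msgStep_iterate_fixed {a b : V → E} {x : Sym2 V → E} {N : Finset V}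
    (h : MsgSystem a b x N) {I : Ideal E} (hb : ∀ v ∈ N, b v ∈ I) {m : ℕ} (hm : I ^ m = ⊥) :
    msgStep a b x ((msgStep a b x)^[2 * m] 0) = (msgStep a b x)^[2 * m] 0 := by
  have : ∀ i w p, msgStep a b x ((msgStep a b x)^[2 * i] 0) w p -
      (msgStep a b x)^[2 * i] 0 w p ∈ I ^ i := by
    intro i
    induction i with
    | zero => intro w p; simp
    | succ i ih =>
      intro w p
      have := h.contract hb i ih w p
      rw [show 2 * (i + 1) = 2 * i + 1 + 1 by ring]
      simpa only [Function.iterate_succ_apply'] using this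
  funext w p
  have := this m w p
  rw [hm, Ideal.mem_bot, sub_eq_zero] at this
  exact this

theorem MsgSystem.exists_fixed {a b : V → E} {x : Sym2 V → E} {N : Finset V}
    (h : MsgSystem a b x N) : ∃ M, msgStep a b x M = M := by
  obtain ⟨m, hm⟩ := h.exists_pow_eq_bot
  exact ⟨_, msgStep_iterate_fixed h (I := nilIdeal a b N)
    (fun v hv => Ideal.subset_span (Or.inr ⟨v, hv, rfl⟩)) hm⟩

theorem MsgSystem.fixed_unique {a b : V → E} {x : Sym2 V → E} {N : Finset V}
    (h : MsgSystem a b x N) {M M' : V → V → E} (hM : msgStep a b x M = M)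
    (hM' : msgStep a b x M' = M') : M = M' := by
  obtain ⟨m, hm⟩ := h.exists_pow_eq_bot
  have : ∀ i w p, M w p - M' w p ∈ nilIdeal a b N ^ i := by
    intro i
    induction i with
    | zero => intro w p; simp
    | succ i ih =>
      intro w p
      have := h.contract (fun v hv => Ideal.subset_span (Or.inr ⟨v, hv, rfl⟩)) i ih w p
      rwa [hM, hM, hM', hM'] at this
  funext w p
  have := this m w p
  rw [hm, Ideal.mem_bot, sub_eq_zero] at this
  exact this

/-- The terms at `(i, j)` and `(j, i)` are equal and cancel in characteristic two. All cancellations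
of walks below are instances of this. -/
theorem sum_offDiag_eq_zero {ι : Type} [DecidableEq ι] (h2 : (2 : E) = 0) (S : Finset ι)
    (g : ι → ι → E) (hg : ∀ i j, g i j = g j i) : ∑ i ∈ S, ∑ j ∈ S.erase i, g i j = 0 := by
  have : ∑ i ∈ S, ∑ j ∈ S.erase i, g i j = ∑ z ∈ S.offDiag, g z.1 z.2 := by
    rw [Finset.sum_sigma']
    refine Finset.sum_bij' (fun z _ => (z.1, z.2)) (fun z _ => ⟨z.1, z.2⟩) ?_ ?_ ?_ ?_ ?_
    · rintro ⟨i, j⟩ h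
      simp only [Finset.mem_sigma, Finset.mem_erase, Finset.mem_offDiag] at h ⊢
      exact ⟨h.1, h.2.2, h.2.1.symm⟩
    · rintro ⟨i, j⟩ h
      simp only [Finset.mem_sigma, Finset.mem_erase, Finset.mem_offDiag] at h ⊢
      exact ⟨h.1, h.2.2.symm, h.2.1⟩
    · intros; rfl
    · intros; rfl
    · intros; rfl
  rw [this]
  refine Finset.sum_involution (fun z _ => (z.2, z.1)) ?_ ?_ ?_ ?_
  · intro z _
    rw [hg z.2 z.1, ← two_mul, h2, zero_mul]
  · rintro ⟨i, j⟩ h _ he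
    simp only [Finset.mem_offDiag, Prod.mk.injEq] at h he
    exact h.2.2 he.2
  · rintro ⟨i, j⟩ h
    simp only [Finset.mem_offDiag] at h ⊢
    exact ⟨h.2.1, h.1, h.2.2.symm⟩
  · intros; rfl

open TrivSqZeroExt in
-- The Leibniz rule, the second component of a dual number being a derivative.
theorem snd_prod {ι : Type} [DecidableEq ι] (S : Finset ι) (f : ι → DualNumber E) :
    (∏ i ∈ S, f i).snd = ∑ i ∈ S, (f i).snd * ∏ j ∈ S.erase i, (f j).fst := by
  induction S using Finset.induction_on with
  | empty => simp
  | insert a S ha ih =>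
    rw [Finset.prod_insert ha, snd_mul, ih, Finset.sum_insert ha, Finset.erase_insert ha]
    have h1 : (∏ i ∈ S, f i).fst = ∏ i ∈ S, (f i).fst := map_prod (fstHom E E E) f S
    rw [h1]
    simp only [smul_eq_mul, MulOpposite.smul_eq_mul_unop, MulOpposite.unop_op, Finset.mul_sum]
    rw [add_comm, mul_comm (f a).snd]
    congr 1
    refine Finset.sum_congr rfl fun i hi => ?_
    have hai : a ≠ i := fun h => ha (h ▸ hi)
    rw [Finset.erase_insert_of_ne hai, Finset.prod_insert (by simp [ha])]
    ring

/-! ### How the fixed point depends on the weights of one free vertex -/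

section Derivative
open TrivSqZeroExt

variable {a b : V → E} {x : Sym2 V → E} {N : Finset V} {v₀ : V}

/-- The system in which the vertex `v₀` sends the infinitesimal `ε` to all its neighbours. -/
def epsA (a : V → E) (v₀ : V) : V → DualNumber E :=
  Function.update (fun v => inl (a v)) v₀ DualNumber.eps

def epsB (b : V → E) (v₀ : V) : V → DualNumber E :=
  Function.update (fun v => inl (b v)) v₀ 0

theorem MsgSystem.two_dual (h2 : (2 : E) = 0) : (2 : DualNumber E) = 0 := by
  have : (2 : DualNumber E) = inl (2 : E) := by
    rw [← one_add_one_eq_two, ← one_add_one_eq_two, inl_add, inl_one]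
  rw [this, h2, inl_zero]

/-- The new weights `ε` and `0` of `v₀` are nilpotent, so `v₀` moves to the nilpotent side. All
hypotheses on the other vertices are inherited, and a fixed point exists. -/
theorem MsgSystem.eps (h : MsgSystem a b x N) (v₀ : V) :
    MsgSystem (epsA a v₀) (epsB b v₀) (fun e => (inl (x e) : DualNumber E)) (insert v₀ N) where
  two := MsgSystem.two_dual h.two
  aa := by
    intro v hv
    by_cases hv0 : v = v₀
    · subst hv0; simp [epsA]
    · simp [epsA, hv0, ← inl_mul, h.aa v ((Finset.mem_insert.1 hv).resolve_left hv0)]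
  ab := by
    intro v hv
    by_cases hv0 : v = v₀
    · subst hv0; simp [epsA, epsB]
    · simp [epsA, epsB, hv0, ← inl_mul, h.ab v ((Finset.mem_insert.1 hv).resolve_left hv0)]
  bb := by
    intro v hv
    by_cases hv0 : v = v₀
    · subst hv0; simp [epsB]
    · simp [epsB, hv0, ← inl_mul, h.bb v ((Finset.mem_insert.1 hv).resolve_left hv0)]
  free := by
    intro v hv
    rw [Finset.mem_insert, not_or] at hv
    simp [epsA, epsB, hv.1, ← inl_mul, ← inl_add, h.free v hv.2]
  indep := by
    intro v hv w hw
    rw [Finset.mem_insert, not_or] at hv hw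
    rw [h.indep v hv.2 w hw.2, inl_zero]
  diag := by intro v; rw [h.diag v, inl_zero]

variable {M : V → V → DualNumber E}

/-- The linearized recursion: the derivative of a message passes through exactly one of the incoming
messages, never the one from the recipient. -/
theorem eps_snd (hM : msgStep (epsA a v₀) (epsB b v₀) (fun e => inl (x e)) M = M) (w p : V)
    (hw : w ≠ v₀) : (M w p).snd = b w * ∑ q ∈ Finset.univ.erase p, x s(w, q) * (M q w).snd *
      ∏ q' ∈ (Finset.univ.erase p).erase q, (1 + x s(w, q') * (M q' w).fst) := by
  conv_lhs => rw [← hM]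
  simp only [msgStep, epsA, epsB, Function.update_of_ne hw]
  rw [snd_add, snd_inl, zero_add, snd_mul, snd_prod]
  simp

/-- The only use of this shape is that, for `w ∈ N`, the element `a w + b w * c` is annihilated by
`a w`, by `b w` and hence by any other message from `w` of the same shape. -/
theorem eps_fst (hM : msgStep (epsA a v₀) (epsB b v₀) (fun e => inl (x e)) M = M) (w p : V)
    (hw : w ≠ v₀) : ∃ c, (M w p).fst = a w + b w * c := by
  refine ⟨(∏ q ∈ Finset.univ.erase p, (1 + inl (x s(w, q)) * M q w)).fst, ?_⟩
  conv_lhs => rw [← hM]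
  simp [msgStep, epsA, epsB, Function.update_of_ne hw]

theorem eps_self (hM : msgStep (epsA a v₀) (epsB b v₀) (fun e => inl (x e)) M = M) (p : V) :
    M v₀ p = DualNumber.eps := by
  rw [← hM]; simp [msgStep, epsA, epsB]

/-- The first-order effect of the messages sent by `v₀` on the messages received by `v₀` cancels. -/
theorem MsgSystem.sum_snd_eq_zero (h : MsgSystem a b x N)
    (hM : msgStep (epsA a v₀) (epsB b v₀) (fun e => inl (x e)) M = M) :
    ∑ q, x s(v₀, q) * (M q v₀).snd = 0 := by
  -- For fixed `w`, expand the derivative of the message from `w` to `p` by `eps_snd`. The result is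
  -- symmetric in the two distinct neighbours `p` and `q` of `w`.
  have h1 : ∑ w ∈ Finset.univ.erase v₀, ∑ p, x s(w, p) * (M p w).snd * (M w p).snd = 0 := by
    refine Finset.sum_eq_zero fun w hw => ?_
    have hw0 := Finset.ne_of_mem_erase hw
    have := sum_offDiag_eq_zero h.two (Finset.univ : Finset V) (fun p q =>
      b w * (x s(w, p) * (M p w).snd) * (x s(w, q) * (M q w).snd) *
        ∏ q' ∈ (Finset.univ.erase p).erase q, (1 + x s(w, q') * (M q' w).fst)) (by
          intro p q
          rw [Finset.erase_right_comm]; ring)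
    rw [← this]
    refine Finset.sum_congr rfl fun p _ => ?_
    rw [eps_snd hM w p hw0, Finset.mul_sum, Finset.mul_sum]
    exact Finset.sum_congr rfl fun q _ => by ring
  -- Away from `v₀` the summand is symmetric in `w` and `p`, and the diagonal has edge weight zero.
  have h2 : ∑ w ∈ Finset.univ.erase v₀, ∑ p ∈ Finset.univ.erase v₀,
      x s(w, p) * (M p w).snd * (M w p).snd = 0 := by
    have := sum_offDiag_eq_zero h.two (Finset.univ.erase v₀)
      (fun w p => x s(w, p) * (M p w).snd * (M w p).snd) (by
        intro w p; rw [Sym2.eq_swap]; ring)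
    rw [← this]
    refine Finset.sum_congr rfl fun w hw => ?_
    rw [← Finset.add_sum_erase _ _ hw, h.diag]
    simp
  -- Only `p = v₀` is left, and there the derivative of the message from `v₀` to `w` is `1`. What
  -- remains is the sum in question.
  have h3 : ∑ w ∈ Finset.univ.erase v₀, ∑ p, x s(w, p) * (M p w).snd * (M w p).snd =
      ∑ w ∈ Finset.univ.erase v₀, x s(v₀, w) * (M w v₀).snd := by
    rw [← add_zero (∑ w ∈ Finset.univ.erase v₀, x s(v₀, w) * (M w v₀).snd), ← h2,
      ← Finset.sum_add_distrib]
    refine Finset.sum_congr rfl fun w _ => ?_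
    rw [← Finset.add_sum_erase _ _ (Finset.mem_univ v₀), eps_self hM, DualNumber.snd_eps, mul_one,
      Sym2.eq_swap]
  rw [← Finset.add_sum_erase _ _ (Finset.mem_univ v₀), h.diag, zero_mul, zero_add, ← h3, h1]

/-- For each neighbour `q` the product of a message with its own derivative vanishes, so the factor
missing in the Leibniz rule can be restored. The derivative of the product is therefore the product
times the sum in `MsgSystem.sum_snd_eq_zero`. -/
theorem MsgSystem.snd_prod_eq_zero (h : MsgSystem a b x N) (hv₀ : v₀ ∉ N)
    (hM : msgStep (epsA a v₀) (epsB b v₀) (fun e => inl (x e)) M = M) :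
    (∏ q, (1 + inl (x s(v₀, q)) * M q v₀)).snd = 0 := by
  rw [snd_prod]
  have : ∀ q, x s(v₀, q) * (M q v₀).snd * (x s(v₀, q) * (M q v₀).fst) = 0 := by
    intro q
    by_cases hq : q ∈ N
    · have hq0 : q ≠ v₀ := fun e => hv₀ (e ▸ hq)
      obtain ⟨c, hc⟩ := eps_fst hM q v₀ hq0
      rw [hc, eps_snd hM q v₀ hq0]
      generalize (∑ q_1 ∈ Finset.univ.erase v₀, _ : E) = d
      linear_combination (x s(v₀, q) * x s(v₀, q) * d) * h.ab q hq +
        (x s(v₀, q) * x s(v₀, q) * d * c) * h.bb q hq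
    · rw [h.indep v₀ hv₀ q hq]; ring
  have e : ∀ q, (1 + inl (x s(v₀, q)) * M q v₀ : DualNumber E).snd *
      ∏ j ∈ Finset.univ.erase q, (1 + inl (x s(v₀, j)) * M j v₀ : DualNumber E).fst =
      x s(v₀, q) * (M q v₀).snd * ∏ j, (1 + inl (x s(v₀, j)) * M j v₀ : DualNumber E).fst := by
    intro q
    rw [← Finset.mul_prod_erase _ _ (Finset.mem_univ q), ← mul_assoc]
    congr 1
    simp only [snd_add, snd_one, snd_mul, fst_inl, snd_inl, smul_eq_mul, fst_add, fst_one, fst_mul,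
      smul_zero, zero_add, add_zero]
    rw [mul_add, this q]; simp
  rw [Finset.sum_congr rfl fun q _ => e q, ← Finset.sum_mul, h.sum_snd_eq_zero hM, zero_mul]

/-- A message from a vertex of `N` has square zero, and `2 = 0`, so each factor `1 + x M` has square
one. -/
theorem MsgSystem.prod_sq (h : MsgSystem a b x N) (hv₀ : v₀ ∉ N)
    (hM : msgStep (epsA a v₀) (epsB b v₀) (fun e => inl (x e)) M = M) :
    (∏ q, (1 + x s(v₀, q) * (M q v₀).fst)) * (∏ q, (1 + x s(v₀, q) * (M q v₀).fst)) = 1 := by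
  rw [← Finset.prod_mul_distrib]
  refine Finset.prod_eq_one fun q _ => ?_
  by_cases hq : q ∈ N
  · have hq0 : q ≠ v₀ := fun e => hv₀ (e ▸ hq)
    obtain ⟨c, hc⟩ := eps_fst hM q v₀ hq0
    rw [hc]
    linear_combination (x s(v₀, q) * (a q + b q * c)) * h.two +
      (x s(v₀, q) * x s(v₀, q)) * (h.aa q hq + 2 * c * h.ab q hq + c * c * h.bb q hq)
  · rw [h.indep v₀ hv₀ q hq]; ring

/-- The ring homomorphism which maps `ε` to `D`. -/
def dualEval {E₂ : Type} [CommRing E₂] (f : E →+* E₂) (D : E₂) (hD : D * D = 0) :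
    DualNumber E →+* E₂ where
  toFun e := f e.fst + D * f e.snd
  map_one' := by simp
  map_zero' := by simp
  map_add' u v := by simp only [fst_add, snd_add, map_add]; ring
  map_mul' u v := by
    simp only [fst_mul, snd_mul, map_mul, map_add, smul_eq_mul, MulOpposite.smul_eq_mul_unop,
      MulOpposite.unop_op]
    linear_combination (-f u.snd * f v.snd) * hD

/-- Scaling both weights of a vertex `v₀` changes the root value by an affine function. -/
theorem MsgSystem.affine (h : MsgSystem a b x N) (hv₀ : v₀ ∉ N) {r : V} (hr : r ∈ N) :
    ∃ F₀ F₁ : E, ∀ (E₂ : Type) [CommRing E₂] (f : E →+* E₂) (ξ : E₂), ∃ M₂ : V → V → E₂,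
      msgStep (Function.update (fun v => f (a v)) v₀ (ξ * f (a v₀)))
        (Function.update (fun v => f (b v)) v₀ (ξ * f (b v₀))) (fun e => f (x e)) M₂ = M₂ ∧
      rootValue (Function.update (fun v => f (a v)) v₀ (ξ * f (a v₀)))
        (Function.update (fun v => f (b v)) v₀ (ξ * f (b v₀))) (fun e => f (x e)) M₂ r =
        f F₀ + ξ * f F₁ := by
  obtain ⟨M, hM⟩ := (h.eps v₀).exists_fixed
  set P := ∏ q, (1 + x s(v₀, q) * (M q v₀).fst) with hP
  have hPP : P * P = 1 := h.prod_sq hv₀ hM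
  set F := rootValue (epsA a v₀) (epsB b v₀) (fun e => inl (x e)) M r with hF
  -- The plan is to substitute `D = ξ * f (a v₀ + b v₀ * P)` for `ε`. Then the root value `F`
  -- becomes `F.fst + D * F.snd`, which is affine in `ξ`.
  refine ⟨F.fst, (a v₀ + b v₀ * P) * F.snd, fun E₂ _ f ξ => ?_⟩
  -- The substitution is allowed because of this: with `P * P = 1` and `2 = 0` the square equals `(a
  -- v₀ + b v₀) ^ 2`, which is zero for a free vertex.
  have hD1 : (a v₀ + b v₀ * P) * (a v₀ + b v₀ * P) = 0 := by
    linear_combination (a v₀ * b v₀ * P - a v₀ * b v₀) * h.two + h.free v₀ hv₀ +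
      b v₀ * b v₀ * hPP
  obtain ⟨D, hDdef⟩ : ∃ D, D = ξ * f (a v₀ + b v₀ * P) := ⟨_, rfl⟩
  have hD : D * D = 0 := by
    have := congrArg f hD1
    rw [map_mul, map_zero] at this
    rw [hDdef]; linear_combination ξ * ξ * this
  set φ := dualEval f D hD with hφ
  have hφ_inl : ∀ e : E, φ (inl e) = f e := fun e => by simp [hφ, dualEval]
  have hφ_eps : φ DualNumber.eps = D := by simp [hφ, dualEval]
  set A := Function.update (fun v => f (a v)) v₀ (ξ * f (a v₀)) with hA
  set B := Function.update (fun v => f (b v)) v₀ (ξ * f (b v₀)) with hB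
  have hA0 : A v₀ = ξ * f (a v₀) := by simp [hA]
  have hB0 : B v₀ = ξ * f (b v₀) := by simp [hB]
  have hA1 : ∀ w, w ≠ v₀ → A w = f (a w) := fun w hw => by simp [hA, hw]
  have hB1 : ∀ w, w ≠ v₀ → B w = f (b w) := fun w hw => by simp [hB, hw]
  -- So `D` is the message `v₀` would send if it did not leave out the recipient. It is the same for
  -- all recipients, because `P` does not depend on `ε`.
  have hDprod : D = ξ * f (a v₀) + ξ * f (b v₀) * ∏ q, (1 + f (x s(v₀, q)) * φ (M q v₀)) := by
    have e : ∏ q, (1 + f (x s(v₀, q)) * φ (M q v₀)) =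
        φ (∏ q, (1 + inl (x s(v₀, q)) * M q v₀)) := by
      rw [map_prod]
      exact Finset.prod_congr rfl fun q _ => by rw [map_add, map_one, map_mul, hφ_inl]
    have e2 : φ (∏ q, (1 + inl (x s(v₀, q)) * M q v₀)) = f P := by
      have h0 := h.snd_prod_eq_zero hv₀ hM
      have h1 : (∏ q, (1 + inl (x s(v₀, q)) * M q v₀) : DualNumber E).fst = P := by
        rw [hP, show ∀ z : DualNumber E, z.fst = fstHom E E E z from fun _ => rfl, map_prod]
        exact Finset.prod_congr rfl fun q _ => by simp
      show f (fst _) + D * f (snd _) = _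
      rw [h0, h1]; simp
    rw [e, e2, hDdef, map_add, map_mul]; ring
  -- The true messages of `v₀` leave out the recipient; all others come from the substitution.
  let M₂ : V → V → E₂ := fun w p => if w = v₀ then
    ξ * f (a v₀) + ξ * f (b v₀) * ∏ q ∈ Finset.univ.erase p, (1 + f (x s(v₀, q)) * φ (M q v₀))
    else φ (M w p)
  have hM₂0 : ∀ p, M₂ v₀ p = ξ * f (a v₀) + ξ * f (b v₀) *
      ∏ q ∈ Finset.univ.erase p, (1 + f (x s(v₀, q)) * φ (M q v₀)) := fun p => by simp [M₂]
  have hM₂1 : ∀ w p, w ≠ v₀ → M₂ w p = φ (M w p) := fun w p hw => by simp [M₂, hw]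
  -- The true message from `v₀` to `w` differs from `D` by a multiple of `x s(w, v₀)` times the
  -- message from `w` to `v₀`, which is a combination of `a w` and `b w`. A factor `c` that
  -- annihilates both hides the difference; it will be `b w` or the weight `a r` of the root.
  have key : ∀ w ≠ v₀, ∀ c : E, c * a w * x s(w, v₀) = 0 → c * b w * x s(w, v₀) = 0 →
      ∀ q, f c * (f (x s(w, q)) * M₂ q w) = f c * (f (x s(w, q)) * φ (M q w)) := by
    intro w hw c hca hcb q
    by_cases hq : q = v₀
    · subst hq
      rw [eps_self hM, hφ_eps, hDprod, hM₂0, ← Finset.mul_prod_erase _ _ (Finset.mem_univ w),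
        Sym2.eq_swap (a := q)]
      generalize ∏ q_1 ∈ Finset.univ.erase w, (1 + f (x s(q, q_1)) * φ (M q_1 q)) = R
      obtain ⟨d, hd⟩ : ∃ d, φ (M w q) = f (a w) + f (b w) * d := by
        rw [← hM]
        refine ⟨φ (∏ q' ∈ Finset.univ.erase q, (1 + inl (x s(w, q')) * M q' w)), ?_⟩
        simp only [msgStep, epsA, epsB, Function.update_of_ne hw, map_add, map_mul, hφ_inl]
      rw [hd]
      have h1 := congrArg f hca
      have h2 := congrArg f hcb
      simp only [map_mul, map_zero] at h1 h2
      linear_combination (-ξ * f (b q) * f (x s(w, q)) * R) * (h1 + d * h2)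
    · rw [hM₂1 q w hq]
  have key' : ∀ w ≠ v₀, ∀ c : E, (w ∈ N → c * a w = 0) → (w ∈ N → c * b w = 0) →
      ∀ q, f c * (f (x s(w, q)) * M₂ q w) = f c * (f (x s(w, q)) * φ (M q w)) := by
    intro w hw c hca hcb
    refine key w hw c ?_ ?_
    · by_cases hwN : w ∈ N
      · rw [hca hwN, zero_mul]
      · rw [h.indep w hwN v₀ hv₀, mul_zero]
    · by_cases hwN : w ∈ N
      · rw [hcb hwN, zero_mul]
      · rw [h.indep w hwN v₀ hv₀, mul_zero]
  have keyprod : ∀ w ≠ v₀, ∀ c : E, (w ∈ N → c * a w = 0) → (w ∈ N → c * b w = 0) →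
      ∀ S : Finset V, f c * ∏ q ∈ S, (1 + f (x s(w, q)) * M₂ q w) =
        f c * φ (∏ q ∈ S, (1 + inl (x s(w, q)) * M q w)) := by
    intro w hw c hca hcb S
    induction S using Finset.induction_on with
    | empty => simp
    | insert q S hq ih =>
      rw [Finset.prod_insert hq, Finset.prod_insert hq, map_mul, map_add, map_one, map_mul, hφ_inl]
      have := key' w hw c hca hcb q
      linear_combination (1 + f (x s(w, q)) * φ (M q w)) * ih +
        (∏ q ∈ S, (1 + f (x s(w, q)) * M₂ q w)) * this
  refine ⟨M₂, ?_, ?_⟩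
  · funext w p
    by_cases hw : w = v₀
    · subst hw
      rw [hM₂0]
      simp only [msgStep, hA0, hB0]
      congr 2
      refine Finset.prod_congr rfl fun q _ => ?_
      by_cases hq : q = w
      · subst hq; rw [h.diag]; simp
      · rw [hM₂1 q w hq]
    · rw [hM₂1 w p hw]
      conv_rhs => rw [← hM]
      simp only [msgStep, hA1 w hw, hB1 w hw, epsA, epsB, Function.update_of_ne hw, map_add,
        map_mul φ (inl _), hφ_inl]
      rw [keyprod w hw (b w) (fun hwN => by rw [mul_comm, h.ab w hwN]) (fun hwN => h.bb w hwN)]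
  · have hr0 : r ≠ v₀ := fun e => hv₀ (e ▸ hr)
    have : rootValue A B (fun e => f (x e)) M₂ r = φ F := by
      simp only [hF, rootValue, hA1 r hr0, hB1 r hr0, epsA, epsB, Function.update_of_ne hr0]
      rw [keyprod r hr0 (b r) (fun hwN => by rw [mul_comm, h.ab r hwN]) (fun hwN => h.bb r hwN),
        map_add, map_mul, map_mul, hφ_inl, hφ_inl, map_sum, Finset.mul_sum, Finset.mul_sum]
      congr 1
      refine Finset.sum_congr rfl fun q _ => ?_
      rw [key' r hr0 (a r) (fun hwN => h.aa r hwN) (fun hwN => h.ab r hwN), map_mul, hφ_inl]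
    rw [this]
    show f (fst F) + D * f (snd F) = _
    rw [hDdef, map_mul]; ring

end Derivative
end Messages
end TreeProg

/-! ### Combinatorics of trees -/

namespace TreeProg

/-! ### Trees as pairs of a vertex set and an edge set -/

section Trees
variable {V : Type} [Fintype V] [DecidableEq V]

/-- `v` can be reached from `u` along edges in `F`. -/
def Reach (F : Finset (Sym2 V)) : V → V → Prop := Relation.ReflTransGen fun u v => s(u, v) ∈ F

/-- `T.1` and `T.2` are the vertices and edges of a tree. -/
structure IsTr (T : Finset V × Finset (Sym2 V)) : Prop where
  not_diag : ∀ e ∈ T.2, ¬ e.IsDiag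
  mem : ∀ e ∈ T.2, ∀ v ∈ e, v ∈ T.1
  reach : ∀ u ∈ T.1, ∀ v ∈ T.1, Reach T.2 u v
  card : T.2.card + 1 = T.1.card

theorem Reach.symm {F : Finset (Sym2 V)} {u v : V} (h : Reach F u v) : Reach F v u := by
  induction h with
  | refl => exact .refl
  | tail _ h ih => exact Relation.ReflTransGen.head (by rwa [Sym2.eq_swap]) ih

theorem Reach.mono {F F' : Finset (Sym2 V)} (hF : F ⊆ F') {u v : V} (h : Reach F u v) :
    Reach F' u v := Relation.ReflTransGen.mono (fun _ _ h => hF h) _ _ h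

theorem Reach.trans {F : Finset (Sym2 V)} {u v w : V} (h : Reach F u v) (h' : Reach F v w) :
    Reach F u w := Relation.ReflTransGen.trans h h'

theorem Reach.mem {F : Finset (Sym2 V)} {U : Finset V} (hU : ∀ u ∈ U, ∀ v, s(u, v) ∈ F → v ∈ U)
    {u v : V} (h : Reach F u v) (hu : u ∈ U) : v ∈ U := by
  induction h with
  | refl => exact hu
  | tail _ h ih => exact hU _ ih _ h

/-- A walk that starts in a set which is closed under the edges of `F` can use only edges that meet
this set. -/
theorem Reach.restrict {F F' : Finset (Sym2 V)} {U : Finset V}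
    (hU : ∀ u ∈ U, ∀ v, s(u, v) ∈ F → v ∈ U ∧ s(u, v) ∈ F')
    {u v : V} (h : Reach F u v) (hu : u ∈ U) : Reach F' u v := by
  induction h with
  | refl => exact .refl
  | tail h' h ih =>
    exact ih.trans (.single (hU _ (Reach.mem (fun u hu v h => (hU u hu v h).1) h' hu) _ h).2)

/-- After the last use of the edge the walk goes on from one of its two ends. -/
theorem Reach.erase {F : Finset (Sym2 V)} {w q u : V} (h : Reach F w u) :
    Reach (F.erase s(w, q)) w u ∨ Reach (F.erase s(w, q)) q u := by
  induction h with
  | refl => exact Or.inl .refl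
  | @tail u v _ h ih =>
    by_cases he : s(u, v) = s(w, q)
    · rcases Sym2.eq_iff.1 he with ⟨rfl, rfl⟩ | ⟨rfl, rfl⟩
      · exact Or.inr .refl
      · exact Or.inl .refl
    · have h' : Reach (F.erase s(w, q)) u v := .single (Finset.mem_erase.2 ⟨he, h⟩)
      exact ih.imp (·.trans h') (·.trans h')

/-- A connected graph on `U` has at least `U.card - 1` edges; `F` may contain loops, which only
helps. -/
theorem card_le_of_reach {U : Finset V} {F : Finset (Sym2 V)} (hF : ∀ e ∈ F, ∀ v ∈ e, v ∈ U)
    (hU : U.Nonempty) (h : ∀ u ∈ U, ∀ v ∈ U, Reach F u v) : U.card ≤ F.card + 1 := by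
  classical
  let G : SimpleGraph U := SimpleGraph.mk (fun u v => u ≠ v ∧ s(u.1, v.1) ∈ F)
    ⟨fun u v h => ⟨h.1.symm, by rw [Sym2.eq_swap]; exact h.2⟩⟩ ⟨fun u h => h.1 rfl⟩
  have hr : ∀ u : U, ∀ v, Reach F u.1 v → ∃ hv : v ∈ U, G.Reachable u ⟨v, hv⟩ := by
    intro u v h
    induction h with
    | refl => exact ⟨u.2, SimpleGraph.Reachable.refl _⟩
    | @tail v w _ h ih =>
      obtain ⟨hv, ih⟩ := ih
      have hw : w ∈ U := hF _ h w (Sym2.mem_mk_right v w)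
      refine ⟨hw, ih.trans ?_⟩
      by_cases e : v = w
      · subst e; exact SimpleGraph.Reachable.refl _
      · exact SimpleGraph.Adj.reachable ⟨fun e' => e (congrArg Subtype.val e'), h⟩
  have : Nonempty U := hU.to_subtype
  have hc : G.Connected := ⟨fun u v => (hr u v.1 (h _ u.2 _ v.2)).2⟩
  have h1 := hc.card_vert_le_card_edgeSet_add_one
  have h2 : Nat.card G.edgeSet ≤ F.card := by
    rw [← Nat.card_eq_finsetCard]
    refine Nat.card_le_card_of_injective (fun e : G.edgeSet => (⟨e.1.map Subtype.val, ?_⟩ : F)) ?_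
    · obtain ⟨e, he⟩ := e
      induction e with | _ u v => exact he.2
    · intro e e' h
      exact Subtype.ext (Sym2.map.injective Subtype.val_injective (congrArg Subtype.val h))
  rw [Nat.card_eq_fintype_card, Fintype.card_coe] at h1
  omega

/-! ### Joining two trees by an edge and cutting a tree at an edge -/

/-- The tree obtained from two trees by adding an edge. -/
def joinTr (w q : V) (T₁ T₂ : Finset V × Finset (Sym2 V)) : Finset V × Finset (Sym2 V) :=
  (T₁.1 ∪ T₂.1, insert s(w, q) (T₁.2 ∪ T₂.2))

theorem Disjoint.edges {T₁ T₂ : Finset V × Finset (Sym2 V)} (h₁ : IsTr T₁) (h₂ : IsTr T₂)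
    (hd : Disjoint T₁.1 T₂.1) : Disjoint T₁.2 T₂.2 := by
  rw [Finset.disjoint_left] at hd ⊢
  intro e he he'
  induction e with | _ u v => exact hd (h₁.mem _ he u (by simp)) (h₂.mem _ he' u (by simp))

theorem not_mem_edges {T₁ T₂ : Finset V × Finset (Sym2 V)} (h₁ : IsTr T₁) (h₂ : IsTr T₂)
    (hd : Disjoint T₁.1 T₂.1) {w q : V} (hw : w ∈ T₁.1) (hq : q ∈ T₂.1) :
    s(w, q) ∉ T₁.2 ∪ T₂.2 := by
  rw [Finset.disjoint_left] at hd
  rw [Finset.mem_union, not_or]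
  exact ⟨fun h => hd (h₁.mem _ h q (by simp)) hq, fun h => hd hw (h₂.mem _ h w (by simp))⟩

theorem isTr_joinTr {T₁ T₂ : Finset V × Finset (Sym2 V)} (h₁ : IsTr T₁) (h₂ : IsTr T₂)
    (hd : Disjoint T₁.1 T₂.1) {w q : V} (hw : w ∈ T₁.1) (hq : q ∈ T₂.1) :
    IsTr (joinTr w q T₁ T₂) := by
  have hwq : w ≠ q := fun h => Finset.disjoint_left.1 hd hw (h ▸ hq)
  refine ⟨?_, ?_, ?_, ?_⟩
  · intro e he
    simp only [joinTr, Finset.mem_insert, Finset.mem_union] at he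
    rcases he with rfl | he | he
    · simpa using hwq
    · exact h₁.not_diag e he
    · exact h₂.not_diag e he
  · intro e he v hv
    simp only [joinTr, Finset.mem_insert, Finset.mem_union] at he ⊢
    rcases he with rfl | he | he
    · rcases Sym2.mem_iff.1 hv with rfl | rfl
      · exact Or.inl hw
      · exact Or.inr hq
    · exact Or.inl (h₁.mem e he v hv)
    · exact Or.inr (h₂.mem e he v hv)
  · have key : ∀ v ∈ (joinTr w q T₁ T₂).1, Reach (joinTr w q T₁ T₂).2 w v := by
      intro v hv
      simp only [joinTr, Finset.mem_union] at hv
      rcases hv with hv | hv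
      · exact (h₁.reach w hw v hv).mono fun e he => by simp [joinTr, he]
      · exact Reach.trans (Relation.ReflTransGen.single (by simp [joinTr]))
          ((h₂.reach q hq v hv).mono fun e he => by simp [joinTr, he])
    intro u hu v hv
    exact (key u hu).symm.trans (key v hv)
  · simp only [joinTr]
    rw [Finset.card_insert_of_notMem (not_mem_edges h₁ h₂ hd hw hq),
      Finset.card_union_of_disjoint hd, Finset.card_union_of_disjoint (Disjoint.edges h₁ h₂ hd)]
    have := h₁.card
    have := h₂.card
    omega

open Classical in
/-- The component of `q` after the edge `wq` has been removed. -/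
noncomputable def cutSnd (w q : V) (T : Finset V × Finset (Sym2 V)) : Finset V × Finset (Sym2 V) :=
  (T.1.filter (fun v => Reach (T.2.erase s(w, q)) q v),
    (T.2.erase s(w, q)).filter fun e => ∀ v ∈ e, Reach (T.2.erase s(w, q)) q v)

open Classical in
/-- The remainder after the edge `wq` and the component of `q` have been removed. -/
noncomputable def cutFst (w q : V) (T : Finset V × Finset (Sym2 V)) : Finset V × Finset (Sym2 V) :=
  (T.1.filter (fun v => ¬ Reach (T.2.erase s(w, q)) q v),
    (T.2.erase s(w, q)).filter fun e => ¬ ∀ v ∈ e, Reach (T.2.erase s(w, q)) q v)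

theorem isTr_cut {T : Finset V × Finset (Sym2 V)} (h : IsTr T) {w q : V} (he : s(w, q) ∈ T.2) :
    IsTr (cutFst w q T) ∧ IsTr (cutSnd w q T) ∧ w ∈ (cutFst w q T).1 ∧ q ∈ (cutSnd w q T).1 ∧
      Disjoint (cutFst w q T).1 (cutSnd w q T).1 ∧ joinTr w q (cutFst w q T) (cutSnd w q T) = T := by
  classical
  have hwq : w ≠ q := fun e => h.not_diag _ he (by simpa using e)
  have hw : w ∈ T.1 := h.mem _ he w (by simp)
  have hq : q ∈ T.1 := h.mem _ he q (by simp)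
  set F := T.2.erase s(w, q) with hF
  have hFT : ∀ u v, s(u, v) ∈ F → v ∈ T.1 := fun u v huv =>
    h.mem _ (Finset.mem_of_mem_erase huv) v (by simp)
  have step : ∀ u v, s(u, v) ∈ F → Reach F q u → Reach F q v := fun u v huv hu =>
    hu.trans (.single huv)
  have hsnd1 : (cutSnd w q T).1 = T.1.filter (fun v => Reach F q v) := by simp [cutSnd, hF]
  have hsnd2 : (cutSnd w q T).2 = F.filter fun e => ∀ v ∈ e, Reach F q v := by simp [cutSnd, hF]
  have hfst1 : (cutFst w q T).1 = T.1.filter (fun v => ¬ Reach F q v) := by simp [cutFst, hF]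
  have hfst2 : (cutFst w q T).2 = F.filter fun e => ¬ ∀ v ∈ e, Reach F q v := by simp [cutFst, hF]
  have hq2 : q ∈ (cutSnd w q T).1 := by
    rw [hsnd1]; exact Finset.mem_filter.2 ⟨hq, .refl⟩
  have hr2 : ∀ v ∈ (cutSnd w q T).1, Reach (cutSnd w q T).2 q v := by
    intro v hv
    rw [hsnd1, Finset.mem_filter] at hv
    refine Reach.restrict (U := Finset.univ.filter fun v => Reach F q v) ?_ hv.2 (by
      rw [Finset.mem_filter]; exact ⟨Finset.mem_univ _, .refl⟩)
    intro u hu v huv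
    rw [Finset.mem_filter] at hu
    rw [Finset.mem_filter, hsnd2, Finset.mem_filter]
    have hv := step u v huv hu.2
    refine ⟨⟨Finset.mem_univ _, hv⟩, huv, ?_⟩
    intro z hz
    rcases Sym2.mem_iff.1 hz with rfl | rfl
    · exact hu.2
    · exact hv
  have hm2 : ∀ e ∈ (cutSnd w q T).2, ∀ v ∈ e, v ∈ (cutSnd w q T).1 := by
    intro e he v hv
    rw [hsnd2, Finset.mem_filter] at he
    rw [hsnd1, Finset.mem_filter]
    exact ⟨h.mem e (Finset.mem_of_mem_erase he.1) v hv, he.2 v hv⟩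
  have hnot : ∀ u v, s(u, v) ∈ F → ¬ Reach F q u → ¬ Reach F q v := fun u v huv hu hv =>
    hu (step v u (by rwa [Sym2.eq_swap]) hv)
  have hm1 : ∀ e ∈ (cutFst w q T).2, ∀ v ∈ e, v ∈ (cutFst w q T).1 := by
    intro e he v hv
    rw [hfst2, Finset.mem_filter] at he
    rw [hfst1, Finset.mem_filter]
    refine ⟨h.mem e (Finset.mem_of_mem_erase he.1) v hv, fun hr => he.2 ?_⟩
    obtain ⟨u, rfl⟩ := hv
    intro z hz
    rcases Sym2.mem_iff.1 hz with rfl | rfl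
    · exact hr
    · exact step _ _ he.1 hr
  have hcardF : F.card + 1 = T.2.card := Finset.card_erase_add_one he
  -- Otherwise `T` would stay connected after the removal of an edge, with too few edges for its
  -- vertices.
  have hwr : ¬ Reach F q w := by
    intro hr
    have hall : ∀ v ∈ T.1, Reach F q v := fun v hv =>
      (h.reach w hw v hv).erase.elim (hr.trans ·) id
    have := card_le_of_reach (U := T.1) (F := F)
      (fun e he v hv => h.mem e (Finset.mem_of_mem_erase he) v hv) ⟨q, hq⟩
      (fun u hu v hv => (hall u hu).symm.trans (hall v hv))
    have := h.card
    omega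
  have hw1 : w ∈ (cutFst w q T).1 := by
    rw [hfst1]; exact Finset.mem_filter.2 ⟨hw, hwr⟩
  have hr1 : ∀ v ∈ (cutFst w q T).1, Reach (cutFst w q T).2 w v := by
    intro v hv
    rw [hfst1, Finset.mem_filter] at hv
    have hwv : Reach F w v := (h.reach w hw v hv.1).erase.resolve_right hv.2
    refine Reach.restrict (U := Finset.univ.filter fun v => ¬ Reach F q v) ?_ hwv (by
      rw [Finset.mem_filter]; exact ⟨Finset.mem_univ _, hwr⟩)
    intro u hu v huv
    rw [Finset.mem_filter] at hu
    rw [Finset.mem_filter, hfst2, Finset.mem_filter]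
    exact ⟨⟨Finset.mem_univ _, hnot u v huv hu.2⟩, huv, fun hall => hu.2 (hall u (by simp))⟩
  -- Each part has at most one vertex more than edges. Together the parts have exactly two more, so
  -- equality holds in both.
  have hc1 := card_le_of_reach hm1 ⟨w, hw1⟩ fun u hu v hv => (hr1 u hu).symm.trans (hr1 v hv)
  have hc2 := card_le_of_reach hm2 ⟨q, hq2⟩ fun u hu v hv => (hr2 u hu).symm.trans (hr2 v hv)
  have hcU : (cutSnd w q T).1.card + (cutFst w q T).1.card = T.1.card := by
    rw [hsnd1, hfst1]; exact Finset.card_filter_add_card_filter_not _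
  have hcF : (cutSnd w q T).2.card + (cutFst w q T).2.card = F.card := by
    rw [hsnd2, hfst2]; exact Finset.card_filter_add_card_filter_not _
  have hcT := h.card
  refine ⟨⟨?_, hm1, fun u hu v hv => (hr1 u hu).symm.trans (hr1 v hv), by omega⟩,
    ⟨?_, hm2, fun u hu v hv => (hr2 u hu).symm.trans (hr2 v hv), by omega⟩, hw1, hq2, ?_, ?_⟩
  · intro e he
    rw [hfst2, Finset.mem_filter] at he
    exact h.not_diag e (Finset.mem_of_mem_erase he.1)
  · intro e he
    rw [hsnd2, Finset.mem_filter] at he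
    exact h.not_diag e (Finset.mem_of_mem_erase he.1)
  · rw [hsnd1, hfst1]
    exact (Finset.disjoint_filter_filter_not _ _ _).symm
  · refine Prod.ext ?_ ?_
    · simp only [joinTr]
      rw [hsnd1, hfst1, Finset.union_comm, Finset.filter_union_filter_not_eq]
    · simp only [joinTr]
      rw [hsnd2, hfst2, Finset.union_comm, Finset.filter_union_filter_not_eq, hF,
        Finset.insert_erase he]

theorem cut_join {T₁ T₂ : Finset V × Finset (Sym2 V)} (h₁ : IsTr T₁) (h₂ : IsTr T₂)
    (hd : Disjoint T₁.1 T₂.1) {w q : V} (hw : w ∈ T₁.1) (hq : q ∈ T₂.1) :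
    cutFst w q (joinTr w q T₁ T₂) = T₁ ∧ cutSnd w q (joinTr w q T₁ T₂) = T₂ := by
  classical
  have hF : (joinTr w q T₁ T₂).2.erase s(w, q) = T₁.2 ∪ T₂.2 :=
    Finset.erase_insert (not_mem_edges h₁ h₂ hd hw hq)
  have hr : ∀ v, Reach (T₁.2 ∪ T₂.2) q v ↔ v ∈ T₂.1 := by
    intro v
    constructor
    · intro h
      refine Reach.mem (fun u hu v huv => ?_) h hq
      rcases Finset.mem_union.1 huv with huv | huv
      · exact absurd hu (Finset.disjoint_left.1 hd (h₁.mem _ huv u (by simp)))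
      · exact h₂.mem _ huv v (by simp)
    · intro h
      exact (h₂.reach q hq v h).mono Finset.subset_union_right
  have hd' := Finset.disjoint_left.1 hd
  have hV : (joinTr w q T₁ T₂).1 = T₁.1 ∪ T₂.1 := rfl
  refine ⟨Prod.ext ?_ ?_, Prod.ext ?_ ?_⟩
  · ext v
    simp only [cutFst, hF, hr, hV, Finset.mem_filter, Finset.mem_union]
    exact ⟨fun h => h.1.resolve_right h.2, fun h => ⟨Or.inl h, hd' h⟩⟩
  · ext e
    simp only [cutFst, hF, hr, Finset.mem_filter, Finset.mem_union]
    refine ⟨fun h => h.1.resolve_right fun h' => h.2 (h₂.mem e h'), fun h => ⟨Or.inl h, fun h' => ?_⟩⟩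
    induction e with | _ u v => exact hd' (h₁.mem _ h u (by simp)) (h' u (by simp))
  · ext v
    simp only [cutSnd, hF, hr, hV, Finset.mem_filter, Finset.mem_union]
    exact ⟨fun h => h.2, fun h => ⟨Or.inr h, h⟩⟩
  · ext e
    simp only [cutSnd, hF, hr, Finset.mem_filter, Finset.mem_union]
    refine ⟨fun h => h.1.resolve_left fun h' => ?_, fun h => ⟨Or.inr h, h₂.mem e h⟩⟩
    obtain ⟨-, h⟩ := h
    induction e with | _ u v => exact hd' (h₁.mem _ h' u (by simp)) (h u (by simp))

/-- The degree of a vertex in a set of edges. -/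
def deg (F : Finset (Sym2 V)) (v : V) : ℕ := (F.filter (v ∈ ·)).card

theorem deg_join {T₁ T₂ : Finset V × Finset (Sym2 V)} (h₁ : IsTr T₁) (h₂ : IsTr T₂)
    (hd : Disjoint T₁.1 T₂.1) {w q : V} (hw : w ∈ T₁.1) (hq : q ∈ T₂.1) :
    (∀ v ∈ T₁.1, deg (joinTr w q T₁ T₂).2 v = deg T₁.2 v + if v = w then 1 else 0) ∧
    (∀ v ∈ T₂.1, deg (joinTr w q T₁ T₂).2 v = deg T₂.2 v + if v = q then 1 else 0) := by
  have hn := not_mem_edges h₁ h₂ hd hw hq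
  have hd' := Finset.disjoint_left.1 hd
  have hwq : w ≠ q := fun h => hd' hw (h ▸ hq)
  have e : ∀ v, deg (joinTr w q T₁ T₂).2 v = deg T₁.2 v + deg T₂.2 v +
      (if v = w then 1 else 0) + if v = q then 1 else 0 := by
    intro v
    simp only [deg, joinTr]
    rw [Finset.filter_insert, Finset.filter_union]
    have hdis : Disjoint (T₁.2.filter (v ∈ ·)) (T₂.2.filter (v ∈ ·)) :=
      Finset.disjoint_filter_filter (Disjoint.edges h₁ h₂ hd)
    by_cases hv : v = w
    · subst hv
      rw [if_pos (by simp), if_pos rfl, if_neg hwq, Finset.card_insert_of_notMem (by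
        rw [← Finset.filter_union]; exact fun h => hn (Finset.mem_of_mem_filter _ h)),
        Finset.card_union_of_disjoint hdis]
    · by_cases hv' : v = q
      · subst hv'
        rw [if_pos (by simp), if_pos rfl, if_neg hv, Finset.card_insert_of_notMem (by
          rw [← Finset.filter_union]; exact fun h => hn (Finset.mem_of_mem_filter _ h)),
          Finset.card_union_of_disjoint hdis]
      · rw [if_neg (by simp [hv, hv']), if_neg hv, if_neg hv', Finset.card_union_of_disjoint hdis]
        omega
  have hz : ∀ {T : Finset V × Finset (Sym2 V)}, IsTr T → ∀ v ∉ T.1, deg T.2 v = 0 := by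
    intro T hT v hv
    rw [deg, Finset.card_eq_zero, Finset.filter_eq_empty_iff]
    exact fun e he h => hv (hT.mem e he v h)
  constructor
  · intro v hv
    rw [e, hz h₂ v (hd' hv), if_neg (fun h : v = q => hd' hv (h ▸ hq))]
    omega
  · intro v hv
    rw [e, hz h₁ v (fun h => hd' h hv), if_neg (fun h : v = w => hd' hw (h ▸ hv))]
    omega

end Trees
end TreeProg

/-! ### Generating functions of trees -/

namespace TreeProg

/-! ### The root value is the generating function of the trees that contain the root -/

section TreeSum
variable {V : Type} [Fintype V] [DecidableEq V] {E : Type} [CommRing E]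

open Classical in
/-- All trees with vertices in `V`. -/
noncomputable def trees (V : Type) [Fintype V] [DecidableEq V] :
    Finset (Finset V × Finset (Sym2 V)) := Finset.univ.filter IsTr

theorem mem_trees {T : Finset V × Finset (Sym2 V)} : T ∈ trees V ↔ IsTr T := by simp [trees]

/-- The weight of a vertex of degree `d`. -/
def vtx (a b : V → E) (v : V) (d : ℕ) : E := b v + if d = 1 then a v else 0

/-- The weight of a tree. -/
def treeWt (a b : V → E) (x : Sym2 V → E) (T : Finset V × Finset (Sym2 V)) : E :=
  (∏ e ∈ T.2, x e) * ∏ v ∈ T.1, vtx a b v (deg T.2 v)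

/-- The weight of a tree without the weight of its vertex `w`. -/
def awayWt (a b : V → E) (x : Sym2 V → E) (w : V) (T : Finset V × Finset (Sym2 V)) : E :=
  (∏ e ∈ T.2, x e) * ∏ v ∈ T.1.erase w, vtx a b v (deg T.2 v)

/-- The weight of a tree with an additional edge at `q`. -/
def stubWt (a b : V → E) (x : Sym2 V → E) (q : V) (T : Finset V × Finset (Sym2 V)) : E :=
  (∏ e ∈ T.2, x e) * ∏ v ∈ T.1, vtx a b v (deg T.2 v + if v = q then 1 else 0)

/-- The neighbours of `w` in the tree are in `S`. -/
def NbrIn (w : V) (S : Finset V) (T : Finset V × Finset (Sym2 V)) : Prop :=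
  ∀ q, s(w, q) ∈ T.2 → q ∈ S

-- The branches at `w` whose first edges lead into `S`; the weight of `w` itself is left out, as it
-- depends on the degree in the whole tree.
open Classical in
noncomputable def awaySum (a b : V → E) (x : Sym2 V → E) (w : V) (S : Finset V) : E :=
  ∑ T ∈ (trees V).filter (fun T => w ∈ T.1 ∧ NbrIn w S T), awayWt a b x w T

-- The candidate for the message from `q` to `w`. Trees that reach `w` on another route are not
-- excluded; they disappear when multiplied by a weight of `w`, which is the only way this sum is
-- used.
open Classical in
noncomputable def stubSum (a b : V → E) (x : Sym2 V → E) (q w : V) : E :=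
  ∑ T ∈ (trees V).filter (fun T => q ∈ T.1 ∧ s(q, w) ∉ T.2), stubWt a b x q T

open Classical in
/-- The sum of the weights of the trees that contain `r`. -/
noncomputable def treeSum (a b : V → E) (x : Sym2 V → E) (r : V) : E :=
  ∑ T ∈ (trees V).filter (fun T => r ∈ T.1), treeWt a b x T

variable {a b : V → E} {x : Sym2 V → E}

/-- Hence the product of the weights of two trees with a common vertex is zero. -/
theorem vtx_mul_vtx (haa : ∀ v, a v * a v = 0) (hab : ∀ v, a v * b v = 0) (hbb : ∀ v, b v * b v = 0)
    (v : V) (d d' : ℕ) : vtx a b v d * vtx a b v d' = 0 := by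
  unfold vtx
  split_ifs
  · linear_combination haa v + 2 * hab v + hbb v
  · linear_combination hab v + hbb v
  · linear_combination hab v + hbb v
  · linear_combination hbb v

theorem awayWt_join {T₁ T₂ : Finset V × Finset (Sym2 V)} (h₁ : IsTr T₁) (h₂ : IsTr T₂)
    (hd : Disjoint T₁.1 T₂.1) {w q : V} (hw : w ∈ T₁.1) (hq : q ∈ T₂.1) :
    awayWt a b x w (joinTr w q T₁ T₂) = awayWt a b x w T₁ * x s(w, q) * stubWt a b x q T₂ := by
  obtain ⟨hd1, hd2⟩ := deg_join h₁ h₂ hd hw hq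
  have hd' := Finset.disjoint_left.1 hd
  have e1 : ∏ e ∈ (joinTr w q T₁ T₂).2, x e = x s(w, q) * ((∏ e ∈ T₁.2, x e) * ∏ e ∈ T₂.2, x e) := by
    simp only [joinTr]
    rw [Finset.prod_insert (not_mem_edges h₁ h₂ hd hw hq),
      Finset.prod_union (Disjoint.edges h₁ h₂ hd)]
  have e2 : (joinTr w q T₁ T₂).1.erase w = T₁.1.erase w ∪ T₂.1 := by
    simp only [joinTr]
    rw [Finset.erase_union_distrib, Finset.erase_eq_of_notMem (hd' hw)]
  rw [awayWt, e1, e2, Finset.prod_union (hd.mono_left (Finset.erase_subset _ _)), awayWt, stubWt,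
    Finset.prod_congr rfl fun v hv => show vtx a b v (deg (joinTr w q T₁ T₂).2 v) =
      vtx a b v (deg T₁.2 v) by
        rw [hd1 v (Finset.mem_of_mem_erase hv), if_neg (Finset.ne_of_mem_erase hv), add_zero],
    Finset.prod_congr rfl fun v hv => show vtx a b v (deg (joinTr w q T₁ T₂).2 v) =
      vtx a b v (deg T₂.2 v + if v = q then 1 else 0) by rw [hd2 v hv]]
  ring

theorem nbrIn_join {T₁ T₂ : Finset V × Finset (Sym2 V)} (h₂ : IsTr T₂)
    (hd : Disjoint T₁.1 T₂.1) {w q : V} (hw : w ∈ T₁.1) {S : Finset V} (hS : NbrIn w S T₁) :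
    NbrIn w (insert q S) (joinTr w q T₁ T₂) := by
  intro z hz
  simp only [joinTr, Finset.mem_insert, Finset.mem_union] at hz ⊢
  rcases hz with hz | hz | hz
  · left
    rcases Sym2.eq_iff.1 hz with ⟨_, h⟩ | ⟨h, h'⟩
    · exact h
    · rw [h', ← h]
  · exact Or.inr (hS z hz)
  · exact absurd (h₂.mem _ hz w (by simp)) (Finset.disjoint_left.1 hd hw)

open Classical in
/-- Splitting the trees which use the edge `wq` at this edge. -/
theorem mul_sum_join (haa : ∀ v, a v * a v = 0) (hab : ∀ v, a v * b v = 0)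
    (hbb : ∀ v, b v * b v = 0) {w q : V} (hwq : w ≠ q) {S : Finset V} {β : E}
    (hβa : β * a w = 0) (hβb : β * b w = 0) :
    β * ∑ T ∈ (trees V).filter (fun T => w ∈ T.1 ∧ s(w, q) ∈ T.2 ∧ NbrIn w (insert q S) T),
      awayWt a b x w T = β * (awaySum a b x w S * (x s(w, q) * stubSum a b x q w)) := by
  have e1 : awaySum a b x w S * (x s(w, q) * stubSum a b x q w) =
      ∑ T ∈ (trees V).filter (fun T => w ∈ T.1 ∧ NbrIn w S T) ×ˢ
        (trees V).filter (fun T => q ∈ T.1 ∧ s(q, w) ∉ T.2),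
        awayWt a b x w T.1 * x s(w, q) * stubWt a b x q T.2 := by
    rw [awaySum, stubSum, Finset.mul_sum, Finset.sum_mul_sum, Finset.sum_product]
    exact Finset.sum_congr rfl fun _ _ => Finset.sum_congr rfl fun _ _ => by ring
  -- Pairs with a common vertex drop out: a common vertex other than `w` contributes two
  -- annihilating weights, and at `w`, whose weight is missing in the first tree, the factor `β`
  -- takes over. Disjoint pairs correspond to trees through the edge by cutting and joining.
  have e2 : β * ∑ T ∈ (trees V).filter (fun T => w ∈ T.1 ∧ NbrIn w S T) ×ˢ
        (trees V).filter (fun T => q ∈ T.1 ∧ s(q, w) ∉ T.2),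
        awayWt a b x w T.1 * x s(w, q) * stubWt a b x q T.2 =
      β * ∑ T ∈ ((trees V).filter (fun T => w ∈ T.1 ∧ NbrIn w S T) ×ˢ
        (trees V).filter (fun T => q ∈ T.1 ∧ s(q, w) ∉ T.2)).filter
          (fun T => Disjoint T.1.1 T.2.1),
        awayWt a b x w T.1 * x s(w, q) * stubWt a b x q T.2 := by
    rw [Finset.mul_sum, Finset.mul_sum]
    symm
    refine Finset.sum_subset (Finset.filter_subset _ _) fun T hT hT' => ?_
    have hnd : ¬ Disjoint T.1.1 T.2.1 := fun h => hT' (Finset.mem_filter.2 ⟨hT, h⟩)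
    obtain ⟨v, hv1, hv2⟩ := Finset.not_disjoint_iff.1 hnd
    rw [stubWt, ← Finset.mul_prod_erase _ _ hv2]
    by_cases hvw : v = w
    · subst hvw
      have : β * vtx a b v (deg T.2.2 v + if v = q then 1 else 0) = 0 := by
        unfold vtx
        split_ifs <;> simp [mul_add, hβa, hβb]
      linear_combination (awayWt a b x v T.1 * x s(v, q) * ((∏ e ∈ T.2.2, x e) *
        ∏ u ∈ T.2.1.erase v, vtx a b u (deg T.2.2 u + if u = q then 1 else 0))) * this
    · rw [awayWt, ← Finset.mul_prod_erase _ _ (Finset.mem_erase.2 ⟨hvw, hv1⟩)]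
      have := vtx_mul_vtx haa hab hbb v (deg T.1.2 v) (deg T.2.2 v + if v = q then 1 else 0)
      generalize vtx a b v (deg T.1.2 v) = y at *
      generalize vtx a b v (deg T.2.2 v + if v = q then 1 else 0) = z at *
      generalize ∏ u ∈ (T.1.1.erase w).erase v, vtx a b u (deg T.1.2 u) = c
      generalize ∏ u ∈ T.2.1.erase v, vtx a b u (deg T.2.2 u + if u = q then 1 else 0) = d
      linear_combination (β * (∏ e ∈ T.1.2, x e) * c * x s(w, q) * (∏ e ∈ T.2.2, x e) * d) * this
  rw [e1, e2]
  congr 1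
  refine Finset.sum_bij' (fun T _ => (cutFst w q T, cutSnd w q T)) (fun T _ => joinTr w q T.1 T.2)
    ?_ ?_ ?_ ?_ ?_
  · intro T hT
    obtain ⟨hT, hw, he, hN⟩ := by simpa [mem_trees] using hT
    obtain ⟨h1, h2, hw1, hq2, hd, hj⟩ := isTr_cut hT he
    have hn := not_mem_edges h1 h2 hd hw1 hq2
    simp only [Finset.mem_filter, Finset.mem_product, mem_trees]
    refine ⟨⟨⟨h1, hw1, fun z hz => ?_⟩, h2, hq2, fun h => hn ?_⟩, hd⟩
    · have : s(w, z) ∈ T.2 := by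
        rw [← hj]; simp [joinTr, hz]
      refine (Finset.mem_insert.1 (hN z this)).resolve_left fun e => hn ?_
      rw [e] at hz; exact Finset.mem_union_left _ hz
    · rw [Sym2.eq_swap]; exact Finset.mem_union_right _ h
  · intro T hT
    simp only [Finset.mem_filter, Finset.mem_product, mem_trees] at hT ⊢
    obtain ⟨⟨⟨h1, hw1, hN⟩, h2, hq2, -⟩, hd⟩ := hT
    refine ⟨isTr_joinTr h1 h2 hd hw1 hq2, ?_, ?_, nbrIn_join h2 hd hw1 hN⟩
    · simp [joinTr, hw1]
    · simp [joinTr]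
  · intro T hT
    simp only [Finset.mem_filter, mem_trees] at hT
    exact (isTr_cut hT.1 hT.2.2.1).2.2.2.2.2
  · intro T hT
    simp only [Finset.mem_filter, Finset.mem_product, mem_trees] at hT
    obtain ⟨⟨⟨h1, hw1, -⟩, h2, hq2, -⟩, hd⟩ := hT
    have := cut_join h1 h2 hd hw1 hq2
    exact Prod.ext this.1 this.2
  · intro T hT
    simp only [Finset.mem_filter, mem_trees] at hT
    obtain ⟨h1, h2, hw1, hq2, hd, hj⟩ := isTr_cut hT.1 hT.2.2.1
    conv_lhs => rw [← hj]
    exact awayWt_join h1 h2 hd hw1 hq2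

theorem IsTr.eq_singleton {T : Finset V × Finset (Sym2 V)} (h : IsTr T) {w : V} (hw : w ∈ T.1)
    (hN : ∀ q, s(w, q) ∉ T.2) : T = ({w}, ∅) := by
  have h1 : T.1 = {w} := by
    refine Finset.eq_singleton_iff_unique_mem.2 ⟨hw, fun v hv => ?_⟩
    have := Reach.mem (U := {w}) (F := T.2) (by
      intro u hu v huv
      rw [Finset.mem_singleton] at hu
      subst hu
      exact absurd huv (hN v)) (h.reach w hw v hv) (Finset.mem_singleton_self w)
    exact Finset.mem_singleton.1 this
  have h2 := h.card
  rw [h1, Finset.card_singleton] at h2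
  exact Prod.ext h1 (Finset.card_eq_zero.1 (by omega))

theorem isTr_singleton (w : V) : IsTr (({w}, ∅) : Finset V × Finset (Sym2 V)) where
  not_diag := by simp
  mem := by simp
  reach := by
    intro u hu v hv
    rw [Finset.mem_singleton] at hu hv
    rw [hu, hv]
    exact .refl
  card := by simp

theorem awaySum_empty (w : V) : awaySum a b x w ∅ = 1 := by
  classical
  have : (trees V).filter (fun T => w ∈ T.1 ∧ NbrIn w ∅ T) = {({w}, ∅)} := by
    ext T
    simp only [Finset.mem_filter, mem_trees, Finset.mem_singleton]
    constructor
    · rintro ⟨h, hw, hN⟩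
      exact h.eq_singleton hw fun q hq => absurd (hN q hq) (Finset.notMem_empty q)
    · rintro rfl
      exact ⟨isTr_singleton w, Finset.mem_singleton_self w, fun q hq => by simp at hq⟩
  rw [awaySum, this, Finset.sum_singleton]
  simp [awayWt]

/-- The set `S` of allowed neighbours grows by one vertex `q` at a time: a tree avoids the edge
`wq`, or it is cut there into a smaller tree and a branch at `q`. These are the two summands of the
new factor. -/
theorem mul_awaySum (haa : ∀ v, a v * a v = 0) (hab : ∀ v, a v * b v = 0)
    (hbb : ∀ v, b v * b v = 0) (hx : ∀ v, x s(v, v) = 0) {w : V} {β : E}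
    (hβa : β * a w = 0) (hβb : β * b w = 0) (S : Finset V) :
    β * awaySum a b x w S = β * ∏ q ∈ S, (1 + x s(w, q) * stubSum a b x q w) := by
  classical
  induction S using Finset.induction_on with
  | empty => rw [awaySum_empty, Finset.prod_empty]
  | insert q S hq ih =>
    rw [Finset.prod_insert hq]
    by_cases hwq : w = q
    · subst hwq
      rw [hx, zero_mul, add_zero, one_mul, ← ih]
      congr 1
      rw [awaySum, awaySum]
      congr 1
      ext T
      simp only [Finset.mem_filter, mem_trees]
      refine and_congr_right fun hT => and_congr_right fun _ => ?_
      refine ⟨fun h z hz => (Finset.mem_insert.1 (h z hz)).resolve_left fun e => ?_,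
        fun h z hz => Finset.mem_insert_of_mem (h z hz)⟩
      exact hT.not_diag _ hz (by simpa using e.symm)
    · have h1 : awaySum a b x w (insert q S) = awaySum a b x w S +
          ∑ T ∈ (trees V).filter (fun T => w ∈ T.1 ∧ s(w, q) ∈ T.2 ∧ NbrIn w (insert q S) T),
            awayWt a b x w T := by
        rw [awaySum, ← Finset.sum_filter_not_add_sum_filter _ (fun T => s(w, q) ∈ T.2),
          Finset.filter_filter, Finset.filter_filter, awaySum]
        congr 1
        · congr 1
          ext T
          simp only [Finset.mem_filter]
          refine and_congr_right fun _ => ⟨fun h => ⟨h.1.1, fun z hz =>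
            (Finset.mem_insert.1 (h.1.2 z hz)).resolve_left fun e => h.2 (e ▸ hz)⟩,
            fun h => ⟨⟨h.1, fun z hz => Finset.mem_insert_of_mem (h.2 z hz)⟩, fun hz => hq (h.2 q hz)⟩⟩
        · congr 1
          ext T
          simp only [Finset.mem_filter]
          tauto
      rw [h1, mul_add, mul_sum_join haa hab hbb hwq hβa hβb]
      linear_combination (1 + x s(w, q) * stubSum a b x q w) * ih

/-- With the stub counted, `w` has degree one only in the tree with the single vertex `w`; this is
where the summand `a w` comes from. -/
theorem stubSum_eq (w p : V) :
    stubSum a b x w p = a w + b w * awaySum a b x w (Finset.univ.erase p) := by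
  classical
  have h1 : ∀ T ∈ (trees V).filter (fun T => w ∈ T.1 ∧ s(w, p) ∉ T.2), stubWt a b x w T =
      (if T = ({w}, ∅) then a w else 0) + b w * awayWt a b x w T := by
    intro T hT
    simp only [Finset.mem_filter, mem_trees] at hT
    obtain ⟨hT, hw, -⟩ := hT
    have e : stubWt a b x w T = vtx a b w (deg T.2 w + 1) * awayWt a b x w T := by
      rw [stubWt, ← Finset.mul_prod_erase _ _ hw, if_pos rfl, awayWt,
        Finset.prod_congr rfl fun v hv => show vtx a b v (deg T.2 v + if v = w then 1 else 0) =
          vtx a b v (deg T.2 v) by rw [if_neg (Finset.ne_of_mem_erase hv), add_zero]]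
      ring
    rw [e, vtx]
    by_cases hs : T = ({w}, ∅)
    · rw [if_pos hs, if_pos (by rw [hs]; simp [deg]), hs]
      simp [awayWt]; ring
    · rw [if_neg hs, if_neg]
      · ring
      · intro h0
        refine hs (hT.eq_singleton hw fun q hq => ?_)
        have : deg T.2 w = 0 := by omega
        rw [deg, Finset.card_eq_zero, Finset.filter_eq_empty_iff] at this
        exact this hq (by simp)
  rw [stubSum, Finset.sum_congr rfl h1, Finset.sum_add_distrib, Finset.sum_ite_eq', if_pos,
    ← Finset.mul_sum, awaySum]
  · congr 3
    ext T
    simp only [Finset.mem_filter]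
    refine and_congr_right fun _ => and_congr_right fun _ => ⟨fun h z hz => ?_, fun h hp => ?_⟩
    · exact Finset.mem_erase.2 ⟨fun e => h (e ▸ hz), Finset.mem_univ _⟩
    · exact Finset.notMem_erase _ _ (h p hp)
  · simp [mem_trees, isTr_singleton]

/-- In a message the product is multiplied by `b w`, which annihilates both weights of `w`, so it
can play the role of `β` in `mul_awaySum`. -/
theorem msgStep_stubSum (haa : ∀ v, a v * a v = 0) (hab : ∀ v, a v * b v = 0)
    (hbb : ∀ v, b v * b v = 0) (hx : ∀ v, x s(v, v) = 0) :
    msgStep a b x (stubSum a b x) = stubSum a b x := by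
  funext w p
  rw [stubSum_eq, mul_awaySum haa hab hbb hx (by rw [mul_comm]; exact hab w) (hbb w),
    msgStep]

theorem rootValue_stubSum (haa : ∀ v, a v * a v = 0) (hab : ∀ v, a v * b v = 0)
    (hbb : ∀ v, b v * b v = 0) (hx : ∀ v, x s(v, v) = 0) (r : V) :
    rootValue a b x (stubSum a b x) r = treeSum a b x r := by
  classical
  have h1 : ∀ T ∈ (trees V).filter (fun T => r ∈ T.1), treeWt a b x T =
      b r * awayWt a b x r T + if deg T.2 r = 1 then a r * awayWt a b x r T else 0 := by
    intro T hT
    simp only [Finset.mem_filter, mem_trees] at hT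
    rw [treeWt, ← Finset.mul_prod_erase _ _ hT.2, awayWt, vtx]
    split_ifs <;> ring
  rw [treeSum, Finset.sum_congr rfl h1, Finset.sum_add_distrib, ← Finset.mul_sum, rootValue]
  congr 1
  · rw [← mul_awaySum haa hab hbb hx (by rw [mul_comm]; exact hab r) (hbb r), awaySum]
    congr 3
    ext T
    simp [NbrIn]
  · rw [← Finset.sum_filter, Finset.mul_sum]
    -- If the root is a leaf, its only neighbour is `q`, and the tree is cut at that edge. Here `a
    -- r` plays the role of `β`.
    have h2 : ∀ q, a r * (x s(r, q) * stubSum a b x q r) =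
        ∑ T ∈ (trees V).filter (fun T => r ∈ T.1 ∧ s(r, q) ∈ T.2 ∧ NbrIn r {q} T),
          a r * awayWt a b x r T := by
      intro q
      by_cases hq : r = q
      · subst hq
        rw [hx, zero_mul, mul_zero, Finset.filter_false_of_mem, Finset.sum_empty]
        intro T hT h
        exact (mem_trees.1 hT).not_diag _ h.2.1 (by simp)
      · rw [← Finset.mul_sum]
        have := mul_sum_join (x := x) haa hab hbb hq (S := ∅) (haa r) (hab r)
        rw [awaySum_empty, one_mul, insert_empty_eq] at this
        exact this.symm
    rw [Finset.sum_congr rfl fun q _ => h2 q, ← Finset.sum_biUnion]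
    · congr 1
      ext T
      simp only [Finset.mem_filter, Finset.mem_biUnion, Finset.mem_univ, true_and]
      constructor
      · rintro ⟨q, hT, hr, hq, hN⟩
        refine ⟨⟨hT, hr⟩, ?_⟩
        rw [deg, Finset.card_eq_one]
        refine ⟨s(r, q), Finset.eq_singleton_iff_unique_mem.2 ⟨by simp [hq], fun e he => ?_⟩⟩
        rw [Finset.mem_filter] at he
        obtain ⟨he, z, rfl⟩ := he
        rw [Finset.mem_singleton.1 (hN z he)]
      · rintro ⟨⟨hT, hr⟩, hd⟩
        rw [deg, Finset.card_eq_one] at hd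
        obtain ⟨e, he⟩ := hd
        have he' : e ∈ T.2.filter (r ∈ ·) := by rw [he]; simp
        obtain ⟨h3, q, rfl⟩ := Finset.mem_filter.1 he'
        refine ⟨q, hT, hr, h3, fun z hz => ?_⟩
        have : s(r, z) ∈ T.2.filter (r ∈ ·) := by simp [hz]
        rw [he, Finset.mem_singleton] at this
        rw [Finset.mem_singleton]
        exact Sym2.congr_right.1 this
    · intro q _ q' _ hqq
      rw [Function.onFun, Finset.disjoint_left]
      intro T hT hT'
      simp only [Finset.mem_filter] at hT hT'
      exact hqq (Finset.mem_singleton.1 (hT'.2.2.2 q hT.2.2.1))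

theorem treeWt_map {E₂ : Type} [CommRing E₂] (f : E →+* E₂) (T : Finset V × Finset (Sym2 V)) :
    treeWt (fun v => f (a v)) (fun v => f (b v)) (fun e => f (x e)) T = f (treeWt a b x T) := by
  simp only [treeWt, vtx, map_mul, map_prod, map_add]
  congr 1
  exact Finset.prod_congr rfl fun v _ => by split_ifs <;> simp

theorem treeWt_update (v₀ : V) (ξ : E) (T : Finset V × Finset (Sym2 V)) :
    treeWt (Function.update a v₀ (ξ * a v₀)) (Function.update b v₀ (ξ * b v₀)) x T =
      (if v₀ ∈ T.1 then ξ else 1) * treeWt a b x T := by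
  have h : ∀ v d, vtx (Function.update a v₀ (ξ * a v₀)) (Function.update b v₀ (ξ * b v₀)) v d =
      (if v = v₀ then ξ else 1) * vtx a b v d := by
    intro v d
    by_cases hv : v = v₀
    · subst hv
      simp only [vtx, Function.update_self, if_true]
      split_ifs <;> ring
    · simp [vtx, hv]
  simp only [treeWt, h, Finset.prod_mul_distrib, Finset.prod_ite_eq']
  ring

/-- The fundamental identity: the root value of the fixed point enumerates the trees. -/
theorem MsgSystem.rootValue_eq {N : Finset V} : ∀ {E : Type} [CommRing E] {a b : V → E}
    {x : Sym2 V → E} (_ : MsgSystem a b x N) {M : V → V → E} (_ : msgStep a b x M = M) {r : V}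
    (_ : r ∈ N), rootValue a b x M r = treeSum a b x r := by
  classical
  -- The ring is quantified inside the statement, because the inductive step passes from `E` to the
  -- dual numbers over `E`.
  induction hN : Nᶜ.card generalizing N with
  | zero =>
    intro E _ a b x h M hM r hr
    have hN' : ∀ v, v ∈ N := fun v => by
      rw [Finset.card_eq_zero, Finset.compl_eq_empty_iff] at hN
      rw [hN]; exact Finset.mem_univ v
    have haa := fun v => h.aa v (hN' v)
    have hab := fun v => h.ab v (hN' v)
    have hbb := fun v => h.bb v (hN' v)
    rw [h.fixed_unique hM (msgStep_stubSum haa hab hbb h.diag),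
      rootValue_stubSum haa hab hbb h.diag]
  | succ m ih =>
    intro E _ a b x h M hM r hr
    obtain ⟨v₀, hv₀⟩ : Nᶜ.Nonempty := Finset.card_pos.1 (by omega)
    rw [Finset.mem_compl] at hv₀
    obtain ⟨F₀, F₁, hF⟩ := h.affine hv₀ hr
    -- The given system is the case `ξ = 1`.
    have h1 : rootValue a b x M r = F₀ + F₁ := by
      obtain ⟨M₂, hM₂, e⟩ := hF E (RingHom.id E) 1
      simp only [RingHom.id_apply, one_mul, Function.update_eq_self] at hM₂ e
      rw [h.fixed_unique hM hM₂, e]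
    -- For `ξ = ε` both weights of `v₀` are multiples of `ε`, so `v₀` joins the nilpotent vertices
    -- and the induction hypothesis applies.
    obtain ⟨M₂, hM₂, e⟩ := hF (DualNumber E) (TrivSqZeroExt.inlHom E E) DualNumber.eps
    have hsys : MsgSystem
        (Function.update (fun v => TrivSqZeroExt.inlHom E E (a v)) v₀
          (DualNumber.eps * TrivSqZeroExt.inlHom E E (a v₀)))
        (Function.update (fun v => TrivSqZeroExt.inlHom E E (b v)) v₀
          (DualNumber.eps * TrivSqZeroExt.inlHom E E (b v₀)))
        (fun e => (TrivSqZeroExt.inlHom E E (x e) : DualNumber E)) (insert v₀ N) := by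
      have hee : ∀ c d : DualNumber E, DualNumber.eps * c * (DualNumber.eps * d) = 0 := by
        intro c d
        have := DualNumber.eps_mul_eps (R := E)
        linear_combination (c * d) * this
      refine ⟨MsgSystem.two_dual h.two, ?_, ?_, ?_, ?_, ?_, ?_⟩
      · intro v hv
        by_cases hv0 : v = v₀
        · subst hv0; simp only [Function.update_self]; exact hee _ _
        · rw [Function.update_of_ne hv0, ← map_mul,
            h.aa v ((Finset.mem_insert.1 hv).resolve_left hv0), map_zero]
      · intro v hv
        by_cases hv0 : v = v₀
        · subst hv0; simp only [Function.update_self]; exact hee _ _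
        · rw [Function.update_of_ne hv0, Function.update_of_ne hv0, ← map_mul,
            h.ab v ((Finset.mem_insert.1 hv).resolve_left hv0), map_zero]
      · intro v hv
        by_cases hv0 : v = v₀
        · subst hv0; simp only [Function.update_self]; exact hee _ _
        · rw [Function.update_of_ne hv0, ← map_mul,
            h.bb v ((Finset.mem_insert.1 hv).resolve_left hv0), map_zero]
      · intro v hv
        rw [Finset.mem_insert, not_or] at hv
        rw [Function.update_of_ne hv.1, Function.update_of_ne hv.1, ← map_add, ← map_mul,
          h.free v hv.2, map_zero]
      · intro v hv w hw
        rw [Finset.mem_insert, not_or] at hv hw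
        rw [h.indep v hv.2 w hw.2, map_zero]
      · intro v
        rw [h.diag, map_zero]
    have hcard : (insert v₀ N)ᶜ.card = m := by
      rw [Finset.card_compl, Finset.card_insert_of_notMem hv₀]
      rw [Finset.card_compl] at hN
      omega
    have h2 := ih hcard hsys hM₂ (Finset.mem_insert_of_mem hr)
    rw [e] at h2
    -- Adding the two components returns from `ξ = ε` to `ξ = 1`. On the side of the trees, those
    -- without `v₀` appear in the first component and those with `v₀` in the second, each with its
    -- original weight.
    have h3 : ∀ c d : E, (TrivSqZeroExt.inlHom E E c + DualNumber.eps * TrivSqZeroExt.inlHom E E d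
        : DualNumber E).fst + (TrivSqZeroExt.inlHom E E c + DualNumber.eps *
          TrivSqZeroExt.inlHom E E d : DualNumber E).snd = c + d := by
      intro c d; simp
    rw [h1, ← h3, h2, treeSum, treeSum, TrivSqZeroExt.fst_sum, TrivSqZeroExt.snd_sum,
      ← Finset.sum_add_distrib]
    refine Finset.sum_congr rfl fun T _ => ?_
    rw [treeWt_update (a := fun v => TrivSqZeroExt.inlHom E E (a v))
      (b := fun v => TrivSqZeroExt.inlHom E E (b v)), treeWt_map]
    split_ifs
    · simp
    · simp

end TreeSum
end TreeProg

/-! ### From the enumeration of trees to a polynomial identity test -/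

namespace TreeProg

/-! ### The weights of the algorithm -/

section Weights
variable {V : Type} [Fintype V] [DecidableEq V] {E : Type} [CommRing E]

/-- A vertex weighs `b` when inner and `a + b` when a leaf. With `2 = 0` a leaf always weighs `t * y
v`; an inner vertex weighs `z` in `I` and `y v` outside. So only inner vertices in `I` go without a
label. For `v ∈ I` the sum `a + b = t * y v` has square zero, as required of a free vertex. -/
def wA (I : Finset V) (t z : E) (y : V → E) (v : V) : E :=
  if v ∈ I then z + t * y v else y v * (t + 1)

def wB (I : Finset V) (z : E) (y : V → E) (v : V) : E := if v ∈ I then z else y v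

-- The product of the entries in both directions is symmetric, so no orientation of the edges has to
-- be chosen.
open Classical in
noncomputable def edgeX (G : SimpleGraph V) (R : V → V → E) : Sym2 V → E :=
  Sym2.lift ⟨fun u v => if G.Adj u v then R u v * R v u else 0, fun u v => by
    simp only [G.adj_comm u v, mul_comm (R u v)]⟩

/-- The quantity computed by message passing. -/
noncomputable def algF (G : SimpleGraph V) (I : Finset V) (R : V → V → E) (θ : V → E) (t z : E)
    (y : V → E) (N : ℕ) : E :=
  ∑ r ∈ Iᶜ, θ r * rootValue (wA I t z y) (wB I z y) (edgeX G R)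
    ((msgStep (wA I t z y) (wB I z y) (edgeX G R))^[N] 0) r

/-- The generating function of trees in `G`. -/
noncomputable def treeF (G : SimpleGraph V) (I : Finset V) (R : V → V → E) (θ : V → E) (t z : E)
    (y : V → E) : E :=
  ∑ r ∈ Iᶜ, θ r * treeSum (wA I t z y) (wB I z y) (edgeX G R) r

theorem wA_map {E₂ : Type} [CommRing E₂] (f : E →+* E₂) (I : Finset V) (t z : E) (y : V → E) :
    wA I (f t) (f z) (fun v => f (y v)) = fun v => f (wA I t z y v) := by
  funext v; simp only [wA]; split_ifs <;> simp

theorem wB_map {E₂ : Type} [CommRing E₂] (f : E →+* E₂) (I : Finset V) (z : E) (y : V → E) :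
    wB I (f z) (fun v => f (y v)) = fun v => f (wB I z y v) := by
  funext v; simp only [wB]; split_ifs <;> simp

theorem edgeX_map {E₂ : Type} [CommRing E₂] (f : E →+* E₂) (G : SimpleGraph V) (R : V → V → E) :
    edgeX G (fun u v => f (R u v)) = fun e => f (edgeX G R e) := by
  funext e
  induction e with | _ u v => simp only [edgeX, Sym2.lift_mk]; split_ifs <;> simp

theorem msgStep_map {E₂ : Type} [CommRing E₂] (f : E →+* E₂) (a b : V → E) (x : Sym2 V → E)
    (M : V → V → E) : msgStep (fun v => f (a v)) (fun v => f (b v)) (fun e => f (x e))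
      (fun u v => f (M u v)) = fun u v => f (msgStep a b x M u v) := by
  funext w p; simp [msgStep]

theorem msgStep_iterate_map {E₂ : Type} [CommRing E₂] (f : E →+* E₂) (a b : V → E) (x : Sym2 V → E)
    (N : ℕ) : (msgStep (fun v => f (a v)) (fun v => f (b v)) (fun e => f (x e)))^[N] 0 =
      fun u v => f ((msgStep a b x)^[N] 0 u v) := by
  induction N with
  | zero => funext u v; simp
  | succ N ih => rw [Function.iterate_succ_apply', ih, msgStep_map, Function.iterate_succ_apply']

theorem rootValue_map {E₂ : Type} [CommRing E₂] (f : E →+* E₂) (a b : V → E) (x : Sym2 V → E)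
    (M : V → V → E) (r : V) : rootValue (fun v => f (a v)) (fun v => f (b v)) (fun e => f (x e))
      (fun u v => f (M u v)) r = f (rootValue a b x M r) := by
  simp [rootValue]

theorem algF_map {E₂ : Type} [CommRing E₂] (f : E →+* E₂) (G : SimpleGraph V) (I : Finset V)
    (R : V → V → E) (θ : V → E) (t z : E) (y : V → E) (N : ℕ) :
    algF G I (fun u v => f (R u v)) (fun v => f (θ v)) (f t) (f z) (fun v => f (y v)) N =
      f (algF G I R θ t z y N) := by
  simp only [algF, wA_map, wB_map, edgeX_map, msgStep_iterate_map, rootValue_map, map_sum, map_mul]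

theorem treeF_map {E₂ : Type} [CommRing E₂] (f : E →+* E₂) (G : SimpleGraph V) (I : Finset V)
    (R : V → V → E) (θ : V → E) (t z : E) (y : V → E) :
    treeF G I (fun u v => f (R u v)) (fun v => f (θ v)) (f t) (f z) (fun v => f (y v)) =
      f (treeF G I R θ t z y) := by
  simp only [treeF, treeSum, wA_map, wB_map, edgeX_map, treeWt_map, map_sum, map_mul]

/-- The free vertices are those in `I`; independence of `I` gives the condition on their edges. Only
roots outside `I` are summed over, as the fundamental identity demands. -/
theorem algF_eq_treeF (h2 : (2 : E) = 0) {G : SimpleGraph V} {I : Finset V}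
    (hI : G.IsIndepSet (I : Set V)) (R : V → V → E) (θ : V → E) (t z : E) {y : V → E}
    (hy : ∀ v, y v * y v = 0) {J : Ideal E} (hJ : ∀ v, y v ∈ J) {m : ℕ} (hm : J ^ m = ⊥) :
    algF G I R θ t z y (2 * m) = treeF G I R θ t z y := by
  have hsys : MsgSystem (wA I t z y) (wB I z y) (edgeX G R) Iᶜ := by
    refine ⟨h2, ?_, ?_, ?_, ?_, ?_, ?_⟩
    · intro v hv
      rw [Finset.mem_compl] at hv
      simp only [wA, if_neg hv]
      linear_combination (t + 1) ^ 2 * hy v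
    · intro v hv
      rw [Finset.mem_compl] at hv
      simp only [wA, wB, if_neg hv]
      linear_combination (t + 1) * hy v
    · intro v hv
      rw [Finset.mem_compl] at hv
      simp only [wB, if_neg hv]
      exact hy v
    · intro v hv
      rw [Finset.mem_compl, not_not] at hv
      simp only [wA, wB, if_pos hv]
      linear_combination (2 * z ^ 2 + 2 * z * t * y v) * h2 + t ^ 2 * hy v
    · intro v hv w hw
      rw [Finset.mem_compl, not_not] at hv hw
      simp only [edgeX, Sym2.lift_mk]
      rw [if_neg]
      intro h
      exact hI hv hw h.ne h
    · intro v
      simp [edgeX]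
  have hfix := msgStep_iterate_fixed hsys (I := J) (m := m) (fun v hv => by
    rw [Finset.mem_compl] at hv
    simp only [wB, if_neg hv]
    exact hJ v) hm
  exact Finset.sum_congr rfl fun r hr => by rw [hsys.rootValue_eq hfix hr]

/-- The leaves of a tree. -/
def leafs (T : Finset V × Finset (Sym2 V)) : Finset V := T.1.filter fun v => deg T.2 v = 1

/-- The other vertices of a tree that are in `I`. -/
def inner (I : Finset V) (T : Finset V × Finset (Sym2 V)) : Finset V :=
  T.1.filter fun v => v ∈ I ∧ deg T.2 v ≠ 1

/-- The vertices of a tree that receive a label. -/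
def labelled (I : Finset V) (T : Finset V × Finset (Sym2 V)) : Finset V :=
  T.1.filter fun v => ¬ (v ∈ I ∧ deg T.2 v ≠ 1)

theorem card_inner_add_card_labelled (I : Finset V) (T : Finset V × Finset (Sym2 V)) :
    (inner I T).card + (labelled I T).card = T.1.card :=
  Finset.card_filter_add_card_filter_not _

theorem treeWt_eq (h2 : (2 : E) = 0) (I : Finset V) (t z : E) (y : V → E) (x : Sym2 V → E)
    (T : Finset V × Finset (Sym2 V)) :
    treeWt (wA I t z y) (wB I z y) x T =
      (∏ e ∈ T.2, x e) * t ^ (leafs T).card * z ^ (inner I T).card * ∏ v ∈ labelled I T, y v := by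
  have h : ∀ v, vtx (wA I t z y) (wB I z y) v (deg T.2 v) = (if deg T.2 v = 1 then t else 1) *
      ((if v ∈ I ∧ deg T.2 v ≠ 1 then z else 1) *
        if ¬ (v ∈ I ∧ deg T.2 v ≠ 1) then y v else 1) := by
    intro v
    simp only [vtx, wA, wB]
    by_cases hv : v ∈ I <;> by_cases hd : deg T.2 v = 1 <;> simp [hv, hd]
    · linear_combination z * h2
    · linear_combination y v * h2
  simp only [treeWt, h, Finset.prod_mul_distrib, Finset.prod_ite, Finset.prod_const_one,
    Finset.prod_const, mul_one, leafs, inner, labelled]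
  ring

end Weights

/-! ### The sieve -/

section Sieve
variable {P : Type} [CommRing P] {L : ℕ}

/-- The exponent of the square-free monomial that contains all variables. -/
noncomputable def fullExp (L : ℕ) : Fin L →₀ ℕ := Finsupp.equivFunOnFinite.symm fun _ => 1

theorem fullExp_apply (i : Fin L) : fullExp L i = 1 := rfl

/-- For a monomial with exponents `m` the sum is its coefficient times `∏ (s ^ m i + 0 ^ m i)`. A
missing variable gives the factor `1 + 1 = 0`. If all variables occur, the result is a power of `s`
with exponent the degree, which is at least `L`, with equality only for the square-free monomial. -/
theorem sum_eval_eq (h2 : (2 : P) = 0) (s : P) (f : MvPolynomial (Fin L) P) :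
    ∃ g, ∑ X : Finset (Fin L), MvPolynomial.eval (fun i => if i ∈ X then s else 0) f =
      s ^ L * f.coeff (fullExp L) + s ^ (L + 1) * g := by
  induction f using MvPolynomial.induction_on' with
  | add f f' ih ih' =>
    obtain ⟨g, hg⟩ := ih
    obtain ⟨g', hg'⟩ := ih'
    refine ⟨g + g', ?_⟩
    simp only [map_add, Finset.sum_add_distrib, hg, hg', MvPolynomial.coeff_add]
    ring
  | monomial m c =>
    have e : ∑ X : Finset (Fin L), MvPolynomial.eval (fun i => if i ∈ X then s else 0)
        (MvPolynomial.monomial m c) = c * ∏ i, (s ^ m i + 0 ^ m i) := by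
      rw [Finset.prod_add, Finset.mul_sum, Finset.powerset_univ]
      refine Finset.sum_congr rfl fun X _ => ?_
      rw [MvPolynomial.eval_monomial, Finsupp.prod_fintype _ _ (fun _ => pow_zero _)]
      congr 1
      rw [← Finset.prod_mul_prod_compl X, Finset.compl_eq_univ_sdiff]
      congr 1
      · exact Finset.prod_congr rfl fun i hi => by rw [if_pos hi]
      · exact Finset.prod_congr rfl fun i hi => by rw [if_neg (Finset.mem_sdiff.1 hi).2]
    rw [e]
    by_cases h0 : ∃ i, m i = 0
    · obtain ⟨i, hi⟩ := h0
      refine ⟨0, ?_⟩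
      rw [Finset.prod_eq_zero (Finset.mem_univ i) (by
        rw [hi, pow_zero, pow_zero, one_add_one_eq_two, h2]), MvPolynomial.coeff_monomial, if_neg]
      · ring
      · intro h
        rw [h, fullExp_apply] at hi
        omega
    · push Not at h0
      have e2 : ∏ i, (s ^ m i + 0 ^ m i) = s ^ ∑ i, m i := by
        rw [← Finset.prod_pow_eq_pow_sum]
        exact Finset.prod_congr rfl fun i _ => by rw [zero_pow (h0 i), add_zero]
      rw [e2, MvPolynomial.coeff_monomial]
      by_cases hm : m = fullExp L
      · refine ⟨0, ?_⟩
        rw [if_pos hm, hm]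
        simp [fullExp_apply]
        ring
      · rw [if_neg hm]
        have hlt : L + 1 ≤ ∑ i, m i := by
          obtain ⟨i, hi⟩ : ∃ i, m i ≠ 1 := by
            by_contra h
            push Not at h
            exact hm (Finsupp.ext h)
          calc L + 1 = ∑ j : Fin L, 1 + 1 := by simp
            _ ≤ ∑ j, m j := by
              rw [Nat.succ_le_iff]
              refine Finset.sum_lt_sum (fun j _ => Nat.one_le_iff_ne_zero.2 (h0 j))
                ⟨i, Finset.mem_univ i, ?_⟩
              have := h0 i
              omega
        refine ⟨c * s ^ (∑ i, m i - (L + 1)), ?_⟩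
        rw [mul_zero, zero_add, mul_left_comm, ← pow_add, Nat.add_sub_cancel' hlt]

/-- The ideal generated by the squares of the variables. -/
noncomputable def sqIdeal (L : ℕ) (P : Type) [CommRing P] : Ideal (MvPolynomial (Fin L) P) :=
  Ideal.span (Set.range fun i => MvPolynomial.X i * MvPolynomial.X i)

/-- A monomial divisible by a square is not square-free, so one may compute modulo squares of the
label variables. -/
theorem coeff_fullExp_of_mem {f : MvPolynomial (Fin L) P} (hf : f ∈ sqIdeal L P) :
    f.coeff (fullExp L) = 0 := by
  rw [sqIdeal, Ideal.mem_span_range_iff_exists_fun] at hf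
  obtain ⟨c, rfl⟩ := hf
  rw [MvPolynomial.coeff_sum]
  refine Finset.sum_eq_zero fun i _ => ?_
  rw [← mul_assoc, MvPolynomial.coeff_mul_X']
  split_ifs
  · rw [MvPolynomial.coeff_mul_X', if_neg]
    simp [fullExp_apply]
  · rfl

/-- Each generator of square zero adds two to the exponent. This is not sharp, but it gives an
explicit number of rounds linear in the number of labels. -/
theorem span_pow_eq_bot {E ι : Type} [CommRing E] (S : Finset ι) (e : ι → E)
    (he : ∀ i ∈ S, e i * e i = 0) : Ideal.span (e '' S) ^ (2 * S.card + 1) = ⊥ := by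
  classical
  induction S using Finset.induction_on with
  | empty => simp
  | insert i S hi ih =>
    rw [Finset.card_insert_of_notMem hi, Finset.coe_insert, Set.image_insert_eq, Ideal.span_insert,
      show 2 * (S.card + 1) + 1 = 2 + (2 * S.card + 1) by ring, eq_bot_iff]
    refine Ideal.sup_pow_add_le_pow_sup_pow.trans ?_
    rw [ih fun j hj => he j (Finset.mem_insert_of_mem hj), Ideal.span_singleton_pow, sq,
      he i (Finset.mem_insert_self i S)]
    simp

variable {V : Type} [Fintype V] [DecidableEq V]

/-- The sum, over all bijections between the set `W` of vertices and the set of labels, of the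
products of the entries of `Y`. -/
noncomputable def lab (Y : V → Fin L → P) (W : Finset V) : P :=
  (∏ v ∈ W, ∑ i, MvPolynomial.C (Y v i) * MvPolynomial.X i).coeff (fullExp L)

theorem lab_map {P₂ : Type} [CommRing P₂] (f : P →+* P₂) (Y : V → Fin L → P) (W : Finset V) :
    lab (fun v i => f (Y v i)) W = f (lab Y W) := by
  rw [lab, lab, ← MvPolynomial.coeff_map]
  simp [map_prod]

open Classical in
theorem lab_eq (Y : V → Fin L → P) (W : Finset V) :
    lab Y W = ∑ σ ∈ W.pi fun _ => (Finset.univ : Finset (Fin L)), (∏ v ∈ W.attach, Y v.1 (σ v.1 v.2)) *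
      if ∑ v ∈ W.attach, Finsupp.single (σ v.1 v.2) 1 = fullExp L then 1 else 0 := by
  rw [lab, Finset.prod_sum, MvPolynomial.coeff_sum]
  refine Finset.sum_congr rfl fun σ _ => ?_
  have : ∏ v ∈ W.attach, MvPolynomial.C (Y v.1 (σ v.1 v.2)) * MvPolynomial.X (σ v.1 v.2) =
      MvPolynomial.monomial (∑ v ∈ W.attach, Finsupp.single (σ v.1 v.2) 1)
        (∏ v ∈ W.attach, Y v.1 (σ v.1 v.2)) := by
    rw [MvPolynomial.monomial_sum_prod]
    exact Finset.prod_congr rfl fun v _ => by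
      rw [MvPolynomial.C_mul_X_eq_monomial]
  rw [this, MvPolynomial.coeff_monomial]
  split_ifs <;> simp

theorem lab_eq_zero (Y : V → Fin L → P) {W : Finset V} (hW : W.card ≠ L) : lab Y W = 0 := by
  classical
  rw [lab_eq]
  refine Finset.sum_eq_zero fun σ _ => ?_
  rw [if_neg, mul_zero]
  intro h
  have := congrArg (fun m : Fin L →₀ ℕ => ∑ i, m i) h
  simp only [Finsupp.finsetSum_apply, fullExp_apply] at this
  rw [Finset.sum_comm] at this
  simp at this
  exact hW this

theorem lab_eq_one {W : Finset V} (σ : W ≃ Fin L) :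
    lab (fun v i => if h : v ∈ W then (if σ ⟨v, h⟩ = i then (1 : P) else 0) else 0) W = 1 := by
  rw [lab, ← Finset.prod_attach]
  have : ∀ v ∈ W.attach, (∑ i, MvPolynomial.C (if h : v.1 ∈ W then
      (if σ ⟨v.1, h⟩ = i then (1 : P) else 0) else 0) * MvPolynomial.X i) =
        (MvPolynomial.X (σ v) : MvPolynomial (Fin L) P) := by
    intro v _
    rw [Finset.sum_eq_single (σ v)]
    · simp
    · intro i _ hi
      simp [hi.symm]
    · simp
  rw [Finset.prod_congr rfl this, ← Finset.univ_eq_attach, Equiv.prod_comp σ MvPolynomial.X]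
  have h2 : ∏ i : Fin L, (MvPolynomial.X i : MvPolynomial (Fin L) P) =
      MvPolynomial.monomial (fullExp L) 1 := by
    rw [MvPolynomial.monomial_eq, Finsupp.prod_fintype _ _ fun _ => pow_zero _]
    simp [fullExp_apply]
  rw [h2, MvPolynomial.coeff_monomial, if_pos rfl]

/-- The contribution of a tree. -/
noncomputable def treePoly (G : SimpleGraph V) (I : Finset V) (R : V → V → P) (θ : V → P)
    (Y : V → Fin L → P) (T : Finset V × Finset (Sym2 V)) : P :=
  (∑ r ∈ T.1.filter (· ∉ I), θ r) * (∏ e ∈ T.2, edgeX G R e) * lab Y (labelled I T)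

theorem treePoly_map {P₂ : Type} [CommRing P₂] (f : P →+* P₂) (G : SimpleGraph V) (I : Finset V)
    (R : V → V → P) (θ : V → P) (Y : V → Fin L → P) (T : Finset V × Finset (Sym2 V)) :
    treePoly G I (fun u v => f (R u v)) (fun v => f (θ v)) (fun v i => f (Y v i)) T =
      f (treePoly G I R θ Y T) := by
  simp only [treePoly, edgeX_map, lab_map, map_mul, map_sum, map_prod]

/-- Summation over all sets of labels extracts the trees with all labels. -/
theorem sum_algF_eq (h2 : (2 : P) = 0) {G : SimpleGraph V} {I : Finset V}
    (hI : G.IsIndepSet (I : Set V)) (R : V → V → P) (θ : V → P) (t z s : P) (Y : V → Fin L → P)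
    {m : ℕ} (hm : 2 * L + 1 ≤ m) :
    ∃ g, ∑ X : Finset (Fin L), algF G I R θ t z (fun v => s * ∑ i ∈ X, Y v i) (2 * m) =
      s ^ L * ∑ T ∈ trees V, treePoly G I R θ Y T * t ^ (leafs T).card * z ^ (inner I T).card +
        s ^ (L + 1) * g := by
  classical
  set C : P →+* MvPolynomial (Fin L) P := MvPolynomial.C with hC
  set y : V → MvPolynomial (Fin L) P := fun v => ∑ i, C (Y v i) * MvPolynomial.X i with hy
  set f := algF G I (fun u v => C (R u v)) (fun v => C (θ v)) (C t) (C z) y (2 * m) with hf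
  set F := treeF G I (fun u v => C (R u v)) (fun v => C (θ v)) (C t) (C z) y with hF
  have h2' : (2 : MvPolynomial (Fin L) P) = 0 := by
    have := congrArg C h2
    rwa [map_ofNat, map_zero] at this
  -- The actual evaluations of `y v` need not have square zero, so message passing need not
  -- enumerate trees there. It does so for generic labels modulo their squares, and this determines
  -- the only coefficient that matters.
  have hmem : f - F ∈ sqIdeal L P := by
    rw [← Ideal.Quotient.eq, hf, hF, ← algF_map, ← treeF_map]
    set π := Ideal.Quotient.mk (sqIdeal L P)
    have hx : ∀ i, π (MvPolynomial.X i) * π (MvPolynomial.X i) = 0 := by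
      intro i
      rw [← map_mul]
      exact Ideal.Quotient.eq_zero_iff_mem.2 (Ideal.subset_span ⟨i, rfl⟩)
    have h2'' : (2 : MvPolynomial (Fin L) P ⧸ sqIdeal L P) = 0 := by
      have := congrArg π h2'
      rwa [map_ofNat, map_zero] at this
    refine algF_eq_treeF h2'' hI _ _ _ _ (J := Ideal.span ((fun i => π (MvPolynomial.X i)) ''
      (Finset.univ : Finset (Fin L)))) ?_ ?_ ?_
    · intro v
      simp only [hy, map_sum, map_mul]
      -- The quotient may be the zero ring, where characteristic two fails in the strict sense.
      have : CharP (MvPolynomial (Fin L) P ⧸ sqIdeal L P) 2 ∨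
          Subsingleton (MvPolynomial (Fin L) P ⧸ sqIdeal L P) := by
        rcases subsingleton_or_nontrivial (MvPolynomial (Fin L) P ⧸ sqIdeal L P) with h | h
        · exact Or.inr h
        · exact Or.inl (CharTwo.of_one_ne_zero_of_two_eq_zero one_ne_zero h2'')
      rcases this with h | h
      · rw [CharTwo.sum_mul_self]
        refine Finset.sum_eq_zero fun i _ => ?_
        linear_combination (π (C (Y v i)) * π (C (Y v i))) * hx i
      · exact Subsingleton.elim _ _
    · intro v
      simp only [hy, map_sum, map_mul]
      refine sum_mem fun i _ => Ideal.mul_mem_left _ _ (Ideal.subset_span ⟨i, by simp, rfl⟩)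
    · rw [eq_bot_iff, ← span_pow_eq_bot (Finset.univ : Finset (Fin L))
        (fun i => π (MvPolynomial.X i)) (fun i _ => hx i), Finset.card_univ, Fintype.card_fin]
      exact Ideal.pow_le_pow_right hm
  have hcoeff : f.coeff (fullExp L) = F.coeff (fullExp L) := by
    rw [← sub_eq_zero, ← MvPolynomial.coeff_sub, coeff_fullExp_of_mem hmem]
  have hFc : F.coeff (fullExp L) =
      ∑ T ∈ trees V, treePoly G I R θ Y T * t ^ (leafs T).card * z ^ (inner I T).card := by
    have e : F = ∑ T ∈ trees V, C ((∑ r ∈ T.1.filter (· ∉ I), θ r) * (∏ e ∈ T.2, edgeX G R e) *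
        t ^ (leafs T).card * z ^ (inner I T).card) * ∏ v ∈ labelled I T, y v := by
      rw [hF, treeF]
      simp only [treeSum, Finset.mul_sum]
      conv_lhs => simp only [Finset.sum_filter]
      rw [Finset.sum_comm]
      refine Finset.sum_congr rfl fun T _ => ?_
      rw [← Finset.sum_filter, ← Finset.sum_mul, treeWt_eq h2', edgeX_map]
      have : Iᶜ.filter (fun r => r ∈ T.1) = T.1.filter (· ∉ I) := by
        ext r; simp [and_comm]
      rw [this]
      simp only [map_mul, map_sum, map_prod, map_pow]
      ring
    rw [e, MvPolynomial.coeff_sum]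
    refine Finset.sum_congr rfl fun T _ => ?_
    rw [hC, MvPolynomial.coeff_C_mul, treePoly, lab]
    ring
  -- The sum of the evaluations is a function of `f`, the output of the message passing; only
  -- afterwards is its extremal coefficient replaced by that of `F`.
  obtain ⟨g, hg⟩ := sum_eval_eq h2 s f
  refine ⟨g, ?_⟩
  rw [← hFc, ← hcoeff, ← hg]
  refine Finset.sum_congr rfl fun X _ => ?_
  rw [hf, ← algF_map]
  simp only [hC, MvPolynomial.eval_C]
  congr 1
  funext v
  simp only [hy, hC, map_sum, map_mul, MvPolynomial.eval_C, MvPolynomial.eval_X, mul_ite, mul_zero]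
  rw [← Finset.sum_filter, Finset.mul_sum, Finset.filter_mem_eq_inter, Finset.univ_inter]
  exact Finset.sum_congr rfl fun i _ => mul_comm _ _

/-- A bound for `treePoly` in a filtered ring. -/
theorem treePoly_mem (A : ℕ → Set P) (h0 : ∀ i, 0 ∈ A i) (h1 : 1 ∈ A 0)
    (hadd : ∀ i, ∀ c ∈ A i, ∀ d ∈ A i, c + d ∈ A i)
    (hmul : ∀ i j, ∀ c ∈ A i, ∀ d ∈ A j, c * d ∈ A (i + j)) {d : ℕ}
    (G : SimpleGraph V) (I : Finset V) {R : V → V → P} {θ : V → P} {Y : V → Fin L → P}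
    (hR : ∀ u v, R u v ∈ A d) (hθ : ∀ v, θ v ∈ A d) (hY : ∀ v i, Y v i ∈ A d)
    (T : Finset V × Finset (Sym2 V)) :
    treePoly G I R θ Y T ∈ A (d * (1 + 2 * T.2.card + L)) := by
  classical
  have hsum : ∀ {ι : Type} (S : Finset ι) (f : ι → P) (i : ℕ), (∀ j ∈ S, f j ∈ A i) →
      ∑ j ∈ S, f j ∈ A i := by
    intro ι S f i h
    induction S using Finset.induction_on with
    | empty => exact h0 i
    | insert j S hj ih =>
      rw [Finset.sum_insert hj]
      exact hadd i _ (h j (by simp)) _ (ih fun k hk => h k (by simp [hk]))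
  have hprod : ∀ {ι : Type} (S : Finset ι) (f : ι → P) (i : ℕ), (∀ j ∈ S, f j ∈ A i) →
      ∏ j ∈ S, f j ∈ A (i * S.card) := by
    intro ι S f i h
    induction S using Finset.induction_on with
    | empty => exact h1
    | insert j S hj ih =>
      rw [Finset.prod_insert hj, Finset.card_insert_of_notMem hj,
        show i * (S.card + 1) = i + i * S.card by ring]
      exact hmul _ _ _ (h j (by simp)) _ (ih fun k hk => h k (by simp [hk]))
  -- One entry of `θ`, two of `R` for each edge, and `L` of `Y`.
  rw [show d * (1 + 2 * T.2.card + L) = d + (d + d) * T.2.card + d * L by ring]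
  refine hmul _ _ _ (hmul _ _ _ (hsum _ _ _ fun r _ => hθ r) _ (hprod _ _ _ fun e _ => ?_)) _ ?_
  · induction e with | _ u v =>
    simp only [edgeX, Sym2.lift_mk]
    split_ifs
    · exact hmul _ _ _ (hR u v) _ (hR v u)
    · exact h0 _
  · by_cases hL : (labelled I T).card = L
    · rw [lab_eq]
      refine hsum _ _ _ fun σ _ => ?_
      split_ifs
      · rw [mul_one]
        have := hprod (labelled I T).attach (fun v => Y v.1 (σ v.1 v.2)) d fun v _ => hY _ _
        rwa [Finset.card_attach, hL] at this
      · rw [mul_zero]; exact h0 _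
    · rw [lab_eq_zero _ hL]; exact h0 _

end Sieve
end TreeProg

namespace TreeProg

/-! ### The trees of a graph -/

section Bridge
variable {n : ℕ}

theorem hasTree_iff {G : SimpleGraph (Fin n)} {k l : ℕ} : HasTree G k l ↔
    ∃ T : Finset (Fin n) × Finset (Sym2 (Fin n)), IsTr T ∧ (∀ e ∈ T.2, e ∈ G.edgeSet) ∧
      T.1.card = k ∧ (leafs T).card = l := by
  classical
  constructor
  · rintro ⟨H, hH, rfl, rfl⟩
    have hU : ∀ v, v ∈ H.verts.toFinset ↔ v ∈ H.verts := fun v => Set.mem_toFinset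
    have hFm : ∀ e, e ∈ Finset.univ.filter (· ∈ H.edgeSet) ↔ e ∈ H.edgeSet := by simp
    have hdeg : ∀ v, deg (Finset.univ.filter (· ∈ H.edgeSet)) v = (H.neighborSet v).ncard := by
      intro v
      rw [deg, ← Set.ncard_coe_finset]
      have : (((Finset.univ.filter (· ∈ H.edgeSet)).filter (v ∈ ·) : Finset (Sym2 (Fin n))) :
          Set (Sym2 (Fin n))) = (fun w => s(v, w)) '' H.neighborSet v := by
        ext e
        simp only [Finset.coe_filter, Finset.mem_filter, Finset.mem_univ, true_and,
          Set.mem_ofPred_eq, Set.mem_image]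
        constructor
        · rintro ⟨h, w, rfl⟩
          exact ⟨w, h, rfl⟩
        · rintro ⟨w, h, rfl⟩
          exact ⟨h, by simp⟩
      rw [this]
      exact Set.ncard_image_of_injective _ fun a b h => Sym2.congr_right.1 h
    refine ⟨(H.verts.toFinset, Finset.univ.filter (· ∈ H.edgeSet)), ⟨?_, ?_, ?_, ?_⟩, ?_, ?_, ?_⟩
    · intro e he
      have := H.edgeSet_subset ((hFm e).1 he)
      exact G.not_isDiag_of_mem_edgeSet this
    · intro e he v hv
      exact (hU v).2 (H.mem_verts_of_mem_edge ((hFm e).1 he) hv)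
    · intro u hu v hv
      obtain ⟨p⟩ := hH.1.preconnected ⟨u, (hU u).1 hu⟩ ⟨v, (hU v).1 hv⟩
      have : ∀ {u v : H.verts}, H.coe.Walk u v →
          Reach (Finset.univ.filter (· ∈ H.edgeSet)) u.1 v.1 := by
        intro u v p
        induction p with
        | nil => exact .refl
        | cons h _ ih => exact Relation.ReflTransGen.head ((hFm _).2 h) ih
      exact this p
    · have h1 := (SimpleGraph.isTree_iff_connected_and_card.1 hH).2
      have h2 : Nat.card H.coe.edgeSet = (Finset.univ.filter (· ∈ H.edgeSet)).card := by
        rw [← Nat.card_eq_finsetCard]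
        refine Nat.card_eq_of_bijective (fun e : H.coe.edgeSet => (⟨e.1.map Subtype.val,
          (hFm _).2 ?_⟩ : {x // x ∈ Finset.univ.filter (· ∈ H.edgeSet)})) ⟨?_, ?_⟩
        · obtain ⟨e, he⟩ := e
          induction e with | _ u v => exact he
        · intro e e' h
          exact Subtype.ext (Sym2.map.injective Subtype.val_injective (congrArg Subtype.val h))
        · rintro ⟨e, he⟩
          have he' := (hFm e).1 he
          induction e with | _ u v =>
          exact ⟨⟨s(⟨u, H.edge_vert he'⟩, ⟨v, H.edge_vert (H.symm.symm _ _ he')⟩), he'⟩, rfl⟩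
      have h3 : Nat.card H.verts = H.verts.toFinset.card := by
        rw [Nat.card_coe_set_eq, Set.ncard_eq_toFinset_card']
      rw [h2, h3] at h1
      exact h1
    · intro e he
      exact H.edgeSet_subset ((hFm e).1 he)
    · simp [Set.ncard_eq_toFinset_card']
    · rw [← Set.ncard_coe_finset]
      congr 1
      ext v
      simp [leafs, hdeg]
  · rintro ⟨T, hT, hG, rfl, rfl⟩
    let H : G.Subgraph :=
      { verts := T.1
        Adj := fun u v => s(u, v) ∈ T.2
        adj_sub := fun h => hG _ h
        edge_vert := fun h => hT.mem _ h _ (by simp)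
        symm := ⟨fun u v h => by rw [Sym2.eq_swap]; exact h⟩ }
    have hdeg : ∀ v, deg T.2 v = (H.neighborSet v).ncard := by
      intro v
      rw [deg, ← Set.ncard_coe_finset]
      have : ((T.2.filter (v ∈ ·) : Finset (Sym2 (Fin n))) : Set (Sym2 (Fin n))) =
          (fun w => s(v, w)) '' H.neighborSet v := by
        ext e
        simp only [Finset.coe_filter, Set.mem_ofPred_eq, Set.mem_image]
        constructor
        · rintro ⟨h, w, rfl⟩
          exact ⟨w, h, rfl⟩
        · rintro ⟨w, h, rfl⟩
          exact ⟨h, by simp⟩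
      rw [this]
      exact Set.ncard_image_of_injective _ fun a b h => Sym2.congr_right.1 h
    refine ⟨H, ?_, ?_, ?_⟩
    · rw [SimpleGraph.isTree_iff_connected_and_card]
      have hr : ∀ u : H.verts, ∀ v, Reach T.2 u.1 v → ∃ hv : v ∈ H.verts,
          H.coe.Reachable u ⟨v, hv⟩ := by
        intro u v h
        induction h with
        | refl => exact ⟨u.2, SimpleGraph.Reachable.refl _⟩
        | @tail v w _ h ih =>
          obtain ⟨hv, ih⟩ := ih
          exact ⟨hT.mem _ h w (by simp), ih.trans (SimpleGraph.Adj.reachable h)⟩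
      have hne : Nonempty H.verts := by
        have : 0 < T.1.card := by have := hT.card; omega
        obtain ⟨v, hv⟩ := Finset.card_pos.1 this
        exact ⟨⟨v, hv⟩⟩
      refine ⟨⟨fun u v => (hr u v.1 (hT.reach _ u.2 _ v.2)).2⟩, ?_⟩
      have h2 : Nat.card H.coe.edgeSet = T.2.card := by
        rw [← Nat.card_eq_finsetCard]
        refine Nat.card_eq_of_bijective (fun e : H.coe.edgeSet => (⟨e.1.map Subtype.val,
          ?_⟩ : {x // x ∈ T.2})) ⟨?_, ?_⟩
        · obtain ⟨e, he⟩ := e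
          induction e with | _ u v => exact he
        · intro e e' h
          exact Subtype.ext (Sym2.map.injective Subtype.val_injective (congrArg Subtype.val h))
        · rintro ⟨e, he⟩
          induction e with | _ u v =>
          exact ⟨⟨s(⟨u, hT.mem _ he u (by simp)⟩, ⟨v, hT.mem _ he v (by simp)⟩), he⟩, rfl⟩
      have h3 : Nat.card H.verts = T.1.card := by
        rw [Nat.card_coe_set_eq]; exact Set.ncard_coe_finset _
      rw [h2, h3]
      exact hT.card
    · exact Set.ncard_coe_finset _
    · rw [← Set.ncard_coe_finset (leafs T)]
      congr 1
      ext v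
      simp only [leafs, Finset.coe_filter, Set.mem_ofPred_eq, hdeg]
      rfl

end Bridge
end TreeProg

namespace TreeProg

/-! ### The polynomial of the trees with prescribed parameters -/

section Select
variable {V : Type} [Fintype V] [DecidableEq V] {P : Type} [CommRing P] {L : ℕ}

/-- The sum of `treePoly` over all trees with `l` leaves and `j` other vertices in `I`. -/
noncomputable def selPoly (G : SimpleGraph V) (I : Finset V) (l j : ℕ) (R : V → V → P) (θ : V → P)
    (Y : V → Fin L → P) : P :=
  ∑ T ∈ (trees V).filter (fun T => (leafs T).card = l ∧ (inner I T).card = j),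
    treePoly G I R θ Y T

theorem edgeX_eq_zero {G : SimpleGraph V} {R : V → V → P} {e : Sym2 V} (he : e ∉ G.edgeSet) :
    edgeX G R e = 0 := by
  induction e with | _ u v =>
  simp only [edgeX, Sym2.lift_mk]
  rw [if_neg]
  simpa using he

/-- There are no false positives: a contributing tree has `L` labelled and `j` unlabelled vertices,
hence `L + j` vertices, and all of its edges belong to `G`. -/
theorem selPoly_eq_zero {n : ℕ} {G : SimpleGraph (Fin n)} {I : Finset (Fin n)} {l j : ℕ}
    (h : ¬ HasTree G (L + j) l) (R : Fin n → Fin n → P) (θ : Fin n → P) (Y : Fin n → Fin L → P) :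
    selPoly G I l j R θ Y = 0 := by
  refine Finset.sum_eq_zero fun T hT => ?_
  rw [Finset.mem_filter, mem_trees] at hT
  obtain ⟨hT, hl, hj⟩ := hT
  rw [treePoly]
  by_cases hL : (labelled I T).card = L
  · have hc := card_inner_add_card_labelled I T
    obtain ⟨e, he, heG⟩ : ∃ e ∈ T.2, e ∉ G.edgeSet := by
      by_contra hG
      push Not at hG
      exact h (hasTree_iff.2 ⟨T, hT, hG, by omega, hl⟩)
    rw [Finset.prod_eq_zero he (edgeX_eq_zero heG)]
    ring
  · rw [lab_eq_zero _ hL, mul_zero]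

theorem selPoly_map {P₂ : Type} [CommRing P₂] (f : P →+* P₂) (G : SimpleGraph V) (I : Finset V)
    (l j : ℕ) (R : V → V → P) (θ : V → P) (Y : V → Fin L → P) :
    selPoly G I l j (fun u v => f (R u v)) (fun v => f (θ v)) (fun v i => f (Y v i)) =
      f (selPoly G I l j R θ Y) := by
  simp only [selPoly, treePoly_map, map_sum]

theorem selPoly_mem (A : ℕ → Set P) (h0 : ∀ i, 0 ∈ A i) (h1 : 1 ∈ A 0)
    (hadd : ∀ i, ∀ c ∈ A i, ∀ d ∈ A i, c + d ∈ A i)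
    (hmul : ∀ i j, ∀ c ∈ A i, ∀ d ∈ A j, c * d ∈ A (i + j)) (hmono : Monotone A) {d : ℕ}
    (G : SimpleGraph V) (I : Finset V) {R : V → V → P} {θ : V → P} {Y : V → Fin L → P}
    (hR : ∀ u v, R u v ∈ A d) (hθ : ∀ v, θ v ∈ A d) (hY : ∀ v i, Y v i ∈ A d) (l j : ℕ) :
    selPoly G I l j R θ Y ∈ A (d * (3 * (L + j))) := by
  classical
  have : ∀ S ⊆ (trees V).filter (fun T => (leafs T).card = l ∧ (inner I T).card = j),
      ∑ T ∈ S, treePoly G I R θ Y T ∈ A (d * (3 * (L + j))) := by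
    intro S hS
    induction S using Finset.induction_on with
    | empty => exact h0 _
    | insert T S hTS ih =>
      rw [Finset.sum_insert hTS]
      refine hadd _ _ ?_ _ (ih fun T' h => hS (Finset.mem_insert_of_mem h))
      have hT := hS (Finset.mem_insert_self T S)
      rw [Finset.mem_filter, mem_trees] at hT
      by_cases hL : (labelled I T).card = L
      · refine hmono ?_ (treePoly_mem A h0 h1 hadd hmul G I hR hθ hY T)
        refine Nat.mul_le_mul_left _ ?_
        have := card_inner_add_card_labelled I T
        have := hT.1.card
        omega
      · rw [treePoly, lab_eq_zero _ hL, mul_zero]; exact h0 _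
  exact this _ (Finset.Subset.refl _)

theorem IsTr.eq_of_subset {T T₀ : Finset V × Finset (Sym2 V)} (hT : IsTr T) (hT₀ : IsTr T₀)
    (hc : T.1.card = T₀.1.card) (h2 : 2 ≤ T.1.card) (hs : T.2 ⊆ T₀.2) : T = T₀ := by
  have h1 := hT.card
  have h1' := hT₀.card
  have he : T.2 = T₀.2 := Finset.eq_of_subset_of_card_le hs (by omega)
  refine Prod.ext (Finset.eq_of_subset_of_card_le (fun v hv => ?_) (by omega)) he
  obtain ⟨u, hu, huv⟩ := Finset.exists_mem_ne (by omega : 1 < T.1.card) v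
  rcases Relation.ReflTransGen.cases_head (hT.reach v hv u hu) with h | ⟨w, h, -⟩
  · exact absurd h.symm huv
  · exact hT₀.mem _ (hs h) v (by simp)

/-- Taking for `R` the indicator of the edges of `T₀` leaves only trees inside `T₀`, hence `T₀`
itself by counting. One root and one bijective labelling then give the value one. So `selPoly` is
not the zero polynomial in its entries. -/
theorem exists_selPoly_eq_one {G : SimpleGraph V} {I : Finset V} (hI : G.IsIndepSet (I : Set V))
    {T₀ : Finset V × Finset (Sym2 V)} (hT₀ : IsTr T₀) (hG : ∀ e ∈ T₀.2, e ∈ G.edgeSet)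
    (h2 : 2 ≤ T₀.1.card) (hL : (labelled I T₀).card = L) :
    ∃ (R : V → V → P) (θ : V → P) (Y : V → Fin L → P),
      selPoly G I (leafs T₀).card (inner I T₀).card R θ Y = 1 := by
  classical
  -- A root outside `I` exists because `T₀` has an edge and `I` is independent; this is why trees
  -- with a single vertex are treated separately.
  obtain ⟨r, hr, hrI⟩ : ∃ r ∈ T₀.1, r ∉ I := by
    have h1 := hT₀.card
    obtain ⟨e, he⟩ : T₀.2.Nonempty := Finset.card_pos.1 (by omega)
    induction e with | _ u v =>
    by_cases hu : u ∈ I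
    · refine ⟨v, hT₀.mem _ he v (by simp), fun hv => ?_⟩
      have hadj : G.Adj u v := hG _ he
      exact hI hu hv hadj.ne hadj
    · exact ⟨u, hT₀.mem _ he u (by simp), hu⟩
  let σ : labelled I T₀ ≃ Fin L := Finset.equivFinOfCardEq hL
  refine ⟨fun u v => if s(u, v) ∈ T₀.2 then 1 else 0, fun v => if v = r then 1 else 0,
    fun v i => if h : v ∈ labelled I T₀ then (if σ ⟨v, h⟩ = i then (1 : P) else 0) else 0, ?_⟩
  have hX : ∀ e, edgeX G (fun u v => if s(u, v) ∈ T₀.2 then (1 : P) else 0) e =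
      if e ∈ T₀.2 then 1 else 0 := by
    intro e
    by_cases he : e ∈ T₀.2
    · rw [if_pos he]
      have := hG e he
      induction e with | _ u v =>
      simp only [edgeX, Sym2.lift_mk]
      rw [if_pos (by exact this), if_pos he, if_pos (by rwa [Sym2.eq_swap]), mul_one]
    · rw [if_neg he]
      induction e with | _ u v =>
      simp only [edgeX, Sym2.lift_mk]
      rw [if_neg he, zero_mul, ite_self]
  rw [selPoly, Finset.sum_eq_single T₀]
  · rw [treePoly, lab_eq_one, Finset.prod_congr rfl fun e he => by rw [hX, if_pos he]]
    rw [Finset.sum_ite_eq', if_pos (by simp [hr, hrI])]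
    simp
  · intro T hT hne
    rw [Finset.mem_filter, mem_trees] at hT
    rw [treePoly]
    by_cases hLT : (labelled I T).card = L
    · have h3 := card_inner_add_card_labelled I T
      have h4 := card_inner_add_card_labelled I T₀
      obtain ⟨e, he, he'⟩ : ∃ e ∈ T.2, e ∉ T₀.2 := by
        by_contra hs
        push Not at hs
        exact hne (hT.1.eq_of_subset hT₀ (by omega) (by omega) hs)
      rw [Finset.prod_eq_zero he (by rw [hX, if_neg he'])]
      ring
    · rw [lab_eq_zero _ hLT, mul_zero]
  · intro h
    exact absurd (by simp [mem_trees, hT₀]) h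

open Polynomial in
/-- For a random choice of the polynomials the value of `selPoly` is not zero with probability at
least one half. -/
theorem card_selPoly_eq_zero_le {G : SimpleGraph V} {I : Finset V} (hI : G.IsIndepSet (I : Set V))
    {T₀ : Finset V × Finset (Sym2 V)} (hT₀ : IsTr T₀) (hG : ∀ e ∈ T₀.2, e ∈ G.edgeSet)
    (h2 : 2 ≤ T₀.1.card) (hL : (labelled I T₀).card = L) {q : ℕ} (iR : V → V → Fin q)
    (iθ : V → Fin q) (iY : V → Fin L → Fin q)
    (hi : ∀ (R : V → V → (ZMod 2)[X]) (θ : V → (ZMod 2)[X]) (Y : V → Fin L → (ZMod 2)[X]), ∃ f : Fin q → (ZMod 2)[X], (∀ u v, f (iR u v) = R u v) ∧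
      (∀ v, f (iθ v) = θ v) ∧ ∀ v i, f (iY v i) = Y v i)
    (S : Finset (ZMod 2)[X]) (hS : 6 * T₀.1.card ≤ S.card) :
    2 * ((Fintype.piFinset fun _ : Fin q => S).filter fun f =>
      selPoly G I (leafs T₀).card (inner I T₀).card (fun u v => f (iR u v)) (fun v => f (iθ v))
        (fun v i => f (iY v i)) = 0).card ≤ S.card ^ q := by
  classical
  set p : MvPolynomial (Fin q) (ZMod 2)[X] := selPoly G I (leafs T₀).card (inner I T₀).card
    (fun u v => MvPolynomial.X (iR u v)) (fun v => MvPolynomial.X (iθ v))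
    (fun v i => MvPolynomial.X (iY v i)) with hp
  have hev : ∀ f : Fin q → (ZMod 2)[X], selPoly G I (leafs T₀).card (inner I T₀).card
      (fun u v => f (iR u v)) (fun v => f (iθ v)) (fun v i => f (iY v i)) = MvPolynomial.eval f p := by
    intro f
    rw [hp, ← selPoly_map]
    simp
  have hp0 : p ≠ 0 := by
    intro h
    obtain ⟨R, θ, Y, h1⟩ := exists_selPoly_eq_one (P := (ZMod 2)[X]) hI hT₀ hG h2 hL
    obtain ⟨f, hf1, hf2, hf3⟩ := hi R θ Y
    have := hev f
    simp only [hf1, hf2, hf3, h1, h, map_zero] at this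
    exact one_ne_zero this
  -- With a sample set of at least `6 k` elements the Schwartz–Zippel bound `3 k / S.card` is at
  -- most one half.
  have hdeg : p.totalDegree ≤ 3 * T₀.1.card := by
    have := selPoly_mem (P := MvPolynomial (Fin q) (ZMod 2)[X]) (L := L)
      (fun i => {p | p.totalDegree ≤ i}) (by simp) (by simp)
      (fun i c hc d hd => (MvPolynomial.totalDegree_add _ _).trans (max_le hc hd))
      (fun i j c hc d hd => (MvPolynomial.totalDegree_mul _ _).trans (Nat.add_le_add hc hd))
      (fun i j hij p (hp : _ ≤ _) => hp.trans hij) (d := 1) G I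
      (R := fun u v => MvPolynomial.X (iR u v)) (θ := fun v => MvPolynomial.X (iθ v))
      (Y := fun v i => MvPolynomial.X (iY v i))
      (fun u v => (MvPolynomial.totalDegree_X _).le) (fun v => (MvPolynomial.totalDegree_X _).le)
      (fun v i => (MvPolynomial.totalDegree_X _).le) (leafs T₀).card (inner I T₀).card
    have h3 := card_inner_add_card_labelled I T₀
    refine (show p.totalDegree ≤ _ from this).trans ?_
    omega
  have hsz := MvPolynomial.schwartz_zippel_totalDegree hp0 S
  have hS0 : (0 : ℚ≥0) < S.card := by
    have : 0 < S.card := by omega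
    exact_mod_cast this
  rw [div_le_div_iff₀ (by positivity) hS0] at hsz
  have hsz' : ((Fintype.piFinset fun _ : Fin q => S).filter fun f => MvPolynomial.eval f p = 0).card *
      S.card ≤ p.totalDegree * S.card ^ q := by exact_mod_cast hsz
  simp only [hev]
  set Z := ((Fintype.piFinset fun _ : Fin q => S).filter fun f => MvPolynomial.eval f p = 0).card
  have h5 : Z * S.card ≤ 3 * T₀.1.card * S.card ^ q :=
    hsz'.trans (Nat.mul_le_mul_right _ hdeg)
  have h6 : S.card * (2 * Z) ≤ S.card * S.card ^ q := by
    calc S.card * (2 * Z) = 2 * (Z * S.card) := by ring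
      _ ≤ 2 * (3 * T₀.1.card * S.card ^ q) := Nat.mul_le_mul_left _ h5
      _ = 6 * T₀.1.card * S.card ^ q := by ring
      _ ≤ S.card * S.card ^ q := Nat.mul_le_mul_right _ hS
  exact Nat.le_of_mul_le_mul_left h6 (by omega)

open Polynomial in
/-- Reading off `selPoly` from a block of coefficients. -/
theorem coeff_sum_algF {G : SimpleGraph V} {I : Finset V} (hI : G.IsIndepSet (I : Set V))
    (R : V → V → (ZMod 2)[X]) (θ : V → (ZMod 2)[X]) (Y : V → Fin L → (ZMod 2)[X])
    {m c₁ c₂ c₃ w : ℕ} (hm : 2 * L + 1 ≤ m) (hR : ∀ u v, (R u v).natDegree ≤ w)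
    (hθ : ∀ v, (θ v).natDegree ≤ w) (hY : ∀ v i, (Y v i).natDegree ≤ w)
    (h₁ : w * (1 + 2 * Fintype.card V + L) < c₁) (h₂ : c₁ * (Fintype.card V + 1) ≤ c₂)
    (h₃ : c₂ * (Fintype.card V + 1) ≤ c₃) {l j i : ℕ} (hl : l ≤ Fintype.card V)
    (hj : j ≤ Fintype.card V) (hi : i < c₁) :
    (∑ Z : Finset (Fin L), algF G I R θ (X ^ c₁) (X ^ c₂) (fun v => X ^ c₃ * ∑ i ∈ Z, Y v i)
      (2 * m)).coeff (c₃ * L + (c₂ * j + (c₁ * l + i))) = (selPoly G I l j R θ Y).coeff i := by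
  classical
  have h2 : (2 : (ZMod 2)[X]) = 0 := by
    have : ((2 : ZMod 2)) = 0 := by decide
    rw [← map_ofNat (C : ZMod 2 →+* (ZMod 2)[X]) 2, this, map_zero]
  obtain ⟨g, hg⟩ := sum_algF_eq h2 hI R θ (X ^ c₁) (X ^ c₂) (X ^ c₃) Y hm
  -- The position `c₃ L + c₂ j + c₁ l + i` is a number in mixed radix; this bound and the next say
  -- that there are no carries.
  have hli : c₁ * l + i < c₂ := by
    calc c₁ * l + i < c₁ * l + c₁ := by omega
      _ = c₁ * (l + 1) := by ring
      _ ≤ c₁ * (Fintype.card V + 1) := Nat.mul_le_mul_left _ (by omega)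
      _ ≤ c₂ := h₂
  have hlt : c₂ * j + (c₁ * l + i) < c₃ := by
    calc c₂ * j + (c₁ * l + i) < c₂ * j + c₂ := by omega
      _ = c₂ * (j + 1) := by ring
      _ ≤ c₂ * (Fintype.card V + 1) := Nat.mul_le_mul_left _ (by omega)
      _ ≤ c₃ := h₃
  have hdeg : ∀ T ∈ trees V, (treePoly G I R θ Y T).natDegree < c₁ := by
    intro T hT
    have := treePoly_mem (P := (ZMod 2)[X]) (fun i => {p | p.natDegree ≤ i}) (by simp) (by simp)
      (fun i c hc d hd => (Polynomial.natDegree_add_le _ _).trans (max_le hc hd))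
      (fun i j c hc d hd => Polynomial.natDegree_mul_le.trans (Nat.add_le_add hc hd))
      G I hR hθ hY T
    refine (show _ ≤ _ from this).trans_lt (lt_of_le_of_lt (Nat.mul_le_mul_left _ ?_) h₁)
    have h1 := (mem_trees.1 hT).card
    have h2 := T.1.card_le_univ
    omega
  -- The error term is divisible by `X ^ (c₃ * (L + 1))` and starts beyond the position considered.
  rw [hg, ← pow_mul, ← pow_mul, Polynomial.coeff_add, Polynomial.coeff_X_pow_mul' _ (c₃ * (L + 1)),
    if_neg (by rw [mul_add]; omega), add_zero, add_comm (c₃ * L), Polynomial.coeff_X_pow_mul,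
    Polynomial.finsetSum_coeff, selPoly, Polynomial.finsetSum_coeff, Finset.sum_filter]
  refine Finset.sum_congr rfl fun T hT => ?_
  have e : treePoly G I R θ Y T * (X ^ c₁) ^ (leafs T).card * (X ^ c₂) ^ (inner I T).card =
      X ^ (c₂ * (inner I T).card + c₁ * (leafs T).card) * treePoly G I R θ Y T := by
    rw [← pow_mul, ← pow_mul, pow_add]; ring
  rw [e, Polynomial.coeff_X_pow_mul']
  set a := (leafs T).card with ha
  set b := (inner I T).card with hb
  have haV : a ≤ Fintype.card V := Finset.card_le_univ _
  by_cases hab : a = l ∧ b = j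
  · rw [if_pos hab, hab.1, hab.2, if_pos (by omega)]
    congr 1
    omega
  · rw [if_neg hab]
    split_ifs with hle
    · refine Polynomial.coeff_eq_zero_of_natDegree_lt ((hdeg T hT).trans_le ?_)
      by_contra hlt'
      push Not at hlt'
      apply hab
      -- If a tree contributed to this position with a degree `d < c₁`, uniqueness of the digits
      -- would give it the prescribed parameters.
      set d := c₂ * j + (c₁ * l + i) - (c₂ * b + c₁ * a) with hd
      have hsum : c₂ * j + (c₁ * l + i) = c₂ * b + (c₁ * a + d) := by omega
      have had : c₁ * a + d < c₂ := by
        calc c₁ * a + d < c₁ * a + c₁ := by omega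
          _ = c₁ * (a + 1) := by ring
          _ ≤ c₁ * (Fintype.card V + 1) := Nat.mul_le_mul_left _ (by omega)
          _ ≤ c₂ := h₂
      have hjb : j = b := by
        have := congrArg (· / c₂) hsum
        simpa only [Nat.mul_add_div (by omega : 0 < c₂), Nat.div_eq_of_lt hli,
          Nat.div_eq_of_lt had, add_zero] using this
      have hla : l = a := by
        rw [hjb] at hsum
        have := congrArg (· / c₁) (Nat.add_left_cancel hsum)
        simpa only [Nat.mul_add_div (by omega : 0 < c₁), Nat.div_eq_of_lt hi,
          Nat.div_eq_of_lt hlt', add_zero] using this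
      exact ⟨hla.symm, hjb.symm⟩
    · rfl

end Select
end TreeProg

/-! ### Implementation of the identity test on lists of bits -/

namespace TreeProg
open Data

/-! ### Message passing on lists of bits -/

@[simp] theorem len_appendD (a b : Data) : (a.appendD b).len = a.len + b.len := by
  simp [appendD, len]

@[simp] theorem len_mulU (a b : Data) : (a.mulU b).len = a.len * b.len := by simp [mulU]

/-- `nil` if and only if the two lengths agree. -/
def eqU (a b : Data) : Data := (a.dropD b).appendD (b.dropD a)

theorem eqU_eq_nil_iff (a b : Data) : eqU a b = nil ↔ a.len = b.len := by
  have h : ∀ d : Data, d = nil ↔ d.len = 0 := by intro d; cases d <;> simp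
  rw [h, eqU, len_appendD, Nat.add_eq_zero_iff, ← h, ← h, dropD_eq_nil_iff, dropD_eq_nil_iff]
  omega

@[fun_prop]
theorem PT.eqU {f g : Data → Data} (hf : PT f) (hg : PT g) :
    PT fun x => TreeProg.eqU (f x) (g x) := by
  unfold TreeProg.eqU; fun_prop

section Environment

/-! An environment contains a set of labels, a graph, the number of labels, a set of vertices, and
the random bits. -/

def eX (e : Data) : Data := e.hd
def eG (e : Data) : Data := e.tl.hd
def eL (e : Data) : Data := e.tl.tl.hd
def eI (e : Data) : Data := e.tl.tl.tl.hd
def eB (e : Data) : Data := e.tl.tl.tl.tl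

/-- The number of coefficients of a random polynomial. -/
def eW (e : Data) : Data := cons nil (cons nil (cons nil (eG e)))

/-- The random bits form a matrix with `n` rows and `2 n + 1` columns, whose entries are polynomials
with `n + 3` coefficients; `u` is the row and `c` the column. The columns below `n` hold `R`, the
next ones `Y`, and the last one `θ`. -/
def rndD (e u c : Data) : Data :=
  tab (eW e) fun i => (eB e).nthD (i.appendD ((eW e).mulU
    (c.appendD ((cons nil ((eG e).appendD (eG e))).mulU u))))

/-- The lengths are, in unary, `c₁ = (n + 3) (3 n + 1) + 1`, which exceeds the degree of every tree
polynomial, then `c₂ = c₁ (n + 1)` and `c₃ = c₂ (n + 1)` with room for the number of leaves and of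
inner vertices, and the truncation order `c₃ (L + 1)`. A graph counts as the unary number `n`,
having `n` rows. -/
def c1D (e : Data) : Data :=
  cons nil ((eW e).mulU (cons nil ((eG e).appendD ((eG e).appendD (eG e)))))
def c2D (e : Data) : Data := (c1D e).mulU (cons nil (eG e))
def c3D (e : Data) : Data := (c2D e).mulU (cons nil (eG e))
def dD (e : Data) : Data := (c3D e).mulU (cons nil (eL e))

noncomputable def yD (e u : Data) : Data :=
  mulD (dD e) (monoD (c3D e)) (sumD (dD e) (eL e) fun i =>
    if (eX e).nthD i = nil then nil else rndD e u ((eG e).appendD i))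

noncomputable def xD (e u v : Data) : Data :=
  if ((eG e).nthD u).nthD v = nil then nil else mulD (dD e) (rndD e u v) (rndD e v u)

noncomputable def aD (e u : Data) : Data :=
  if (eI e).nthD u = nil then mulD (dD e) (yD e u) (addD (dD e) (monoD (c1D e)) (cons tt nil))
  else addD (dD e) (monoD (c2D e)) (mulD (dD e) (monoD (c1D e)) (yD e u))

noncomputable def bD (e u : Data) : Data :=
  if (eI e).nthD u = nil then yD e u else monoD (c2D e)

/-- The recipient is left out of the product by giving it the factor one. -/
noncomputable def msgD (e M : Data) : Data :=
  tab (eG e) fun w => tab (eG e) fun p => addD (dD e) (aD e w) (mulD (dD e) (bD e w)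
    (prodD (dD e) (eG e) fun q => if eqU q p = nil then cons tt nil else
      addD (dD e) (cons tt nil) (mulD (dD e) (xD e w q) ((M.nthD q).nthD w))))

noncomputable def rhoD (e M r : Data) : Data :=
  addD (dD e) (mulD (dD e) (bD e r) (prodD (dD e) (eG e) fun q =>
      addD (dD e) (cons tt nil) (mulD (dD e) (xD e r q) ((M.nthD q).nthD r))))
    (mulD (dD e) (aD e r) (sumD (dD e) (eG e) fun q =>
      mulD (dD e) (xD e r q) ((M.nthD q).nthD r)))

/-- The number of iterations. -/
def itD (e : Data) : Data :=
  (cons nil (cons nil nil)).mulU (cons nil ((eG e).appendD (eG e)))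

/-- The empty list is a table of zero messages, since missing entries are read as `nil`. -/
noncomputable def fixD (e : Data) : Data := foldU (itD e) (fun M _ => msgD e M) nil

noncomputable def valD (e : Data) : Data :=
  sumD (dD e) (eG e) fun r => if (eI e).nthD r = nil then
    mulD (dD e) (rndD e r ((eG e).appendD (eG e))) (rhoD e (fixD e) r) else nil

end Environment

@[fun_prop] theorem PT.eX {f : Data → Data} (hf : PT f) : PT fun x => TreeProg.eX (f x) := by
  unfold TreeProg.eX; fun_prop
@[fun_prop] theorem PT.eG {f : Data → Data} (hf : PT f) : PT fun x => TreeProg.eG (f x) := by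
  unfold TreeProg.eG; fun_prop
@[fun_prop] theorem PT.eL {f : Data → Data} (hf : PT f) : PT fun x => TreeProg.eL (f x) := by
  unfold TreeProg.eL; fun_prop
@[fun_prop] theorem PT.eI {f : Data → Data} (hf : PT f) : PT fun x => TreeProg.eI (f x) := by
  unfold TreeProg.eI; fun_prop
@[fun_prop] theorem PT.eB {f : Data → Data} (hf : PT f) : PT fun x => TreeProg.eB (f x) := by
  unfold TreeProg.eB; fun_prop
@[fun_prop] theorem PT.eW {f : Data → Data} (hf : PT f) : PT fun x => TreeProg.eW (f x) := by
  unfold TreeProg.eW; fun_prop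
@[fun_prop] theorem PT.c1D {f : Data → Data} (hf : PT f) : PT fun x => TreeProg.c1D (f x) := by
  unfold TreeProg.c1D; fun_prop
@[fun_prop] theorem PT.c2D {f : Data → Data} (hf : PT f) : PT fun x => TreeProg.c2D (f x) := by
  unfold TreeProg.c2D; fun_prop
@[fun_prop] theorem PT.c3D {f : Data → Data} (hf : PT f) : PT fun x => TreeProg.c3D (f x) := by
  unfold TreeProg.c3D; fun_prop
@[fun_prop] theorem PT.dD {f : Data → Data} (hf : PT f) : PT fun x => TreeProg.dD (f x) := by
  unfold TreeProg.dD; fun_prop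
@[fun_prop] theorem PT.itD {f : Data → Data} (hf : PT f) : PT fun x => TreeProg.itD (f x) := by
  unfold TreeProg.itD; fun_prop

/-- A function of two arguments, given as a function of the pair. -/
theorem PT.comp₂ {h : Data → Data → Data} (hh : PT fun y => h y.hd y.tl) {f g : Data → Data}
    (hf : PT f) (hg : PT g) : PT fun x => h (f x) (g x) :=
  hh.comp (f := fun x => Data.cons (f x) (g x)) (hf.cons hg)

theorem PT.comp₃ {h : Data → Data → Data → Data} (hh : PT fun y => h y.hd y.tl.hd y.tl.tl)
    {f g k : Data → Data} (hf : PT f) (hg : PT g) (hk : PT k) :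
    PT fun x => h (f x) (g x) (k x) :=
  hh.comp (f := fun x => Data.cons (f x) (Data.cons (g x) (k x))) (hf.cons (hg.cons hk))

@[fun_prop]
theorem PT.rndD {f u c : Data → Data} (hf : PT f) (hu : PT u) (hc : PT c) :
    PT fun x => TreeProg.rndD (f x) (u x) (c x) := by
  refine PT.comp₃ ?_ hf hu hc
  unfold TreeProg.rndD
  fun_prop

@[fun_prop]
theorem PT.yD {f u : Data → Data} (hf : PT f) (hu : PT u) :
    PT fun x => TreeProg.yD (f x) (u x) := by
  refine PT.comp₂ ?_ hf hu
  unfold TreeProg.yD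
  fun_prop

@[fun_prop]
theorem PT.xD {f u v : Data → Data} (hf : PT f) (hu : PT u) (hv : PT v) :
    PT fun x => TreeProg.xD (f x) (u x) (v x) := by
  refine PT.comp₃ ?_ hf hu hv
  unfold TreeProg.xD
  fun_prop

@[fun_prop]
theorem PT.aD {f u : Data → Data} (hf : PT f) (hu : PT u) :
    PT fun x => TreeProg.aD (f x) (u x) := by
  refine PT.comp₂ ?_ hf hu
  unfold TreeProg.aD
  fun_prop

@[fun_prop]
theorem PT.bD {f u : Data → Data} (hf : PT f) (hu : PT u) :
    PT fun x => TreeProg.bD (f x) (u x) := by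
  refine PT.comp₂ ?_ hf hu
  unfold TreeProg.bD
  fun_prop

@[fun_prop]
theorem PT.msgD {f M : Data → Data} (hf : PT f) (hM : PT M) :
    PT fun x => TreeProg.msgD (f x) (M x) := by
  refine PT.comp₂ ?_ hf hM
  unfold TreeProg.msgD
  fun_prop

@[fun_prop]
theorem PT.rhoD {f M r : Data → Data} (hf : PT f) (hM : PT M) (hr : PT r) :
    PT fun x => TreeProg.rhoD (f x) (M x) (r x) := by
  refine PT.comp₃ ?_ hf hM hr
  unfold TreeProg.rhoD
  fun_prop

-- Truncation bounds the size of a table of messages independently of the table before, so the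
-- iteration stays polynomial.
@[fun_prop]
theorem PT.fixD {f : Data → Data} (hf : PT f) : PT fun x => TreeProg.fixD (f x) := by
  refine PT.comp (g := TreeProg.fixD) ?_ hf
  unfold TreeProg.fixD
  obtain ⟨q, hq⟩ := PT.dD PT.id |>.bound
  obtain ⟨r, hr⟩ := PT.eG PT.id |>.bound
  refine PT.foldU (g := fun e M _ => TreeProg.msgD e M) (by fun_prop) (by fun_prop) (by fun_prop)
    ⟨r * (r * (q * 4 + 2) + 2) + 1, fun e M _ => ?_⟩
  refine (size_tab_le _ _ (r.eval e.size * (q.eval e.size * 4 + 2) + 1) fun w =>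
    (size_tab_le _ _ (q.eval e.size * 4 + 1) fun p => ?_).trans ?_).trans ?_
  · refine (size_addD_le _ _ _).trans ?_
    have := hq e
    omega
  · have := hr e
    simp only [add_le_add_iff_right, add_assoc]
    gcongr
  · have := hr e
    simp only [Polynomial.eval_add, Polynomial.eval_mul, Polynomial.eval_ofNat,
      Polynomial.eval_one, add_le_add_iff_right, add_assoc]
    gcongr
    norm_num

@[fun_prop]
theorem PT.valD {f : Data → Data} (hf : PT f) : PT fun x => TreeProg.valD (f x) := by
  refine PT.comp (g := TreeProg.valD) ?_ hf
  unfold TreeProg.valD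
  fun_prop

end TreeProg

namespace TreeProg
open Data

/-! ### The meaning of the message passing on lists of bits -/

theorem nthD_len (d i : Data) : d.nthD i = d.nthD (un i.len) := by
  rw [nthD_eq, nthD_eq, len_un]

theorem rndD_len (e u c : Data) : rndD e u c = rndD e (un u.len) (un c.len) := by
  have h : ∀ i : Data, (eB e).nthD (i.appendD ((eW e).mulU
    (c.appendD ((cons nil ((eG e).appendD (eG e))).mulU u)))) = (eB e).nthD (i.appendD ((eW e).mulU
    ((un c.len).appendD ((cons nil ((eG e).appendD (eG e))).mulU (un u.len))))) := by
    intro i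
    rw [nthD_len]
    conv_rhs => rw [nthD_len]
    simp
  simp only [rndD, h]

variable {n L : ℕ}

/-- The environment `e` represents a graph, a set of vertices, and a set of labels. -/
structure Env (e : Data) (G : SimpleGraph (Fin n)) (I : Finset (Fin n)) (Z : Finset (Fin L)) :
    Prop where
  len_eG : (eG e).len = n
  adj : ∀ u v : Fin n, ((eG e).nthD (un u)).nthD (un v) = nil ↔ ¬ G.Adj u v
  mem : ∀ v : Fin n, (eI e).nthD (un v) = nil ↔ v ∉ I
  len_eL : (eL e).len = L
  lab : ∀ i : Fin L, (eX e).nthD (un i) = nil ↔ i ∉ Z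

open Polynomial

noncomputable def eR (e : Data) (u v : Fin n) : (ZMod 2)[X] := toPoly (rndD e (un u) (un v))
noncomputable def eθ (e : Data) (u : Fin n) : (ZMod 2)[X] := toPoly (rndD e (un u) (un (2 * n)))
noncomputable def eY (e : Data) (u : Fin n) (i : Fin L) : (ZMod 2)[X] :=
  toPoly (rndD e (un u) (un (n + i)))

noncomputable abbrev mkT (D : ℕ) : (ZMod 2)[X] →+* Trunc D := Ideal.Quotient.mk _

theorem ev_eq (D : ℕ) (d : Data) : ev D d = mkT D (toPoly d) := rfl

section
variable {e : Data} {G : SimpleGraph (Fin n)} {I : Finset (Fin n)} {Z : Finset (Fin L)}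

noncomputable def ePow (e : Data) (u : Fin n) (Z : Finset (Fin L)) : (ZMod 2)[X] :=
  X ^ (c3D e).len * ∑ i ∈ Z, eY e u i

theorem Env.ev_yD (h : Env e G I Z) (u : Fin n) :
    ev (dD e).len (yD e (un u)) = mkT _ (ePow e u Z) := by
  rw [yD, ev_mulD, ev_sumD, ev_eq, toPoly_monoD, ePow, map_mul, h.len_eL, Finset.sum_range, map_sum,
    ← Finset.sum_filter_add_sum_filter_not Finset.univ (· ∈ Z)]
  rw [Finset.filter_mem_eq_inter, Finset.univ_inter, Finset.sum_congr rfl (g := fun i =>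
    mkT (dD e).len (eY e u i)) fun i hi => by
      rw [if_neg (by rw [h.lab]; simpa using hi), rndD_len]; simp [h.len_eG, eY, ev_eq],
    Finset.sum_eq_zero (s := Finset.univ.filter (· ∉ Z)) fun i hi => by
      rw [if_pos (by rw [h.lab]; simpa using hi), ev_nil], add_zero]

theorem Env.ev_xD (h : Env e G I Z) (u v : Fin n) :
    ev (dD e).len (xD e (un u) (un v)) = mkT _ (edgeX G (eR e) s(u, v)) := by
  rw [xD, edgeX, Sym2.lift_mk]
  by_cases huv : G.Adj u v
  · rw [if_neg (by rw [h.adj]; simpa using huv), ev_mulD]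
    simp [huv, eR, ev_eq]
  · rw [if_pos (by rw [h.adj]; exact huv), ev_nil]
    simp [huv]

theorem Env.ev_aD (h : Env e G I Z) (u : Fin n) : ev (dD e).len (aD e (un u)) =
    mkT _ (wA I (X ^ (c1D e).len) (X ^ (c2D e).len) (fun v => ePow e v Z) u) := by
  rw [aD, wA]
  by_cases hu : u ∈ I
  · rw [if_neg (by rw [h.mem]; simpa using hu), if_pos hu, ev_addD, ev_mulD, h.ev_yD, ev_eq, ev_eq,
      toPoly_monoD, toPoly_monoD]
    simp
  · rw [if_pos (by rw [h.mem]; exact hu), if_neg hu, ev_mulD, ev_addD, h.ev_yD, ev_one, ev_eq,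
      toPoly_monoD]
    simp

theorem Env.ev_bD (h : Env e G I Z) (u : Fin n) : ev (dD e).len (bD e (un u)) =
    mkT _ (wB I (X ^ (c2D e).len) (fun v => ePow e v Z) u) := by
  rw [bD, wB]
  by_cases hu : u ∈ I
  · rw [if_neg (by rw [h.mem]; simpa using hu), if_pos hu, ev_eq, toPoly_monoD]
  · rw [if_pos (by rw [h.mem]; exact hu), if_neg hu, h.ev_yD]

theorem Env.ev_msgD (h : Env e G I Z) {M : Data} {N : Fin n → Fin n → (ZMod 2)[X]}
    (hM : ∀ q w : Fin n, ev (dD e).len ((M.nthD (un q)).nthD (un w)) = mkT _ (N q w))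
    (w p : Fin n) : ev (dD e).len (((msgD e M).nthD (un w)).nthD (un p)) =
      mkT _ (msgStep (wA I (X ^ (c1D e).len) (X ^ (c2D e).len) (fun v => ePow e v Z))
        (wB I (X ^ (c2D e).len) (fun v => ePow e v Z)) (edgeX G (eR e)) N w p) := by
  rw [msgD, nthD_tab_un _ _ _ (by rw [h.len_eG]; exact w.2),
    nthD_tab_un _ _ _ (by rw [h.len_eG]; exact p.2), ev_addD, ev_mulD, h.ev_aD, h.ev_bD, ev_prodD,
    h.len_eG, Finset.prod_range, msgStep, map_add, map_mul, map_prod,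
    ← Finset.mul_prod_erase _ _ (Finset.mem_univ p), if_pos (by rw [eqU_eq_nil_iff]), ev_one,
    one_mul]
  congr 2
  refine Finset.prod_congr rfl fun q hq => ?_
  have hqp : q ≠ p := Finset.ne_of_mem_erase hq
  rw [if_neg (by rw [eqU_eq_nil_iff]; simpa [Fin.val_inj] using hqp), ev_addD, ev_mulD, ev_one, h.ev_xD, hM]
  simp

theorem Env.ev_foldl_msgD (h : Env e G I Z) (N : ℕ) (w p : Fin n) : ev (dD e).len
    ((((List.range N).foldl (fun M _ => msgD e M) nil).nthD (un w)).nthD (un p)) =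
      mkT _ ((msgStep (wA I (X ^ (c1D e).len) (X ^ (c2D e).len) (fun v => ePow e v Z))
        (wB I (X ^ (c2D e).len) (fun v => ePow e v Z)) (edgeX G (eR e)))^[N] 0 w p) := by
  induction N generalizing w p with
  | zero => simp [nthD, dropD, ofList, Data.hd, ev_nil]
  | succ N ih =>
    rw [List.range_succ, List.foldl_append, List.foldl_cons, List.foldl_nil,
      Function.iterate_succ_apply', h.ev_msgD ih]

theorem Env.ev_fixD (h : Env e G I Z) (w p : Fin n) :
    ev (dD e).len (((fixD e).nthD (un w)).nthD (un p)) =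
      mkT _ ((msgStep (wA I (X ^ (c1D e).len) (X ^ (c2D e).len) (fun v => ePow e v Z))
        (wB I (X ^ (c2D e).len) (fun v => ePow e v Z)) (edgeX G (eR e)))^[2 * (2 * n + 1)] 0 w p) := by
  have hit : (itD e).len = 2 * (2 * n + 1) := by
    rw [itD, len_mulU, len_cons, len_cons, len_nil, len_cons, len_appendD, h.len_eG]
    ring
  have e1 : fixD e = (List.range (2 * (2 * n + 1))).foldl (fun M _ => msgD e M) nil := by
    unfold fixD foldU
    rw [hit]
  rw [e1]
  exact h.ev_foldl_msgD _ w p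

theorem Env.ev_rhoD (h : Env e G I Z) {M : Data} {N : Fin n → Fin n → (ZMod 2)[X]}
    (hM : ∀ q w : Fin n, ev (dD e).len ((M.nthD (un q)).nthD (un w)) = mkT _ (N q w))
    (r : Fin n) : ev (dD e).len (rhoD e M (un r)) =
      mkT _ (rootValue (wA I (X ^ (c1D e).len) (X ^ (c2D e).len) (fun v => ePow e v Z))
        (wB I (X ^ (c2D e).len) (fun v => ePow e v Z)) (edgeX G (eR e)) N r) := by
  rw [rhoD, ev_addD, ev_mulD, ev_mulD, ev_prodD, ev_sumD, h.ev_aD, h.ev_bD, h.len_eG,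
    Finset.prod_range, Finset.sum_range, rootValue, map_add, map_mul, map_mul, map_prod, map_sum]
  refine congrArg₂ (· + ·) (congrArg₂ (· * ·) rfl (Finset.prod_congr rfl fun q _ => ?_))
    (congrArg₂ (· * ·) rfl (Finset.sum_congr rfl fun q _ => ?_))
  · rw [ev_addD, ev_mulD, ev_one, h.ev_xD, hM, map_add, map_one, map_mul]
  · rw [ev_mulD, h.ev_xD, hM, map_mul]

theorem Env.ev_valD (h : Env e G I Z) : ev (dD e).len (valD e) =
    mkT _ (algF G I (eR e) (eθ e) (X ^ (c1D e).len) (X ^ (c2D e).len) (fun v => ePow e v Z)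
      (2 * (2 * n + 1))) := by
  rw [valD, ev_sumD, h.len_eG, Finset.sum_range, algF, map_sum,
    ← Finset.sum_filter_add_sum_filter_not Finset.univ (· ∉ I)]
  rw [Finset.sum_eq_zero (s := Finset.univ.filter (¬ · ∉ I)) fun i hi => by
      rw [if_neg (by rw [h.mem]; simpa using hi), ev_nil], add_zero]
  refine Finset.sum_congr (by ext; simp) fun r hr => ?_
  rw [if_pos (by rw [h.mem]; simpa using hr), ev_mulD, h.ev_rhoD h.ev_fixD, map_mul, rndD_len]
  simp [h.len_eG, eθ, ev_eq, two_mul]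

end
end TreeProg

namespace TreeProg
open Data

/-! ### Enumerating all sets of labels with a binary counter -/

/-- The binary digits of `i`, least significant digit first. -/
def bitsL : ℕ → ℕ → List Bool
  | 0, _ => []
  | L + 1, i => i.testBit 0 :: bitsL L (i / 2)

theorem length_bitsL (L i : ℕ) : (bitsL L i).length = L := by
  induction L generalizing i with
  | zero => rfl
  | succ L ih => simp [bitsL, ih]

theorem getD_bitsL (L i t : ℕ) (ht : t < L) : (bitsL L i).getD t false = i.testBit t := by
  induction L generalizing i t with
  | zero => omega
  | succ L ih =>
    cases t with
    | zero => simp [bitsL]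
    | succ t =>
      rw [bitsL, List.getD_cons_succ, ih _ _ (by omega), Nat.testBit_div_two]

theorem bitsL_zero (L : ℕ) : bitsL L 0 = List.replicate L false := by
  induction L with
  | zero => rfl
  | succ L ih => simp [bitsL, ih, List.replicate_succ]

/-- Incrementing a binary counter. -/
def incL : List Bool → Option (List Bool)
  | [] => none
  | false :: l => some (true :: l)
  | true :: l => (incL l).map (false :: ·)

theorem incL_bitsL (L i : ℕ) (hi : i < 2 ^ L) :
    incL (bitsL L i) = if i + 1 < 2 ^ L then some (bitsL L (i + 1)) else none := by
  induction L generalizing i with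
  | zero =>
    have : i = 0 := by simpa using hi
    subst this; rfl
  | succ L ih =>
    rw [pow_succ] at hi
    rcases Nat.even_or_odd' i with ⟨c, rfl | rfl⟩
    · have h1 : bitsL (L + 1) (2 * c) = false :: bitsL L c := by simp [bitsL]
      have h2 : bitsL (L + 1) (2 * c + 1) = true :: bitsL L c := by
        have : (2 * c + 1) / 2 = c := by omega
        simp [bitsL, this]
      rw [h1, h2, incL, if_pos (by rw [pow_succ]; omega)]
    · have h1 : bitsL (L + 1) (2 * c + 1) = true :: bitsL L c := by
        have : (2 * c + 1) / 2 = c := by omega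
        simp [bitsL, this]
      have h2 : bitsL (L + 1) (2 * c + 1 + 1) = false :: bitsL L (c + 1) := by
        have h3 : (2 * c + 1 + 1) / 2 = c + 1 := by omega
        have h4 : (2 * c + 1 + 1) = 2 * (c + 1) := by ring
        rw [bitsL, h3, h4]
        simp
      rw [h1, h2, incL, ih c (by omega), pow_succ]
      by_cases h : c + 1 < 2 ^ L
      · rw [if_pos h, if_pos (by omega)]; rfl
      · rw [if_neg h, if_neg (by omega)]; rfl

/-- The head of the accumulator is the carry; its tail collects the new digits in reverse. -/
noncomputable def incStep (acc b : Data) : Data :=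
  if acc.hd = nil then cons nil (cons b acc.tl) else
    if b = nil then cons nil (cons tt acc.tl) else cons tt (cons nil acc.tl)

/-- The incremented counter in a singleton list, or `nil` if there is an overflow. -/
noncomputable def incD (x : Data) : Data :=
  if (x.toList.foldl incStep (cons tt nil)).hd = nil then
    cons (x.toList.foldl incStep (cons tt nil)).tl.revD nil else nil

def boolsD (l : List Bool) : Data := ofList (l.map ofBool)

theorem foldl_incStep_nil (l : List Bool) (out : List Data) :
    (l.map ofBool).foldl incStep (cons nil (ofList out)) =
      cons nil (ofList ((l.map ofBool).reverse ++ out)) := by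
  induction l generalizing out with
  | nil => rfl
  | cons b l ih =>
    rw [List.map_cons, List.foldl_cons]
    have : incStep (cons nil (ofList out)) (ofBool b) = cons nil (ofList (ofBool b :: out)) := by
      simp [incStep, Data.hd, Data.tl, ofList]
    rw [this, ih]
    simp

theorem foldl_incStep_tt (l : List Bool) (out : List Data) :
    (l.map ofBool).foldl incStep (cons tt (ofList out)) =
      match incL l with
      | none => cons tt (ofList (List.replicate l.length nil ++ out))
      | some l' => cons nil (ofList ((l'.map ofBool).reverse ++ out)) := by
  induction l generalizing out with
  | nil => rfl
  | cons b l ih =>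
    rw [List.map_cons, List.foldl_cons]
    cases b with
    | false =>
      have : incStep (cons tt (ofList out)) (ofBool false) = cons nil (ofList (tt :: out)) := by
        simp [incStep, Data.hd, Data.tl, ofList, tt, ofBool]
      rw [this, foldl_incStep_nil]
      simp [incL, ofBool, tt]
    | true =>
      have : incStep (cons tt (ofList out)) (ofBool true) = cons tt (ofList (nil :: out)) := by
        simp [incStep, Data.hd, Data.tl, ofList, tt, ofBool]
      rw [this, ih, incL]
      cases incL l with
      | none =>
        simp [List.replicate_succ']
      | some l' => simp [ofBool]

theorem incD_boolsD (l : List Bool) : incD (boolsD l) =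
    match incL l with
    | none => nil
    | some l' => cons (boolsD l') nil := by
  have h := foldl_incStep_tt l []
  rw [incD, boolsD, toList_ofList, show (cons tt nil) = cons tt (ofList []) from rfl, h]
  cases incL l with
  | none => simp [Data.hd, tt]
  | some l' => simp [Data.hd, Data.tl, revD, boolsD, ← List.map_reverse]

theorem size_foldl_incStep (l : List Data) (acc : Data) :
    (l.foldl incStep acc).size ≤ acc.size + (l.map fun d => d.size + 6).sum := by
  induction l generalizing acc with
  | nil => simp
  | cons b l ih =>
    rw [List.foldl_cons, List.map_cons, List.sum_cons]
    refine (ih _).trans ?_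
    have : (incStep acc b).size ≤ acc.size + (b.size + 6) := by
      have h1 : acc.hd.size + acc.tl.size ≤ acc.size + 1 := by
        cases acc <;> (simp [Data.hd, Data.tl, size]; try omega)
      have h2 := acc.hd.size_pos
      have h3 := b.size_pos
      unfold incStep tt
      split_ifs <;> simp only [size] <;> omega
    omega

theorem PT.incD : PT TreeProg.incD := by
  have h1 : PT fun x => x.toList.foldl incStep (Data.cons tt Data.nil) := by
    refine PT.foldl (g := fun _ => incStep) (l := fun x => x) (by unfold incStep; fun_prop)
      (by fun_prop) PT.id ⟨7 * Polynomial.X + 10, fun x l' hl' => ?_⟩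
    refine (size_foldl_incStep _ _).trans ?_
    obtain ⟨t, ht⟩ := hl'
    have h2 : ∀ l : List Data, (l.map fun d => d.size + 6).sum ≤ 6 * (ofList l).size := by
      intro l
      induction l with
      | nil => simp
      | cons a l ih =>
        simp only [List.map_cons, List.sum_cons, ofList, size]
        have := a.size_pos
        omega
    have h3 := h2 l'
    have h4 := size_ofList_le_of_suffix (l := l'.reverse) (l' := x.toList.reverse)
      ⟨t.reverse, by rw [← ht]; simp⟩
    have h5 : ∀ l : List Data, (ofList l.reverse).size = (ofList l).size := by
      intro l; rw [size_ofList, size_ofList, List.map_reverse, List.sum_reverse]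
    rw [h5, h5, ofList_toList] at h4
    simp only [size, tt, Polynomial.eval_add, Polynomial.eval_mul, Polynomial.eval_ofNat,
      Polynomial.eval_X]
    omega
  unfold TreeProg.incD
  fun_prop

/-- Summation over all subsets by means of the binary digits. -/
theorem sum_range_two_pow {A : Type} [AddCommMonoid A] (L : ℕ) (f : Finset (Fin L) → A) :
    ∑ i ∈ Finset.range (2 ^ L), f (Finset.univ.filter fun t => i.testBit t = true) =
      ∑ Z, f Z := by
  classical
  have hinj : Set.InjOn (fun i : ℕ => (Finset.univ.filter fun t : Fin L => i.testBit t = true))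
      (Finset.range (2 ^ L)) := by
    intro i hi i' hi' h
    simp only [Finset.coe_range, Set.mem_Iio] at hi hi'
    refine Nat.eq_of_testBit_eq fun t => ?_
    by_cases ht : t < L
    · have := congrArg (⟨t, ht⟩ ∈ ·) h
      simp only [Finset.mem_filter, Finset.mem_univ, true_and, eq_iff_iff] at this
      exact Bool.eq_iff_iff.2 this
    · have h1 : 2 ^ L ≤ 2 ^ t := Nat.pow_le_pow_right (by norm_num) (by omega)
      rw [Nat.testBit_lt_two_pow (hi.trans_le h1), Nat.testBit_lt_two_pow (hi'.trans_le h1)]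
  have himg : (Finset.range (2 ^ L)).image (fun i : ℕ => (Finset.univ.filter fun t : Fin L =>
      i.testBit t = true)) = Finset.univ := by
    refine Finset.eq_univ_of_card _ ?_
    rw [Finset.card_image_of_injOn hinj]
    simp
  rw [← himg, Finset.sum_image hinj]

/-! ### The loop over all sets of labels -/

/-- The counter is wrapped in a singleton list: an empty head then means overflow and ends the loop,
even for `L = 0`, where the counter itself is `nil`. -/
noncomputable def loopStep (y : Data) : Data :=
  cons (incD y.hd.hd) (cons (addD (dD (cons y.hd.hd y.tl.tl)) y.tl.hd (valD (cons y.hd.hd y.tl.tl)))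
    y.tl.tl)

theorem PT.loopStep : PT TreeProg.loopStep := by
  have := PT.incD
  unfold TreeProg.loopStep
  fun_prop

def loopInit (ev : Data) : Data := cons (cons (tab (eL (cons nil ev)) fun _ => nil) nil) (cons nil ev)

/-- The bound on `acc` does not depend on `i`: exponentially many passes are made in polynomial
space. -/
theorem loopStep_iterate (ev : Data) (i : ℕ) (hi : i ≤ 2 ^ (eL (cons nil ev)).len) :
    ∃ acc, loopStep^[i] (loopInit ev) = cons (if i < 2 ^ (eL (cons nil ev)).len then
        cons (boolsD (bitsL (eL (cons nil ev)).len i)) nil else nil) (cons acc ev) ∧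
      acc.size ≤ (dD (cons nil ev)).size * 4 + 1 ∧
      TreeProg.ev (dD (cons nil ev)).len acc = ∑ i' ∈ Finset.range i,
        TreeProg.ev (dD (cons nil ev)).len
          (valD (cons (boolsD (bitsL (eL (cons nil ev)).len i')) ev)) := by
  induction i with
  | zero =>
    refine ⟨nil, ?_, by simp [size], by simp [ev_nil]⟩
    rw [if_pos (by positivity), bitsL_zero]
    simp [loopInit, boolsD, tab_nil, un, ofNatUnary, ofBool]
  | succ i ih =>
    obtain ⟨acc, h1, h2, h3⟩ := ih (by omega)
    rw [Function.iterate_succ_apply', h1, if_pos (by omega)]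
    have h4 : loopStep (cons (cons (boolsD (bitsL (eL (cons nil ev)).len i)) nil) (cons acc ev)) =
        cons (incD (boolsD (bitsL (eL (cons nil ev)).len i)))
          (cons (addD (dD (cons nil ev)) acc
            (valD (cons (boolsD (bitsL (eL (cons nil ev)).len i)) ev))) ev) := rfl
    refine ⟨_, ?_, size_addD_le (dD (cons nil ev)) acc
      (valD (cons (boolsD (bitsL (eL (cons nil ev)).len i)) ev)), ?_⟩
    · rw [h4, incD_boolsD, incL_bitsL _ _ (by omega)]
      by_cases h : i + 1 < 2 ^ (eL (cons nil ev)).len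
      · rw [if_pos h, if_pos h]
      · rw [if_neg h, if_neg h]
    · rw [ev_addD, h3, Finset.sum_range_succ]

/-! ### Reading `selPoly` off the accumulated sum -/

section Test
open Polynomial

/-- The part of an environment that does not depend on the set of labels. -/
structure EnvB {n : ℕ} (ev : Data) (G : SimpleGraph (Fin n)) (I : Finset (Fin n)) (L : ℕ) :
    Prop where
  len_eG : (eG (cons nil ev)).len = n
  adj : ∀ u v : Fin n, ((eG (cons nil ev)).nthD (un u)).nthD (un v) = nil ↔ ¬ G.Adj u v
  mem : ∀ v : Fin n, (eI (cons nil ev)).nthD (un v) = nil ↔ v ∉ I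
  len_eL : (eL (cons nil ev)).len = L

variable {n L : ℕ} {ev : Data} {G : SimpleGraph (Fin n)} {I : Finset (Fin n)}

theorem EnvB.env (h : EnvB ev G I L) (i : ℕ) :
    Env (cons (boolsD (bitsL L i)) ev) G I (Finset.univ.filter fun t : Fin L => i.testBit t) where
  len_eG := h.len_eG
  adj := h.adj
  mem := h.mem
  len_eL := h.len_eL
  lab t := by
    show (boolsD (bitsL L i)).nthD (un t) = nil ↔ _
    rw [nthD_eq, boolsD, toList_ofList, len_un, show nil = ofBool false from rfl, List.getD_map,
      getD_bitsL _ _ _ t.2]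
    cases h : i.testBit t <;> simp [ofBool, h]

theorem c1D_cons (b ev : Data) : c1D (cons b ev) = c1D (cons nil ev) := rfl
theorem c2D_cons (b ev : Data) : c2D (cons b ev) = c2D (cons nil ev) := rfl
theorem c3D_cons (b ev : Data) : c3D (cons b ev) = c3D (cons nil ev) := rfl
theorem dD_cons (b ev : Data) : dD (cons b ev) = dD (cons nil ev) := rfl
theorem eR_cons (b ev : Data) : eR (n := n) (cons b ev) = eR (cons nil ev) := rfl
theorem eθ_cons (b ev : Data) : eθ (n := n) (cons b ev) = eθ (cons nil ev) := rfl
theorem eY_cons (b ev : Data) : eY (n := n) (L := L) (cons b ev) = eY (cons nil ev) := rfl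

theorem natDegree_rndD (e u c : Data) : (toPoly (rndD e u c)).natDegree ≤ (eW e).len := by
  rw [natDegree_le_iff_coeff_eq_zero]
  intro i hi
  rw [coeff_toPoly, cf_eq_zero]
  rw [rndD, len_tab]
  exact hi.le

/-- The position of the coefficients of interest. -/
def posD (e j l : Data) : Data :=
  ((c3D e).mulU (eL e)).appendD (((c2D e).mulU j).appendD ((c1D e).mulU l))

/-- Whether some coefficient in the block of length `c₁` at the position for `l` and `j` is nonzero.
-/
noncomputable def testD (e j l acc : Data) : Data :=
  foldU (c1D e) (fun t i => if acc.nthD ((posD e j l).appendD i) = nil then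
    (if t = nil then nil else tt) else tt) nil

theorem testD_ne_nil_iff (e j l acc : Data) : testD e j l acc ≠ nil ↔
    ∃ i < (c1D e).len, cf acc ((posD e j l).len + i) ≠ 0 := by
  have : ∀ N : ℕ, (List.range N).foldl (fun t i =>
      if acc.nthD ((posD e j l).appendD (un i)) = nil then
        (if t = nil then nil else tt) else tt) nil ≠ nil ↔
      ∃ i < N, cf acc ((posD e j l).len + i) ≠ 0 := by
    intro N
    induction N with
    | zero => simp
    | succ N ih =>
      rw [List.range_succ, List.foldl_append, List.foldl_cons, List.foldl_nil]
      have h1 : cf acc ((posD e j l).len + N) ≠ 0 ↔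
          acc.nthD ((posD e j l).appendD (un N)) ≠ nil := by
        rw [nthD_len, len_appendD, len_un, cf, bit]
        split_ifs with h <;> simp [h]
      by_cases h : acc.nthD ((posD e j l).appendD (un N)) = nil
      · have h2 : ∀ t : Data, (if t = nil then nil else tt) ≠ nil ↔ t ≠ nil := by
          intro t; split_ifs <;> simp_all [tt]
        rw [if_pos h, h2, ih]
        constructor
        · rintro ⟨i, hi, h'⟩; exact ⟨i, by omega, h'⟩
        · rintro ⟨i, hi, h'⟩
          rcases Nat.lt_succ_iff_lt_or_eq.1 hi with h2 | rfl
          · exact ⟨i, h2, h'⟩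
          · exact absurd h (h1.1 h')
      · rw [if_neg h]
        exact ⟨fun _ => ⟨N, by omega, h1.2 h⟩, fun _ => by simp [tt]⟩
  exact this _

theorem EnvB.ev_valD (h : EnvB ev G I L) (i : ℕ) :
    TreeProg.ev (dD (cons nil ev)).len (valD (cons (boolsD (bitsL L i)) ev)) =
      mkT _ (algF G I (eR (cons nil ev)) (eθ (cons nil ev)) (X ^ (c1D (cons nil ev)).len)
        (X ^ (c2D (cons nil ev)).len) (fun v => X ^ (c3D (cons nil ev)).len *
          ∑ t ∈ Finset.univ.filter (fun t : Fin L => i.testBit t = true), eY (cons nil ev) v t)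
        (2 * (2 * n + 1))) := by
  have h1 := (h.env i).ev_valD
  unfold ePow at h1
  rwa [c1D_cons, c2D_cons, c3D_cons, dD_cons, eR_cons, eθ_cons, eY_cons] at h1

theorem EnvB.sum_ev_valD (h : EnvB ev G I L) :
    ∑ i ∈ Finset.range (2 ^ L),
        TreeProg.ev (dD (cons nil ev)).len (valD (cons (boolsD (bitsL L i)) ev)) =
      mkT (dD (cons nil ev)).len (∑ Z : Finset (Fin L), algF G I (eR (cons nil ev))
        (eθ (cons nil ev)) (X ^ (c1D (cons nil ev)).len) (X ^ (c2D (cons nil ev)).len)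
        (fun v => X ^ (c3D (cons nil ev)).len * ∑ t ∈ Z, eY (cons nil ev) v t)
        (2 * (2 * n + 1))) := by
  rw [map_sum, ← sum_range_two_pow L]
  refine Finset.sum_congr rfl fun i _ => ?_
  rw [h.ev_valD i]

/-- The outcome of the test. -/
theorem EnvB.testD_iff (h : EnvB ev G I L) (hI : G.IsIndepSet (I : Set (Fin n))) {j l : ℕ}
    (hLj : L + j ≤ n) (hl : l ≤ n) {acc : Data}
    (hacc : TreeProg.ev (dD (cons nil ev)).len acc = ∑ i ∈ Finset.range (2 ^ L),
        TreeProg.ev (dD (cons nil ev)).len (valD (cons (boolsD (bitsL L i)) ev))) :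
    testD (cons nil ev) (un j) (un l) acc ≠ nil ↔
      selPoly G I l j (eR (cons nil ev)) (eθ (cons nil ev)) (eY (L := L) (cons nil ev)) ≠ 0 := by
  have hsum := h.sum_ev_valD
  rw [← hacc] at hsum
  have hG := h.len_eG
  have hL := h.len_eL
  clear hacc h
  generalize cons nil ev = e at *
  have hw : (eW e).len = n + 3 := by
    rw [eW, len_cons, len_cons, len_cons, hG]
  have hc1 : (c1D e).len = (n + 3) * (3 * n + 1) + 1 := by
    rw [c1D, len_cons, len_mulU, hw, len_cons, len_appendD, len_appendD, hG]
    ring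
  have hc2 : (c2D e).len = (c1D e).len * (n + 1) := by
    rw [c2D, len_mulU, len_cons, hG]
  have hc3 : (c3D e).len = (c2D e).len * (n + 1) := by
    rw [c3D, len_mulU, len_cons, hG]
  have hd : (dD e).len = (c3D e).len * (L + 1) := by
    rw [dD, len_mulU, len_cons, hL]
  have hpos : (posD e (un j) (un l)).len = (c3D e).len * L + ((c2D e).len * j + (c1D e).len * l) := by
    rw [posD, len_appendD, len_appendD, len_mulU, len_mulU, len_mulU, hL, len_un, len_un]
  -- The whole block lies below the truncation order, so its coefficients are known exactly.
  have hlt : ∀ i < (c1D e).len, (posD e (un j) (un l)).len + i < (dD e).len := by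
    intro i hi
    rw [hpos, hd]
    have h1 : (c1D e).len * l + i < (c2D e).len := by
      rw [hc2]
      calc (c1D e).len * l + i < (c1D e).len * l + (c1D e).len := by omega
        _ = (c1D e).len * (l + 1) := by ring
        _ ≤ (c1D e).len * (n + 1) := Nat.mul_le_mul_left _ (by omega)
    have h2 : (c2D e).len * j + (c2D e).len ≤ (c3D e).len := by
      rw [hc3]
      calc (c2D e).len * j + (c2D e).len = (c2D e).len * (j + 1) := by ring
        _ ≤ (c2D e).len * (n + 1) := Nat.mul_le_mul_left _ (by omega)
    rw [mul_add]
    omega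
  have hcf : ∀ i < (c1D e).len, cf acc ((posD e (un j) (un l)).len + i) =
      (selPoly G I l j (eR e) (eθ e) (eY (L := L) e)).coeff i := by
    intro i hi
    have h1 : mkT (dD e).len (toPoly acc) = mkT (dD e).len (∑ Z : Finset (Fin L), algF G I (eR e)
        (eθ e) (X ^ (c1D e).len) (X ^ (c2D e).len)
        (fun v => X ^ (c3D e).len * ∑ t ∈ Z, eY e v t) (2 * (2 * n + 1))) := by
      exact hsum
    have h2 := (mk_eq_mk_iff _ _ _).1 h1 _ (hlt i hi)
    rw [coeff_toPoly] at h2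
    rw [h2, hpos]
    have h3 := coeff_sum_algF hI (eR e) (eθ e) (eY (L := L) e) (m := 2 * n + 1)
      (c₁ := (c1D e).len) (c₂ := (c2D e).len) (c₃ := (c3D e).len) (w := n + 3) (by omega)
      (fun u v => (natDegree_rndD _ _ _).trans hw.le) (fun v => (natDegree_rndD _ _ _).trans hw.le)
      (fun v i => (natDegree_rndD _ _ _).trans hw.le) (by
        rw [hc1, Fintype.card_fin, Nat.lt_succ_iff]
        exact Nat.mul_le_mul_left _ (by omega))
      (by rw [hc2, Fintype.card_fin]) (by rw [hc3, Fintype.card_fin])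
      (l := l) (j := j) (i := i) (by simpa using hl) (by rw [Fintype.card_fin]; omega) hi
    rw [← add_assoc (_ * j)] at h3
    rw [add_assoc]
    exact h3
  rw [testD_ne_nil_iff]
  constructor
  · rintro ⟨i, hi, h1⟩ h0
    rw [hcf i hi, h0] at h1
    exact h1 (coeff_zero i)
  · intro h0
    by_contra hcon
    push Not at hcon
    apply h0
    ext i
    rw [coeff_zero]
    by_cases hi : i < (c1D e).len
    · rw [← hcf i hi, hcon i hi]
    -- Conversely the block is long enough: the degree is at most `(n + 3) (3 n)`, which is less
    -- than `c₁`.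
    · apply coeff_eq_zero_of_natDegree_lt
      have := selPoly_mem (P := (ZMod 2)[X]) (L := L) (fun i => {p | p.natDegree ≤ i}) (by simp)
        (by simp) (fun i c hc d hd => (natDegree_add_le _ _).trans (max_le hc hd))
        (fun i j c hc d hd => natDegree_mul_le.trans (Nat.add_le_add hc hd))
        (fun i j hij p (hp : _ ≤ _) => hp.trans hij) (d := n + 3) G I (R := eR e) (θ := eθ e)
        (Y := eY e) (fun u v => (natDegree_rndD _ _ _).trans hw.le)
        (fun v => (natDegree_rndD _ _ _).trans hw.le)
        (fun v i => (natDegree_rndD _ _ _).trans hw.le) l j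
      have h2 : (n + 3) * (3 * (L + j)) ≤ (n + 3) * (3 * n + 1) := Nat.mul_le_mul_left _ (by omega)
      have h3 : (selPoly G I l j (eR e) (eθ e) (eY (L := L) e)).natDegree ≤ _ := this
      omega

end Test

end TreeProg

namespace TreeProg
open Data

/-! ### Random bits -/

/-- `N` random bits in front of the list `acc`. -/
noncomputable def bitsPMF : List Bool → ℕ → PMF (List Bool)
  | acc, 0 => PMF.pure acc
  | acc, N + 1 => (PMF.uniformOfFintype Bool).bind fun b => bitsPMF (b :: acc) N

/-- Bits are put in front of the list, so the first one drawn ends up last. -/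
theorem uniform_snoc (N : ℕ) : PMF.uniformOfFintype (Fin (N + 1) → Bool) =
    (PMF.uniformOfFintype Bool).bind fun b =>
      (PMF.uniformOfFintype (Fin N → Bool)).map fun f => Fin.snoc f b := by
  ext f
  rw [PMF.bind_apply, tsum_fintype, Finset.sum_eq_single (f (Fin.last N))]
  · rw [PMF.map_apply, tsum_fintype, Finset.sum_eq_single (Fin.init f)]
    · rw [if_pos (Fin.snoc_init_self f).symm]
      simp only [PMF.uniformOfFintype_apply, Fintype.card_pi, Fintype.card_bool,
        Finset.prod_const, Finset.card_univ, Fintype.card_fin]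
      rw [← ENNReal.mul_inv (by simp) (by simp)]
      push_cast
      rw [pow_succ, mul_comm]
    · intro g _ hg
      rw [if_neg]
      intro h
      have := congrArg Fin.init h
      rw [Fin.init_snoc] at this
      exact hg this.symm
    · simp
  · intro b _ hb
    rw [PMF.map_apply, ENNReal.tsum_eq_zero.2, mul_zero]
    intro g
    rw [if_neg]
    rintro rfl
    exact hb (by simp)
  · simp

theorem bitsPMF_eq (acc : List Bool) (N : ℕ) : bitsPMF acc N =
    (PMF.uniformOfFintype (Fin N → Bool)).map fun f => List.ofFn f ++ acc := by
  induction N generalizing acc with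
  | zero =>
    ext l
    rw [bitsPMF, PMF.map_apply, tsum_fintype]
    simp [PMF.pure_apply]
  | succ N ih =>
    rw [bitsPMF, uniform_snoc, PMF.map_bind]
    congr 1
    funext b
    rw [ih, PMF.map_comp]
    congr 1
    funext f
    simp only [Function.comp_apply]
    rw [List.ofFn_succ']
    simp

theorem bitsPMF_le_half {N : ℕ} {bad : List Bool → Prop}
    (h : 2 * {f : Fin N → Bool | bad (List.ofFn f)}.ncard ≤ 2 ^ N) :
    (bitsPMF [] N).toOuterMeasure {l | bad l} ≤ 1 / 2 := by
  classical
  rw [bitsPMF_eq, PMF.toOuterMeasure_map_apply, PMF.toOuterMeasure_uniformOfFintype_apply]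
  rw [← Nat.card_eq_fintype_card, Nat.card_coe_set_eq]
  have h1 : ((fun f : Fin N → Bool => List.ofFn f ++ []) ⁻¹' {l | bad l}) =
      {f : Fin N → Bool | bad (List.ofFn f)} := by
    ext f; simp
  rw [h1]
  simp only [Fintype.card_pi, Fintype.card_bool, Finset.prod_const, Finset.card_univ,
    Fintype.card_fin]
  rw [ENNReal.div_le_iff_le_mul (by simp) (by simp), one_div, mul_comm, ← div_eq_mul_inv,
    ENNReal.le_div_iff_mul_le (by simp) (by simp), mul_comm]
  exact_mod_cast h

/-! ### The random matrix of polynomials and its probability of failure -/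

section Matrix
open Polynomial

/-- The polynomial whose coefficients are given bits. -/
noncomputable def polyOf {w : ℕ} (v : Fin w → Bool) : (ZMod 2)[X] :=
  ∑ i, monomial i.1 (if v i then 1 else 0)

theorem coeff_polyOf {w : ℕ} (v : Fin w → Bool) (i : Fin w) :
    (polyOf v).coeff i = if v i then 1 else 0 := by
  rw [polyOf, finsetSum_coeff, Finset.sum_eq_single i]
  · simp
  · intro j _ hj
    rw [coeff_monomial, if_neg (fun h => hj (Fin.ext h))]
  · simp

theorem polyOf_injective (w : ℕ) : Function.Injective (polyOf : (Fin w → Bool) → _) := by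
  intro v v' h
  funext i
  have := congrArg (fun p => p.coeff i.1) h
  simp only [coeff_polyOf] at this
  cases hv : v i <;> cases hv' : v' i <;> simp_all

variable {n : ℕ}

/-- The index of an entry of the random matrix. -/
def posFin (u : Fin n) (c : ℕ) (hc : c < 2 * n + 1) : Fin (n * (2 * n + 1)) :=
  finProdFinEquiv (u, ⟨c, hc⟩)

theorem toPoly_rndD {e : Data} (hG : (eG e).len = n)
    {b : Fin (n * (2 * n + 1) * (n + 3)) → Bool} (hB : eB e = boolsD (List.ofFn b)) (u : Fin n)
    (c : ℕ) (hc : c < 2 * n + 1) : toPoly (rndD e (un u) (un c)) =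
      polyOf fun i => b (finProdFinEquiv (posFin u c hc, i)) := by
  have hw : (eW e).len = n + 3 := by rw [eW, len_cons, len_cons, len_cons, hG]
  ext i
  rw [coeff_toPoly]
  by_cases hi : i < n + 3
  · rw [coeff_polyOf _ ⟨i, hi⟩, rndD, cf_tab _ _ _ (by rw [hw]; exact hi), hB, nthD_eq, boolsD,
      toList_ofList, show nil = ofBool false from rfl, List.getD_map, bit_ofBool]
    have hlen : ((un i).appendD ((eW e).mulU ((un c).appendD
        ((cons (ofBool false) ((eG e).appendD (eG e))).mulU (un u))))).len =
        (finProdFinEquiv (posFin u c hc, (⟨i, hi⟩ : Fin (n + 3))) : ℕ) := by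
      simp [hw, hG, posFin, finProdFinEquiv]
      left; ring
    rw [hlen, List.getD_eq_getElem _ _ (by rw [List.length_ofFn]; exact Fin.is_lt _),
      List.getElem_ofFn]
  · rw [cf_eq_zero (by rw [rndD, len_tab, hw]; omega), polyOf, finsetSum_coeff,
      Finset.sum_eq_zero]
    intro j _
    rw [coeff_monomial, if_neg]
    have := j.2
    omega

/-- The environment with given data. -/
def mkEnv (g LU d : Data) (l : List Bool) : Data := cons g (cons LU (cons d (boolsD l)))

theorem bad_bits {G : SimpleGraph (Fin n)} {I : Finset (Fin n)}
    (hI : G.IsIndepSet (I : Set (Fin n))) {T₀ : Finset (Fin n) × Finset (Sym2 (Fin n))}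
    (hT₀ : IsTr T₀) (hG : ∀ e ∈ T₀.2, e ∈ G.edgeSet) (h2 : 2 ≤ T₀.1.card) {L : ℕ}
    (hL : (labelled I T₀).card = L) {g LU d : Data} (hg : g.len = n) :
    2 * {b : Fin (n * (2 * n + 1) * (n + 3)) → Bool |
      selPoly G I (leafs T₀).card (inner I T₀).card (eR (cons nil (mkEnv g LU d (List.ofFn b))))
        (eθ (cons nil (mkEnv g LU d (List.ofFn b))))
        (eY (L := L) (cons nil (mkEnv g LU d (List.ofFn b)))) = 0}.ncard ≤
      2 ^ (n * (2 * n + 1) * (n + 3)) := by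
  classical
  have hTn : T₀.1.card ≤ n := (Finset.card_le_univ _).trans (by simp)
  have hLn : L ≤ n := by
    rw [← hL]; exact (Finset.card_le_univ _).trans (by simp)
  -- Entries with `n + 3` random bits give `8 * 2 ^ n` polynomials, more than the `6 * n` that
  -- suffice.
  let S : Finset (ZMod 2)[X] := Finset.univ.image (polyOf : (Fin (n + 3) → Bool) → _)
  have hS : S.card = 2 ^ (n + 3) := by
    rw [Finset.card_image_of_injective _ (polyOf_injective _)]
    simp
  let iR : Fin n → Fin n → Fin (n * (2 * n + 1)) := fun u v => posFin u v (by omega)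
  let iθ : Fin n → Fin (n * (2 * n + 1)) := fun u => posFin u (2 * n) (by omega)
  let iY : Fin n → Fin L → Fin (n * (2 * n + 1)) := fun u i => posFin u (n + i) (by omega)
  have key := card_selPoly_eq_zero_le hI hT₀ hG h2 hL iR iθ iY (by
    intro R θ Y
    let f' : Fin n × Fin (2 * n + 1) → (ZMod 2)[X] := fun z =>
      if h : z.2.1 < n then R z.1 ⟨z.2.1, h⟩ else if z.2.1 = 2 * n then θ z.1 else
        if h' : z.2.1 - n < L then Y z.1 ⟨z.2.1 - n, h'⟩ else 0
    refine ⟨fun q => f' (finProdFinEquiv.symm q), ?_, ?_, ?_⟩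
    · intro u v
      simp [iR, posFin, f']
    · intro u
      simp only [iθ, posFin, Equiv.symm_apply_apply, f']
      rw [dif_neg (by omega), if_pos trivial]
    · intro u i
      have := i.2
      simp only [iY, posFin, Equiv.symm_apply_apply, f']
      rw [dif_neg (by omega), if_neg (by omega), dif_pos (by omega)]
      congr 1
      exact Fin.ext (by simp)) S (by
    rw [hS]
    have : n < 2 ^ n := Nat.lt_two_pow_self
    rw [pow_add]
    omega)
  rw [hS, ← pow_mul, show (n + 3) * (n * (2 * n + 1)) = n * (2 * n + 1) * (n + 3) by ring] at key
  refine le_trans (Nat.mul_le_mul_left 2 ?_) key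
  -- Cutting the bit string into blocks is injective, so bad bit strings are at most as many as bad
  -- matrices.
  let Φ : (Fin (n * (2 * n + 1) * (n + 3)) → Bool) → Fin (n * (2 * n + 1)) → (ZMod 2)[X] :=
    fun b q => polyOf fun i => b (finProdFinEquiv (q, i))
  have hΦ : Function.Injective Φ := by
    intro b b' h
    funext z
    have h1 := polyOf_injective _ (congrFun h (finProdFinEquiv.symm z).1)
    have h2 : b (finProdFinEquiv (finProdFinEquiv.symm z)) =
      b' (finProdFinEquiv (finProdFinEquiv.symm z)) := congrFun h1 (finProdFinEquiv.symm z).2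
    rwa [Equiv.apply_symm_apply] at h2
  refine (Set.ncard_le_ncard_of_injOn Φ ?_ hΦ.injOn (Finset.finite_toSet _)).trans_eq
    (Set.ncard_coe_finset _)
  intro b hb
  simp only [Finset.coe_filter, Fintype.mem_piFinset, Set.mem_ofPred_eq] at hb ⊢
  refine ⟨fun q => Finset.mem_image_of_mem _ (Finset.mem_univ _), ?_⟩
  rw [← hb]
  congr 1
  · funext u v
    exact (toPoly_rndD (e := cons nil (mkEnv g LU d (List.ofFn b))) hg rfl u v _).symm
  · funext u
    exact (toPoly_rndD (e := cons nil (mkEnv g LU d (List.ofFn b))) hg rfl u _ _).symm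
  · funext u i
    exact (toPoly_rndD (e := cons nil (mkEnv g LU d (List.ofFn b))) hg rfl u _ _).symm

end Matrix

/-! ### The number of inner vertices in a random independent set -/

/-- Let `m` be the size of `W`. The expected size of the intersection is at least `p m`. If every
value from `p m - 1` on had probability below `1 / (m + 1) ^ 2`, these values would contribute less
than one to the expectation and the smaller ones at most `p m - 1`, a contradiction. -/
theorem exists_likely_card {Ω V : Type} [Fintype Ω] [DecidableEq V] (w : Ω → ℝ) (hw : ∀ ω, 0 ≤ w ω)
    (hw1 : ∑ ω, w ω = 1) (W : Finset V) (S : Ω → Finset V) (p : ℝ)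
    (hp : ∀ v ∈ W, p ≤ ∑ ω, if v ∈ S ω then w ω else 0) :
    ∃ j ≤ W.card, p * W.card - 1 ≤ j ∧
      1 / ((W.card : ℝ) + 1) ^ 2 ≤ ∑ ω, if (W ∩ S ω).card = j then w ω else 0 := by
  set m := W.card with hm
  set Pr : ℕ → ℝ := fun j => ∑ ω, if (W ∩ S ω).card = j then w ω else 0 with hPr
  have hPr0 : ∀ j, 0 ≤ Pr j := fun j => Finset.sum_nonneg fun ω _ => by
    split_ifs
    · exact hw ω
    · exact le_rfl
  have hXm : ∀ ω, (W ∩ S ω).card ∈ Finset.range (m + 1) := fun ω => by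
    rw [Finset.mem_range, Nat.lt_succ_iff]; exact Finset.card_le_card Finset.inter_subset_left
  have hsum1 : ∑ j ∈ Finset.range (m + 1), Pr j = 1 := by
    rw [hPr, Finset.sum_comm, ← hw1]
    refine Finset.sum_congr rfl fun ω _ => ?_
    rw [Finset.sum_ite_eq, if_pos (hXm ω)]
  have hE : p * m ≤ ∑ j ∈ Finset.range (m + 1), j * Pr j := by
    have h1 : ∑ j ∈ Finset.range (m + 1), (j : ℝ) * Pr j = ∑ ω, w ω * (W ∩ S ω).card := by
      simp only [hPr, Finset.mul_sum]
      rw [Finset.sum_comm]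
      refine Finset.sum_congr rfl fun ω _ => ?_
      simp only [mul_ite, mul_zero]
      rw [Finset.sum_ite_eq, if_pos (hXm ω), mul_comm]
    have h2 : ∑ ω, w ω * ((W ∩ S ω).card : ℝ) = ∑ v ∈ W, ∑ ω, if v ∈ S ω then w ω else 0 := by
      rw [Finset.sum_comm]
      refine Finset.sum_congr rfl fun ω _ => ?_
      rw [← Finset.sum_filter, Finset.filter_mem_eq_inter, Finset.sum_const, nsmul_eq_mul, mul_comm]
    rw [h1, h2]
    calc p * m = ∑ v ∈ W, p := by rw [Finset.sum_const, nsmul_eq_mul, mul_comm]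
      _ ≤ _ := Finset.sum_le_sum hp
  by_contra hcon
  push Not at hcon
  have hm0 : (0 : ℝ) < (m : ℝ) + 1 := by positivity
  have hlt : ∀ j ∈ Finset.range (m + 1), p * m - 1 ≤ j → Pr j < 1 / ((m : ℝ) + 1) ^ 2 :=
    fun j hj hpj => hcon j (by simpa [Nat.lt_succ_iff] using hj) hpj
  -- Here `p m - 1` is negative, so it cannot be multiplied with the inequalities; but then every
  -- value is large enough, and the total mass would be less than one.
  by_cases hpm : p * m < 1
  · have h1 : ∑ j ∈ Finset.range (m + 1), Pr j < ∑ j ∈ Finset.range (m + 1), 1 / ((m : ℝ) + 1) ^ 2 :=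
      Finset.sum_lt_sum_of_nonempty ⟨0, by simp⟩ fun j hj => hlt j hj (by
        have : (0 : ℝ) ≤ j := by positivity
        linarith)
    rw [hsum1, Finset.sum_const, Finset.card_range, nsmul_eq_mul] at h1
    have h2 : ((m + 1 : ℕ) : ℝ) * (1 / ((m : ℝ) + 1) ^ 2) = 1 / ((m : ℝ) + 1) := by
      push_cast; field_simp
    rw [h2, lt_div_iff₀ hm0] at h1
    have : (0 : ℝ) ≤ m := by positivity
    linarith
  · push Not at hpm
    have h1 : ∑ j ∈ Finset.range (m + 1), (j : ℝ) * Pr j ≤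
        ∑ j ∈ Finset.range (m + 1), ((p * m - 1) * Pr j + m * (1 / ((m : ℝ) + 1) ^ 2)) := by
      refine Finset.sum_le_sum fun j hj => ?_
      have hjm : (j : ℝ) ≤ m := by
        have := Finset.mem_range.1 hj
        exact_mod_cast Nat.lt_succ_iff.1 this
      have h3 : 0 ≤ (m : ℝ) * (1 / ((m : ℝ) + 1) ^ 2) := by positivity
      by_cases hj' : p * m - 1 ≤ j
      · have h4 := (hlt j hj hj').le
        have h5 : (j : ℝ) * Pr j ≤ m * (1 / ((m : ℝ) + 1) ^ 2) :=
          mul_le_mul hjm h4 (hPr0 j) (by positivity)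
        have h6 := mul_nonneg (by linarith : 0 ≤ p * m - 1) (hPr0 j)
        linarith
      · push Not at hj'
        have := mul_le_mul_of_nonneg_right hj'.le (hPr0 j)
        linarith
    rw [Finset.sum_add_distrib, ← Finset.mul_sum, hsum1, Finset.sum_const, Finset.card_range,
      nsmul_eq_mul] at h1
    have h2 : ((m + 1 : ℕ) : ℝ) * (m * (1 / ((m : ℝ) + 1) ^ 2)) < 1 := by
      have : ((m + 1 : ℕ) : ℝ) * (m * (1 / ((m : ℝ) + 1) ^ 2)) = m / ((m : ℝ) + 1) := by
        push_cast; field_simp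
      rw [this, div_lt_one hm0]
      linarith
    linarith

end TreeProg

/-! ### Randomized procedures with polynomial space and an exponential factor in the time -/

namespace TreeProg
open Data

/-! ### Randomized functions computed in polynomial space -/

/-- On the inputs satisfying `D`, the law `K x` can be sampled in polynomial space and in time `E x`
up to a polynomial factor. -/
def RT (D : Data → Prop) (K : Data → PMF Data) (E : Data → ℕ) : Prop :=
  ∃ q : Polynomial ℕ, Impl (fun x μ T S => D x ∧ μ = K x ∧ q.eval x.size * E x ≤ T ∧
    q.eval x.size ≤ S) ∧ ∀ x, D x → 1 ≤ E x ∧ ∀ y ∈ (K x).support, y.size ≤ q.eval x.size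

theorem PT.rt {f : Data → Data} (hf : PT f) : RT (fun _ => True) (fun x => PMF.pure (f x))
    fun _ => 1 := by
  obtain ⟨q, hq, hq'⟩ := hf
  refine ⟨q, hq.mono ?_, fun x _ => ⟨le_rfl, fun y hy => ?_⟩⟩
  · rintro x μ T S ⟨-, rfl, hT, hS⟩
    exact ⟨T, S, ⟨rfl, by simpa using hT, hS⟩, le_rfl, le_rfl⟩
  · rw [PMF.mem_support_pure_iff] at hy
    subst hy; exact hq' x

theorem RT.congr {D D' : Data → Prop} {K K' : Data → PMF Data} {E E' : Data → ℕ} (h : RT D K E)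
    (H : ∀ x, D' x → D x ∧ K x = K' x ∧ E x ≤ E' x) : RT D' K' E' := by
  obtain ⟨q, hq, hq'⟩ := h
  refine ⟨q, hq.mono ?_, fun x hx => ?_⟩
  · rintro x μ T S ⟨hx, rfl, hT, hS⟩
    obtain ⟨h1, h2, h3⟩ := H x hx
    exact ⟨T, S, ⟨h1, h2.symm, (Nat.mul_le_mul_left _ h3).trans hT, hS⟩, le_rfl, le_rfl⟩
  · obtain ⟨h1, h2, h3⟩ := H x hx
    rw [← h2]
    exact ⟨(hq' x h1).1.trans h3, (hq' x h1).2⟩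

theorem RT.bind {D D' : Data → Prop} {K K' : Data → PMF Data} {E E' F : Data → ℕ} (h : RT D K E)
    (h' : RT D' K' E') (H : ∀ x, D x → E x ≤ F x ∧ ∀ y ∈ (K x).support, D' y ∧ E' y ≤ F x) :
    RT D (fun x => (K x).bind K') F := by
  obtain ⟨p, hp, hp'⟩ := h
  obtain ⟨q, hq, hq'⟩ := h'
  refine ⟨p + q.comp p + Polynomial.X + p + 1, (hp.seq hq).mono ?_, fun x hx => ?_⟩
  · rintro x μ T S ⟨hx, rfl, hT, hS⟩
    obtain ⟨h1, h2⟩ := H x hx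
    obtain ⟨h3, h4⟩ := hp' x hx
    simp only [Polynomial.eval_add, Polynomial.eval_comp, Polynomial.eval_X,
      Polynomial.eval_one] at hT hS
    have h5 : p.eval x.size * E x ≤ p.eval x.size * F x := Nat.mul_le_mul_left _ h1
    have h6 : 1 ≤ F x := h3.trans h1
    simp only [add_mul, one_mul] at hT
    refine ⟨T, S, ⟨K x, K', p.eval x.size * E x, q.eval (p.eval x.size) * F x, p.eval x.size,
      ⟨hx, rfl, le_rfl, le_rfl⟩, by omega, fun y hy => ?_, rfl, by omega⟩, le_rfl, le_rfl⟩
    obtain ⟨h7, h8⟩ := h2 y hy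
    have h9 := h4 y hy
    have h10 := eval_mono q h9
    exact ⟨q.eval (p.eval x.size), ⟨h7, rfl, Nat.mul_le_mul h10 h8, h10⟩, by omega⟩
  · obtain ⟨h1, h2⟩ := H x hx
    obtain ⟨h3, h4⟩ := hp' x hx
    refine ⟨h3.trans h1, fun z hz => ?_⟩
    rw [PMF.mem_support_bind_iff] at hz
    obtain ⟨y, hy, hz⟩ := hz
    have h5 := (hq' y (h2 y hy).1).2 z hz
    have h6 := eval_mono q (h4 y hy)
    simp only [Polynomial.eval_add, Polynomial.eval_comp, Polynomial.eval_X, Polynomial.eval_one]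
    omega

theorem RT.keep {D : Data → Prop} {K : Data → PMF Data} {E : Data → ℕ} (h : RT D K E) :
    RT D (fun x => (K x).map (Data.cons x)) E := by
  obtain ⟨p, hp, hp'⟩ := h
  refine ⟨10 * p + 10 * Polynomial.X + 30, hp.keep.mono ?_, fun x hx => ⟨(hp' x hx).1, ?_⟩⟩
  · rintro x μ T S ⟨hx, rfl, hT, hS⟩
    obtain ⟨h3, h4⟩ := hp' x hx
    simp only [Polynomial.eval_add, Polynomial.eval_mul, Polynomial.eval_ofNat,
      Polynomial.eval_X] at hT hS
    refine ⟨T, S, ⟨K x, p.eval x.size * E x, p.eval x.size, p.eval x.size,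
      ⟨hx, rfl, le_rfl, le_rfl⟩, h4, rfl, ?_, by omega⟩, le_rfl, le_rfl⟩
    have h5 : x.size * 1 ≤ x.size * E x := Nat.mul_le_mul_left _ h3
    have h6 : p.eval x.size * 1 ≤ p.eval x.size * E x := Nat.mul_le_mul_left _ h3
    simp only [add_mul, mul_assoc] at hT
    omega
  · intro z hz
    rw [PMF.mem_support_map_iff] at hz
    obtain ⟨y, hy, rfl⟩ := hz
    have := (hp' x hx).2 y hy
    simp only [Polynomial.eval_add, Polynomial.eval_mul, Polynomial.eval_ofNat, Polynomial.eval_X,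
      Data.size]
    omega

/-- Run `K` on `f x` and combine the outcome with `x`. -/
theorem RT.keep_pt {D D' : Data → Prop} {K : Data → PMF Data} {E : Data → ℕ} (h : RT D K E)
    {f : Data → Data} (hf : PT f) (H : ∀ x, D' x → D (f x)) :
    RT D' (fun x => (K (f x)).map (Data.cons x)) fun x => E (f x) := by
  have h1 : RT D' (fun x => (PMF.pure (f x)).bind K) fun x => E (f x) := by
    refine (hf.rt.congr (E' := fun _ => 1) fun x _ => ⟨trivial, rfl, le_rfl⟩).bind h fun x hx => ?_
    have h2 := H x hx
    refine ⟨?_, fun y hy => ?_⟩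
    · obtain ⟨q, -, hq⟩ := h
      exact (hq _ h2).1
    · rw [PMF.mem_support_pure_iff] at hy
      subst hy; exact ⟨h2, le_rfl⟩
  simp only [PMF.pure_bind] at h1
  exact h1.keep

theorem RT.flip : RT (fun _ => True)
    (fun x => (PMF.uniformOfFintype Bool).map fun b => Data.cons (Data.ofBool b) x) fun _ => 1 := by
  refine ⟨2 * Polynomial.X + 20, Impl.flip.mono ?_, fun x _ => ⟨le_rfl, fun y hy => ?_⟩⟩
  · rintro x μ T S ⟨-, rfl, hT, hS⟩
    simp only [Polynomial.eval_add, Polynomial.eval_mul, Polynomial.eval_ofNat, Polynomial.eval_X,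
      mul_one] at hT hS
    exact ⟨T, S, ⟨rfl, by omega, by omega⟩, le_rfl, le_rfl⟩
  · rw [PMF.mem_support_map_iff] at hy
    obtain ⟨b, -, rfl⟩ := hy
    have := size_ofBool_le b
    simp only [Polynomial.eval_add, Polynomial.eval_mul, Polynomial.eval_ofNat, Polynomial.eval_X,
      Data.size]
    omega

theorem support_iterK {K : Data → PMF Data} {P : ℕ → Data → Prop}
    (hP : ∀ m y, P m y → y.hd ≠ nil → ∃ m', m = m' + 1 ∧ ∀ z ∈ (K y).support, P m' z) (n : ℕ) :
    ∀ x, P n x → ∀ z ∈ (iterK K n x).support, ∃ m, P m z := by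
  induction n with
  | zero =>
    intro x hx z hz
    rw [iterK, PMF.mem_support_pure_iff] at hz
    exact ⟨0, hz ▸ hx⟩
  | succ n ih =>
    intro x hx z hz
    rw [iterK] at hz
    split_ifs at hz with h
    · rw [PMF.mem_support_pure_iff] at hz
      exact ⟨_, hz ▸ hx⟩
    · rw [PMF.mem_support_bind_iff] at hz
      obtain ⟨y, hy, hz⟩ := hz
      obtain ⟨m', h1, h2⟩ := hP _ x hx h
      have : m' = n := by omega
      subst this
      exact ih y (h2 y hy) z hz

/-- `F x` is the exponential factor of one pass and `E₀ x` that of the loop; `hF` balances the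
number of passes against both. This covers many cheap passes, as in `RT.loop`, and few expensive
ones, as in `RT.rounds`. -/
theorem RT.while {D D₀ : Data → Prop} {K : Data → PMF Data} {E E₀ : Data → ℕ} (h : RT D K E)
    (cnt F : Data → ℕ) (s r : Polynomial ℕ) (H : ∀ x, D₀ x → ∃ P : ℕ → Data → Prop, P (cnt x) x ∧
      ∀ m y, P m y → y.size ≤ s.eval x.size ∧ (y.hd ≠ nil → ∃ m', m = m' + 1 ∧ D y ∧ E y ≤ F x ∧
        ∀ z ∈ (K y).support, P m' z))
    (hF : ∀ x, D₀ x → 1 ≤ F x ∧ (cnt x + 1) * F x ≤ r.eval x.size * E₀ x) (hE : ∀ x, D₀ x → 1 ≤ E₀ x) :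
    RT D₀ (fun x => iterK K (cnt x) x) E₀ := by
  obtain ⟨q, hq, hq'⟩ := h
  refine ⟨r * (2 * q.comp s + s + 20) + 4 * (s + q.comp s), hq.while.mono ?_, fun x hx =>
    ⟨hE x hx, ?_⟩⟩
  · rintro x μ T S ⟨hx, rfl, hT, hS⟩
    obtain ⟨P, hP, hP'⟩ := H x hx
    simp only [Polynomial.eval_add, Polynomial.eval_mul, Polynomial.eval_ofNat,
      Polynomial.eval_comp] at hT hS
    refine ⟨_, _, ⟨P, K, q.eval (s.eval x.size) * F x, s.eval x.size + q.eval (s.eval x.size),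
      cnt x, hP, ?_, rfl, le_rfl, le_rfl⟩, ?_, by omega⟩
    · intro m y hy
      obtain ⟨h1, h2⟩ := hP' m y hy
      refine ⟨by omega, fun h3 => ?_⟩
      obtain ⟨m', h4, h5, h6, h7⟩ := h2 h3
      have h8 := eval_mono q h1
      exact ⟨m', h4, ⟨h5, rfl, Nat.mul_le_mul h8 h6, by omega⟩, h7⟩
    · obtain ⟨h1, h2⟩ := hF x hx
      refine le_trans ?_ ((Nat.mul_le_mul_right (E₀ x) (Nat.le_add_right _ _)).trans hT)
      generalize q.eval (s.eval x.size) = Q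
      generalize s.eval x.size = W
      calc (cnt x + 1) * (Q * F x + (W + Q) + 20)
          ≤ (cnt x + 1) * (Q * F x + (W + Q) * F x + 20 * F x) := by
            gcongr
            · exact Nat.le_mul_of_pos_right _ h1
            · omega
        _ = ((cnt x + 1) * F x) * (2 * Q + W + 20) := by ring
        _ ≤ (r.eval x.size * E₀ x) * (2 * Q + W + 20) := Nat.mul_le_mul_right _ h2
        _ = _ := by ring
  · intro z hz
    obtain ⟨P, hP, hP'⟩ := H x hx
    obtain ⟨m, hm⟩ := support_iterK (K := K) (P := P) (fun m y hy h0 => by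
      obtain ⟨m', h1, -, -, h2⟩ := (hP' m y hy).2 h0
      exact ⟨m', h1, h2⟩) _ x hP z hz
    have := (hP' m z hm).1
    simp only [Polynomial.eval_add, Polynomial.eval_mul, Polynomial.eval_ofNat,
      Polynomial.eval_comp]
    omega

/-- A program without bound on the space, on inputs on which it runs in polynomial time. -/
theorem RT.program (P : Program) (D : Data → Prop) (q : Polynomial ℕ)
    (h : ∀ x, D x → P.RunsInTime x ((q.eval x.size : ℕ) : ℝ)) :
    ∃ K : Data → PMF Data, RT D K (fun _ => 1) ∧
      ∀ x, D x → ∀ E, P.prob x E = (K x).toOuterMeasure E := by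
  have key : ∀ x, ∃ μ : PMF (Store P.Var), D x →
      Halts (x.size + Fintype.card P.Var + 3 * q.eval x.size)
        (x.size + Fintype.card P.Var + 3 * q.eval x.size) (P.init x) μ ∧
      ∀ s ∈ μ.support, storeSize s ≤ x.size + Fintype.card P.Var + 3 * q.eval x.size := by
    intro x
    by_cases hx : D x
    · have hs : storeSize (P.initStore x) ≤ x.size + Fintype.card P.Var := by
        have h1 := storeSize_update (fun _ : P.Var => Data.nil) P.input x
        have h2 : storeSize (fun _ : P.Var => Data.nil) = Fintype.card P.Var := by
          simp [storeSize, Data.size]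
        rw [Program.initStore]
        omega
      obtain ⟨μ, h1, h2⟩ := exists_halts (T := q.eval x.size) (S₀ := x.size + Fintype.card P.Var)
        (c₀ := P.init x) (fun m c hc => by
          rw [← law_eq_lawFrom] at hc
          exact_mod_cast h x hx m c hc) (by simp only [Program.init]; omega)
          (by simp only [Program.init]; omega)
      exact ⟨μ, fun _ => ⟨h1.mono (by omega) le_rfl, h2⟩⟩
    -- A dummy law: nothing is claimed outside `D`.
    · exact ⟨PMF.pure fun _ => Data.nil, fun h' => absurd h' hx⟩
  choose μ hμ using key
  obtain ⟨C, hC⟩ := Impl.program P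
  refine ⟨fun x => (μ x).map fun s => s P.output, ⟨(Polynomial.C C + 10) * (Polynomial.X +
    Polynomial.C (Fintype.card P.Var) + 3 * q + 1), hC.mono ?_, fun x hx => ⟨le_rfl, ?_⟩⟩, ?_⟩
  · rintro x μ' T S ⟨hx, rfl, hT, hS⟩
    obtain ⟨h1, h2⟩ := hμ x hx
    simp only [Polynomial.eval_add, Polynomial.eval_mul, Polynomial.eval_ofNat, Polynomial.eval_X,
      Polynomial.eval_C, Polynomial.eval_one, mul_one, add_mul] at hT hS
    refine ⟨_, _, ⟨μ x, _, h1, h2, rfl, by omega, le_rfl, le_rfl⟩, ?_, ?_⟩ <;> omega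
  · intro y hy
    rw [PMF.mem_support_map_iff] at hy
    obtain ⟨s, hs, rfl⟩ := hy
    have h1 := (hμ x hx).2 s hs
    have h2 := size_le_storeSize s P.output
    simp only [Polynomial.eval_add, Polynomial.eval_mul, Polynomial.eval_ofNat, Polynomial.eval_X,
      Polynomial.eval_C, Polynomial.eval_one, add_mul]
    omega
  · intro x hx E
    rw [(hμ x hx).1.prob_eq, PMF.toOuterMeasure_map_apply]
    rfl

end TreeProg

namespace TreeProg
open Data

/-! ### Numbers in binary -/

/-- The number with given binary digits. -/
noncomputable def Data.valB (d : Data) : ℕ :=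
  d.toList.foldr (fun b v => 2 * v + if b = nil then 0 else 1) 0

theorem valB_ofNat (n : ℕ) : (ofNat n).valB = n := by
  induction n using Nat.strong_induction_on with
  | _ n ih =>
  rcases Nat.even_or_odd' n with ⟨c, rfl | rfl⟩
  · rcases Nat.eq_zero_or_pos c with rfl | hc
    · simp [ofNat, valB, ofList]
    · have h := ih c (by omega)
      rw [ofNat, valB, toList_ofList] at h ⊢
      rw [Nat.bit0_bits c (by omega), List.map_cons, List.foldr_cons, h]
      simp [ofBool]
  · have h := ih c (by omega)
    rw [ofNat, valB, toList_ofList] at h ⊢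
    rw [Nat.bit1_bits c, List.map_cons, List.foldr_cons, h]
    simp [ofBool]

theorem size_un_le (n : ℕ) (d : Data) (h : n ≤ d.len) : (un n).size ≤ 2 * d.size := by
  have := len_lt_size d
  rw [size_un]; omega

@[fun_prop]
theorem PT.minU {f g : Data → Data} (hf : PT f) (hg : PT g) :
    PT fun x => un (min (f x).len (g x).len) := by
  have h : PT fun x => Data.tab ((f x).dropD ((f x).dropD (g x))) fun _ => nil := by fun_prop
  have e : ∀ d i : Data, (d.dropD i).len = d.len - i.len := fun d i => by simp [Data.dropD, len]
  have e2 : ∀ a b : ℕ, a - (a - b) = min a b := by omega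
  simpa only [tab_nil, e, e2] using h

/-- Conversion from binary to unary, truncated at the length of `c`. -/
noncomputable def Data.binU (c d : Data) : Data := un (min c.len d.valB)

-- Horner's rule from the most significant digit. The value is truncated after each digit, since in
-- unary it would otherwise double in size each time.
@[fun_prop]
theorem PT.binU {f g : Data → Data} (hf : PT f) (hg : PT g) :
    PT fun x => (f x).binU (g x) := by
  have h : PT fun x => (g x).revD.toList.foldl (fun acc b => un (min (f x).len
      ((acc.appendD acc).appendD (if b = nil then nil else tt)).len)) nil := by
    obtain ⟨q, hq⟩ := hf.bound
    refine PT.foldl_of_bounded (g := fun x acc b => un (min (f x).len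
      ((acc.appendD acc).appendD (if b = nil then nil else tt)).len)) ?_ (by fun_prop)
      (by fun_prop) ⟨2 * q, fun x acc b => ?_⟩
    · have := hf.comp (f := Data.hd) (by fun_prop)
      fun_prop
    · refine (size_un_le _ (f x) (min_le_left _ _)).trans ?_
      simpa using hq x
  have e : ∀ x, (g x).revD.toList.foldl (fun acc b => un (min (f x).len
      ((acc.appendD acc).appendD (if b = nil then nil else tt)).len)) nil = (f x).binU (g x) := by
    intro x
    rw [Data.revD, toList_ofList, List.foldl_reverse, Data.binU, valB]
    induction (g x).toList with
    | nil => simp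
    | cons b l ih =>
      rw [List.foldr_cons, List.foldr_cons, ih]
      congr 1
      simp only [len_appendD, len_un]
      split_ifs <;> simp only [len_nil, tt, len_cons] <;> omega
  simpa only [e] using h

/-- The list `l`, repeated as many times as `c` has entries. -/
def Data.repD (c l : Data) : Data := ofList (List.replicate c.len l.toList).flatten

@[fun_prop]
theorem PT.repD {f g : Data → Data} (hf : PT f) (hg : PT g) :
    PT fun x => (f x).repD (g x) := by
  have key : ∀ (l : List Data) (b : Data), l.foldl (fun acc _ => acc.appendD b) nil =
      ofList (List.replicate l.length b.toList).flatten := by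
    intro l b
    induction l using List.reverseRecOn with
    | nil => rfl
    | append_singleton l a ih =>
      rw [List.foldl_append, ih, List.foldl_cons, List.foldl_nil, List.length_append,
        List.length_singleton, List.replicate_succ', List.flatten_append]
      simp [Data.appendD]
  have h : PT fun x => (f x).toList.foldl (fun acc _ => acc.appendD (g x)) nil := by
    obtain ⟨q, hq⟩ := hf.bound
    obtain ⟨r, hr⟩ := hg.bound
    refine PT.foldl (g := fun x acc _ => acc.appendD (g x)) ?_ (by fun_prop) hf
      ⟨q * r + 1, fun x l' hl' => ?_⟩
    · have := hg.comp (f := Data.hd) (by fun_prop)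
      fun_prop
    · rw [key, size_ofList, List.map_flatten, List.map_replicate, List.sum_flatten,
        List.map_replicate, List.sum_replicate]
      have h1 := size_ofList (g x).toList
      rw [ofList_toList] at h1
      have h2 := hl'.length_le
      have h3 := length_toList_lt (f x)
      have h4 := hq x
      have h5 := hr x
      simp only [Polynomial.eval_add, Polynomial.eval_mul, Polynomial.eval_one, smul_eq_mul]
      gcongr <;> omega
  simp only [key] at h
  exact h

theorem PT.posD : PT fun x => TreeProg.posD x.hd x.tl.hd x.tl.tl := by
  unfold TreeProg.posD
  fun_prop

@[fun_prop]
theorem PT.posD' {e j l : Data → Data} (he : PT e) (hj : PT j) (hl : PT l) :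
    PT fun x => TreeProg.posD (e x) (j x) (l x) := PT.comp₃ PT.posD he hj hl

@[fun_prop]
theorem PT.testD {e j l a : Data → Data} (he : PT e) (hj : PT j) (hl : PT l) (ha : PT a) :
    PT fun x => TreeProg.testD (e x) (j x) (l x) (a x) := by
  have h : PT fun x => TreeProg.testD x.hd x.tl.hd x.tl.tl.hd x.tl.tl.tl := by
    unfold TreeProg.testD
    refine PT.foldU (g := fun x t i => if x.tl.tl.tl.nthD ((TreeProg.posD x.hd x.tl.hd
      x.tl.tl.hd).appendD i) = nil then (if t = nil then nil else tt) else tt) ?_ (by fun_prop)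
      (by fun_prop) ⟨3, fun x acc b => ?_⟩
    · fun_prop
    · split_ifs <;> simp [size, tt]
  exact h.comp (f := fun x => Data.cons (e x) (Data.cons (j x) (Data.cons (l x) (a x))))
    (he.cons (hj.cons (hl.cons ha)))

@[fun_prop]
theorem PT.loopInit {f : Data → Data} (hf : PT f) : PT fun x => TreeProg.loopInit (f x) := by
  unfold TreeProg.loopInit
  fun_prop

/-! ### Sampling random bits -/

/-- The head is a unary counter that also guards the loop; the tail holds the bits drawn so far. -/
noncomputable def sampleStep (y : Data) : PMF Data :=
  (PMF.uniformOfFintype Bool).map fun b => cons y.hd.tl (cons (ofBool b) y.tl)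

theorem iterK_sampleStep (N : ℕ) (c : Data) (hc : c.len = N) (acc : List Bool) :
    iterK sampleStep N (cons c (boolsD acc)) =
      (bitsPMF acc N).map fun l => cons nil (boolsD l) := by
  induction N generalizing c acc with
  | zero =>
    cases c with
    | nil => rw [iterK, bitsPMF, PMF.pure_map]
    | cons a c => simp at hc
  | succ N ih =>
    cases c with
    | nil => simp at hc
    | cons a c =>
      rw [iterK, if_neg (by simp [Data.hd]), bitsPMF, PMF.map_bind, sampleStep, PMF.bind_map]
      refine congrArg₂ _ rfl (funext fun b => ?_)
      exact ih c (by simpa using hc) (b :: acc)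

theorem RT.bits : RT (fun _ => True) (fun x => (bitsPMF [] x.len).map boolsD) fun _ => 1 := by
  have h1 : RT (fun _ => True) sampleStep fun _ => 1 := by
    have h : PT fun z => cons z.tl.hd.tl (cons z.hd z.tl.tl) := by fun_prop
    refine (RT.flip.bind (F := fun _ => 1) h.rt fun x _ => ⟨le_rfl, fun _ _ =>
      ⟨trivial, le_rfl⟩⟩).congr fun x _ => ⟨trivial, ?_, le_rfl⟩
    rw [PMF.bind_map]
    rfl
  have h2 : RT (fun y => y.tl = nil) (fun y => iterK sampleStep y.hd.len y) fun _ => 1 := by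
    refine h1.while (fun y => y.hd.len) (fun _ => 1) (6 * Polynomial.X) (Polynomial.X + 1)
      -- A pass adds at most four nodes, hence the credit of four for each pass that remains.
      (fun x _ => ⟨fun m y => y.hd.len = m ∧ y.size + 4 * m ≤ x.size + 4 * x.hd.len,
        ⟨rfl, le_rfl⟩, ?_⟩) (fun x _ => ⟨le_rfl, ?_⟩) fun _ _ => le_rfl
    · rintro m y ⟨hm, hy⟩
      have hx := len_lt_size x.hd
      have hx' := x.size_hd_le
      refine ⟨by simp; omega, fun h0 => ?_⟩
      rcases y with _ | ⟨_ | ⟨a, c⟩, r⟩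
      · exact absurd rfl h0
      · exact absurd rfl h0
      · simp only [Data.hd, len_cons] at hm
        refine ⟨c.len, hm.symm, trivial, le_rfl, fun z hz => ?_⟩
        rw [sampleStep, PMF.mem_support_map_iff] at hz
        obtain ⟨b, -, rfl⟩ := hz
        refine ⟨rfl, le_trans ?_ hy⟩
        have := size_ofBool_le b
        have := a.size_pos
        simp only [size, Data.hd, Data.tl]
        omega
    · have hx := len_lt_size x.hd
      have hx' := x.size_hd_le
      simp; omega
  have h3 : PT fun x => cons x nil := by fun_prop
  have h4 : RT (fun _ => True) (fun x => ((PMF.pure (cons x nil)).bind fun y =>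
      iterK sampleStep y.hd.len y).bind fun y => PMF.pure y.tl) fun _ => 1 :=
    (h3.rt.bind h2 fun x _ => ⟨le_rfl, fun y hy => by
      rw [PMF.mem_support_pure_iff] at hy
      subst hy; exact ⟨rfl, le_rfl⟩⟩).bind (PT.tl PT.id).rt fun x _ => ⟨le_rfl, fun _ _ =>
        ⟨trivial, le_rfl⟩⟩
  refine h4.congr fun x _ => ⟨trivial, ?_, le_rfl⟩
  rw [PMF.pure_bind]
  have h5 := iterK_sampleStep x.len x rfl []
  simp only [boolsD, List.map_nil, ofList] at h5
  rw [show (cons x nil).hd.len = x.len from rfl, h5, PMF.bind_map]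
  rfl

/-! ### The loop over all sets of labels as a program -/

theorem iterK_pure (f : Data → Data) (n : ℕ) : ∀ x, (∀ i < n, (f^[i] x).hd ≠ nil) →
    iterK (fun y => PMF.pure (f y)) n x = PMF.pure (f^[n] x) := by
  induction n with
  | zero => intro x _; rfl
  | succ n ih =>
    intro x hx
    have h0 : x.hd ≠ nil := hx 0 (by omega)
    rw [iterK, if_neg h0, PMF.pure_bind, ih _ fun i hi => hx (i + 1) (by omega)]
    rfl

/-- The number of passes through the loop. -/
noncomputable def loopCount (x : Data) : ℕ := if x = nil then 0 else 2 ^ x.hd.hd.len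

theorem loopCount_loopInit (ev : Data) :
    loopCount (loopInit ev) = 2 ^ (eL (cons nil ev)).len := by
  rw [loopCount, if_neg (by simp [loopInit])]
  simp [loopInit, Data.hd]

theorem size_boolsD (l : List Bool) : (boolsD l).size ≤ 4 * l.length + 1 := by
  induction l with
  | nil => simp [boolsD, ofList, size]
  | cons b l ih =>
    have := size_ofBool_le b
    simp only [boolsD, List.map_cons, ofList, size, List.length_cons] at ih ⊢
    omega

/-- The input `nil` stands for a round that is skipped. It makes the loop end at once, so that no
exponential cost arises. -/
theorem RT.loop : RT (fun x => x = nil ∨ ∃ ev, x = loopInit ev)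
    (fun x => PMF.pure (loopStep^[loopCount x] x)) fun x => loopCount x + 1 := by
  have hd : PT fun x => dD (cons nil x.tl.tl) := by fun_prop
  obtain ⟨d, hd⟩ := hd.bound
  have key : ∀ ev i, i ≤ 2 ^ (eL (cons nil ev)).len → (loopStep^[i] (loopInit ev)).size ≤
      4 * d.eval (loopInit ev).size + 5 * (loopInit ev).size + 10 ∧
      ((loopStep^[i] (loopInit ev)).hd ≠ nil ↔ i < 2 ^ (eL (cons nil ev)).len) := by
    intro ev i hi
    obtain ⟨acc, h1, h2, -⟩ := loopStep_iterate ev i hi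
    rw [h1]
    have h3 : (dD (cons nil ev)).size ≤ _ := hd (loopInit ev)
    have h4 := len_lt_size (eL (cons nil ev))
    have h5 : (eL (cons nil ev)).size ≤ ev.size :=
      (Data.size_hd_le _).trans (Data.size_tl_le _)
    have h6 : ev.size ≤ (loopInit ev).size := by
      simp only [loopInit, size]; omega
    have h7 := size_boolsD (bitsL (eL (cons nil ev)).len i)
    rw [length_bitsL] at h7
    constructor
    · split_ifs <;> simp only [size] <;> omega
    · split_ifs with h <;> simp [h, Data.hd]
  have h1 := PT.loopStep.rt.while (D₀ := fun x => x = nil ∨ ∃ ev, x = loopInit ev)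
    (E₀ := fun x => loopCount x + 1) loopCount (fun _ => 1) (4 * d + 5 * Polynomial.X + 10) 1 (by
      rintro x hx
      refine ⟨fun m y => ∃ i, i + m = loopCount x ∧ y = loopStep^[i] x, ⟨0, by simp, rfl⟩, ?_⟩
      rintro m y ⟨i, hi, rfl⟩
      simp only [Polynomial.eval_add, Polynomial.eval_mul, Polynomial.eval_ofNat, Polynomial.eval_X]
      rcases hx with rfl | ⟨ev, rfl⟩
      · have : i = 0 := by simp [loopCount] at hi; exact hi.1
        subst this
        exact ⟨by simp [size], fun h => absurd rfl h⟩
      · rw [loopCount_loopInit] at hi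
        obtain ⟨h2, h3⟩ := key ev i (by omega)
        refine ⟨h2, fun h => ?_⟩
        rw [h3] at h
        refine ⟨m - 1, by omega, trivial, le_rfl, fun z hz => ?_⟩
        rw [PMF.mem_support_pure_iff] at hz
        subst hz
        exact ⟨i + 1, by rw [loopCount_loopInit]; omega, by rw [Function.iterate_succ_apply']⟩)
    (fun x _ => ⟨le_rfl, by simp⟩) (fun x _ => by omega)
  refine h1.congr fun x hx => ⟨hx, ?_, le_rfl⟩
  rcases hx with rfl | ⟨ev, rfl⟩
  · simp [loopCount, iterK]
  · refine iterK_pure _ _ _ fun i hi => ?_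
    rw [loopCount_loopInit] at hi
    exact (key ev i hi.le).2.2 hi

end TreeProg

/-! ### The algorithm and its running time -/

namespace TreeProg
open Data

/-! ### One round of the algorithm -/

theorem RT.one_le {D : Data → Prop} {K : Data → PMF Data} {E : Data → ℕ} (h : RT D K E) {x : Data}
    (hx : D x) : 1 ≤ E x := by
  obtain ⟨q, -, hq⟩ := h
  exact (hq x hx).1

theorem RT.bind_keep {D D' : Data → Prop} {K K' : Data → PMF Data} {E E' F : Data → ℕ}
    (h : RT D K E) (h' : RT D' K' E') {f : Data → Data} (hf : PT f)
    (H : ∀ x, D x → E x ≤ F x ∧ ∀ y ∈ (K x).support, D' (f y) ∧ E' (f y) ≤ F x) :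
    RT D (fun x => (K x).bind fun y => (K' (f y)).map (cons y)) F :=
  h.bind (h'.keep_pt (D' := fun y => D' (f y)) hf fun _ hy => hy) H

/-! The state of the algorithm: the numbers `j` that remain to be tried, the answer found so far,
the graph, and the numbers `k` and `l` in unary. -/

def yj (y : Data) : Data := y.hd.hd
def yf (y : Data) : Data := y.tl.hd
def yg (y : Data) : Data := y.tl.tl.hd
def yk (y : Data) : Data := y.tl.tl.tl.hd
def yl (y : Data) : Data := y.tl.tl.tl.tl

/-- `nil` if and only if `a ≤ j + 2`, where `a` is given in binary. -/
noncomputable def skipD (y a : Data) : Data :=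
  ((cons nil (cons nil (cons nil (yj y)))).binU a).dropD (cons nil (cons nil (yj y)))

def envD (y I b : Data) : Data := cons (yg y) (cons ((yk y).dropD (yj y)) (cons I b))

/-- If `j` is too small, the sum over `2 ^ (k - j)` sets would exceed the permitted time, and the
loop receives `nil` instead. -/
noncomputable def startD (y I a b : Data) : Data :=
  if skipD y a = nil then loopInit (envD y I b) else nil

/-- The current `j` is removed from the list. The answer can only change to `tt`; it is never reset.
-/
noncomputable def endD (y I a b r : Data) : Data :=
  cons y.hd.tl (cons (if skipD y a = nil then
    if testD (cons nil (envD y I b)) (yj y) (yl y) r.tl.hd = nil then yf y else tt else yf y) y.tl.tl)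

/-- The number of random bits. -/
def nbD (y : Data) : Data :=
  ((yg y).mulU (cons nil ((yg y).appendD (yg y)))).mulU (cons nil (cons nil (cons nil (yg y))))

noncomputable def nextD (y I a b : Data) : Data :=
  endD y I a b (loopStep^[loopCount (startD y I a b)] (startD y I a b))

noncomputable def roundK (KA KQ : Data → PMF Data) (y : Data) : PMF Data :=
  (KA (yg y)).bind fun I => (KQ ((yk y).dropD (yl y))).bind fun a =>
    (bitsPMF [] (nbD y).len).bind fun b => PMF.pure (nextD y I a (boolsD b))

theorem PT.startD : PT fun x => TreeProg.startD x.hd.hd.hd x.hd.hd.tl x.hd.tl x.tl := by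
  unfold TreeProg.startD TreeProg.skipD TreeProg.envD yg yk yj
  fun_prop

theorem PT.endD : PT fun x => TreeProg.endD x.hd.hd.hd.hd x.hd.hd.hd.tl x.hd.hd.tl x.hd.tl x.tl := by
  unfold TreeProg.endD TreeProg.skipD TreeProg.envD yg yk yj yl yf
  fun_prop

theorem PT.nbD : PT TreeProg.nbD := by
  unfold TreeProg.nbD yg
  fun_prop

/-- The exponential factor of the running time. -/
noncomputable def expo (p : ℝ) (k l : ℕ) : ℕ := ⌊8 * (2 : ℝ) ^ ((1 - p) * k + p * l)⌋₊ + 2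

/-- From `a ≥ p (k - l) - 1` and `j ≥ a - 2` follows `k - j ≤ (1 - p) k + p l + 3`. The additive
constant `3` becomes the factor `8` in `expo`. -/
theorem two_pow_le_expo {p : ℝ} (hp0 : 0 ≤ p) (hp1 : p ≤ 1) {k l j a : ℕ} (hl : l ≤ k)
    (ha : |((k - l : ℕ) : ℝ) * p - a| ≤ 1) (haj : a ≤ j + 2) :
    2 ^ (k - j) + 1 ≤ expo p k l := by
  have hexp : 0 ≤ (1 - p) * k + p * l :=
    add_nonneg (mul_nonneg (by linarith) (by positivity)) (by positivity)
  have h1 : ((k - j : ℕ) : ℝ) ≤ (1 - p) * k + p * l + 3 := by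
    rcases le_total k j with h | h
    · rw [Nat.sub_eq_zero_of_le h]
      push_cast; linarith
    · rw [Nat.cast_sub hl] at ha
      rw [Nat.cast_sub h]
      have h2 := (abs_le.1 ha).2
      have h3 : (a : ℝ) ≤ j + 2 := by exact_mod_cast haj
      linarith
  have h2 : ((2 ^ (k - j) : ℕ) : ℝ) ≤ 8 * (2 : ℝ) ^ ((1 - p) * k + p * l) := by
    push_cast
    rw [← Real.rpow_natCast]
    refine (Real.rpow_le_rpow_of_exponent_le (by norm_num) h1).trans_eq ?_
    rw [Real.rpow_add (by norm_num), mul_comm]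
    norm_num
  have h3 := Nat.le_floor h2
  unfold expo
  omega

theorem skipD_eq_nil_iff (y : Data) (a : ℕ) :
    skipD y (ofNat a) = nil ↔ a ≤ (yj y).len + 2 := by
  -- Truncating `a` at `j + 3` does not change the comparison with `j + 2`.
  rw [skipD, dropD_eq_nil_iff, binU, len_un, valB_ofNat]
  simp only [len_cons]
  omega

/-- The states on which the algorithm works. -/
def StateOK (DA : Data → Prop) (y : Data) : Prop :=
  DA (yg y) ∧ ∃ k l, l ≤ k ∧ yk y = un k ∧ yl y = un l

/-- Every sampled value is kept next to the state, so the round is a chain of polynomial-time steps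
around the one exponential loop. Its length is controlled because `KQ` only returns good
approximations `a` and because of the test `skipD`. -/
theorem RT.round {p : ℝ} (hp0 : 0 ≤ p) (hp1 : p ≤ 1) {DA : Data → Prop} {KA KQ : Data → PMF Data}
    (hA : RT DA KA fun _ => 1) (hQ : RT (fun x => ∃ m, x = un m) KQ fun _ => 1)
    (hQ' : ∀ m, ∀ d ∈ (KQ (un m)).support, ∃ a : ℕ, |m * p - a| ≤ 1 ∧ d = ofNat a) :
    RT (StateOK DA) (roundK KA KQ) fun y => expo p (yk y).len (yl y).len := by
  have hE : ∀ y, 1 ≤ expo p (yk y).len (yl y).len := fun y => by unfold expo; omega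
  have hfg : PT yg := by unfold yg; fun_prop
  have hfm : PT fun w => (yk w.hd).dropD (yl w.hd) := by unfold yk yl; fun_prop
  have hfn : PT fun w => nbD w.hd.hd := PT.nbD.comp (f := fun w => w.hd.hd) (by fun_prop)
  have h1 := hA.keep_pt (D' := StateOK DA) hfg fun y hy => hy.1
  have h2 := h1.bind_keep hQ hfm (F := fun _ => 1) fun y hy => ⟨le_rfl, fun w hw => by
    rw [PMF.mem_support_map_iff] at hw
    obtain ⟨I, -, rfl⟩ := hw
    obtain ⟨-, k, l, -, hk, hl⟩ := hy
    exact ⟨⟨k - l, by rw [show (cons y I).hd = y from rfl, hk, hl, dropD_un]⟩, le_rfl⟩⟩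
  have h3 := h2.bind_keep RT.bits hfn (F := fun _ => 1) fun y hy =>
    ⟨le_rfl, fun w hw => ⟨trivial, le_rfl⟩⟩
  have h4 := h3.bind_keep RT.loop PT.startD (F := fun y => expo p (yk y).len (yl y).len)
    fun y hy => ⟨hE y, fun w hw => by
      simp only [PMF.mem_support_bind_iff, PMF.mem_support_map_iff] at hw
      obtain ⟨w2, ⟨w1, ⟨I, -, rfl⟩, a, ha, rfl⟩, b, -, rfl⟩ := hw
      obtain ⟨-, k, l, hlk, hk, hl⟩ := hy
      simp only [Data.hd, Data.tl, hk, hl, dropD_un] at ha ⊢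
      obtain ⟨a, ha', rfl⟩ := hQ' _ a ha
      by_cases h : skipD y (ofNat a) = nil
      · rw [startD, if_pos h]
        refine ⟨Or.inr ⟨_, rfl⟩, ?_⟩
        rw [loopCount_loopInit]
        have h5 : (eL (cons nil (envD y I b))).len = k - (yj y).len := by
          rw [show eL (cons nil (envD y I b)) = (yk y).dropD (yj y) from rfl, hk]
          simp [dropD, un, ofNatUnary, len]
        rw [h5, len_un, len_un]
        exact two_pow_le_expo hp0 hp1 hlk ha' ((skipD_eq_nil_iff _ _).1 h)
      · rw [startD, if_neg h]
        refine ⟨Or.inl rfl, ?_⟩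
        simp [loopCount, expo]⟩
  have h5 := h4.bind PT.endD.rt (F := fun y => expo p (yk y).len (yl y).len)
    fun y hy => ⟨le_rfl, fun w hw => ⟨trivial, hE y⟩⟩
  refine h5.congr fun y hy => ⟨hy, ?_, le_rfl⟩
  simp only [roundK, PMF.bind_bind, PMF.bind_map, PMF.pure_bind, PMF.pure_map, Function.comp_def,
    Data.hd, Data.tl, nextD]

end TreeProg

namespace TreeProg
open Data

/-! ### The whole algorithm -/

/-- A state without remaining rounds. -/
def haltD (v g : Data) : Data := cons nil (cons v (cons g (cons nil nil)))

/-- The state before the first round, where `k` and `l` are in unary. -/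
def mainD (g k l : Data) : Data :=
  cons (((cons nil (cons nil nil)).mulU ((cons nil g).mulU (cons nil g))).repD
    (tab (cons nil (k.dropD l)) fun i => i)) (cons nil (cons g (cons k l)))

/-- Instances with `k > n` or `l > k` have no solution, and `k ≤ 1` is decided directly: the test
itself needs an edge to find a root outside `I`. -/
noncomputable def prepD (g k l : Data) : Data :=
  if k.dropD g = nil then
    if l.dropD k = nil then
      if k.tl = nil then haltD (if k = nil then nil else if l = nil then tt else nil) g
      else mainD g k l
    else haltD nil g
  else haltD nil g

/-- `k` and `l` arrive in binary and may be huge; truncating them at `n + 1` keeps their unary form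
small and still shows when they are too large. -/
noncomputable def initD (x : Data) : Data :=
  prepD x.hd ((cons nil x.hd).binU x.tl.hd) ((cons nil x.hd).binU x.tl.tl)

theorem PT.initD : PT TreeProg.initD := by
  have h : PT fun x => prepD x.hd x.tl.hd x.tl.tl := by
    unfold prepD haltD mainD
    fun_prop
  exact h.comp (f := fun x => Data.cons x.hd (Data.cons ((Data.cons nil x.hd).binU x.tl.hd)
    ((Data.cons nil x.hd).binU x.tl.tl))) (by fun_prop)

/-- The law of the answer. -/
noncomputable def answerK (KA KQ : Data → PMF Data) (x : Data) : PMF Data :=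
  (iterK (roundK KA KQ) (initD x).hd.len (initD x)).map yf

theorem nextD_eq (y I a b : Data) : ∃ f, (f = yf y ∨ f = tt) ∧
    nextD y I a b = cons y.hd.tl (cons f y.tl.tl) := by
  refine ⟨_, ?_, rfl⟩
  split_ifs <;> simp

theorem mem_support_roundK {KA KQ : Data → PMF Data} {y z : Data}
    (hz : z ∈ (roundK KA KQ y).support) : ∃ I ∈ (KA (yg y)).support,
      ∃ a ∈ (KQ ((yk y).dropD (yl y))).support, ∃ b, z = nextD y I a (boolsD b) := by
  simp only [roundK, PMF.mem_support_bind_iff, PMF.mem_support_pure_iff] at hz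
  obtain ⟨I, hI, a, ha, b, -, rfl⟩ := hz
  exact ⟨I, hI, a, ha, b, rfl⟩

theorem RT.rounds {DA : Data → Prop} {KA KQ : Data → PMF Data} {E : Data → Data → ℕ}
    (h : RT (StateOK DA) (roundK KA KQ) fun y => E (yk y) (yl y)) :
    RT (fun y => StateOK DA y ∧ ∃ c f w, y = cons c (cons f w))
      (fun y => iterK (roundK KA KQ) y.hd.len y) fun y => E (yk y) (yl y) := by
  refine h.while (fun y => y.hd.len) (fun y => E (yk y) (yl y)) (3 * Polynomial.X + 5)
    (Polynomial.X + 1) ?_ (fun y hy => ⟨h.one_le hy.1, ?_⟩) fun y hy => h.one_le hy.1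
  · rintro y ⟨hy, c, f, w, rfl⟩
    refine ⟨fun m z => ∃ c' f', z = cons c' (cons f' w) ∧ c'.len = m ∧ c'.size ≤ c.size ∧
      f'.size ≤ f.size + 3, ⟨c, f, rfl, rfl, le_rfl, by omega⟩, ?_⟩
    rintro m z ⟨c', f', rfl, rfl, hc, hf⟩
    refine ⟨by simp [size]; omega, fun h0 => ⟨c'.tl.len, ?_, hy, le_rfl, fun z hz => ?_⟩⟩
    · cases c' with
      | nil => exact absurd rfl h0
      | cons a c' => rfl
    · obtain ⟨I, -, a, -, b, rfl⟩ := mem_support_roundK hz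
      obtain ⟨f'', h1, h2⟩ := nextD_eq (cons c' (cons f' w)) I a (boolsD b)
      refine ⟨_, _, h2, rfl, (size_tl_le c').trans hc, ?_⟩
      rcases h1 with rfl | rfl
      · exact hf
      · simp [tt, size]
  · have := len_lt_size y.hd
    have := size_hd_le y
    simp only [Polynomial.eval_add, Polynomial.eval_X, Polynomial.eval_one]
    gcongr
    omega

theorem expo_mono {p : ℝ} (hp0 : 0 ≤ p) (hp1 : p ≤ 1) (k l : ℕ) : expo p 0 0 ≤ expo p k l := by
  unfold expo
  have : 0 ≤ (1 - p) * k + p * l :=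
    add_nonneg (mul_nonneg (by linarith) (by positivity)) (by positivity)
  gcongr 2
  · exact mul_le_mul_of_nonneg_left (Real.rpow_le_rpow_of_exponent_le (by norm_num)
      (by simpa using this)) (by norm_num)

theorem initD_encode {n : ℕ} (G : SimpleGraph (Fin n)) (k l : ℕ) :
    initD (encodeInstance G k l) = if 2 ≤ k ∧ k ≤ n ∧ l ≤ k then
      mainD (encodeGraph G) (un k) (un l) else
      haltD (if k = 1 ∧ l = 0 ∧ 1 ≤ n then tt else nil) (encodeGraph G) := by
  have hg : (encodeGraph G).len = n := by simp [encodeGraph, len]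
  have hk : ∀ m, (cons nil (encodeGraph G)).binU (ofNat m) = un (min (n + 1) m) := by
    intro m
    rw [binU, valB_ofNat, len_cons, hg]
  rw [initD, show (encodeInstance G k l).hd = encodeGraph G from rfl,
    show (encodeInstance G k l).tl.hd = ofNat k from rfl,
    show (encodeInstance G k l).tl.tl = ofNat l from rfl, hk, hk, prepD]
  simp only [dropD_eq_nil_iff, len_un, hg, un_eq_nil_iff]
  have h1 : (un (min (n + 1) k)).tl = nil ↔ k ≤ 1 ∨ n = 0 := by
    have : ∀ m, (un m).tl = nil ↔ m ≤ 1 := by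
      intro m
      rcases m with _ | m
      · simp [Data.tl]
      · simp [un_succ, Data.tl, un_eq_nil_iff]
    rw [this]; omega
  simp only [h1]
  by_cases hkn : k ≤ n
  · rw [min_eq_right (by omega : k ≤ n + 1)]
    by_cases hlk : l ≤ k
    · rw [min_eq_right (by omega : l ≤ n + 1)]
      split_ifs <;> first | omega | rfl
    · split_ifs <;> first | omega | rfl
  · split_ifs <;> first | omega | rfl

theorem RT.answer {p : ℝ} (hp0 : 0 ≤ p) (hp1 : p ≤ 1) {𝒢 : ∀ n : ℕ, Set (SimpleGraph (Fin n))}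
    {KA KQ : Data → PMF Data}
    (hA : RT (fun x => ∃ n, ∃ G ∈ 𝒢 n, x = encodeGraph G) KA fun _ => 1)
    (hQ : RT (fun x => ∃ m, x = un m) KQ fun _ => 1)
    (hQ' : ∀ m, ∀ d ∈ (KQ (un m)).support, ∃ a : ℕ, |m * p - a| ≤ 1 ∧ d = ofNat a) :
    RT (fun x => ∃ n, ∃ G ∈ 𝒢 n, ∃ k l, x = encodeInstance G k l) (answerK KA KQ)
      fun x => expo p x.tl.hd.valB x.tl.tl.valB := by
  have h1 := (RT.round hp0 hp1 hA hQ hQ').rounds (E := fun a b => expo p a.len b.len)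
  have hf : PT yf := by unfold yf; fun_prop
  have hE : ∀ k l, 1 ≤ expo p k l := fun k l => by unfold expo; omega
  have h2 := ((PT.initD.rt.congr (E' := fun _ => 1) (D' := fun x => ∃ n, ∃ G ∈ 𝒢 n, ∃ k l,
    x = encodeInstance G k l) fun x _ => ⟨trivial, rfl, le_rfl⟩).bind h1
    (F := fun x => expo p x.tl.hd.valB x.tl.tl.valB) fun x hx => ⟨hE _ _, fun y hy => by
      rw [PMF.mem_support_pure_iff] at hy
      subst hy
      obtain ⟨n, G, hG, k, l, rfl⟩ := hx
      rw [show (encodeInstance G k l).tl.hd = ofNat k from rfl,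
        show (encodeInstance G k l).tl.tl = ofNat l from rfl, valB_ofNat, valB_ofNat, initD_encode]
      split_ifs with h
      · refine ⟨⟨⟨⟨n, G, hG, rfl⟩, k, l, h.2.2, rfl, rfl⟩, _, _, _, rfl⟩, ?_⟩
        show expo p (un k).len (un l).len ≤ _
        rw [len_un, len_un]
      · exact ⟨⟨⟨⟨n, G, hG, rfl⟩, 0, 0, le_rfl, rfl, rfl⟩, _, _, _, rfl⟩, expo_mono hp0 hp1 k l⟩
      · exact ⟨⟨⟨⟨n, G, hG, rfl⟩, 0, 0, le_rfl, rfl, rfl⟩, _, _, _, rfl⟩, expo_mono hp0 hp1 k l⟩⟩).bind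
    hf.rt (F := fun x => expo p x.tl.hd.valB x.tl.tl.valB) fun x hx => ⟨le_rfl, fun _ _ =>
      ⟨trivial, hE _ _⟩⟩
  refine h2.congr fun x hx => ⟨hx, ?_, le_rfl⟩
  rw [PMF.pure_bind]
  rfl

/-- The implementing command, started with empty private variables, is itself a program; input and
output share a variable. -/
theorem RT.exists_program {D : Data → Prop} {K : Data → PMF Data} {E : Data → ℕ} (h : RT D K E) :
    ∃ (B : Program) (q : Polynomial ℕ), ∀ x, D x → (∀ S, B.prob x S = (K x).toOuterMeasure S) ∧
      B.RunsInTime x ((q.eval x.size * E x : ℕ) : ℝ) ∧ B.RunsInSpace x ((q.eval x.size : ℕ) : ℝ) := by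
  obtain ⟨q, ⟨κ, i1, i2, c, C, hc⟩, -⟩ := h
  let B : Program := { Var := Option κ, input := none, output := none, body := c }
  refine ⟨B, q + Polynomial.X + Polynomial.C (Fintype.card κ + C), fun x hx => ?_⟩
  simp only [Polynomial.eval_add, Polynomial.eval_X, Polynomial.eval_C]
  have h1 := hc x (K x) ((q.eval x.size + x.size + (Fintype.card κ + C)) * E x)
    (q.eval x.size + x.size + Fintype.card κ) ⟨hx, rfl, Nat.mul_le_mul_right _ (by omega), by omega⟩
  have hst : B.initStore x = st x := by
    show Function.update (fun _ => Data.nil) none x = st x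
    have : (fun _ : Option κ => Data.nil) = st Data.nil := by
      funext i; cases i <;> rfl
    rw [this, update_st_none]
  have h2 : Halts ((q.eval x.size + x.size + (Fintype.card κ + C)) * E x)
      (q.eval x.size + x.size + Fintype.card κ + C) (B.init x) ((K x).map st) := by
    rw [Program.init, hst]
    exact h1.halts (storeSize (st x)) (by rw [storeSize_st]; omega)
  refine ⟨fun S => ?_, h2.runsInTime, ?_⟩
  · rw [h2.prob_eq, PMF.toOuterMeasure_map_apply]
    rfl
  · rw [show q.eval x.size + x.size + (Fintype.card κ + C) =
      q.eval x.size + x.size + Fintype.card κ + C by omega]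
    exact h2.runsInSpace

/-! ### Small and degenerate instances -/

theorem HasTree.bounds {n : ℕ} {G : SimpleGraph (Fin n)} {k l : ℕ} (h : HasTree G k l) :
    1 ≤ k ∧ k ≤ n ∧ l ≤ k ∧ (k = 1 → l = 0) := by
  obtain ⟨T, hT, -, rfl, rfl⟩ := hasTree_iff.1 h
  have h1 := hT.card
  refine ⟨by omega, (Finset.card_le_univ _).trans (by simp), Finset.card_filter_le _ _, fun h2 => ?_⟩
  have h3 : T.2 = ∅ := Finset.card_eq_zero.1 (by omega)
  rw [leafs, Finset.card_eq_zero, Finset.filter_eq_empty_iff]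
  intro v _
  simp [deg, h3]

theorem hasTree_one {n : ℕ} (G : SimpleGraph (Fin n)) (h : 1 ≤ n) : HasTree G 1 0 := by
  rw [hasTree_iff]
  refine ⟨_, isTr_singleton ⟨0, h⟩, by simp, by simp, ?_⟩
  simp [leafs, deg]

end TreeProg

/-! ### Correctness and amplification -/

namespace TreeProg
open Data

/-! ### The outcome of a round -/

section Outcome
variable {n : ℕ} {G : SimpleGraph (Fin n)} {I : Finset (Fin n)} {k l : ℕ}

theorem nthD_ofFn (f : Fin n → Data) (i : Fin n) : (ofList (List.ofFn f)).nthD (un i) = f i := by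
  rw [nthD_eq, toList_ofList, len_un]
  simp [List.getD]

theorem ofBool_eq_nil_iff (b : Bool) : ofBool b = nil ↔ b = false := by
  cases b <;> simp [ofBool]

theorem len_encodeGraph (G : SimpleGraph (Fin n)) : (encodeGraph G).len = n := by
  simp [encodeGraph, len]

theorem nthD_encodeSet (I : Finset (Fin n)) (v : Fin n) :
    (encodeSet I).nthD (un v) = nil ↔ v ∉ I := by
  rw [encodeSet, nthD_ofFn, ofBool_eq_nil_iff]
  simp

theorem envB_mkEnv (G : SimpleGraph (Fin n)) (I : Finset (Fin n)) (L : ℕ) (b : List Bool) :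
    EnvB (mkEnv (encodeGraph G) (un L) (encodeSet I) b) G I L where
  len_eG := len_encodeGraph G
  adj u v := by
    show ((encodeGraph G).nthD (un u)).nthD (un v) = nil ↔ _
    rw [encodeGraph, nthD_ofFn, nthD_ofFn, ofBool_eq_nil_iff]
    simp
  mem v := nthD_encodeSet I v
  len_eL := len_un L

/-- The part of the state that never changes. -/
noncomputable def ctxD (G : SimpleGraph (Fin n)) (k l : ℕ) : Data :=
  cons (encodeGraph G) (cons (un k) (un l))

/-- A round turns the answer to `tt` exactly when it is not skipped and `selPoly` is nonzero. The
latter requires a tree with `(k - j) + j = k` vertices, so the answer is always sound. -/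
theorem nextD_found (hI : G.IsIndepSet (I : Set (Fin n))) {j : ℕ} (hj : j ≤ k) (hk : k ≤ n)
    (hl : l ≤ n) (c f : Data) (a : ℕ) (b : List Bool) :
    ∃ f', nextD (cons (cons (un j) c) (cons f (ctxD G k l))) (encodeSet I) (ofNat a) (boolsD b) =
        cons c (cons f' (ctxD G k l)) ∧ (f' = f ∨ f' = tt ∧ HasTree G k l) ∧
      (a ≤ j + 2 → selPoly G I l j
        (eR (cons nil (mkEnv (encodeGraph G) (un (k - j)) (encodeSet I) b)))
        (eθ (cons nil (mkEnv (encodeGraph G) (un (k - j)) (encodeSet I) b)))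
        (eY (L := k - j) (cons nil (mkEnv (encodeGraph G) (un (k - j)) (encodeSet I) b))) ≠ 0 →
        f' = tt) := by
  have hskip := skipD_eq_nil_iff (cons (cons (un j) c) (cons f (ctxD G k l))) a
  rw [show yj (cons (cons (un j) c) (cons f (ctxD G k l))) = un j from rfl, len_un] at hskip
  have henv : envD (cons (cons (un j) c) (cons f (ctxD G k l))) (encodeSet I) (boolsD b) =
      mkEnv (encodeGraph G) (un (k - j)) (encodeSet I) b := by
    rw [mkEnv, ← dropD_un]; rfl
  have hB := envB_mkEnv G I (k - j) b
  generalize hev : mkEnv (encodeGraph G) (un (k - j)) (encodeSet I) b = ev at *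
  refine ⟨_, rfl, ?_⟩
  by_cases ha : a ≤ j + 2
  · rw [if_pos (hskip.2 ha), startD, if_pos (hskip.2 ha), henv, loopCount_loopInit]
    obtain ⟨acc, h1, -, h2⟩ := loopStep_iterate ev _ le_rfl
    rw [hB.len_eL] at h1 h2 ⊢
    rw [h1]
    have h3 := hB.testD_iff hI (j := j) (l := l) (by omega) hl h2
    rw [show (cons (if 2 ^ (k - j) < 2 ^ (k - j) then cons (boolsD (bitsL (k - j) (2 ^ (k - j))))
      nil else nil) (cons acc ev)).tl.hd = acc from rfl,
      show yj (cons (cons (un j) c) (cons f (ctxD G k l))) = un j from rfl,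
      show yl (cons (cons (un j) c) (cons f (ctxD G k l))) = un l from rfl,
      show yf (cons (cons (un j) c) (cons f (ctxD G k l))) = f from rfl]
    by_cases h4 : testD (cons nil ev) (un j) (un l) acc = nil
    · rw [if_pos h4]
      exact ⟨Or.inl rfl, fun _ h5 => absurd h4 (h3.2 h5)⟩
    · rw [if_neg h4]
      refine ⟨Or.inr ⟨rfl, ?_⟩, fun _ _ => rfl⟩
      by_contra h5
      refine h3.1 h4 (selPoly_eq_zero ?_ _ _ _)
      rwa [Nat.sub_add_cancel hj]
  · rw [if_neg (fun h => ha (hskip.1 h))]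
    exact ⟨Or.inl rfl, fun h => absurd h ha⟩

end Outcome

/-! ### Probabilities -/

theorem toOuterMeasure_le_one {α : Type} (μ : PMF α) (S : Set α) : μ.toOuterMeasure S ≤ 1 := by
  rw [PMF.toOuterMeasure_apply, ← μ.tsum_coe]
  exact ENNReal.tsum_le_tsum fun a => Set.indicator_le_self _ _ a

theorem toOuterMeasure_bind_le {α β : Type} (μ : PMF α) (f : α → PMF β) (S : Set β)
    (g : α → ENNReal) (h : ∀ a ∈ μ.support, (f a).toOuterMeasure S ≤ g a) :
    (μ.bind f).toOuterMeasure S ≤ ∑' a, μ a * g a := by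
  rw [PMF.toOuterMeasure_bind_apply]
  refine ENNReal.tsum_le_tsum fun a => ?_
  by_cases ha : μ a = 0
  · simp [ha]
  · exact mul_le_mul_right (h a ((μ.mem_support_iff a).2 ha)) _

theorem toOuterMeasure_bind_le_const {α β : Type} (μ : PMF α) (f : α → PMF β) (S : Set β)
    (r : ENNReal) (h : ∀ a ∈ μ.support, (f a).toOuterMeasure S ≤ r) :
    (μ.bind f).toOuterMeasure S ≤ r := by
  refine (toOuterMeasure_bind_le μ f S (fun _ => r) h).trans ?_
  rw [ENNReal.tsum_mul_right, μ.tsum_coe, one_mul]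

/-- With `g` the probability of the good event, failure has probability at most `g / 2 + (1 - g)`.
-/
theorem toOuterMeasure_bind_le_of_good {α β : Type} (μ : PMF α) (f : α → PMF β) (S : Set β)
    (good : Set α) {q : ℝ} (hq : ENNReal.ofReal q ≤ μ.toOuterMeasure good)
    (h : ∀ a ∈ μ.support, a ∈ good → (f a).toOuterMeasure S ≤ 1 / 2) :
    (μ.bind f).toOuterMeasure S ≤ ENNReal.ofReal (1 - q / 2) := by
  classical
  have h1 : (μ.bind f).toOuterMeasure S ≤
      μ.toOuterMeasure good * (1 / 2) + μ.toOuterMeasure goodᶜ := by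
    refine (toOuterMeasure_bind_le μ f S (fun a => if a ∈ good then 1 / 2 else 1) ?_).trans ?_
    · intro a ha
      split_ifs with hg
      · exact h a ha hg
      · exact toOuterMeasure_le_one _ _
    · rw [PMF.toOuterMeasure_apply, PMF.toOuterMeasure_apply, ← ENNReal.tsum_mul_right,
        ← ENNReal.tsum_add]
      refine ENNReal.tsum_le_tsum fun a => ?_
      by_cases hg : a ∈ good <;> simp [hg]
  have h2 : μ.toOuterMeasure good + μ.toOuterMeasure goodᶜ = 1 := by
    rw [PMF.toOuterMeasure_apply, PMF.toOuterMeasure_apply, ← ENNReal.tsum_add, ← μ.tsum_coe]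
    refine tsum_congr fun a => ?_
    by_cases hg : a ∈ good <;> simp [hg]
  refine h1.trans ?_
  have h3 : μ.toOuterMeasure good ≠ ⊤ := ne_top_of_le_ne_top ENNReal.one_ne_top
    (toOuterMeasure_le_one _ _)
  have h4 : μ.toOuterMeasure goodᶜ ≠ ⊤ := ne_top_of_le_ne_top ENNReal.one_ne_top
    (toOuterMeasure_le_one _ _)
  have h5 := (ENNReal.ofReal_le_iff_le_toReal h3).1 hq
  have h6 := congrArg ENNReal.toReal h2
  rw [ENNReal.toReal_add h3 h4, ENNReal.toReal_one] at h6
  rw [ENNReal.le_ofReal_iff_toReal_le (ENNReal.add_ne_top.2 ⟨ENNReal.mul_ne_top h3 (by simp), h4⟩)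
    (by have := (μ.toOuterMeasure goodᶜ).toReal_nonneg
        have := (μ.toOuterMeasure good).toReal_nonneg
        linarith), ENNReal.toReal_add (ENNReal.mul_ne_top h3 (by simp)) h4, ENNReal.toReal_mul]
  simp only [one_div, ENNReal.toReal_inv, ENNReal.toReal_ofNat]
  linarith

/-! ### The success probability of a round -/

section Success
variable {n : ℕ} {G : SimpleGraph (Fin n)} {k l : ℕ} {KA KQ : Data → PMF Data} {p : ℝ}

/-- The set encoded by a list of bits. -/
noncomputable def decodeSet (n : ℕ) (d : Data) : Finset (Fin n) :=
  Finset.univ.filter fun v => d.nthD (un v) ≠ nil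

theorem decodeSet_encodeSet (I : Finset (Fin n)) : decodeSet n (encodeSet I) = I := by
  ext v
  simp [decodeSet, nthD_encodeSet]

/-- The number of inner vertices of a tree that are chosen is likely to be not much smaller than
its expectation. -/
theorem exists_likely_inner (T₀ : Finset (Fin n) × Finset (Sym2 (Fin n))) (μ : PMF Data)
    (hμ : ∀ v : Fin n, ENNReal.ofReal p ≤
      μ.toOuterMeasure {d | ∃ I : Finset (Fin n), v ∈ I ∧ d = encodeSet I}) :
    ∃ j ≤ T₀.1.card - (leafs T₀).card, p * ((T₀.1.card - (leafs T₀).card : ℕ) : ℝ) - 1 ≤ j ∧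
      ENNReal.ofReal (1 / (((T₀.1.card - (leafs T₀).card : ℕ) : ℝ) + 1) ^ 2) ≤
        μ.toOuterMeasure {d | (inner (decodeSet n d) T₀).card = j} := by
  classical
  let ν := μ.map (decodeSet n)
  have hν : ∀ (Q : Finset (Fin n) → Prop) [DecidablePred Q],
      ∑ I, (if Q I then (ν I).toReal else 0) =
        (μ.toOuterMeasure {d | Q (decodeSet n d)}).toReal := by
    intro Q _
    rw [show {d | Q (decodeSet n d)} = decodeSet n ⁻¹' {I | Q I} from rfl,
      ← PMF.toOuterMeasure_map_apply, PMF.toOuterMeasure_apply_fintype, ENNReal.toReal_sum]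
    · refine Finset.sum_congr rfl fun I _ => ?_
      by_cases h : Q I <;> simp [h, ν]
    · intro I _
      exact ne_top_of_le_ne_top (ν.apply_ne_top I) (Set.indicator_le_self _ _ I)
  let W := T₀.1.filter fun v => deg T₀.2 v ≠ 1
  have hW : W.card = T₀.1.card - (leafs T₀).card := by
    have : (leafs T₀).card + W.card = T₀.1.card := by
      rw [← Finset.card_filter_add_card_filter_not (s := T₀.1) (fun v => deg T₀.2 v = 1)]
      rfl
    omega
  have hfin : ∀ S, μ.toOuterMeasure S ≠ ⊤ := fun S =>
    ne_top_of_le_ne_top ENNReal.one_ne_top (toOuterMeasure_le_one _ _)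
  obtain ⟨j, h1, h2, h3⟩ := exists_likely_card (fun I => (ν I).toReal)
    (fun _ => ENNReal.toReal_nonneg) (by
      have := hν fun _ => True
      simp only [if_true] at this
      rw [this, (PMF.toOuterMeasure_apply_eq_one_iff μ {_d | True}).2 fun _ _ => trivial,
        ENNReal.toReal_one])
    W (fun I => I) p (by
      intro v _
      rw [hν (v ∈ ·), ← ENNReal.ofReal_le_iff_le_toReal (hfin _)]
      refine (hμ v).trans (MeasureTheory.measure_mono ?_)
      rintro d ⟨I, hI, rfl⟩
      simpa [decodeSet_encodeSet] using hI)
  rw [hW] at h1 h2 h3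
  refine ⟨j, h1, h2, ?_⟩
  rw [hν fun I => (W ∩ I).card = j, ← ENNReal.ofReal_le_iff_le_toReal (hfin _)] at h3
  refine h3.trans (MeasureTheory.measure_mono ?_)
  intro d hd
  rw [Set.mem_ofPred_eq] at hd
  rw [Set.mem_ofPred_eq, ← hd]
  congr 1
  ext v
  simp only [inner, W, Finset.mem_filter, Finset.mem_inter]
  tauto

/-- The number `j` depends only on a fixed tree and on the law of the sampler. With probability at
least `1 / (k - l + 1) ^ 2` the sampled set contains exactly `j` inner vertices of the tree; then
the random polynomials fail with probability at most one half. -/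
theorem roundK_fail_le (hA : ∀ d ∈ (KA (encodeGraph G)).support, ∃ I : Finset (Fin n),
      G.IsIndepSet (I : Set (Fin n)) ∧ d = encodeSet I)
    (hA' : ∀ v : Fin n, ENNReal.ofReal p ≤
      (KA (encodeGraph G)).toOuterMeasure {d | ∃ I : Finset (Fin n), v ∈ I ∧ d = encodeSet I})
    (hQ : ∀ m, ∀ d ∈ (KQ (un m)).support, ∃ a : ℕ, |m * p - a| ≤ 1 ∧ d = ofNat a)
    (hT : HasTree G k l) (hk : 2 ≤ k) :
    ∃ j ≤ k - l, ∀ c, (roundK KA KQ (cons (cons (un j) c) (cons nil (ctxD G k l)))).toOuterMeasure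
      {z | yf z = nil} ≤ ENNReal.ofReal (1 - 1 / (((k - l : ℕ) : ℝ) + 1) ^ 2 / 2) := by
  obtain ⟨-, hkn, hlk, -⟩ := hT.bounds
  obtain ⟨T₀, hT₀, hT₀G, rfl, rfl⟩ := hasTree_iff.1 hT
  obtain ⟨j, hj, hpj, hprob⟩ := exists_likely_inner T₀ _ hA'
  refine ⟨j, hj, fun c => toOuterMeasure_bind_le_of_good _ _ _ _ hprob fun d hd hgood => ?_⟩
  obtain ⟨I, hI, rfl⟩ := hA d hd
  rw [Set.mem_ofPred_eq, decodeSet_encodeSet] at hgood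
  refine toOuterMeasure_bind_le_const _ _ _ _ fun a ha => ?_
  have hm : (yk (cons (cons (un j) c) (cons nil (ctxD G T₀.1.card (leafs T₀).card)))).dropD
      (yl (cons (cons (un j) c) (cons nil (ctxD G T₀.1.card (leafs T₀).card)))) =
      un (T₀.1.card - (leafs T₀).card) := dropD_un _ _
  rw [hm] at ha
  obtain ⟨a, ha', rfl⟩ := hQ _ a ha
  -- The round for this `j` is never skipped: `a ≤ p (k - l) + 1` and `p (k - l) - 1 ≤ j`. This is
  -- where the margin of two in `skipD` comes from.
  have haj : a ≤ j + 2 := by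
    have := (abs_le.1 ha').1
    have h1 : (a : ℝ) ≤ j + 2 := by linarith
    exact_mod_cast h1
  have hnb : (nbD (cons (cons (un j) c) (cons nil (ctxD G T₀.1.card (leafs T₀).card)))).len =
      n * (2 * n + 1) * (n + 3) := by
    have : yg (cons (cons (un j) c) (cons nil (ctxD G T₀.1.card (leafs T₀).card))) =
      encodeGraph G := rfl
    rw [nbD, this]
    simp only [len_mulU, len_cons, len_appendD, len_encodeGraph]
    ring
  rw [hnb, show (fun b => PMF.pure (nextD (cons (cons (un j) c) (cons nil
    (ctxD G T₀.1.card (leafs T₀).card))) (encodeSet I) (ofNat a) (boolsD b))) = PMF.pure ∘ (fun b =>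
    nextD (cons (cons (un j) c) (cons nil (ctxD G T₀.1.card (leafs T₀).card))) (encodeSet I)
      (ofNat a) (boolsD b)) from rfl, PMF.bind_pure_comp, PMF.toOuterMeasure_map_apply]
  have hL : (labelled I T₀).card = T₀.1.card - j := by
    have := card_inner_add_card_labelled I T₀
    omega
  have hbad := bad_bits hI hT₀ hT₀G hk hL (LU := un (T₀.1.card - j)) (d := encodeSet I)
    (len_encodeGraph G)
  rw [hgood] at hbad
  refine le_trans (MeasureTheory.measure_mono ?_) (bitsPMF_le_half (bad := fun b =>
    selPoly G I (leafs T₀).card j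
      (eR (cons nil (mkEnv (encodeGraph G) (un (T₀.1.card - j)) (encodeSet I) b)))
      (eθ (cons nil (mkEnv (encodeGraph G) (un (T₀.1.card - j)) (encodeSet I) b)))
      (eY (L := T₀.1.card - j)
        (cons nil (mkEnv (encodeGraph G) (un (T₀.1.card - j)) (encodeSet I) b))) = 0) hbad)
  intro b hb
  obtain ⟨f', h1, -, h2⟩ := nextD_found (l := (leafs T₀).card) hI (by omega : j ≤ T₀.1.card) hkn
    (by omega) c nil a b
  rw [Set.mem_preimage, Set.mem_ofPred_eq, h1] at hb
  by_contra h3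
  have h4 := h2 haj h3
  rw [h4] at hb
  exact absurd hb (by simp [yf, Data.hd, Data.tl, tt])

end Success

end TreeProg

namespace TreeProg
open Data

/-! ### Correctness -/

section Correct
variable {n : ℕ} {G : SimpleGraph (Fin n)} {k l : ℕ} {KA KQ : Data → PMF Data} {p : ℝ}

/-- As long as nothing has been found the state is determined by the rest of the list, so the bounds
for the rounds with entry `a` multiply; the other rounds cannot do harm. -/
theorem iterK_fail_le (K : Data → PMF Data) (w a : Data) (r : ENNReal)
    (hK : ∀ c f, ∀ z ∈ (K (cons c (cons f w))).support, ∃ f', (f' = f ∨ f' = tt) ∧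
      z = cons c.tl (cons f' w))
    (hr : ∀ c, (K (cons (cons a c) (cons nil w))).toOuterMeasure {z | yf z = nil} ≤ r)
    (L : List Data) :
    (iterK K L.length (cons (ofList L) (cons nil w))).toOuterMeasure {z | yf z = nil} ≤
      r ^ L.count a := by
  induction L with
  | nil => exact (toOuterMeasure_le_one _ _).trans (by simp)
  | cons b L ih =>
    rw [List.length_cons, iterK, if_neg (by simp [ofList, Data.hd])]
    have h1 : ((K (cons (ofList (b :: L)) (cons nil w))).bind (iterK K L.length)).toOuterMeasure
        {z | yf z = nil} ≤
        (K (cons (ofList (b :: L)) (cons nil w))).toOuterMeasure {z | yf z = nil} *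
          r ^ L.count a := by
      classical
      refine (toOuterMeasure_bind_le _ _ _ (fun z => if yf z = nil then r ^ L.count a else 0)
        ?_).trans ?_
      · intro z hz
        obtain ⟨f', hf, rfl⟩ := hK _ _ z hz
        rcases hf with rfl | rfl
        · rw [if_pos (show yf (cons (ofList (b :: L)).tl (cons nil w)) = nil from rfl)]
          exact ih
        -- Once the answer is `tt` it stays so, and failure has probability zero from here on.
        · rw [if_neg (by simp [yf, Data.hd, Data.tl, tt]), nonpos_iff_eq_zero,
            PMF.toOuterMeasure_apply_eq_zero_iff, Set.disjoint_left]
          intro z' hz' h0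
          obtain ⟨m, c, rfl, -⟩ := support_iterK (K := K)
            (P := fun m y => ∃ c, y = cons c (cons tt w) ∧ c.len = m) (by
              rintro m y ⟨c, rfl, rfl⟩ hne
              cases c with
              | nil => exact absurd rfl hne
              | cons d c =>
                refine ⟨c.len, rfl, fun z hz => ?_⟩
                obtain ⟨f', hf, rfl⟩ := hK _ _ z hz
                exact ⟨c, by rcases hf with rfl | rfl <;> rfl, rfl⟩) _ _
            ⟨(ofList (b :: L)).tl, rfl, by simp [ofList, Data.tl, len]⟩ z' hz'
          exact absurd h0 (by simp [yf, Data.hd, Data.tl, tt])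
      · rw [PMF.toOuterMeasure_apply, ← ENNReal.tsum_mul_right]
        refine ENNReal.tsum_le_tsum fun z => ?_
        by_cases h : yf z = nil <;> simp [h]
    refine h1.trans ?_
    by_cases hb : b = a
    · subst hb
      rw [List.count_cons_self, pow_succ']
      gcongr
      exact hr (ofList L)
    · rw [List.count_cons_of_ne hb]
      exact mul_le_of_le_one_left (by simp) (toOuterMeasure_le_one _ _)

/-- The entries of the list of rounds. -/
theorem toList_ctl (g : Data) :
    (mainD g (un k) (un l)).hd.toList = (List.replicate (2 * ((g.len + 1) * (g.len + 1)))
      ((List.range (k - l + 1)).map un)).flatten := by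
  simp [mainD, Data.hd, repD, tab, dropD_un]

/-- Soundness for all outcomes of the coins: the loop invariant says that the answer is `nil`, or is
`tt` and a tree exists. -/
theorem answerK_support (hA : ∀ d ∈ (KA (encodeGraph G)).support, ∃ I : Finset (Fin n),
      G.IsIndepSet (I : Set (Fin n)) ∧ d = encodeSet I)
    (hQ : ∀ m, ∀ d ∈ (KQ (un m)).support, ∃ a : ℕ, |m * p - a| ≤ 1 ∧ d = ofNat a) :
    ∀ d ∈ (answerK KA KQ (encodeInstance G k l)).support,
      d = nil ∨ d = tt ∧ HasTree G k l := by
  intro d hd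
  rw [answerK, PMF.mem_support_map_iff] at hd
  obtain ⟨z, hz, rfl⟩ := hd
  rw [initD_encode] at hz
  split_ifs at hz with h h'
  · obtain ⟨hk2, hkn, hlk⟩ := h
    obtain ⟨m, c, f, rfl, hf, -⟩ := support_iterK (K := roundK KA KQ)
      (P := fun m y => ∃ c f, y = cons c (cons f (ctxD G k l)) ∧
        (f = nil ∨ f = tt ∧ HasTree G k l) ∧ c.len = m ∧ ∀ d ∈ c.toList, ∃ j ≤ k, d = un j) (by
        rintro m y ⟨c, f, rfl, hf, rfl, hc⟩ hne
        cases c with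
        | nil => exact absurd rfl hne
        | cons d c =>
          refine ⟨c.len, rfl, fun z hz => ?_⟩
          obtain ⟨d', hd', a, ha, b, rfl⟩ := mem_support_roundK hz
          obtain ⟨I, hI, rfl⟩ := hA d' hd'
          obtain ⟨j, hj, rfl⟩ := hc d (by simp)
          have hm : (yk (cons (cons (un j) c) (cons f (ctxD G k l)))).dropD
            (yl (cons (cons (un j) c) (cons f (ctxD G k l)))) = un (k - l) := dropD_un _ _
          rw [hm] at ha
          obtain ⟨a, -, rfl⟩ := hQ _ a ha
          obtain ⟨f', h1, h2, -⟩ := nextD_found (l := l) hI hj hkn (by omega) c f a b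
          refine ⟨c, f', h1, ?_, rfl, fun d hd => hc d (by simp [hd])⟩
          rcases h2 with rfl | h2
          · exact hf
          · exact Or.inr h2) _ _ ⟨(mainD (encodeGraph G) (un k) (un l)).hd, nil, rfl, Or.inl rfl, rfl,
            by
              intro d hd
              rw [toList_ctl] at hd
              simp only [List.mem_flatten, List.mem_replicate] at hd
              obtain ⟨L, ⟨-, rfl⟩, hd⟩ := hd
              simp only [List.mem_map, List.mem_range] at hd
              obtain ⟨j, hj, rfl⟩ := hd
              exact ⟨j, by omega, rfl⟩⟩ z hz
    exact hf
  · rw [show (haltD tt (encodeGraph G)).hd.len = 0 from rfl, iterK,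
      PMF.mem_support_pure_iff] at hz
    subst hz
    refine Or.inr ⟨rfl, ?_⟩
    obtain ⟨rfl, rfl, hn⟩ := h'
    exact hasTree_one G hn
  · rw [show (haltD nil (encodeGraph G)).hd.len = 0 from rfl, iterK,
      PMF.mem_support_pure_iff] at hz
    subst hz
    exact Or.inl rfl

/-- By `1 - u ≤ exp (-u)` with `u = 1 / (2 (m + 1) ^ 2)`, and `2 (n + 1) ^ 2` repetitions give an
exponent of at most `-1`. -/
theorem pow_failure_le (m n : ℕ) (h : m ≤ n) :
    ENNReal.ofReal (1 - 1 / ((m : ℝ) + 1) ^ 2 / 2) ^ (2 * ((n + 1) * (n + 1))) ≤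
      ENNReal.ofReal (Real.exp (-1)) := by
  have hm : (1 : ℝ) ≤ (m : ℝ) + 1 := by
    have : (0 : ℝ) ≤ m := by positivity
    linarith
  have h0 : 1 / ((m : ℝ) + 1) ^ 2 ≤ 1 := by
    rw [div_le_one (by positivity)]
    exact one_le_pow₀ hm
  rw [← ENNReal.ofReal_pow (by linarith)]
  refine ENNReal.ofReal_le_ofReal ?_
  have h1 := Real.add_one_le_exp (-(1 / ((m : ℝ) + 1) ^ 2 / 2))
  calc (1 - 1 / ((m : ℝ) + 1) ^ 2 / 2) ^ (2 * ((n + 1) * (n + 1)))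
      ≤ Real.exp (-(1 / ((m : ℝ) + 1) ^ 2 / 2)) ^ (2 * ((n + 1) * (n + 1))) :=
        pow_le_pow_left₀ (by linarith) (by linarith) _
    _ = Real.exp (((2 * ((n + 1) * (n + 1)) : ℕ) : ℝ) * -(1 / ((m : ℝ) + 1) ^ 2 / 2)) :=
        (Real.exp_nat_mul _ _).symm
    _ ≤ Real.exp (-1) := by
        refine Real.exp_le_exp.2 ?_
        push_cast
        have h2 : ((m : ℝ) + 1) ^ 2 ≤ ((n : ℝ) + 1) * ((n : ℝ) + 1) := by
          rw [sq]; gcongr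
        have h3 : 1 ≤ ((n : ℝ) + 1) * ((n : ℝ) + 1) / ((m : ℝ) + 1) ^ 2 := by
          rwa [one_le_div (by positivity)]
        calc 2 * (((n : ℝ) + 1) * ((n : ℝ) + 1)) * -(1 / ((m : ℝ) + 1) ^ 2 / 2)
            = -(((n : ℝ) + 1) * ((n : ℝ) + 1) / ((m : ℝ) + 1) ^ 2) := by ring
          _ ≤ -1 := by linarith

theorem answerK_fail_le (hA : ∀ d ∈ (KA (encodeGraph G)).support, ∃ I : Finset (Fin n),
      G.IsIndepSet (I : Set (Fin n)) ∧ d = encodeSet I)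
    (hA' : ∀ v : Fin n, ENNReal.ofReal p ≤
      (KA (encodeGraph G)).toOuterMeasure {d | ∃ I : Finset (Fin n), v ∈ I ∧ d = encodeSet I})
    (hQ : ∀ m, ∀ d ∈ (KQ (un m)).support, ∃ a : ℕ, |m * p - a| ≤ 1 ∧ d = ofNat a)
    (hT : HasTree G k l) :
    (answerK KA KQ (encodeInstance G k l)).toOuterMeasure {nil} ≤
      ENNReal.ofReal (Real.exp (-1)) := by
  obtain ⟨hk1, hkn, hlk, hl0⟩ := hT.bounds
  rw [answerK, PMF.toOuterMeasure_map_apply, initD_encode]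
  by_cases hk : 2 ≤ k
  · rw [if_pos ⟨hk, hkn, hlk⟩]
    obtain ⟨j, hj, hr⟩ := roundK_fail_le hA hA' hQ hT hk
    obtain ⟨c, hc, hcl⟩ : ∃ c, mainD (encodeGraph G) (un k) (un l) =
      cons c (cons nil (ctxD G k l)) ∧ c.toList = _ := ⟨_, rfl, toList_ctl _⟩
    have h1 := iterK_fail_le (roundK KA KQ) (ctxD G k l) (un j) _ (by
      intro c f z hz
      obtain ⟨I, -, a, -, b, rfl⟩ := mem_support_roundK hz
      exact nextD_eq (cons c (cons f (ctxD G k l))) I a (boolsD b)) hr c.toList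
    rw [ofList_toList] at h1
    rw [hc]
    refine h1.trans (le_trans ?_ (pow_failure_le (k - l) n (by omega)))
    refine pow_le_pow_right_of_le_one' ?_ ?_
    · rw [ENNReal.ofReal_le_one]
      have : 0 ≤ 1 / (((k - l : ℕ) : ℝ) + 1) ^ 2 / 2 := by positivity
      linarith
    · rw [hcl, List.count_flatten, List.map_replicate, List.sum_replicate, len_encodeGraph,
        smul_eq_mul]
      -- Each of the `2 (n + 1) ^ 2` copies of the list `0, …, k - l` contains `j`.
      refine Nat.le_mul_of_pos_right _ (List.count_pos_iff.2 ?_)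
      exact List.mem_map_of_mem (List.mem_range.2 (by omega))
  · have : k = 1 := by omega
    subst this
    rw [if_neg (by omega), if_pos ⟨rfl, hl0 rfl, hkn⟩,
      show (haltD tt (encodeGraph G)).hd.len = 0 from rfl, iterK,
      (PMF.toOuterMeasure_apply_eq_zero_iff _ _).2]
    · exact zero_le
    · rw [PMF.support_pure, Set.disjoint_singleton_left]
      simp [yf, haltD, Data.hd, Data.tl, tt]

end Correct

theorem expo_le {p : ℝ} (hp0 : 0 ≤ p) (hp1 : p ≤ 1) (k l : ℕ) :
    (expo p k l : ℝ) ≤ 10 * (2 : ℝ) ^ ((1 - p) * k + p * l) := by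
  have hexp : 0 ≤ (1 - p) * k + p * l :=
    add_nonneg (mul_nonneg (by linarith) (by positivity)) (by positivity)
  have h1 : (1 : ℝ) ≤ (2 : ℝ) ^ ((1 - p) * k + p * l) := Real.one_le_rpow (by norm_num) hexp
  have h2 := Nat.floor_le (a := 8 * (2 : ℝ) ^ ((1 - p) * k + p * l)) (by positivity)
  rw [expo]
  push_cast
  linarith

end TreeProg

theorem mainTheorem8 (𝒢 : ∀ n : ℕ, Set (SimpleGraph (Fin n))) (p : ℝ) (hp0 : 0 < p) (hp1 : p < 1)
    (hp : TreeProg.IsPolyTimeApproximable p)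
    (hA : ∃ A : TreeProg.Program, TreeProg.SamplesIndepSets A 𝒢 p) :
    ∃ B : TreeProg.Program, TreeProg.SolvesTree B 𝒢 ∧
      ∃ q : Polynomial ℕ, ∀ n : ℕ, ∀ G ∈ 𝒢 n, ∀ k l : ℕ,
        B.RunsInTime (TreeProg.encodeInstance G k l)
          ((q.eval (TreeProg.encodeInstance G k l).size : ℕ) *
            (2 : ℝ) ^ ((1 - p) * (k : ℝ) + p * (l : ℝ))) ∧
        B.RunsInSpace (TreeProg.encodeInstance G k l)
          ((q.eval (TreeProg.encodeInstance G k l).size : ℕ) : ℝ) := by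
  open TreeProg Data in
  obtain ⟨A, qA, hA⟩ := hA
  obtain ⟨Q, qQ, hQ⟩ := hp
  obtain ⟨KA, hKA, hKA'⟩ := RT.program A (fun x => ∃ n, ∃ G ∈ 𝒢 n, x = encodeGraph G) qA (by
    rintro x ⟨n, G, hG, rfl⟩
    exact (hA n G hG).1)
  obtain ⟨KQ, hKQ, hKQ'⟩ := RT.program Q (fun x => ∃ m, x = un m) qQ (by
    rintro x ⟨m, rfl⟩
    intro i c hc
    refine ((hQ m).1 i c hc).trans ?_
    exact_mod_cast eval_mono qQ (by rw [size_un]; omega))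
  have hQs : ∀ m, ∀ d ∈ (KQ (un m)).support, ∃ a : ℕ, |m * p - a| ≤ 1 ∧ d = ofNat a := by
    intro m
    have h := (hQ m).2
    rw [show ofNatUnary m = un m from rfl, hKQ' _ ⟨m, rfl⟩,
      PMF.toOuterMeasure_apply_eq_one_iff] at h
    exact fun d hd => h hd
  have hAs : ∀ n, ∀ G ∈ 𝒢 n, ∀ d ∈ (KA (encodeGraph G)).support, ∃ I : Finset (Fin n),
      G.IsIndepSet (I : Set (Fin n)) ∧ d = encodeSet I := by
    intro n G hG
    have h := (hA n G hG).2.1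
    rw [hKA' _ ⟨n, G, hG, rfl⟩, PMF.toOuterMeasure_apply_eq_one_iff] at h
    exact fun d hd => h hd
  obtain ⟨B, q, hB⟩ := (RT.answer hp0.le hp1.le hKA hKQ hQs).exists_program
  -- The factor `10` absorbs the constants of `expo`, see `expo_le`.
  refine ⟨B, ⟨ENNReal.ofReal (Real.exp (-1)), ?_, fun n G hG k l => ?_⟩, 10 * q,
    fun n G hG k l => ?_⟩
  · rw [ENNReal.ofReal_lt_one]
    simp
  · obtain ⟨h1, -⟩ := hB (encodeInstance G k l) ⟨n, G, hG, k, l, rfl⟩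
    have hs := answerK_support (k := k) (l := l) (hAs n G hG) hQs
    refine ⟨?_, fun hT => ?_, fun hT => ?_⟩
    · rw [h1, PMF.toOuterMeasure_apply_eq_one_iff]
      intro d hd
      rcases hs d hd with h | ⟨h, -⟩
      · exact Or.inr h
      · exact Or.inl h
    · rw [h1, PMF.toOuterMeasure_apply_eq_zero_iff, Set.disjoint_left]
      intro d hd h0
      rcases hs d hd with rfl | ⟨-, h⟩
      · exact absurd h0 (by simp [ofBool])
      · exact hT h
    · rw [h1]
      refine answerK_fail_le (hAs n G hG) (fun v => ?_) hQs hT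
      rw [← hKA' _ ⟨n, G, hG, rfl⟩]
      exact (hA n G hG).2.2 v
  · obtain ⟨-, h1, h2⟩ := hB (encodeInstance G k l) ⟨n, G, hG, k, l, rfl⟩
    rw [show (encodeInstance G k l).tl.hd = ofNat k from rfl,
      show (encodeInstance G k l).tl.tl = ofNat l from rfl, valB_ofNat, valB_ofNat] at h1
    have hq : (10 * q).eval (encodeInstance G k l).size =
        10 * q.eval (encodeInstance G k l).size := by simp
    rw [hq]
    refine ⟨fun m c hc => (h1 m c hc).trans ?_, fun m c hc => (h2 m c hc).trans ?_⟩
    · have h3 := expo_le hp0.le hp1.le k l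
      push_cast
      have h4 : (0 : ℝ) ≤ (q.eval (encodeInstance G k l).size : ℕ) := by positivity
      calc ((q.eval (encodeInstance G k l).size : ℕ) : ℝ) * expo p k l
          ≤ (q.eval (encodeInstance G k l).size : ℕ) * (10 * (2 : ℝ) ^ ((1 - p) * (k : ℝ) + p * l)) :=
            mul_le_mul_of_nonneg_left h3 h4
        _ = _ := by ring
    · push_cast
      have h4 : (0 : ℝ) ≤ (q.eval (encodeInstance G k l).size : ℕ) := by positivity
      linarith
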